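/- **Setting.** Units are such that the particle mass and Boltzmann's constant are $1$; $\mathfrak c>0$ is the speed of light. For $p\in\mathbb R^3$ put $p^0=\sqrt{\mathfrak c^2+|p|^2}$, and for a velocity $u\in\mathbb R^3$ put $u^0=\sqrt{\mathfrak c^2+|u|^2}$. Let $$K_j(z)=\Big(\frac z2\Big)^j\frac{\Gamma(\frac12)}{\Gamma(j+\frac12)}\int_1^\infty e^{-zt}(t^2-1)^{j-\frac12}\,dt .$$ *Relativistic fluid.* Fields $n_0>0$, $u$, $T_0>0$, with $\gamma=\mathfrak c^2/T_0$, $P_0=n_0T_0$, $e_0=\mathfrak c^2n_0\frac{K_1(\gamma)}{K_2(\gamma)}+3P_0$, and $S$ given by $n_0=4\pi e^4\mathfrak c^3e^{-S}\frac{K_2(\gamma)}{\gamma}\exp\big(\gamma\frac{K_1(\gamma)}{K_2(\gamma)}\big)$, solving the relativistic Euler equations $$\tfrac1{\mathfrak c}\partial_t(n_0u^0)+\nabla\cdot(n_0u)=0,\qquad \tfrac1{\mathfrak c}\partial_t[(e_0+P_0)u^0u]+\nabla\cdot[(e_0+P_0)u\otimes u]+\mathfrak c^2\nabla P_0=0,$$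 $$\tfrac1{\mathfrak c}\partial_t[(e_0+P_0)(u^0)^2-\mathfrak c^2P_0]+\nabla\cdot[(e_0+P_0)u^0u]=0 .$$ *Classical fluid.* Fields $\rho>0$, $\mathfrak u$, $\theta>0$, with $\mathcal P=\rho\theta$, $\mathcal E=\frac32\theta$, $\eta=-\ln\big((2\pi)^{-3/2}e^{-5/2}\rho\,\theta^{-3/2}\big)$, solving $$\partial_t\rho+\nabla\cdot(\rho\mathfrak u)=0,\quad \partial_t(\rho\mathfrak u)+\nabla\cdot(\rho\mathfrak u\otimes\mathfrak u)+\nabla\mathcal P=0,\quad \partial_t\big[\rho(\tfrac12|\mathfrak u|^2+\mathcal E)\big]+\nabla\cdot\big[(\rho(\tfrac12|\mathfrak u|^2+\mathcal E)+\mathcal P)\mathfrak u\big]=0 .$$ *Relativistic kernels* at a state $(n_0,u,T_0)$. Put $s=2(p^0q^0-p\cdot q+\mathfrak c^2)$, $g=\sqrt{2(p^0q^0-p\cdot q-\mathfrak c^2)}$, $c_0=\frac{n_0\gamma}{4\pi\mathfrak c^3K_2(\gamma)}$, $\mathbf M_{\mathfrak c}(p)=c_0\exp\big(\frac{-u^0p^0+u\cdot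 p}{T_0}\big)$, $\bar p^0=\frac{u^0p^0-u\cdot p}{\mathfrak c}$, $\bar p=p-\frac{p^0}{\mathfrak c}u+\big(\frac{u^0}{\mathfrak c}-1\big)\frac{u\cdot p}{|u|^2}u$ (with $\bar p=p$ if $u=0$), and define $\bar q^0,\bar q$ in the same way from $q$. Put also $\bar\ell=\frac{\mathfrak c(\bar p^0+\bar q^0)}{2T_0}$, $\bar j=\frac{\mathfrak c|\bar p\times\bar q|}{gT_0}$, $D=\sqrt{\bar\ell^2-\bar j^2}$. Then $$k_{\mathfrak c1}(p,q)=\frac{\pi\mathfrak c\,g\sqrt s}{p^0q^0}\sqrt{\mathbf M_{\mathfrak c}(p)\mathbf M_{\mathfrak c}(q)},\qquad k_{\mathfrak c2}(p,q)=\frac{\mathfrak c\,c_0\pi s^{3/2}}{4g\,p^0q^0}\Big[\frac{\bar\ell}{D^2}\Big(1+\frac1D\Big)+\frac1D\Big]e^{-D}.$$ *Newtonian hard-sphere kernels* at a state $(\rho,\mathfrak u,\theta)$: $$k_1(p,q)=2\pi|p-q|\frac{\rho}{(2\pi\theta)^{3/2}}e^{-\frac{|p-\mathfrak u|^2+|q-\mathfrak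 u|^2}{4\theta}},\qquad k_2(p,q)=\frac{2}{|p-q|}\frac{\rho}{\sqrt{2\pi\theta}}\exp\Big(-\frac{|p-q|^2}{8\theta}-\frac{(|p-\mathfrak u|^2-|q-\mathfrak u|^2)^2}{8\theta|p-q|^2}\Big).$$ **Statement.** Let $N_0\ge3$ be an integer, $T>0$, $\bar P>0$ and $\bar S\in\mathbb R$. Let $(\rho,\mathfrak u,\theta)$ be a $C^1$ solution of the classical Euler equations on $[0,T]\times\mathbb R^3$ such that the five components of $(\mathcal P,\mathfrak u,\eta)-(\bar P,0,\bar S)$ belong to $C([0,T];H^{N_0})\cap C^1([0,T];H^{N_0-1})$. Then for every $B$ there are constants $C>0$ and $\mathfrak c_0>0$ such that the following holds for all $\mathfrak c\ge\mathfrak c_0$. Let $(n_0,u,T_0)$ be any $C^1$ solution on $[0,T]\times\mathbb R^3$ of the relativistic Euler equations with light speed $\mathfrak c$, with the same initial data, $(P_0,u,S)|_{t=0}=(\mathcal P,\mathfrak u,\eta)|_{t=0}$, such that the five components of $(P_0,u,S)-(\bar P,0,\bar S)$ belong to $C([0,T];H^{N_0})\cap C^1([0,T];H^{N_0-1})$ and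 have $H^{N_0}$ norm at most $B$ at every time in $[0,T]$. Then for all $t\in[0,T]$, $x\in\mathbb R^3$ and $p\in\mathbb R^3$, with the kernels taken at the fluid states at $(t,x)$, both differences below are integrable in $q$ and $$\int_{\mathbb R^3}|k_{\mathfrak c1}(p,q)-k_1(p,q)|\,dq\le C\,\mathfrak c^{-3/2},\qquad \int_{\mathbb R^3}|k_{\mathfrak c2}(p,q)-k_2(p,q)|\,dq\le C\,\mathfrak c^{-3/8}.$$ -/

import Mathlib

open MeasureTheory Set

noncomputable section

/-- Physical space and momentum space `ℝ³` with the Euclidean norm. -/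
abbrev E3 : Type := EuclideanSpace ℝ (Fin 3)

/-! ### Sobolev regularity of time-dependent functions -/

/-- `h ∈ L²` represents the Bessel potential `⟨D⟩ˢ f` of the real function `f ∈ L²(ℝ³)`. Thus
`∃ h, IsBesselRep s f h` says `f ∈ Hˢ(ℝ³)` (for `0 ≤ s`), and then `‖h‖` is the `Hˢ` norm of `f`. -/
def IsBesselRep (s : ℝ) (f : E3 → ℝ) (h : Lp ℂ 2 (volume : Measure E3)) : Prop :=
  ∃ hf : MemLp (fun x => (f x : ℂ)) 2 (volume : Measure E3),
    TemperedDistribution.besselPotential E3 ℂ s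
      (hf.toLp (fun x => (f x : ℂ)) : TemperedDistribution E3 ℂ) = h

/-- `f ∈ C([0,T]; H^N) ∩ C¹([0,T]; H^{N-1})` and `sup_{0 ≤ t ≤ T} ‖f(t)‖_{H^N} ≤ B`. -/
def SobolevPath (N : ℕ) (T B : ℝ) (f : ℝ → E3 → ℝ) : Prop :=
  (∃ h : ℝ → Lp ℂ 2 (volume : Measure E3), ContinuousOn h (Icc 0 T) ∧
    ∀ t ∈ Icc 0 T, IsBesselRep (N : ℝ) (f t) (h t) ∧ ‖h t‖ ≤ B) ∧
  (∃ h : ℝ → Lp ℂ 2 (volume : Measure E3), ContDiffOn ℝ 1 h (Icc 0 T) ∧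
    ∀ t ∈ Icc 0 T, IsBesselRep ((N : ℝ) - 1) (f t) (h t))

/-! ### Derivatives on `[0,T] × ℝ³` -/

/-- Time derivative on `[0,T]` (one-sided at the end points). -/
def dt (T : ℝ) (f : ℝ → E3 → ℝ) (t : ℝ) (x : E3) : ℝ :=
  derivWithin (fun τ => f τ x) (Icc 0 T) t

/-- Spatial partial derivative `∂ᵢ`. -/
def dx (i : Fin 3) (f : ℝ → E3 → ℝ) (t : ℝ) (x : E3) : ℝ :=
  fderiv ℝ (f t) x (EuclideanSpace.single i 1)

/-- `f` is `C¹` on `[0,T] × ℝ³`. -/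
def C1On {F : Type*} [NormedAddCommGroup F] [NormedSpace ℝ F] (T : ℝ) (f : ℝ → E3 → F) : Prop :=
  ContDiffOn ℝ 1 (fun z : ℝ × E3 => f z.1 z.2) (Icc 0 T ×ˢ (univ : Set E3))

/-! ### Equations of state (units with `m₀ = k_B = 1`) -/

/-- The modified Bessel function of the second kind `K_j(z)`, `z > 0`. -/
def besselK (j : ℕ) (z : ℝ) : ℝ :=
  (z / 2) ^ j * (Real.Gamma (1 / 2) / Real.Gamma ((j : ℝ) + 1 / 2)) *
    ∫ t in Ioi (1 : ℝ), Real.exp (-z * t) * (t ^ 2 - 1) ^ ((j : ℝ) - 1 / 2)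

/-- The energy `p⁰ = √(c² + |p|²)` of a particle of momentum `p`; also `u⁰` for a velocity `u`. -/
def energy (c : ℝ) (p : E3) : ℝ := Real.sqrt (c ^ 2 + ‖p‖ ^ 2)

/-- `γ = c² / T₀`. -/
def gam (c θ : ℝ) : ℝ := c ^ 2 / θ

/-- Relativistic pressure `P₀ = n₀ T₀`. -/
def relPressure (n θ : ℝ) : ℝ := n * θ

/-- Proper energy density `e₀ = c² n₀ K₁(γ) / K₂(γ) + 3 P₀`. -/
def relEnergyDensity (c n θ : ℝ) : ℝ :=
  c ^ 2 * n * (besselK 1 (gam c θ) / besselK 2 (gam c θ)) + 3 * relPressure n θ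

/-- Entropy per particle: the unique `S` with
`n₀ = 4 π e⁴ c³ exp(-S) (K₂(γ) / γ) exp(γ K₁(γ) / K₂(γ))`. -/
def relEntropy (c n θ : ℝ) : ℝ :=
  Real.log (4 * Real.pi * Real.exp 4 * c ^ 3 * (besselK 2 (gam c θ) / gam c θ) / n) +
    gam c θ * (besselK 1 (gam c θ) / besselK 2 (gam c θ))

/-- Classical entropy `η = -ln(A₀ ρ θ^{-3/2})`, `A₀ = (2π)^{-3/2} e^{-5/2}`. -/
def clEntropy (ρ θ : ℝ) : ℝ :=
  -Real.log ((2 * Real.pi) ^ (-(3 / 2) : ℝ) * Real.exp (-(5 / 2)) * ρ * θ ^ (-(3 / 2) : ℝ))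

/-! ### The two Euler systems -/

/-- Density, velocity and temperature fields. For the relativistic fluid these are the proper
number density `n₀`, the spatial part `u` of the four-velocity and `T₀`; for the classical fluid
the density `ρ`, the velocity `𝔲` and `θ`. -/
structure Fluid where
  n : ℝ → E3 → ℝ
  u : ℝ → E3 → E3
  θ : ℝ → E3 → ℝ

namespace Fluid

/-- Pressure field; the formula `n θ` is the same for both fluids. -/
def P (V : Fluid) (t : ℝ) (x : E3) : ℝ := relPressure (V.n t x) (V.θ t x)

/-- Relativistic entropy field. -/
def S (c : ℝ) (V : Fluid) (t : ℝ) (x : E3) : ℝ := relEntropy c (V.n t x) (V.θ t x)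

/-- Classical entropy field. -/
def η (W : Fluid) (t : ℝ) (x : E3) : ℝ := clEntropy (W.n t x) (W.θ t x)

/-- Time component `u⁰` of the four-velocity. -/
def u0 (c : ℝ) (V : Fluid) (t : ℝ) (x : E3) : ℝ := energy c (V.u t x)

/-- Relativistic enthalpy density `e₀ + P₀`. -/
def h (c : ℝ) (V : Fluid) (t : ℝ) (x : E3) : ℝ :=
  relEnergyDensity c (V.n t x) (V.θ t x) + V.P t x

/-- Classical total energy density `ρ (|𝔲|²/2 + 𝓔)` with `𝓔 = 3 θ / 2`. -/
def E (W : Fluid) (t : ℝ) (x : E3) : ℝ :=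
  W.n t x * (‖W.u t x‖ ^ 2 / 2 + 3 / 2 * W.θ t x)

/-- Positive density and temperature, and `C¹` fields, on `[0,T] × ℝ³`. -/
def Regular (T : ℝ) (V : Fluid) : Prop :=
  (∀ t ∈ Icc 0 T, ∀ x, 0 < V.n t x ∧ 0 < V.θ t x) ∧ C1On T V.n ∧ C1On T V.u ∧ C1On T V.θ

/-- Classical solution on `[0,T] × ℝ³` of the relativistic Euler equations with light speed `c`. -/
def IsRelEuler (c T : ℝ) (V : Fluid) : Prop :=
  V.Regular T ∧ ∀ t ∈ Icc 0 T, ∀ x,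
    (1 / c * dt T (fun t x => V.n t x * V.u0 c t x) t x +
      ∑ i, dx i (fun t x => V.n t x * V.u t x i) t x = 0) ∧
    (∀ j, 1 / c * dt T (fun t x => V.h c t x * V.u0 c t x * V.u t x j) t x +
      ∑ i, dx i (fun t x => V.h c t x * V.u t x i * V.u t x j) t x +
      c ^ 2 * dx j V.P t x = 0) ∧
    (1 / c * dt T (fun t x => V.h c t x * V.u0 c t x ^ 2 - c ^ 2 * V.P t x) t x +
      ∑ i, dx i (fun t x => V.h c t x * V.u0 c t x * V.u t x i) t x = 0)

/-- Classical solution on `[0,T] × ℝ³` of the compressible Euler equations. -/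
def IsClEuler (T : ℝ) (W : Fluid) : Prop :=
  W.Regular T ∧ ∀ t ∈ Icc 0 T, ∀ x,
    (dt T W.n t x + ∑ i, dx i (fun t x => W.n t x * W.u t x i) t x = 0) ∧
    (∀ j, dt T (fun t x => W.n t x * W.u t x j) t x +
      ∑ i, dx i (fun t x => W.n t x * W.u t x i * W.u t x j) t x + dx j W.P t x = 0) ∧
    (dt T W.E t x + ∑ i, dx i (fun t x => (W.E t x + W.P t x) * W.u t x i) t x = 0)

/-- `(P₀, u, S) - (P̄, 0, S̄)` is in `C([0,T]; H^N) ∩ C¹([0,T]; H^{N-1})`, each of its five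
components having `H^N` norm at most `B`. -/
def RelSobolev (c : ℝ) (N : ℕ) (T B Pbar Sbar : ℝ) (V : Fluid) : Prop :=
  SobolevPath N T B (fun t x => V.P t x - Pbar) ∧
  (∀ i, SobolevPath N T B (fun t x => V.u t x i)) ∧
  SobolevPath N T B (fun t x => V.S c t x - Sbar)

/-- The same for `(𝓟, 𝔲, η) - (P̄, 0, S̄)`. -/
def ClSobolev (N : ℕ) (T B Pbar Sbar : ℝ) (W : Fluid) : Prop :=
  SobolevPath N T B (fun t x => W.P t x - Pbar) ∧
  (∀ i, SobolevPath N T B (fun t x => W.u t x i)) ∧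
  SobolevPath N T B (fun t x => W.η t x - Sbar)

/-- Same initial data: `(P₀, u, S) = (𝓟, 𝔲, η)` at `t = 0`. -/
def SameData (c : ℝ) (V W : Fluid) : Prop :=
  ∀ x, V.P 0 x = W.P 0 x ∧ V.u 0 x = W.u 0 x ∧ V.S c 0 x = W.η 0 x

end Fluid

/-! ### The collision kernels at a fluid state `(n, u, θ)` -/

/-- `s(p,q) = 2 (p⁰ q⁰ - p·q + c²)`. -/
def sInv (c : ℝ) (p q : E3) : ℝ :=
  2 * (energy c p * energy c q - inner ℝ p q + c ^ 2)

/-- `g(p,q) = √(2 (p⁰ q⁰ - p·q - c²))`. -/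
def gInv (c : ℝ) (p q : E3) : ℝ :=
  Real.sqrt (2 * (energy c p * energy c q - inner ℝ p q - c ^ 2))

/-- The factor `c₀ = n γ / (4 π c³ K₂(γ))`. -/
def juttnerFactor (c n θ : ℝ) : ℝ :=
  n * gam c θ / (4 * Real.pi * c ^ 3 * besselK 2 (gam c θ))

/-- The local relativistic Maxwellian `M_c(n, u, θ; p) = c₀ exp(u^μ p_μ / θ)`. -/
def juttner (c n : ℝ) (u : E3) (θ : ℝ) (p : E3) : ℝ :=
  juttnerFactor c n θ * Real.exp ((-(energy c u * energy c p) + inner ℝ u p) / θ)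

/-- The time component `p̄⁰ = (u⁰ p⁰ - u·p) / c` of the boosted momentum. -/
def boostEnergy (c : ℝ) (u p : E3) : ℝ :=
  (energy c u * energy c p - inner ℝ u p) / c

/-- The spatial part `p̄` of the boosted momentum (for `u = 0` the last term is `0`). -/
def boost (c : ℝ) (u p : E3) : E3 :=
  p - (energy c p / c) • u + ((energy c u / c - 1) * (inner ℝ u p / ‖u‖ ^ 2)) • u

/-- Cross product on `ℝ³`. -/
def cross (p q : E3) : E3 := WithLp.toLp 2 (crossProduct (WithLp.ofLp p) (WithLp.ofLp q))

/-- `ℓ / θ` with `ℓ = c (p̄⁰ + q̄⁰) / 2`. -/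
def ellBar (c : ℝ) (u : E3) (θ : ℝ) (p q : E3) : ℝ :=
  c / 2 * (boostEnergy c u p + boostEnergy c u q) / θ

/-- `j / θ` with `j = c |p̄ × q̄| / g`. -/
def jBar (c : ℝ) (u : E3) (θ : ℝ) (p q : E3) : ℝ :=
  c * ‖cross (boost c u p) (boost c u q)‖ / gInv c p q / θ

/-- `J₁(ℓ,j)`. -/
def J1 (l j : ℝ) : ℝ :=
  l / (l ^ 2 - j ^ 2) * (1 + 1 / Real.sqrt (l ^ 2 - j ^ 2)) * Real.exp (-Real.sqrt (l ^ 2 - j ^ 2))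

/-- `J₂(ℓ,j)`. -/
def J2 (l j : ℝ) : ℝ :=
  1 / Real.sqrt (l ^ 2 - j ^ 2) * Real.exp (-Real.sqrt (l ^ 2 - j ^ 2))

/-- The relativistic kernel `k_{c1}(p,q)`. -/
def kc1 (c n : ℝ) (u : E3) (θ : ℝ) (p q : E3) : ℝ :=
  Real.pi * c * gInv c p q * Real.sqrt (sInv c p q) / (energy c p * energy c q) *
    Real.sqrt (juttner c n u θ p * juttner c n u θ q)

/-- The relativistic kernel `k_{c2}(p,q)`. -/
def kc2 (c n : ℝ) (u : E3) (θ : ℝ) (p q : E3) : ℝ :=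
  c * juttnerFactor c n θ * Real.pi * sInv c p q ^ (3 / 2 : ℝ) /
      (4 * gInv c p q * energy c p * energy c q) *
    (J1 (ellBar c u θ p q) (jBar c u θ p q) + J2 (ellBar c u θ p q) (jBar c u θ p q))

/-- The Newtonian hard-sphere kernel `k₁(p,q)`. -/
def k1 (ρ : ℝ) (u : E3) (θ : ℝ) (p q : E3) : ℝ :=
  2 * Real.pi * ‖p - q‖ * (ρ / (2 * Real.pi * θ) ^ (3 / 2 : ℝ)) *
    Real.exp (-(‖p - u‖ ^ 2 / (4 * θ)) - ‖q - u‖ ^ 2 / (4 * θ))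

/-- The Newtonian hard-sphere kernel `k₂(p,q)`. -/
def k2 (ρ : ℝ) (u : E3) (θ : ℝ) (p q : E3) : ℝ :=
  2 / ‖p - q‖ * (ρ / Real.sqrt (2 * Real.pi * θ)) *
    Real.exp (-(‖p - q‖ ^ 2 / (8 * θ)) -
      (‖p - u‖ ^ 2 - ‖q - u‖ ^ 2) ^ 2 / (8 * θ * ‖p - q‖ ^ 2))

end

/-! The kernels depend on the fluids only through the states at `(t, x)`, so the theorem splits into
a uniform estimate of the distance of the two fluids (`exists_stateClose`) and an estimate of the
kernels at two close states.

*Fluids.* In the unknowns `(P, u, S)` both systems are symmetric, `∑ₖ Kₖ ∂ₖ X = 0` with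
`K = Fluid.symCoef δ`, where `δ = c⁻²` or `δ = 0`. The Bessel quotients in the coefficients are
functions of `ε = θ / c²` built from the Laplace integrals `lapInt`; at `ε = 0` they are continuous
and take the values of the monatomic gas. Hence the difference of the solutions solves a
`PerturbedSystem` with forcing `O(|X| + δ)` times the gradient of the classical solution, and the
energy inequality `energy_le` for `X` and its difference quotients gives `‖X‖_{H¹} = O(δ)`
(`PerturbedSystem.stability`). The second derivatives of the classical solution need not be bounded,
but their products with `X` are controlled by `H¹ · H¹ ⊆ L²` (`integral_sq_convolution_le`).
Interpolation of `H¹` with the uniform `H³` bound (`HasSpectrum.abs_le_interp`) yields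
`|X| = O(δ^{3/4}) = O(c^{-3/2})`. The symmetrization needs a positive lower bound on the
relativistic pressure, which a continuity argument propagates in time (`RefSol.Rel.P_ge`).

*Kernels.* The first difference is `O(c^{-3/2})` times a weight decaying exponentially in `|p| + |q|`
(`KPt.kc1_sub_k1`). The second kernels are `|p - q|⁻¹` times a prefactor times `e^{-X}`, `e^{-Y}`. Put
`R = c^{3/8}`. If `|p|, |p - q| ≤ R`, the prefactors agree up to a factor `1 + O(R² / c²)` and
`X - Y` is at most of order `R⁴ / c² = R⁻¹` (`KPt.kc2_sub_k2`). If `|p - q| > R`, both kernels are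
exponentially small (`KPt.kc2_sub_k2_of_lt`). If `|p| > R`, both live, up to `O(R⁻¹)`, where the
energy transfer is small, in a shell around a sphere of radius comparable to `|p|`; there the
integral is `O(1 / |p|)`, respectively `O(1 / c + 1 / |p|)` (`exists_integral_shell_le`). All bounds
are `O(R⁻¹) = O(c^{-3/8})`. -/

open Real Asymptotics Filter FourierTransform
open Finset (sum_le_sum sum_congr sum_nonneg mul_sum sum_add_distrib single_le_sum sum_mul
  abs_sum_le_sum_abs sum_comm sum_eq_zero sum_sub_distrib sum_const card_univ sum_div)
open Complex (ofRealCLM norm_real)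
open EuclideanSpace (single)
open Fintype (card sum_option card_option card_fin)

noncomputable section

/-! ### Fourier analysis of `L²` functions -/

lemma continuous_fourier {φ : E3 → ℂ} (h : Integrable φ) : Continuous (𝓕 φ) :=
  VectorFourier.fourierIntegral_continuous continuous_fourierChar (by exact continuous_inner) h

lemma norm_sq_eq_integral (w : Lp ℂ 2 (volume : Measure E3)) : ‖w‖ ^ 2 = ∫ x, ‖w x‖ ^ 2 := by
  have h := congrArg Complex.re (L2.inner_def (𝕜 := ℂ) w w)
  rw [inner_self_eq_norm_sq_to_K] at h
  have h' : ∀ x, inner ℂ (w x) (w x) = ((‖w x‖ ^ 2 : ℝ) : ℂ) := fun x => by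
    rw [inner_self_eq_norm_sq_to_K]; norm_cast
  simp_rw [h'] at h
  norm_cast at h

/-- If the `L²` Fourier transform `v` of `F` is integrable, then `F` is the Fourier integral of the
reflection of `v`. -/
lemma ae_eq_fourier {F v : Lp ℂ 2 (volume : Measure E3)} (hv : 𝓕 F = v)
    (hφ : Integrable fun ξ : E3 => v (-ξ)) : F =ᵐ[volume] 𝓕 (fun ξ : E3 => v (-ξ)) := by
  refine ae_eq_of_integral_contDiff_smul_eq ((Lp.memLp _).locallyIntegrable (by norm_num))
    (continuous_fourier hφ).locallyIntegrable fun g hg hgc => ?_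
  have hg₁ : HasCompactSupport (ofRealCLM ∘ g) := hgc.comp_left rfl
  have hg₂ : ContDiff ℝ ((⊤ : ℕ∞) : WithTop ℕ∞) (ofRealCLM ∘ g) := by fun_prop
  set G := hg₁.toSchwartzMap hg₂ with hGdef
  have e1 : (F : TemperedDistribution E3 ℂ) G = (v : TemperedDistribution E3 ℂ) (𝓕⁻ G) := by
    rw [← hv, ← Lp.fourier_toTemperedDistribution_eq, TemperedDistribution.fourier_apply,
      fourier_fourierInv_eq]
  rw [Lp.toTemperedDistribution_apply, Lp.toTemperedDistribution_apply] at e1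
  have e2 : ∫ x, (𝓕 (G : E3 → ℂ) x) • (v (-x)) = ∫ x, G x • 𝓕 (fun ξ : E3 => v (-ξ)) x := by
    simpa using! VectorFourier.integral_fourierIntegral_smul_eq_flip (L := innerₗ E3)
      continuous_fourierChar continuous_inner G.integrable hφ
  have e5 : ∫ x, (𝓕⁻ (G : E3 → ℂ) x) • v x = ∫ x, (𝓕 (G : E3 → ℂ) x) • (v (-x)) := by
    rw [← integral_neg_eq_self]
    simp [fourierInv_eq_fourier_neg]
  have e3 : ∀ x, G x = (g x : ℂ) := fun x => by simp [hGdef]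
  rw [SchwartzMap.fourierInv_coe, e5, e2] at e1
  simpa [e3] using e1

lemma memLp_fourier {φ : E3 → ℂ} (h1 : Integrable φ) (h2 : MemLp φ 2 volume) :
    MemLp (𝓕 φ) 2 volume ∧ ∫ x, ‖𝓕 φ x‖ ^ 2 = ∫ ξ, ‖φ ξ‖ ^ 2 := by
  have hmp := Measure.measurePreserving_neg (volume : Measure E3)
  have h3 := h2.comp_measurePreserving hmp
  set v := h3.toLp _ with hv
  have hvφ : (fun ξ => v (-ξ)) =ᵐ[volume] φ := by
    filter_upwards [hmp.quasiMeasurePreserving.ae h3.coeFn_toLp] with ξ h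
    rw [hv, h]; simp
  obtain ⟨w, hw⟩ : ∃ w : Lp ℂ 2 (volume : Measure E3), 𝓕 w = v := ⟨_, fourier_fourierInv_eq v⟩
  have h4 := ae_eq_fourier hw ((integrable_congr hvφ).2 h1)
  rw [show 𝓕 (fun ξ => v (-ξ)) = 𝓕 φ from funext fun x => integral_congr_ae (by
    filter_upwards [hvφ] with y hy
    rw [hy])] at h4
  refine ⟨(memLp_congr_ae h4).1 (Lp.memLp _), ?_⟩
  have h5 := Lp.norm_fourier_eq w
  rw [hw, eq_comm, ← sq_eq_sq₀ (norm_nonneg _) (norm_nonneg _), norm_sq_eq_integral,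
    norm_sq_eq_integral, ← integral_neg_eq_self (fun x => ‖v x‖ ^ 2)] at h5
  exact (integral_congr_ae (h4.symm.fun_comp fun z => ‖z‖ ^ 2)).trans
    (h5.trans (integral_congr_ae (hvφ.fun_comp fun z => ‖z‖ ^ 2)))

/-- The weight `1 + |ξ|²` of the Sobolev norms. -/
def wt (ξ : E3) : ℝ := 1 + ‖ξ‖ ^ 2

lemma one_le_wt (ξ : E3) : 1 ≤ wt ξ := by unfold wt; nlinarith [sq_nonneg ‖ξ‖]

lemma wt_pos (ξ : E3) : 0 < wt ξ := lt_of_lt_of_le one_pos (one_le_wt ξ)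

lemma continuous_wt : Continuous wt := by unfold wt; fun_prop

lemma norm_sq_le_wt (ξ : E3) : ‖ξ‖ ^ 2 ≤ wt ξ := by unfold wt; linarith

/-- `f = 𝓕 φ` with `∫ (1 + |ξ|²)³ |φ|² ≤ B²`, i.e. `f` is the continuous representative of a
function whose `H³` norm is at most `B`. -/
structure HasSpectrum (f : E3 → ℝ) (φ : E3 → ℂ) (B : ℝ) : Prop where
  meas : AEStronglyMeasurable φ volume
  int : Integrable (fun ξ => wt ξ ^ 3 * ‖φ ξ‖ ^ 2)
  le : ∫ ξ, wt ξ ^ 3 * ‖φ ξ‖ ^ 2 ≤ B ^ 2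
  eq : ∀ x, (f x : ℂ) = 𝓕 φ x

/-- Cauchy–Schwarz for a product of nonnegative functions with square-integrable factors. -/
lemma integral_mul_le_sqrt {α : Type*} [MeasurableSpace α] {μ : Measure α} {f g : α → ℝ}
    (hf : AEStronglyMeasurable f μ) (hg : AEStronglyMeasurable g μ)
    (hf2 : Integrable (fun x => f x ^ 2) μ) (hg2 : Integrable (fun x => g x ^ 2) μ) :
    Integrable (fun x => f x * g x) μ ∧
      ∫ x, |f x * g x| ∂μ ≤ √(∫ x, f x ^ 2 ∂μ) * √(∫ x, g x ^ 2 ∂μ) := by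
  have hfm : MemLp f 2 μ := (memLp_two_iff_integrable_sq hf).2 hf2
  have hgm : MemLp g 2 μ := (memLp_two_iff_integrable_sq hg).2 hg2
  refine ⟨hfm.integrable_mul hgm, ?_⟩
  have := integral_mul_le_Lp_mul_Lq_of_nonneg (μ := μ) (f := fun x => |f x|) (g := fun x => |g x|)
    Real.HolderConjugate.two_two (ae_of_all _ fun x => abs_nonneg _)
    (ae_of_all _ fun x => abs_nonneg _) (by simpa using! hfm.abs) (by simpa using! hgm.abs)
  simpa [abs_mul, sqrt_eq_rpow] using this

lemma integrable_radial {f : ℝ → ℝ} (h : IntegrableOn (fun y => y ^ 2 * f y) (Ioi 0)) :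
    Integrable (fun ξ : E3 => f ‖ξ‖) := by
  rw [integrable_fun_norm_addHaar (volume : Measure E3)]
  simpa using h

lemma integrable_wt_neg_two : Integrable (fun ξ : E3 => (wt ξ ^ 2)⁻¹) := by
  have h := integrable_rpow_neg_one_add_norm_sq (E := E3) (μ := volume) (r := 4) (by norm_num)
  refine h.congr (ae_of_all _ fun ξ => ?_)
  have : (-4 / 2 : ℝ) = -(2 : ℕ) := by norm_num
  aesop

/-- Cauchy–Schwarz with a weight. -/
lemma integral_norm_le_weighted {f : E3 → ℂ} {W : E3 → ℝ} (hf : AEStronglyMeasurable f volume)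
    (hW : Continuous W) (hW0 : ∀ ξ, 0 < W ξ) (h1 : Integrable fun ξ => W ξ * ‖f ξ‖ ^ 2)
    (h2 : Integrable fun ξ => (W ξ)⁻¹) : Integrable f ∧
      ∫ ξ, ‖f ξ‖ ≤ √(∫ ξ, W ξ * ‖f ξ‖ ^ 2) * √(∫ ξ, (W ξ)⁻¹) := by
  have es : ∀ ξ, √(W ξ) ^ 2 = W ξ := fun ξ => sq_sqrt (hW0 ξ).le
  have key := integral_mul_le_sqrt (f := fun ξ => √(W ξ) * ‖f ξ‖) (g := fun ξ => (√(W ξ))⁻¹)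
    (hW.sqrt.aestronglyMeasurable.mul hf.norm)
    (hW.sqrt.inv₀ fun ξ => (sqrt_pos.2 (hW0 ξ)).ne').aestronglyMeasurable
    (by simpa only [mul_pow, es] using h1) (by simpa only [inv_pow, es] using h2)
  have e1 : ∀ ξ, √(W ξ) * ‖f ξ‖ * (√(W ξ))⁻¹ = ‖f ξ‖ := fun ξ => by
    have := (sqrt_pos.2 (hW0 ξ)).ne'
    field_simp
  simp only [e1, abs_norm, mul_pow, inv_pow, es] at key
  exact ⟨(integrable_norm_iff hf).1 key.1, key.2⟩

/-- `∫ (1 + |ξ|²)^{1/2} |φ|` is controlled by the `H³` norm. -/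
lemma integrable_sqrt_wt_mul {φ : E3 → ℂ} (hφ : AEStronglyMeasurable φ volume)
    (h : Integrable fun ξ => wt ξ ^ 3 * ‖φ ξ‖ ^ 2) :
    Integrable (fun ξ => √(wt ξ) * ‖φ ξ‖) ∧ ∫ ξ, √(wt ξ) * ‖φ ξ‖ ≤
      √(∫ ξ, wt ξ ^ 3 * ‖φ ξ‖ ^ 2) * √(∫ ξ : E3, (wt ξ ^ 2)⁻¹) := by
  have hw := continuous_wt
  have e : ∀ ξ, ‖(√(wt ξ) : ℂ) * φ ξ‖ = √(wt ξ) * ‖φ ξ‖ := fun ξ => by simp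
  have e2 : ∀ ξ, wt ξ ^ 2 * (√(wt ξ) * ‖φ ξ‖) ^ 2 = wt ξ ^ 3 * ‖φ ξ‖ ^ 2 := fun ξ => by
    rw [mul_pow, sq_sqrt (wt_pos ξ).le]; ring
  have key := integral_norm_le_weighted (f := fun ξ => (√(wt ξ) : ℂ) * φ ξ)
    ((by fun_prop : Continuous fun ξ => (√(wt ξ) : ℂ)).aestronglyMeasurable.mul hφ)
    (W := fun ξ => wt ξ ^ 2) (hw.pow 2) (fun ξ => pow_pos (wt_pos ξ) 2) (by simpa only [e, e2]) integrable_wt_neg_two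
  simp only [e, e2] at key
  exact ⟨by simpa only [e] using key.1.norm, key.2⟩

lemma integrable_of_wt {φ : E3 → ℂ} (hφ : AEStronglyMeasurable φ volume)
    (h : Integrable fun ξ => wt ξ ^ 3 * ‖φ ξ‖ ^ 2) : Integrable φ :=
  (integrable_sqrt_wt_mul hφ h).1.mono' hφ (ae_of_all _ fun ξ =>
    le_mul_of_one_le_left (norm_nonneg _) (one_le_sqrt.2 (one_le_wt ξ)))

namespace HasSpectrum

variable {f : E3 → ℝ} {φ : E3 → ℂ} {B : ℝ}

lemma integrable_sqrt_wt (h : HasSpectrum f φ B) (hB : 0 ≤ B) :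
    Integrable (fun ξ => √(wt ξ) * ‖φ ξ‖) ∧
      ∫ ξ, √(wt ξ) * ‖φ ξ‖ ≤ B * √(∫ ξ : E3, (wt ξ ^ 2)⁻¹) := by
  obtain ⟨h1, h2⟩ := integrable_sqrt_wt_mul h.meas h.int
  refine ⟨h1, h2.trans ?_⟩
  gcongr
  exact (sqrt_le_sqrt h.le).trans_eq (sqrt_sq hB)

lemma integrable (h : HasSpectrum f φ B) : Integrable φ := integrable_of_wt h.meas h.int

lemma integrable_norm_mul (h : HasSpectrum f φ B) : Integrable (fun ξ => ‖ξ‖ * ‖φ ξ‖) := by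
  refine (integrable_sqrt_wt_mul h.meas h.int).1.mono'
    (continuous_norm.aestronglyMeasurable.mul h.meas.norm) (ae_of_all _ fun ξ => ?_)
  rw [norm_of_nonneg (by positivity)]
  gcongr
  exact le_sqrt_of_sq_le (norm_sq_le_wt ξ)

lemma integrable_mul_of_le (h : HasSpectrum f φ B) {w : E3 → ℝ} (hw : Continuous w)
    (h0 : ∀ ξ, 0 ≤ w ξ) {C : ℝ} (hC : ∀ ξ, w ξ ≤ C * wt ξ ^ 3) :
    Integrable (fun ξ => w ξ * ‖φ ξ‖ ^ 2) ∧ ∫ ξ, w ξ * ‖φ ξ‖ ^ 2 ≤ C * B ^ 2 := by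
  have hC0 : 0 ≤ C := by
    have := (h0 0).trans (hC 0)
    exact nonneg_of_mul_nonneg_left this (pow_pos (wt_pos 0) 3)
  have h1 : Integrable (fun ξ => w ξ * ‖φ ξ‖ ^ 2) := by
    refine (h.int.const_mul C).mono' (hw.aestronglyMeasurable.mul (h.meas.norm.pow 2))
      (ae_of_all _ fun ξ => ?_)
    rw [norm_of_nonneg (mul_nonneg (h0 ξ) (by positivity)), ← mul_assoc]
    gcongr; exact hC ξ
  refine ⟨h1, (integral_mono h1 (h.int.const_mul C) fun ξ => ?_).trans ?_⟩
  · rw [← mul_assoc]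
    gcongr; exact hC ξ
  · rw [integral_const_mul]
    gcongr; exact h.le

lemma memLp (h : HasSpectrum f φ B) : MemLp φ 2 volume := by
  rw [memLp_two_iff_integrable_sq_norm h.meas]
  simpa using (h.integrable_mul_of_le (w := fun _ => 1) continuous_const (by simp) (C := 1)
    (fun ξ => by rw [one_mul]; exact one_le_pow₀ (one_le_wt ξ))).1

lemma abs_le_integral (h : HasSpectrum f φ B) (x : E3) : |f x| ≤ ∫ ξ, ‖φ ξ‖ := by
  have : |f x| = ‖𝓕 φ x‖ := by rw [← h.eq x, norm_real, norm_eq_abs]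
  rw [this]
  exact VectorFourier.norm_fourierIntegral_le_integral_norm _ _ _ _ _

lemma tendsto_zero (h : HasSpectrum f φ B) :
    Tendsto f (cocompact E3) (nhds 0) := by
  have h1 := tendsto_integral_exp_inner_smul_cocompact (V := E3) φ
  have : f = fun x => (𝓕 φ x).re := by
    ext x; rw [← h.eq x, Complex.ofReal_re]
  rw [this]
  simpa [fourier_eq] using! (Complex.continuous_re.tendsto _).comp h1

/-- The multiplier of the `i`-th derivative acting on the spectrum. -/
lemma dx_eq (h : HasSpectrum f φ B) (i : Fin 3) :
    Differentiable ℝ f ∧ ∀ x, ((fderiv ℝ f x (single i 1) : ℝ) : ℂ) =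
      𝓕 (fun ξ => -(2 * π * Complex.I) * (ξ i : ℂ) * φ ξ) x := by
  have hd := fun x => hasFDerivAt_fourier h.integrable h.integrable_norm_mul x
  have hf : f = fun x => Complex.reCLM (𝓕 φ x) := by
    ext x; rw [← h.eq x]; simp
  have hd' : ∀ x, HasFDerivAt f (Complex.reCLM.comp
      (𝓕 (VectorFourier.fourierSMulRight (innerSL ℝ) φ) x)) x := fun x => by
    conv => arg 1; rw [hf]
    exact Complex.reCLM.hasFDerivAt.comp x (hd x)
  refine ⟨fun x => (hd' x).differentiableAt, fun x => ?_⟩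
  -- the complex derivative is real because `f` is
  have h1 : HasFDerivAt (fun x => (f x : ℂ)) (ofRealCLM.comp (fderiv ℝ f x)) x :=
    ofRealCLM.hasFDerivAt.comp x (hd' x).differentiableAt.hasFDerivAt
  have h2 : (fun x => (f x : ℂ)) = 𝓕 φ := funext h.eq
  rw [h2] at h1
  have h3 := congrArg (fun L => L (single i (1 : ℝ))) (h1.unique (hd x))
  simp only [ContinuousLinearMap.comp_apply, Complex.ofRealCLM_apply] at h3
  rw [h3]
  simp only [fourier_eq]
  rw [ContinuousLinearMap.integral_apply]
  · refine integral_congr_ae (ae_of_all _ fun ξ => ?_)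
    simp only []
    rw [Circle.smul_def, _root_.smul_apply, VectorFourier.fourierSMulRight_apply,
      Circle.smul_def]
    have hi : (innerSL ℝ ξ) (single i (1 : ℝ)) = ξ i := by
      rw [innerSL_apply_apply, EuclideanSpace.inner_single_right]; simp
    rw [hi]
    simp
    ring
  · rw [fourierIntegral_convergent_iff]
    refine (h.integrable_norm_mul.const_mul (2 * π * ‖(innerSL ℝ : E3 →L[ℝ] E3 →L[ℝ] ℝ)‖)).mono'
      (h.meas.fourierSMulRight (L := innerSL ℝ)) (ae_of_all _ fun ξ => ?_)
    refine (VectorFourier.norm_fourierSMulRight_le _ _ _).trans (le_of_eq ?_)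
    ring

end HasSpectrum

/-! ### Derivatives on the Fourier side -/

lemma continuous_spatial_deriv_spectrum (i : Fin 3) {φ : E3 → ℂ}
    (h : AEStronglyMeasurable φ volume) :
    AEStronglyMeasurable (fun ξ : E3 => -(2 * π * Complex.I) * (ξ i : ℂ) * φ ξ) volume :=
  (by fun_prop : Continuous fun ξ : E3 =>
    -(2 * π * Complex.I) * (ξ i : ℂ)).aestronglyMeasurable.mul h

lemma abs_apply_le_norm (ξ : E3) (i : Fin 3) : |ξ i| ≤ ‖ξ‖ := by
  simpa using PiLp.norm_apply_le ξ i

lemma norm_deriv_spectrum (i : Fin 3) (φ : E3 → ℂ) (ξ : E3) :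
    ‖-(2 * π * Complex.I) * (ξ i : ℂ) * φ ξ‖ = 2 * π * |ξ i| * ‖φ ξ‖ := by
  simp [abs_of_pos pi_pos]

/-- Integrals of squares of real functions given by a Fourier integral. -/
lemma integral_sq_of_eq_fourier {g : E3 → ℝ} {ψ : E3 → ℂ} (h1 : Integrable ψ)
    (h2 : MemLp ψ 2 volume) (hg : ∀ x, (g x : ℂ) = 𝓕 ψ x) :
    Integrable (fun x => g x ^ 2) ∧ ∫ x, g x ^ 2 = ∫ ξ, ‖ψ ξ‖ ^ 2 := by
  obtain ⟨h3, h4⟩ := memLp_fourier h1 h2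
  have e : ∀ x, ‖𝓕 ψ x‖ ^ 2 = g x ^ 2 := fun x => by
    rw [← hg x, norm_real, norm_eq_abs, sq_abs]
  rw [memLp_two_iff_integrable_sq_norm h3.1] at h3
  simp only [e] at h3 h4
  exact ⟨h3, h4⟩

namespace HasSpectrum

variable {f g : E3 → ℝ} {φ ψ : E3 → ℂ} {B B' : ℝ}

lemma integral_sq (h : HasSpectrum f φ B) :
    Integrable (fun x => f x ^ 2) ∧ ∫ x, f x ^ 2 = ∫ ξ, ‖φ ξ‖ ^ 2 :=
  integral_sq_of_eq_fourier h.integrable h.memLp h.eq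

lemma sq_coord_le (ξ : E3) (i : Fin 3) : (ξ i) ^ 2 ≤ wt ξ :=
  ((sq_abs (ξ i)).symm.le.trans (by gcongr; exact abs_apply_le_norm ξ i)).trans (norm_sq_le_wt ξ)

lemma wt_le_cube (ξ : E3) : wt ξ ≤ wt ξ ^ 3 := le_self_pow₀ (one_le_wt ξ) (by norm_num)

lemma integrable_dx (h : HasSpectrum f φ B) (i : Fin 3) :
    Integrable (fun ξ : E3 => -(2 * π * Complex.I) * (ξ i : ℂ) * φ ξ) := by
  refine (h.integrable_norm_mul.const_mul (2 * π)).mono'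
    (continuous_spatial_deriv_spectrum i h.meas) (ae_of_all _ fun ξ => ?_)
  rw [norm_deriv_spectrum, mul_assoc]
  gcongr
  exact abs_apply_le_norm ξ i

lemma integrable_coord_sq (h : HasSpectrum f φ B) (i : Fin 3) :
    Integrable (fun ξ : E3 => (ξ i) ^ 2 * ‖φ ξ‖ ^ 2) :=
  (h.integrable_mul_of_le (w := fun ξ => (ξ i) ^ 2) (by fun_prop) (fun ξ => sq_nonneg _) (C := 1)
    (fun ξ => by rw [one_mul]; exact (sq_coord_le ξ i).trans (wt_le_cube ξ))).1

lemma integral_sq_dx (h : HasSpectrum f φ B) (i : Fin 3) :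
    Integrable (fun x => (fderiv ℝ f x (single i 1)) ^ 2) ∧
      ∫ x, (fderiv ℝ f x (single i 1)) ^ 2 =
        4 * π ^ 2 * ∫ ξ, (ξ i) ^ 2 * ‖φ ξ‖ ^ 2 := by
  have e : ∀ ξ : E3, ‖-(2 * π * Complex.I) * (ξ i : ℂ) * φ ξ‖ ^ 2 =
      4 * π ^ 2 * ((ξ i) ^ 2 * ‖φ ξ‖ ^ 2) := fun ξ => by
    rw [norm_deriv_spectrum, mul_pow, mul_pow, sq_abs]; ring
  have h2 : MemLp (fun ξ : E3 => -(2 * π * Complex.I) * (ξ i : ℂ) * φ ξ) 2 volume := by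
    rw [memLp_two_iff_integrable_sq_norm (continuous_spatial_deriv_spectrum i h.meas)]
    simp only [e]
    exact (h.integrable_coord_sq i).const_mul _
  have := integral_sq_of_eq_fourier (h.integrable_dx i) h2 (h.dx_eq i).2
  simp only [e] at this
  rwa [integral_const_mul] at this

/-- The `H¹` part of the spectrum is controlled by the `L²` norms of `f` and its derivatives. -/
lemma integral_wt_le (h : HasSpectrum f φ B) :
    Integrable (fun ξ => wt ξ * ‖φ ξ‖ ^ 2) ∧ ∫ ξ, wt ξ * ‖φ ξ‖ ^ 2 ≤
      (∫ x, f x ^ 2) + ∑ i, ∫ x, (fderiv ℝ f x (single i 1)) ^ 2 := by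
  refine ⟨(h.integrable_mul_of_le continuous_wt (fun ξ => (wt_pos ξ).le) (C := 1)
    (fun ξ => by rw [one_mul]; exact wt_le_cube ξ)).1, ?_⟩
  have hint : Integrable (fun ξ => ‖φ ξ‖ ^ 2) :=
    (memLp_two_iff_integrable_sq_norm h.meas).1 h.memLp
  have e : ∀ ξ, wt ξ * ‖φ ξ‖ ^ 2 = ‖φ ξ‖ ^ 2 + ∑ i : Fin 3, (ξ i) ^ 2 * ‖φ ξ‖ ^ 2 := fun ξ => by
    rw [← sum_mul, ← EuclideanSpace.real_norm_sq_eq]; unfold wt; ring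
  simp only [e]
  rw [integral_add hint (integrable_finsetSum _ fun i _ => h.integrable_coord_sq i),
    integral_finsetSum _ fun i _ => h.integrable_coord_sq i, ← h.integral_sq.2]
  refine add_le_add le_rfl (sum_le_sum fun i _ => ?_)
  rw [(h.integral_sq_dx i).2]
  refine le_mul_of_one_le_left (integral_nonneg fun ξ => by positivity) ?_
  nlinarith [pi_gt_three]

lemma integral_sq_le (h : HasSpectrum f φ B) : ∫ x, f x ^ 2 ≤ B ^ 2 := by
  rw [h.integral_sq.2]
  simpa using (h.integrable_mul_of_le (w := fun _ => 1) continuous_const (by simp) (C := 1)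
    (fun ξ => by rw [one_mul]; exact one_le_pow₀ (one_le_wt ξ))).2

lemma integral_sq_dx_le (h : HasSpectrum f φ B) (i : Fin 3) :
    ∫ x, (fderiv ℝ f x (single i 1)) ^ 2 ≤ 4 * π ^ 2 * B ^ 2 := by
  rw [(h.integral_sq_dx i).2]
  gcongr
  simpa using (h.integrable_mul_of_le (w := fun ξ => (ξ i) ^ 2) (by fun_prop)
    (fun ξ => sq_nonneg _) (C := 1)
    (fun ξ => by rw [one_mul]; exact (sq_coord_le ξ i).trans (wt_le_cube ξ))).2

lemma abs_le (h : HasSpectrum f φ B) (hB : 0 ≤ B) (x : E3) :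
    |f x| ≤ B * √(∫ ξ : E3, (wt ξ ^ 2)⁻¹) := by
  obtain ⟨h1, h2⟩ := h.integrable_sqrt_wt hB
  refine (h.abs_le_integral x).trans (le_trans (integral_mono h.integrable.norm h1 fun ξ => ?_) h2)
  exact le_mul_of_one_le_left (norm_nonneg _) (one_le_sqrt.2 (one_le_wt ξ))

lemma abs_dx_le (h : HasSpectrum f φ B) (hB : 0 ≤ B) (i : Fin 3) (x : E3) :
    |fderiv ℝ f x (single i 1)| ≤
      2 * π * (B * √(∫ ξ : E3, (wt ξ ^ 2)⁻¹)) := by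
  obtain ⟨h1, h2⟩ := h.integrable_sqrt_wt hB
  have : |fderiv ℝ f x (single i 1)| =
      ‖𝓕 (fun ξ : E3 => -(2 * π * Complex.I) * (ξ i : ℂ) * φ ξ) x‖ := by
    rw [← (h.dx_eq i).2 x, norm_real, norm_eq_abs]
  rw [this]
  refine (VectorFourier.norm_fourierIntegral_le_integral_norm _ _ _ _ _).trans ?_
  refine (integral_mono (h.integrable_dx i).norm (h1.const_mul (2 * π)) fun ξ => ?_).trans ?_
  · simp only [norm_deriv_spectrum]
    rw [mul_assoc]
    gcongr
    exact (abs_apply_le_norm ξ i).trans (le_sqrt_of_sq_le (norm_sq_le_wt ξ))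
  · rw [integral_const_mul]
    gcongr

lemma sub (h : HasSpectrum f φ B) (h' : HasSpectrum g ψ B') (hB : 0 ≤ B) (hB' : 0 ≤ B') :
    HasSpectrum (fun x => f x - g x) (fun ξ => φ ξ - ψ ξ) (2 * (B + B')) := by
  have hle : ∀ ξ, wt ξ ^ 3 * ‖φ ξ - ψ ξ‖ ^ 2 ≤
      2 * (wt ξ ^ 3 * ‖φ ξ‖ ^ 2) + 2 * (wt ξ ^ 3 * ‖ψ ξ‖ ^ 2) := fun ξ => by
    have h1 := norm_sub_le (φ ξ) (ψ ξ)
    have h2 : ‖φ ξ - ψ ξ‖ ^ 2 ≤ 2 * ‖φ ξ‖ ^ 2 + 2 * ‖ψ ξ‖ ^ 2 := by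
      nlinarith [norm_nonneg (φ ξ - ψ ξ), sq_nonneg (‖φ ξ‖ - ‖ψ ξ‖)]
    nlinarith [pow_pos (wt_pos ξ) 3]
  have hi := (h.int.const_mul 2).add (h'.int.const_mul 2)
  have hw := continuous_wt
  have hint : Integrable (fun ξ => wt ξ ^ 3 * ‖φ ξ - ψ ξ‖ ^ 2) := by
    refine hi.mono' ((hw.pow 3).aestronglyMeasurable.mul ((h.meas.sub h'.meas).norm.pow 2))
      (ae_of_all _ fun ξ => ?_)
    rw [norm_of_nonneg (mul_nonneg (pow_nonneg (wt_pos ξ).le _) (by positivity))]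
    exact hle ξ
  refine ⟨h.meas.sub h'.meas, hint, ?_, fun x => ?_⟩
  · refine (integral_mono hint hi hle).trans ?_
    simp only [Pi.add_apply]
    rw [integral_add (h.int.const_mul 2) (h'.int.const_mul 2), integral_const_mul,
      integral_const_mul]
    nlinarith [h.le, h'.le, mul_nonneg hB hB']
  · push_cast
    rw [h.eq, h'.eq]
    simp only [fourier_eq, smul_sub]
    rw [integral_sub]
    · exact (fourierIntegral_convergent_iff x).2 h.integrable
    · exact (fourierIntegral_convergent_iff x).2 h'.integrable

end HasSpectrum

/-! ### Sobolev functions and their spectra -/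

lemma IsBesselRep.hasSpectrum {N : ℕ} (hN : 3 ≤ N) {f : E3 → ℝ}
    {h : Lp ℂ 2 (volume : Measure E3)} (hf : IsBesselRep (N : ℝ) f h) (hc : Continuous f) :
    ∃ φ, HasSpectrum f φ ‖h‖ := by
  obtain ⟨hmem, hb⟩ := hf
  set F := hmem.toLp (fun x => (f x : ℂ)) with hF
  set u : Lp ℂ 2 (volume : Measure E3) := 𝓕 h with hu
  set v : Lp ℂ 2 (volume : Measure E3) := 𝓕 F with hv
  have hgrow : Function.HasTemperateGrowth
      (fun x : E3 => (((1 + ‖x‖ ^ 2) ^ (-(N : ℝ) / 2) : ℝ) : ℂ)) := by fun_prop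
  have hgrow' : Function.HasTemperateGrowth
      (fun x : E3 => (((1 + ‖x‖ ^ 2) ^ ((N : ℝ) / 2) : ℝ) : ℂ)) := by fun_prop
  have hle1 : ∀ x : E3, (1 + ‖x‖ ^ 2) ^ (-(N : ℝ) / 2) ≤ 1 := fun x =>
    rpow_le_one_of_one_le_of_nonpos (one_le_wt x) (by
      grind)
  have hg2 : MemLp (fun x : E3 => (((1 + ‖x‖ ^ 2) ^ (-(N : ℝ) / 2) : ℝ) : ℂ)) ⊤ volume := by
    refine memLp_top_of_bound hgrow.1.continuous.aestronglyMeasurable 1 (ae_of_all _ fun x => ?_)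
    rw [norm_real, norm_of_nonneg (by positivity)]
    exact hle1 x
  have e1 : ((hg2.toLp _ • u : Lp ℂ 2 (volume : Measure E3)) : TemperedDistribution E3 ℂ) = v := by
    rw [Lp.toTemperedDistribution_smul_eq hgrow hg2 u, hu,
      ← Lp.fourier_toTemperedDistribution_eq, ← hb,
      TemperedDistribution.fourier_besselPotential_eq_smulLeftCLM_fourier_apply,
      TemperedDistribution.smulLeftCLM_smulLeftCLM_apply hgrow' hgrow,
      Lp.fourier_toTemperedDistribution_eq]
    have : ((fun x : E3 => (((1 + ‖x‖ ^ 2) ^ (-(N : ℝ) / 2) : ℝ) : ℂ)) *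
        fun x : E3 => (((1 + ‖x‖ ^ 2) ^ ((N : ℝ) / 2) : ℝ) : ℂ)) = fun _ => 1 := by
      ext x
      rw [Pi.mul_apply, ← Complex.ofReal_mul, ← rpow_add (by positivity)]
      simp [neg_div]
    rw [mul_comm, this, TemperedDistribution.smulLeftCLM_const, one_smul]
  have e2 : (hg2.toLp _ • u : Lp ℂ 2 (volume : Measure E3)) = v := by
    have hk := Lp.ker_toTemperedDistributionCLM_eq_bot (E := E3) (F := ℂ)
      (μ := (volume : Measure E3)) (p := 2)
    exact LinearMap.ker_eq_bot.1 hk e1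
  have e3 : (v : E3 → ℂ) =ᵐ[volume] fun ξ => ((wt ξ ^ (-(N : ℝ) / 2) : ℝ) : ℂ) * u ξ := by
    rw [← e2]
    filter_upwards [Lp.coeFn_lpSMul (r := 2) (hg2.toLp _) u, hg2.coeFn_toLp] with x h1 h2
    aesop
  have hum : Integrable (fun ξ => ‖u ξ‖ ^ 2) :=
    (memLp_two_iff_integrable_sq_norm (Lp.memLp u).1).1 (Lp.memLp u)
  have hpt : ∀ᵐ ξ : E3, wt ξ ^ 3 * ‖v ξ‖ ^ 2 ≤ ‖u ξ‖ ^ 2 := by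
    filter_upwards [e3] with ξ hξ
    rw [hξ, norm_mul, norm_real, norm_of_nonneg (rpow_nonneg (wt_pos ξ).le _),
      mul_pow, ← mul_assoc]
    refine mul_le_of_le_one_left (by positivity) ?_
    rw [← rpow_natCast, ← rpow_natCast, ← rpow_mul (wt_pos ξ).le,
      ← rpow_add (wt_pos ξ)]
    refine rpow_le_one_of_one_le_of_nonpos (one_le_wt ξ) ?_
    simp_all
  have hw := continuous_wt
  have hvint : Integrable (fun ξ => wt ξ ^ 3 * ‖v ξ‖ ^ 2) := by
    refine hum.mono' ((hw.pow 3).aestronglyMeasurable.mul ((Lp.memLp v).1.norm.pow 2)) ?_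
    filter_upwards [hpt] with ξ hξ
    rwa [norm_of_nonneg (mul_nonneg (pow_nonneg (wt_pos ξ).le _) (by positivity))]
  have hnorm : ∫ ξ, ‖u ξ‖ ^ 2 = ‖h‖ ^ 2 := by
    rw [← norm_sq_eq_integral, Lp.norm_fourier_eq h]
  -- the spectrum is reflected, since `F = 𝓕⁻ v`
  have hmp := Measure.measurePreserving_neg (volume : Measure E3)
  have hemb : MeasurableEmbedding (Neg.neg : E3 → E3) := (MeasurableEquiv.neg E3).measurableEmbedding
  have hwn : ∀ ξ, wt (-ξ) = wt ξ := fun ξ => by simp [wt]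
  have hφm : AEStronglyMeasurable (fun ξ : E3 => v (-ξ)) volume :=
    (Lp.memLp v).1.comp_measurePreserving hmp
  have hφi : Integrable (fun ξ : E3 => wt ξ ^ 3 * ‖v (-ξ)‖ ^ 2) := by
    have := (hmp.integrable_comp_emb hemb (g := fun ξ => wt ξ ^ 3 * ‖v ξ‖ ^ 2)).2 hvint
    simpa [Function.comp_def, hwn] using this
  have hφl : ∫ ξ : E3, wt ξ ^ 3 * ‖v (-ξ)‖ ^ 2 ≤ ‖h‖ ^ 2 := by
    have := hmp.integral_comp hemb (fun ξ => wt ξ ^ 3 * ‖v ξ‖ ^ 2)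
    simp only [hwn] at this
    rw [this, ← hnorm]
    exact integral_mono_ae hvint hum hpt
  have hφint := integrable_of_wt hφm hφi
  have e6 : (fun x => (f x : ℂ)) = 𝓕 (fun ξ : E3 => v (-ξ)) := by
    refine (Continuous.ae_eq_iff_eq (μ := (volume : Measure E3))
      (Complex.continuous_ofReal.comp hc) (continuous_fourier hφint)).1 ?_
    filter_upwards [ae_eq_fourier hv.symm hφint, hmem.coeFn_toLp] with x h1 h2
    rw [← h1]
    exact h2.symm
  exact ⟨_, hφm, hφi, hφl, fun x => congrFun e6 x⟩

lemma IsBesselRep.sub {s : ℝ} {f g : E3 → ℝ} {h k : Lp ℂ 2 (volume : Measure E3)}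
    (hf : IsBesselRep s f h) (hg : IsBesselRep s g k) :
    IsBesselRep s (fun x => f x - g x) (h - k) := by
  obtain ⟨hf1, hf2⟩ := hf
  obtain ⟨hg1, hg2⟩ := hg
  have hm : MemLp (fun x => ((f x - g x : ℝ) : ℂ)) 2 (volume : Measure E3) := by
    simpa using! hf1.sub hg1
  refine ⟨hm, ?_⟩
  have e : hm.toLp _ = hf1.toLp _ - hg1.toLp _ := by
    rw [← MemLp.toLp_sub]
    congr 1
    ext x; simp
  rw [e, ← Lp.toTemperedDistributionCLM_apply, ← Lp.toTemperedDistributionCLM_apply, map_sub,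
    map_sub, map_sub, Lp.toTemperedDistributionCLM_apply, Lp.toTemperedDistributionCLM_apply,
    Lp.toTemperedDistributionCLM_apply, Lp.toTemperedDistributionCLM_apply, hf2, hg2]

/-! ### Products, difference quotients and interpolation -/

/-- `∫ (1 + |ξ|²)⁻² dξ`, the constant of the Sobolev embedding and product estimates. -/
def sobConst : ℝ := ∫ ξ : E3, (wt ξ ^ 2)⁻¹

lemma sobConst_nonneg : 0 ≤ sobConst := integral_nonneg fun ξ => by
  positivity

/-- The product of two `H¹` functions on `ℝ³` is in `L²`: on the Fourier side this is Young's
inequality with the weights distributed by Cauchy–Schwarz. -/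
lemma integral_sq_convolution_le {φ χ : E3 → ℂ} (hφ : Integrable φ) (hχ : Integrable χ)
    (hφ1 : Integrable fun ξ => wt ξ * ‖φ ξ‖ ^ 2) (hχ1 : Integrable fun ξ => wt ξ * ‖χ ξ‖ ^ 2) :
    MemLp (convolution φ χ (ContinuousLinearMap.mul ℂ ℂ) volume) 2 volume ∧
      ∫ ξ, ‖convolution φ χ (ContinuousLinearMap.mul ℂ ℂ) volume ξ‖ ^ 2 ≤
        sobConst * ((∫ ξ, wt ξ * ‖φ ξ‖ ^ 2) * ∫ ξ, wt ξ * ‖χ ξ‖ ^ 2) := by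
  set A : E3 → ℝ := fun ξ => wt ξ * ‖φ ξ‖ ^ 2 with hA
  set D : E3 → ℝ := fun ξ => wt ξ * ‖χ ξ‖ ^ 2 with hD
  set cv := convolution φ χ (ContinuousLinearMap.mul ℂ ℂ) volume with hcv
  have hcvI : Integrable cv := hφ.integrable_convolution _ hχ
  have hADI : Integrable (convolution A D (ContinuousLinearMap.mul ℝ ℝ) volume) :=
    hφ1.integrable_convolution _ hχ1
  have hADe := Integrable.ae_convolution_exists (ContinuousLinearMap.mul ℝ ℝ) hφ1 hχ1
  have hw := continuous_wt
  have hpt : ∀ᵐ ξ : E3, ‖cv ξ‖ ^ 2 ≤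
      sobConst * convolution A D (ContinuousLinearMap.mul ℝ ℝ) volume ξ := by
    filter_upwards [hADe] with ξ hξ
    have hξ' : Integrable (fun η => A η * D (ξ - η)) := hξ
    have hmχ : AEStronglyMeasurable (fun η => χ (ξ - η)) volume :=
      hχ.1.comp_measurePreserving (Measure.measurePreserving_sub_left volume ξ)
    have hws : Continuous fun η => wt (ξ - η) := hw.comp (by fun_prop)
    have hwi : Integrable (fun η => (wt η * wt (ξ - η))⁻¹) ∧
        ∫ η, (wt η * wt (ξ - η))⁻¹ ≤ sobConst := by
      have i2 : Integrable (fun η => (wt (ξ - η) ^ 2)⁻¹) := by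
        have := (Measure.measurePreserving_sub_left (volume : Measure E3) ξ).integrable_comp_emb
          (MeasurableEquiv.subLeft ξ).measurableEmbedding (g := fun η => (wt η ^ 2)⁻¹)
        exact this.2 integrable_wt_neg_two
      have v2 : ∫ η, (wt (ξ - η) ^ 2)⁻¹ = sobConst :=
        integral_sub_left_eq_self (fun η => (wt η ^ 2)⁻¹) volume ξ
      have hle : ∀ η, (wt η * wt (ξ - η))⁻¹ ≤
          (1 / 2) * (wt η ^ 2)⁻¹ + (1 / 2) * (wt (ξ - η) ^ 2)⁻¹ := fun η => by
        rw [mul_inv, ← inv_pow, ← inv_pow]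
        nlinarith [sq_nonneg ((wt η)⁻¹ - (wt (ξ - η))⁻¹)]
      have hs := (integrable_wt_neg_two.const_mul (1 / 2)).add (i2.const_mul (1 / 2))
      have hi : Integrable (fun η => (wt η * wt (ξ - η))⁻¹) := by
        refine hs.mono' ((hw.mul hws).inv₀ fun η =>
          (mul_pos (wt_pos η) (wt_pos _)).ne').aestronglyMeasurable (ae_of_all _ fun η => ?_)
        rw [norm_of_nonneg (inv_nonneg.2 (mul_pos (wt_pos η) (wt_pos _)).le)]
        exact hle η
      refine ⟨hi, (integral_mono hi hs hle).trans (le_of_eq ?_)⟩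
      simp only [Pi.add_apply]
      rw [integral_add (integrable_wt_neg_two.const_mul _) (i2.const_mul _), integral_const_mul,
        integral_const_mul, v2]
      change 1 / 2 * sobConst + _ = _
      ring
    have e2 : ∀ η, wt η * wt (ξ - η) * ‖φ η * χ (ξ - η)‖ ^ 2 = A η * D (ξ - η) := fun η => by
      simp only [norm_mul, mul_pow, hA, hD]; ring
    have key := integral_norm_le_weighted (hφ.1.mul hmχ) (hw.mul hws)
      (fun η => mul_pos (wt_pos η) (wt_pos _)) (hξ'.congr (ae_of_all _ fun η => (e2 η).symm)) hwi.1
    simp only [Pi.mul_apply, e2] at key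
    have hn : ‖cv ξ‖ ≤ ∫ η, ‖φ η * χ (ξ - η)‖ := norm_integral_le_integral_norm _
    have hAD0 : 0 ≤ ∫ η, A η * D (ξ - η) := integral_nonneg fun η => by
      have := wt_pos η; have := wt_pos (ξ - η); positivity
    have hW0 : 0 ≤ ∫ η, (wt η * wt (ξ - η))⁻¹ := integral_nonneg fun η => by
      have := wt_pos η; have := wt_pos (ξ - η); positivity
    calc ‖cv ξ‖ ^ 2 ≤ (√(∫ η, A η * D (ξ - η)) *
          √(∫ η, (wt η * wt (ξ - η))⁻¹)) ^ 2 := by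
            gcongr; exact hn.trans key.2
      _ = (∫ η, (wt η * wt (ξ - η))⁻¹) * ∫ η, A η * D (ξ - η) := by
            rw [mul_pow, sq_sqrt hAD0, sq_sqrt hW0]; ring
      _ ≤ sobConst * ∫ η, A η * D (ξ - η) := by gcongr; exact hwi.2
      _ = _ := rfl
  have hsq : Integrable fun ξ => ‖cv ξ‖ ^ 2 := by
    refine (hADI.const_mul sobConst).mono' (hcvI.1.norm.pow 2) ?_
    filter_upwards [hpt] with ξ hξ
    rwa [norm_of_nonneg (by positivity)]
  refine ⟨(memLp_two_iff_integrable_sq_norm hcvI.1).2 hsq, ?_⟩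
  refine (integral_mono_ae hsq (hADI.const_mul sobConst) hpt).trans (le_of_eq ?_)
  rw [integral_const_mul, integral_convolution _ hφ1 hχ1]
  rfl

/-- The difference quotient in direction `j` with step `h`. -/
def dq (j : Fin 3) (h : ℝ) (f : E3 → ℝ) (x : E3) : ℝ :=
  (f (x + h • single j 1) - f x) / h

namespace HasSpectrum

variable {f g : E3 → ℝ} {φ ψ : E3 → ℂ} {B B' : ℝ}

/-- Spectrum of the difference quotient of a derivative of `g`. -/
lemma dq_dx_eq (h : HasSpectrum g ψ B) (i j : Fin 3) {t : ℝ} (ht : t ≠ 0) :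
    ∃ χ : E3 → ℂ, Integrable χ ∧ MemLp χ 2 volume ∧
      (∀ x, ((dq j t (fun x => fderiv ℝ g x (single i 1)) x : ℝ) : ℂ) = 𝓕 χ x) ∧
      (Integrable fun ξ => wt ξ * ‖χ ξ‖ ^ 2) ∧
      ∫ ξ, wt ξ * ‖χ ξ‖ ^ 2 ≤ 16 * π ^ 4 * B ^ 2 := by
  set ψi : E3 → ℂ := fun ξ => -(2 * π * Complex.I) * (ξ i : ℂ) * ψ ξ with hψi
  have hI := h.integrable_dx i
  set m : E3 → ℂ := fun ξ => (Complex.exp (Complex.I * ((-(2 * π * t * ξ j) : ℝ) : ℂ)) - 1) / t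
    with hm
  have hmc : Continuous m := by
    fun_prop
  have hmb : ∀ ξ, ‖m ξ‖ ≤ 2 * π * |ξ j| := fun ξ => by
    simp only [hm, norm_div, norm_real, norm_eq_abs]
    rw [div_le_iff₀ (abs_pos.2 ht)]
    refine (norm_exp_I_mul_ofReal_sub_one_le).trans (le_of_eq ?_)
    rw [norm_eq_abs, abs_neg, abs_mul, abs_mul, abs_mul, abs_of_pos pi_pos]
    ring
  have hmb' : ∀ ξ, ‖m ξ‖ ≤ 2 / |t| := fun ξ => by
    simp only [hm, norm_div, norm_real, norm_eq_abs]
    gcongr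
    refine (norm_sub_le _ _).trans ?_
    rw [mul_comm, Complex.norm_exp_ofReal_mul_I]; norm_num
  set χ : E3 → ℂ := fun ξ => m ξ * ψi ξ with hχ
  have hχm : AEStronglyMeasurable χ volume := hmc.aestronglyMeasurable.mul hI.1
  have hχI : Integrable χ := by
    refine (hI.norm.const_mul (2 / |t|)).mono' hχm (ae_of_all _ fun ξ => ?_)
    rw [hχ, norm_mul]
    gcongr; exact hmb' ξ
  have hχb : ∀ ξ, wt ξ * ‖χ ξ‖ ^ 2 ≤ 16 * π ^ 4 * (wt ξ ^ 3 * ‖ψ ξ‖ ^ 2) := fun ξ => by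
    have h1 : ‖χ ξ‖ ≤ 2 * π * |ξ j| * (2 * π * |ξ i| * ‖ψ ξ‖) := by
      rw [hχ, norm_mul, hψi, norm_deriv_spectrum]
      gcongr; exact hmb ξ
    have h2 : ‖χ ξ‖ ^ 2 ≤ 16 * π ^ 4 * ((ξ j) ^ 2 * (ξ i) ^ 2 * ‖ψ ξ‖ ^ 2) := by
      calc _ ≤ (2 * π * |ξ j| * (2 * π * |ξ i| * ‖ψ ξ‖)) ^ 2 := by gcongr
        _ = 16 * π ^ 4 * (|ξ j| ^ 2 * |ξ i| ^ 2 * ‖ψ ξ‖ ^ 2) := by ring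
        _ = _ := by rw [sq_abs, sq_abs]
    have hw0 := wt_pos ξ
    calc wt ξ * ‖χ ξ‖ ^ 2 ≤ wt ξ * (16 * π ^ 4 * ((ξ j) ^ 2 * (ξ i) ^ 2 * ‖ψ ξ‖ ^ 2)) := by
          gcongr
      _ ≤ wt ξ * (16 * π ^ 4 * (wt ξ * wt ξ * ‖ψ ξ‖ ^ 2)) := by
          gcongr <;> exact sq_coord_le ξ _
      _ = _ := by ring
  have hχi : Integrable fun ξ => wt ξ * ‖χ ξ‖ ^ 2 := by
    refine (h.int.const_mul (16 * π ^ 4)).mono'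
      (continuous_wt.aestronglyMeasurable.mul (hχm.norm.pow 2)) (ae_of_all _ fun ξ => ?_)
    rw [norm_of_nonneg (mul_nonneg (wt_pos ξ).le (by positivity))]
    exact hχb ξ
  refine ⟨χ, hχI, ?_, fun x => ?_, hχi, ?_⟩
  · rw [memLp_two_iff_integrable_sq_norm hχm]
    refine hχi.mono' (hχm.norm.pow 2) (ae_of_all _ fun ξ => ?_)
    rw [norm_of_nonneg (by positivity)]
    exact le_mul_of_one_le_left (by positivity) (one_le_wt ξ)
  · unfold dq
    push_cast
    rw [(h.dx_eq i).2, (h.dx_eq i).2]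
    simp only [fourier_eq]
    rw [← integral_sub ((fourierIntegral_convergent_iff _).2 hI)
      ((fourierIntegral_convergent_iff x).2 hI), div_eq_inv_mul, ← integral_const_mul]
    refine integral_congr_ae (ae_of_all _ fun ξ => ?_)
    simp only [Circle.smul_def, hχ, hm, fourierChar_apply, inner_add_right, inner_smul_right,
      EuclideanSpace.inner_single_right, smul_eq_mul]
    have : Complex.exp (2 * π * ((-(inner ℝ ξ x + t * (1 * (starRingEnd ℝ) (ξ j))) : ℝ) : ℂ) *
        Complex.I) = Complex.exp (2 * π * ((-(inner ℝ ξ x) : ℝ) : ℂ) * Complex.I) *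
        Complex.exp (Complex.I * ((-(2 * π * t * ξ j) : ℝ) : ℂ)) := by
      rw [← Complex.exp_add]; simp; ring_nf
    push_cast at this ⊢
    rw [this]
    ring
  · refine (integral_mono hχi (h.int.const_mul _) hχb).trans ?_
    rw [integral_const_mul]
    gcongr
    exact h.le

lemma integral_sq_dq_dx_le (h : HasSpectrum g ψ B) (i j : Fin 3) {t : ℝ} (ht : t ≠ 0) :
    Integrable (fun x => dq j t (fun x => fderiv ℝ g x (single i 1)) x ^ 2) ∧
    ∫ x, dq j t (fun x => fderiv ℝ g x (single i 1)) x ^ 2 ≤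
      16 * π ^ 4 * B ^ 2 := by
  obtain ⟨χ, h1, h2, h3, h4, h5⟩ := h.dq_dx_eq i j ht
  obtain ⟨h6, h7⟩ := integral_sq_of_eq_fourier h1 h2 h3
  refine ⟨h6, ?_⟩
  rw [h7]
  refine (integral_mono ((memLp_two_iff_integrable_sq_norm h2.1).1 h2) h4 fun ξ => ?_).trans h5
  exact le_mul_of_one_le_left (by positivity) (one_le_wt ξ)

/-- An `H¹` function times a second difference quotient of an `H³` function: no pointwise bound of
the latter is available, and the product estimate on the Fourier side replaces it. -/
lemma integral_sq_mul_dq_dx_le (hf : HasSpectrum f φ B') (h : HasSpectrum g ψ B) (i j : Fin 3)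
    {t : ℝ} (ht : t ≠ 0) :
    Integrable (fun x =>
      (f x * dq j t (fun x => fderiv ℝ g x (single i 1)) x) ^ 2) ∧
    ∫ x, (f x * dq j t (fun x => fderiv ℝ g x (single i 1)) x) ^ 2 ≤
      sobConst * (16 * π ^ 4 * B ^ 2) *
        ((∫ x, f x ^ 2) + ∑ i, ∫ x, (fderiv ℝ f x (single i 1)) ^ 2) := by
  obtain ⟨χ, h1, h2, h3, h4, h5⟩ := h.dq_dx_eq i j ht
  obtain ⟨h6, h7⟩ := integral_sq_convolution_le hf.integrable h1 hf.integral_wt_le.1 h4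
  have h8 := integral_sq_of_eq_fourier
    (g := fun x => f x * dq j t (fun x => fderiv ℝ g x (single i 1)) x)
    (hf.integrable.integrable_convolution (ContinuousLinearMap.mul ℂ ℂ) h1) h6 (fun x => by
      rw [fourier_mul_convolution_eq hf.integrable h1, ← hf.eq, ← h3]
      push_cast; rfl)
  refine ⟨h8.1, ?_⟩
  rw [h8.2]
  refine h7.trans ?_
  have hp : 0 ≤ ∫ ξ, wt ξ * ‖φ ξ‖ ^ 2 := integral_nonneg fun ξ => by
    have := wt_pos ξ; positivity
  calc _ ≤ sobConst * (((∫ x, f x ^ 2) + ∑ i, ∫ x, (fderiv ℝ f x (single i 1)) ^ 2) *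
        (16 * π ^ 4 * B ^ 2)) := by
          refine mul_le_mul_of_nonneg_left ?_ sobConst_nonneg
          refine mul_le_mul hf.integral_wt_le.2 h5 (integral_nonneg fun ξ => ?_)
            (hp.trans hf.integral_wt_le.2)
          have := wt_pos ξ; positivity
    _ = _ := by ring

end HasSpectrum

lemma integrable_interp_weight : Integrable (fun ζ : E3 => (‖ζ‖ ^ 2 + ‖ζ‖ ^ 6)⁻¹) := by
  refine integrable_radial (f := fun r => (r ^ 2 + r ^ 6)⁻¹) ?_
  have h := (integrable_inv_one_add_sq).const_mul (2 : ℝ)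
  refine (h.integrableOn (s := Ioi 0)).mono' ?_ ?_
  · exact (by fun_prop : Measurable fun y : ℝ => y ^ 2 * (y ^ 2 + y ^ 6)⁻¹).aestronglyMeasurable
  · filter_upwards [self_mem_ae_restrict measurableSet_Ioi] with y hy
    have hy : (0 : ℝ) < y := hy
    rw [norm_of_nonneg (by positivity), ← div_eq_mul_inv, ← div_eq_mul_inv,
      div_le_div_iff₀ (by positivity) (by positivity)]
    nlinarith [sq_nonneg (y ^ 2 - 1), pow_pos hy 2, mul_nonneg (sq_nonneg y) (sq_nonneg (y ^ 2 - 1))]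

/-- Interpolation of `L^∞` between `H¹` and `H³` (exponents `3/4` and `1/4`). -/
lemma HasSpectrum.abs_le_interp {f : E3 → ℝ} {φ : E3 → ℂ} {B K δ : ℝ} (h : HasSpectrum f φ B)
    (hδ : 0 < δ)
    (hK : (∫ x, f x ^ 2) + ∑ i, ∫ x, (fderiv ℝ f x (single i 1)) ^ 2 ≤ K * δ ^ 2)
    (x : E3) :
    |f x| ≤ √(K + B ^ 2) * √(∫ ζ : E3, (‖ζ‖ ^ 2 + ‖ζ‖ ^ 6)⁻¹) *
      δ ^ (3 / 4 : ℝ) := by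
  set W : E3 → ℝ := fun ξ => δ⁻¹ ^ 2 * wt ξ + wt ξ ^ 3 with hW
  have hW0 : ∀ ξ, 0 < W ξ := fun ξ => by have := wt_pos ξ; positivity
  have hWc : Continuous W := by have := continuous_wt; fun_prop
  set r : ℝ := √δ with hr
  have hr0 : 0 < r := sqrt_pos.2 hδ
  have hrδ : r ^ 2 = δ := sq_sqrt hδ.le
  -- rescaling `ξ = ζ / √δ`
  have hWle : ∀ᵐ ξ : E3, (W ξ)⁻¹ ≤ δ ^ 3 * (‖r • ξ‖ ^ 2 + ‖r • ξ‖ ^ 6)⁻¹ := by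
    have : ∀ᵐ ξ : E3, ξ ≠ 0 := by
      simp [ae_iff]
    filter_upwards [this] with ξ hξ
    rw [norm_smul, norm_of_nonneg hr0.le, mul_pow, mul_pow, show r ^ 6 = (r ^ 2) ^ 3 by ring,
      hrδ, ← div_eq_mul_inv, inv_eq_one_div, div_le_div_iff₀ (hW0 ξ) (by positivity)]
    have h1 := norm_sq_le_wt ξ
    have h2 : ‖ξ‖ ^ 6 ≤ wt ξ ^ 3 := by
      rw [show ‖ξ‖ ^ 6 = (‖ξ‖ ^ 2) ^ 3 by ring]; gcongr
    have h3 : δ ^ 3 * W ξ = δ * wt ξ + δ ^ 3 * wt ξ ^ 3 := by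
      simp only [hW]; field_simp
    rw [h3, one_mul]
    gcongr
  have hsc : Integrable (fun ξ : E3 => (‖r • ξ‖ ^ 2 + ‖r • ξ‖ ^ 6)⁻¹) :=
    integrable_interp_weight.comp_smul hr0.ne'
  have hWi : Integrable (fun ξ => (W ξ)⁻¹) := by
    refine (hsc.const_mul (δ ^ 3)).mono' (hWc.inv₀ fun ξ => (hW0 ξ).ne').aestronglyMeasurable ?_
    filter_upwards [hWle] with ξ hξ
    rwa [norm_of_nonneg (inv_nonneg.2 (hW0 ξ).le)]
  have hWint : ∫ ξ, (W ξ)⁻¹ ≤ (∫ ζ : E3, (‖ζ‖ ^ 2 + ‖ζ‖ ^ 6)⁻¹) * δ ^ (3 / 2 : ℝ) := by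
    refine (integral_mono_ae hWi (hsc.const_mul (δ ^ 3)) hWle).trans (le_of_eq ?_)
    rw [integral_const_mul, Measure.integral_comp_smul volume
      (fun ζ : E3 => (‖ζ‖ ^ 2 + ‖ζ‖ ^ 6)⁻¹) r]
    simp only [finrank_euclideanSpace, card_fin, smul_eq_mul]
    have h3 : δ ^ (3 / 2 : ℝ) = r ^ 3 := by
      rw [hr, sqrt_eq_rpow, ← rpow_natCast, ← rpow_mul hδ.le]; norm_num
    rw [abs_of_pos (by positivity), h3, ← hrδ]
    field_simp
  have hwφ := h.integral_wt_le
  have e2 : ∀ ξ, W ξ * ‖φ ξ‖ ^ 2 = δ⁻¹ ^ 2 * (wt ξ * ‖φ ξ‖ ^ 2) + wt ξ ^ 3 * ‖φ ξ‖ ^ 2 :=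
    fun ξ => by ring
  have hWφ : Integrable (fun ξ => W ξ * ‖φ ξ‖ ^ 2) := by
    simp only [e2]; exact (hwφ.1.const_mul _).add h.int
  have hWφi : ∫ ξ, W ξ * ‖φ ξ‖ ^ 2 ≤ K + B ^ 2 := by
    simp only [e2]
    rw [integral_add (hwφ.1.const_mul _) h.int, integral_const_mul]
    have : δ⁻¹ ^ 2 * ∫ ξ, wt ξ * ‖φ ξ‖ ^ 2 ≤ δ⁻¹ ^ 2 * (K * δ ^ 2) := by
      gcongr; exact hwφ.2.trans hK
    have e : δ⁻¹ ^ 2 * (K * δ ^ 2) = K := by field_simp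
    linarith [h.le]
  have h34 : √(δ ^ (3 / 2 : ℝ)) = δ ^ (3 / 4 : ℝ) := by
    rw [sqrt_eq_rpow, ← rpow_mul hδ.le]; norm_num
  calc |f x| ≤ ∫ ξ, ‖φ ξ‖ := h.abs_le_integral x
    _ ≤ _ := (integral_norm_le_weighted h.meas hWc hW0 hWφ hWi).2
    _ ≤ √(K + B ^ 2) *
        √((∫ ζ : E3, (‖ζ‖ ^ 2 + ‖ζ‖ ^ 6)⁻¹) * δ ^ (3 / 2 : ℝ)) := by gcongr
    _ = _ := by
      rw [sqrt_mul (integral_nonneg fun ζ => by positivity), h34]; ring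

/-! ### Laplace integrals and Bessel functions -/

/-- The integrals `∫₀^∞ e^{-x} x^k (2 + ε x)^s dx`. Under `t = 1 + ε x`, `ε = 1 / γ`, the Bessel
functions become such integrals, which are smooth in `ε` up to `ε = 0`. -/
def lapInt (k s ε : ℝ) : ℝ := ∫ x in Ioi (0 : ℝ), exp (-x) * x ^ k * (2 + ε * x) ^ s

lemma rpow_le_sq {a s : ℝ} (ha : 1 ≤ a) (hs : s ≤ 2) : a ^ s ≤ a ^ 2 := by
  rw [← rpow_natCast]
  exact rpow_le_rpow_of_exponent_le ha (by exact_mod_cast hs)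

lemma integrableOn_exp_rpow {k : ℝ} (hk : -1 < k) :
    IntegrableOn (fun x : ℝ => exp (-x) * x ^ k) (Ioi 0) := by
  have := GammaIntegral_convergent (s := k + 1) (by linarith)
  simpa using this

lemma integrableOn_exp_rpow_sq {k : ℝ} (hk : -1 < k) (ε : ℝ) :
    IntegrableOn (fun x : ℝ => exp (-x) * x ^ k * (2 + ε * x) ^ 2) (Ioi 0) := by
  have h0 := (integrableOn_exp_rpow hk).const_mul 4
  have h1 := (integrableOn_exp_rpow (k := k + 1) (by linarith)).const_mul (4 * ε)
  have h2 := (integrableOn_exp_rpow (k := k + 2) (by linarith)).const_mul (ε ^ 2)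
  refine ((h0.add h1).add h2).congr ?_
  filter_upwards [self_mem_ae_restrict measurableSet_Ioi] with x hx
  simp only [Pi.add_apply]
  rw [rpow_add hx, rpow_add hx, rpow_one, rpow_two]
  ring

lemma lapInt_integrand_measurable (k s ε : ℝ) :
    AEStronglyMeasurable (fun x : ℝ => exp (-x) * x ^ k * (2 + ε * x) ^ s)
      (volume.restrict (Ioi 0)) :=
  (by fun_prop : Measurable fun x : ℝ =>
    exp (-x) * x ^ k * (2 + ε * x) ^ s).aestronglyMeasurable

lemma lapInt_integrable {k s ε : ℝ} (hk : -1 < k) (hs : s ≤ 2) (hε : 0 ≤ ε) :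
    IntegrableOn (fun x : ℝ => exp (-x) * x ^ k * (2 + ε * x) ^ s) (Ioi 0) := by
  refine (integrableOn_exp_rpow_sq hk ε).mono' (lapInt_integrand_measurable k s ε) ?_
  filter_upwards [self_mem_ae_restrict measurableSet_Ioi] with x hx
  have h2 : 1 ≤ 2 + ε * x := by nlinarith [mul_nonneg hε hx.le]
  have := rpow_le_sq h2 hs
  have h3 : 0 ≤ (2 + ε * x) ^ s := rpow_nonneg (by linarith) _
  have h4 : 0 < x ^ k := rpow_pos_of_pos hx _
  rw [norm_of_nonneg (by positivity)]
  gcongr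

lemma hasDerivAt_lapInt {k s ε : ℝ} (hk : -1 < k) (hs : s ≤ 2) (hε : 0 < ε) :
    HasDerivAt (lapInt k s) (s * lapInt (k + 1) (s - 1) ε) ε := by
  have key := hasDerivAt_integral_of_dominated_loc_of_deriv_le
    (μ := volume.restrict (Ioi (0 : ℝ))) (x₀ := ε) (s := Ioo 0 (2 * ε))
    (F := fun ε x => exp (-x) * x ^ k * (2 + ε * x) ^ s)
    (F' := fun ε x => s * (exp (-x) * x ^ (k + 1) * (2 + ε * x) ^ (s - 1)))
    (bound := fun x => |s| * (exp (-x) * x ^ (k + 1) * (2 + (2 * ε) * x) ^ 2))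
    (Ioo_mem_nhds hε (by linarith))
    (Eventually.of_forall fun e => lapInt_integrand_measurable k s e)
    (lapInt_integrable hk hs hε.le)
    ((lapInt_integrand_measurable (k + 1) (s - 1) ε).const_mul s) ?_
    ((integrableOn_exp_rpow_sq (by linarith) _).const_mul _) ?_
  · have := key.2
    rw [integral_const_mul] at this
    exact this
  · filter_upwards [self_mem_ae_restrict measurableSet_Ioi] with x hx e he
    have hx : (0 : ℝ) < x := hx
    have he0 : 0 < e * x := mul_pos he.1 hx
    rw [norm_mul, norm_eq_abs, norm_of_nonneg (by positivity)]
    gcongr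
    refine (rpow_le_sq (by linarith) (by linarith)).trans ?_
    have : e * x ≤ 2 * ε * x := by gcongr; exact he.2.le
    gcongr
  · filter_upwards [self_mem_ae_restrict measurableSet_Ioi] with x hx e he
    have he0 : 0 < e * x := mul_pos he.1 hx
    have h1 : HasDerivAt (fun e => 2 + e * x) x e := by
      simpa using ((hasDerivAt_id e).mul_const x).const_add 2
    have h2 := (h1.rpow_const (p := s) (Or.inl (by linarith))).const_mul (exp (-x) * x ^ k)
    refine h2.congr_deriv ?_
    rw [rpow_add hx, rpow_one]; ring

lemma lapInt_zero {k s : ℝ} (hk : -1 < k) : lapInt k s 0 = 2 ^ s * Gamma (k + 1) := by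
  have h := integral_const_mul (μ := volume.restrict (Ioi (0 : ℝ))) ((2 : ℝ) ^ s)
    (fun x => exp (-x) * x ^ k)
  unfold lapInt
  rw [Gamma_eq_integral (by linarith)]
  simp only [add_sub_cancel_right]
  rw [← h]
  simp [mul_comm]

lemma abs_two_add_rpow_sub_le {s y : ℝ} (hs : s ≤ 2) (hy : 0 ≤ y) :
    |(2 + y) ^ s - 2 ^ s| ≤ |s| * (2 + y) ^ 2 * y := by
  have key := Convex.norm_image_sub_le_of_norm_hasDerivWithin_le (𝕜 := ℝ)
    (f := fun z : ℝ => (2 + z) ^ s) (f' := fun z => s * (2 + z) ^ (s - 1)) (s := Icc 0 y)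
    (C := |s| * (2 + y) ^ 2) (x := 0) (y := y) (fun z hz => ?_) (fun z hz => ?_) (convex_Icc 0 y)
    ⟨le_rfl, hy⟩ ⟨hy, le_rfl⟩
  · simpa [abs_of_nonneg hy] using key
  · have h1 : HasDerivAt (fun z : ℝ => 2 + z) 1 z := (hasDerivAt_id z).const_add 2
    have := (h1.rpow_const (p := s) (Or.inl (by linarith [hz.1]))).hasDerivWithinAt (s := Icc 0 y)
    simpa using this
  · have h3 : 0 ≤ (2 + z) ^ (s - 1) := rpow_nonneg (by linarith [hz.1]) _
    rw [norm_mul, norm_eq_abs, norm_of_nonneg h3]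
    gcongr
    refine (rpow_le_sq (by linarith [hz.1]) (by linarith)).trans ?_
    have := hz.1
    have := hz.2
    gcongr

lemma abs_lapInt_sub_le {k s ε : ℝ} (hk : -1 < k) (hs : s ≤ 2) (hε : 0 ≤ ε) (hε1 : ε ≤ 1) :
    |lapInt k s ε - lapInt k s 0| ≤ |s| * lapInt (k + 1) 2 1 * ε := by
  unfold lapInt
  rw [← integral_sub (lapInt_integrable hk hs hε) (lapInt_integrable hk hs le_rfl)]
  have hb := (lapInt_integrable (k := k + 1) (s := 2) (ε := 1) (by linarith) le_rfl
    zero_le_one).const_mul (|s| * ε)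
  rw [← norm_eq_abs]
  refine (norm_integral_le_of_norm_le hb ?_).trans (le_of_eq ?_)
  · filter_upwards [self_mem_ae_restrict measurableSet_Ioi] with x hx
    have hx : (0 : ℝ) < x := hx
    have hex : 0 ≤ ε * x := mul_nonneg hε hx.le
    rw [zero_mul, add_zero, ← mul_sub, norm_mul, norm_of_nonneg (by positivity),
      norm_eq_abs]
    have h1 := abs_two_add_rpow_sub_le hs hex
    rw [rpow_add hx, rpow_one, rpow_two]
    calc _ ≤ exp (-x) * x ^ k * (|s| * (2 + 1 * x) ^ 2 * (ε * x)) := by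
          gcongr
          exact h1.trans (by gcongr)
      _ = _ := by ring
  · rw [integral_const_mul]; ring

/-- Integration by parts. -/
lemma lapInt_by_parts {k s ε : ℝ} (hk : -1 < k) (hs : s ≤ 2) (hε : 0 ≤ ε) :
    lapInt (k + 1) s ε = (k + 1) * lapInt k s ε + s * ε * lapInt (k + 1) (s - 1) ε := by
  set f : ℝ → ℝ := fun x => exp (-x) * x ^ (k + 1) * (2 + ε * x) ^ s with hf
  set f' : ℝ → ℝ := fun x => -(exp (-x) * x ^ (k + 1) * (2 + ε * x) ^ s) +
    ((k + 1) * (exp (-x) * x ^ k * (2 + ε * x) ^ s) +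
      s * ε * (exp (-x) * x ^ (k + 1) * (2 + ε * x) ^ (s - 1))) with hf'
  have i1 := lapInt_integrable (k := k + 1) (s := s) (ε := ε) (by linarith) hs hε
  have i2 := lapInt_integrable (k := k) (s := s) (ε := ε) hk hs hε
  have i3 := lapInt_integrable (k := k + 1) (s := s - 1) (ε := ε) (by linarith) (by linarith) hε
  have hd : ∀ x ∈ Ioi (0 : ℝ), HasDerivAt f (f' x) x := fun x hx => by
    have hp : 0 < 2 + ε * x := by have := mul_nonneg hε hx.le; linarith
    have d1 : HasDerivAt (fun x => exp (-x)) (-exp (-x)) x := by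
      simpa using (hasDerivAt_neg x).exp
    have d2 := hasDerivAt_rpow_const (x := x) (p := k + 1) (Or.inl hx.ne')
    have d3 : HasDerivAt (fun x => 2 + ε * x) ε x := by
      simpa using ((hasDerivAt_id x).const_mul ε).const_add 2
    have d4 := d3.rpow_const (p := s) (Or.inl hp.ne')
    refine ((d1.mul d2).mul d4).congr_deriv ?_
    simp only [hf', add_sub_cancel_right, Pi.mul_apply]; ring
  have hint : IntegrableOn f' (Ioi 0) := i1.neg.add ((i2.const_mul _).add (i3.const_mul _))
  have hc : ContinuousWithinAt f (Ici 0) 0 := by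
    have h1 : ContinuousAt f 0 := by
      have := continuousAt_rpow_const 0 (k + 1) (Or.inr (by linarith))
      have h2 : ContinuousAt (fun x : ℝ => (2 + ε * x) ^ s) 0 :=
        ContinuousAt.rpow_const (by fun_prop) (Or.inl (by simp))
      fun_prop
    exact h1.continuousWithinAt
  have ht : Tendsto f atTop (nhds 0) :=
    tendsto_zero_of_hasDerivAt_of_integrableOn_Ioi hd hint i1
  have key := integral_Ioi_of_hasDerivAt_of_tendsto hc hd hint ht
  have h0 : f 0 = 0 := by simp [hf, zero_rpow (by linarith : k + 1 ≠ 0)]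
  have i23 : IntegrableOn (fun x => (k + 1) * (exp (-x) * x ^ k * (2 + ε * x) ^ s) +
      s * ε * (exp (-x) * x ^ (k + 1) * (2 + ε * x) ^ (s - 1))) (Ioi 0) :=
    (i2.const_mul _).add (i3.const_mul _)
  rw [integral_add (by exact i1.neg) i23,
    integral_add (i2.const_mul _) (i3.const_mul _), integral_neg, integral_const_mul,
    integral_const_mul] at key
  unfold lapInt
  linarith

lemma lapInt_succ {k s ε : ℝ} (hk : -1 < k) (hs : s ≤ 1) (hε : 0 ≤ ε) :
    lapInt k (s + 1) ε = 2 * lapInt k s ε + ε * lapInt (k + 1) s ε := by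
  have i2 := lapInt_integrable (k := k) (s := s) (ε := ε) hk (by linarith) hε
  have i3 := lapInt_integrable (k := k + 1) (s := s) (ε := ε) (by linarith) (by linarith) hε
  unfold lapInt
  rw [← integral_const_mul, ← integral_const_mul, ← integral_add (i2.const_mul _) (i3.const_mul _)]
  refine setIntegral_congr_fun measurableSet_Ioi fun x hx => ?_
  have hp : 0 < 2 + ε * x := by have := mul_nonneg hε hx.le; linarith
  rw [rpow_add hp, rpow_add hx, rpow_one, rpow_one]
  ring

lemma lapInt_pos {k s ε : ℝ} (hk : -1 < k) (hs : s ≤ 2) (hε : 0 ≤ ε) : 0 < lapInt k s ε := by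
  have hpos : ∀ x ∈ Ioi (0 : ℝ), 0 < exp (-x) * x ^ k * (2 + ε * x) ^ s := fun x hx => by
    have hp : 0 < 2 + ε * x := by have := mul_nonneg hε hx.le; linarith
    have := rpow_pos_of_pos hx k
    have := rpow_pos_of_pos hp s
    positivity
  unfold lapInt
  rw [setIntegral_pos_iff_support_of_nonneg_ae]
  · have : Ioi (0 : ℝ) ⊆ Function.support (fun x : ℝ =>
        exp (-x) * x ^ k * (2 + ε * x) ^ s) ∩ Ioi 0 :=
      fun x hx => ⟨(hpos x hx).ne', hx⟩
    refine lt_of_lt_of_le ?_ (measure_mono this)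
    simp
  · filter_upwards [self_mem_ae_restrict measurableSet_Ioi] with x hx
    exact (hpos x hx).le
  · exact lapInt_integrable hk hs hε

lemma lapInt_zero_le {k s ε : ℝ} (hk : -1 < k) (hs0 : 0 ≤ s) (hs : s ≤ 2) (hε : 0 ≤ ε) :
    lapInt k s 0 ≤ lapInt k s ε := by
  refine setIntegral_mono_on (lapInt_integrable hk hs le_rfl) (lapInt_integrable hk hs hε)
    measurableSet_Ioi fun x hx => ?_
  have hx : (0 : ℝ) < x := hx
  gcongr

/-- The modified Bessel functions in terms of `lapInt`. -/
lemma besselK_eq (j : ℕ) {ε : ℝ} (hε : 0 < ε) :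
    besselK j (1 / ε) = (1 / (2 * ε)) ^ j * (Gamma (1 / 2) / Gamma ((j : ℝ) + 1 / 2)) *
      (exp (-(1 / ε)) * (ε * ε ^ ((j : ℝ) - 1 / 2)) *
        lapInt ((j : ℝ) - 1 / 2) ((j : ℝ) - 1 / 2) ε) := by
  unfold besselK lapInt
  congr 1
  · field_simp
  · have h1 : ∫ t in Ioi (1 : ℝ), exp (-(1 / ε) * t) * (t ^ 2 - 1) ^ ((j : ℝ) - 1 / 2) =
        ∫ y in Ioi (0 : ℝ), exp (-(1 / ε) * (y + 1)) *
          ((y + 1) ^ 2 - 1) ^ ((j : ℝ) - 1 / 2) := by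
      have := (measurePreserving_add_right (volume : Measure ℝ) 1).setIntegral_preimage_emb
        (measurableEmbedding_addRight (1 : ℝ))
        (fun t => exp (-(1 / ε) * t) * (t ^ 2 - 1) ^ ((j : ℝ) - 1 / 2)) (Ioi 1)
      rw [← this]; simp
    rw [h1]
    have h2 := integral_comp_mul_left_Ioi (fun y => exp (-(1 / ε) * (y + 1)) *
          ((y + 1) ^ 2 - 1) ^ ((j : ℝ) - 1 / 2)) 0 hε
    rw [mul_zero, smul_eq_mul] at h2
    have h3 : ∀ I : ℝ, I = ε * (ε⁻¹ * I) := fun I => by field_simp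
    rw [h3 (∫ y in Ioi (0 : ℝ), _), ← h2, ← integral_const_mul, ← integral_const_mul]
    refine setIntegral_congr_fun measurableSet_Ioi fun x hx => ?_
    have hx : (0 : ℝ) < x := hx
    have e1 : (ε * x + 1) ^ 2 - 1 = ε * x * (2 + ε * x) := by ring
    have e2 : -(1 / ε) * (ε * x + 1) = -(1 / ε) + -x := by field_simp; ring
    rw [e1, e2, exp_add, mul_rpow (by positivity) (by positivity),
      mul_rpow hε.le hx.le]
    ring

/-! ### Thermodynamic functions of `ε = θ / c²` -/

/-- `Q₀`: up to elementary factors, `K₂(1/ε)`. -/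
def Q0 (ε : ℝ) : ℝ := lapInt (3 / 2) (3 / 2) ε

/-- The normalised first moment: the enthalpy per particle is `c² (1 + ε j(ε))`. -/
def jfun (ε : ℝ) : ℝ := lapInt (5 / 2) (3 / 2) ε / Q0 ε

/-- The enthalpy per particle in units of `c²`. -/
def mfun (ε : ℝ) : ℝ := 1 + ε * jfun ε

/-- The heat capacity at constant pressure, `(ε j(ε))'`; its value at `ε = 0` is `5/2`. -/
def cpfun (ε : ℝ) : ℝ := lapInt (7 / 2) (3 / 2) ε / Q0 ε - jfun ε * jfun ε

/-- The inverse adiabatic index `1 - 1 / c_p`; its value at `ε = 0` is `3/5`. -/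
def alfun (ε : ℝ) : ℝ := 1 - (cpfun ε)⁻¹

/-- The relativistic correction in the entropy: `log P + S = 5/2 log θ + Ψ(θ/c²) + const`. -/
def psifun (ε : ℝ) : ℝ := log (Q0 ε) + jfun ε

lemma Q0_pos {ε : ℝ} (hε : 0 ≤ ε) : 0 < Q0 ε := lapInt_pos (by norm_num) (by norm_num) hε

lemma jfun_pos {ε : ℝ} (hε : 0 ≤ ε) : 0 < jfun ε :=
  div_pos (lapInt_pos (by norm_num) (by norm_num) hε) (Q0_pos hε)

lemma Gamma_five_halves : Gamma (5 / 2) = 3 / 4 * √π := by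
  rw [show (5 / 2 : ℝ) = 3 / 2 + 1 by norm_num, Gamma_add_one (by norm_num),
    show (3 / 2 : ℝ) = 1 / 2 + 1 by norm_num, Gamma_add_one (by norm_num),
    Gamma_one_half_eq]
  ring

lemma Q0_zero : Q0 0 = 2 ^ (3 / 2 : ℝ) * Gamma (5 / 2) := by
  unfold Q0; rw [lapInt_zero (by norm_num)]; norm_num

lemma jfun_zero : jfun 0 = 5 / 2 := by
  have h : lapInt (5 / 2) (3 / 2) 0 = 5 / 2 * Q0 0 := by
    have := lapInt_by_parts (k := 3 / 2) (s := 3 / 2) (ε := 0) (by norm_num) (by norm_num) le_rfl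
    norm_num at this ⊢
    exact this
  unfold jfun; rw [h, mul_div_cancel_right₀ _ (Q0_pos le_rfl).ne']

lemma cpfun_zero : cpfun 0 = 5 / 2 := by
  have h : lapInt (7 / 2) (3 / 2) 0 = 35 / 4 * Q0 0 := by
    unfold Q0
    have h1 := lapInt_by_parts (k := 3 / 2) (s := 3 / 2) (ε := 0) (by norm_num) (by norm_num) le_rfl
    have h2 := lapInt_by_parts (k := 5 / 2) (s := 3 / 2) (ε := 0) (by norm_num) (by norm_num) le_rfl
    norm_num at h1 h2 ⊢
    rw [h2, h1]; ring
  unfold cpfun; rw [h, mul_div_cancel_right₀ _ (Q0_pos le_rfl).ne', jfun_zero]; norm_num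

lemma hasDerivAt_mfun_aux {ε : ℝ} (hε : 0 < ε) :
    HasDerivAt Q0 (3 / 2 * lapInt (5 / 2) (1 / 2) ε) ε ∧
    HasDerivAt jfun ((cpfun ε - jfun ε) / ε) ε := by
  have h0 := hasDerivAt_lapInt (k := 3 / 2) (s := 3 / 2) (by norm_num) (by norm_num) hε
  have h1 := hasDerivAt_lapInt (k := 5 / 2) (s := 3 / 2) (by norm_num) (by norm_num) hε
  have p1 := lapInt_by_parts (k := 3 / 2) (s := 3 / 2) (ε := ε) (by norm_num) (by norm_num) hε.le
  have p2 := lapInt_by_parts (k := 5 / 2) (s := 3 / 2) (ε := ε) (by norm_num) (by norm_num) hε.le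
  norm_num at h0 h1 p1 p2
  refine ⟨h0, (h1.div h0 (Q0_pos hε.le).ne').congr_deriv ?_⟩
  unfold cpfun jfun
  have e0 : lapInt (3 / 2) (3 / 2) ε = Q0 ε := rfl
  grind

lemma hasDerivAt_mfun {ε : ℝ} (hε : 0 < ε) : HasDerivAt mfun (cpfun ε) ε := by
  refine (((hasDerivAt_id ε).mul (hasDerivAt_mfun_aux hε).2).const_add 1).congr_deriv ?_
  simp only [id]; field_simp; ring

lemma hasDerivAt_psifun {ε : ℝ} (hε : 0 < ε) :
    HasDerivAt psifun ((cpfun ε - 5 / 2) / ε) ε := by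
  obtain ⟨h1, h2⟩ := hasDerivAt_mfun_aux hε
  refine ((h1.log (Q0_pos hε.le).ne').add h2).congr_deriv ?_
  have p1 := lapInt_by_parts (k := 3 / 2) (s := 3 / 2) (ε := ε) (by norm_num) (by norm_num) hε.le
  have e0 : lapInt (3 / 2) (3 / 2) ε = Q0 ε := rfl
  have hQ := (Q0_pos hε.le).ne'
  have q1 : lapInt (5 / 2) (1 / 2) ε = (lapInt (5 / 2) (3 / 2) ε - 5 / 2 * Q0 ε) / (3 / 2 * ε) := by
    field_simp; linarith
  rw [q1]
  have : lapInt (5 / 2) (3 / 2) ε = jfun ε * Q0 ε := by unfold jfun; field_simp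
  rw [this]
  field_simp
  ring

/-! ### The equation of state in terms of `ε` -/

lemma besselK_two {ε : ℝ} (hε : 0 < ε) :
    besselK 2 (1 / ε) = exp (-(1 / ε)) * √ε * Q0 ε / 3 := by
  rw [besselK_eq 2 hε]
  have e1 : ((2 : ℕ) : ℝ) - 1 / 2 = 3 / 2 := by norm_num
  have e2 : ((2 : ℕ) : ℝ) + 1 / 2 = 5 / 2 := by norm_num
  have e3 : ε ^ (3 / 2 : ℝ) = ε * √ε := by
    rw [show (3 / 2 : ℝ) = 1 + 1 / 2 by norm_num, rpow_add hε, rpow_one,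
      sqrt_eq_rpow]
  rw [e1, e2, e3, Gamma_five_halves, Gamma_one_half_eq]
  change _ * (_ * Q0 ε) = _
  field_simp
  norm_num

lemma besselK_ratio {ε : ℝ} (hε : 0 < ε) :
    besselK 1 (1 / ε) / besselK 2 (1 / ε) = mfun ε - 4 * ε := by
  have hQ := (Q0_pos hε.le).ne'
  have hK1 : besselK 1 (1 / ε) = exp (-(1 / ε)) * √ε * lapInt (1 / 2) (1 / 2) ε := by
    rw [besselK_eq 1 hε]
    have e1 : ((1 : ℕ) : ℝ) - 1 / 2 = 1 / 2 := by norm_num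
    have e2 : ((1 : ℕ) : ℝ) + 1 / 2 = 1 / 2 + 1 := by norm_num
    rw [e1, e2, Gamma_add_one (by norm_num), Gamma_one_half_eq, ← sqrt_eq_rpow]
    field_simp
  have hK1' : 3 * lapInt (1 / 2) (1 / 2) ε = (1 - 4 * ε) * Q0 ε + ε * lapInt (5 / 2) (3 / 2) ε := by
    have p1 := lapInt_by_parts (k := 3 / 2) (s := 3 / 2) (ε := ε) (by norm_num) (by norm_num) hε.le
    have p2 := lapInt_by_parts (k := 1 / 2) (s := 3 / 2) (ε := ε) (by norm_num) (by norm_num) hε.le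
    have a1 := lapInt_succ (k := 3 / 2) (s := 1 / 2) (ε := ε) (by norm_num) (by norm_num) hε.le
    have a2 := lapInt_succ (k := 1 / 2) (s := 1 / 2) (ε := ε) (by norm_num) (by norm_num) hε.le
    norm_num at p1 p2 a1 a2
    have e0 : lapInt (3 / 2) (3 / 2) ε = Q0 ε := rfl
    grind
  rw [hK1, besselK_two hε]
  unfold mfun jfun
  field_simp
  linarith

lemma gam_eq {c θ : ℝ} : gam c θ = 1 / (θ / c ^ 2) := by unfold gam; rw [one_div_div]

lemma relEnthalpy_eq {c n θ : ℝ} (hc : 0 < c) (hθ : 0 < θ) :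
    relEnergyDensity c n θ + relPressure n θ = c ^ 2 * n * mfun (θ / c ^ 2) := by
  unfold relEnergyDensity relPressure
  rw [gam_eq, besselK_ratio (by positivity)]
  field_simp; ring

/-- The entropy law of the relativistic gas. -/
lemma log_add_relEntropy {c n θ : ℝ} (hc : 0 < c) (hn : 0 < n) (hθ : 0 < θ) :
    log (relPressure n θ) + relEntropy c n θ =
      5 / 2 * log θ + psifun (θ / c ^ 2) + log (4 * π / 3) := by
  have hε : 0 < θ / c ^ 2 := by positivity
  unfold relPressure relEntropy
  rw [gam_eq, besselK_ratio hε, besselK_two hε]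
  set ε := θ / c ^ 2 with hεd
  have hQ := Q0_pos hε.le
  have e1 : 4 * π * exp 4 * c ^ 3 *
      (exp (-(1 / ε)) * √ε * Q0 ε / 3 / (1 / ε)) / n =
      (4 * π / 3) * exp 4 * exp (-(1 / ε)) * (c ^ 3 * (ε * √ε)) * Q0 ε / n := by
    field_simp
  have e2 : c ^ 3 * (ε * √ε) = θ * √θ := by
    have : √ε = √θ / c := by
      rw [hεd, sqrt_div hθ.le, sqrt_sq hc.le]
    rw [this, hεd]; field_simp
  have hst := sqrt_pos.2 hθ
  have hp : 0 < 4 * π / 3 := by positivity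
  have l1 : log (4 * π / 3 * exp 4 * exp (-(1 / ε))) =
      log (4 * π / 3) + 4 + -(1 / ε) := by
    rw [log_mul (by positivity) (by positivity), log_mul hp.ne' (by positivity),
      log_exp, log_exp]
  rw [e1, e2, log_div (by positivity) hn.ne', log_mul (by positivity) hQ.ne',
    log_mul (x := 4 * π / 3 * exp 4 * exp (-(1 / ε))) (by positivity)
      (by positivity), l1, log_mul hθ.ne' hst.ne', log_mul hn.ne' hθ.ne', log_sqrt hθ.le]
  unfold psifun mfun
  field_simp
  ring

/-- The entropy law of the classical gas, with the same constants at `ε = 0`. -/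
lemma log_add_clEntropy {ρ θ : ℝ} (hn : 0 < ρ) (hθ : 0 < θ) :
    log (relPressure ρ θ) + clEntropy ρ θ =
      5 / 2 * log θ + psifun 0 + log (4 * π / 3) := by
  unfold relPressure clEntropy psifun
  have h2 : 0 < 2 * π := by positivity
  have hp := sqrt_pos.2 pi_pos
  have l1 : log ((2 * π) ^ (-(3 / 2) : ℝ) * exp (-(5 / 2)) * ρ *
      θ ^ (-(3 / 2) : ℝ)) = -(3 / 2) * (log 2 + log π) + -(5 / 2) + log ρ +
        -(3 / 2) * log θ := by
    rw [log_mul (by positivity) (by positivity), log_mul (by positivity) hn.ne',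
      log_mul (by positivity) (by positivity), log_exp, log_rpow h2,
      log_rpow hθ, log_mul (by norm_num) pi_pos.ne']
  have l4 : log 4 = 2 * log 2 := by
    rw [show (4 : ℝ) = 2 ^ 2 by norm_num, log_pow]; norm_num
  have l2 : log (2 ^ (3 / 2 : ℝ) * (3 / 4 * √π)) =
      3 / 2 * log 2 + (log 3 - 2 * log 2 + log π / 2) := by
    rw [log_mul (by positivity) (by positivity), log_rpow (by norm_num),
      log_mul (by norm_num) hp.ne', log_sqrt pi_pos.le,
      log_div (by norm_num) (by norm_num), l4]
  have l3 : log (4 * π / 3) = 2 * log 2 + log π - log 3 := by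
    rw [log_div (by positivity) (by norm_num), log_mul (by norm_num) pi_pos.ne', l4]
  rw [Q0_zero, jfun_zero, Gamma_five_halves, l1, l2, l3, log_mul hn.ne' hθ.ne']
  ring

lemma juttnerFactor_eq {c n θ : ℝ} (hc : 0 < c) (hθ : 0 < θ) :
    juttnerFactor c n θ = n / (2 * π * θ) ^ (3 / 2 : ℝ) * (Q0 0 / Q0 (θ / c ^ 2)) *
      exp (c ^ 2 / θ) := by
  have hε : 0 < θ / c ^ 2 := by positivity
  unfold juttnerFactor
  rw [gam_eq, besselK_two hε, Q0_zero, Gamma_five_halves, exp_neg, one_div_div]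
  have e0 : √(θ / c ^ 2) = √θ / c := by
    rw [sqrt_div hθ.le, sqrt_sq hc.le]
  have e3 : ∀ x : ℝ, 0 < x → x ^ (3 / 2 : ℝ) = x * √x := fun x hx => by
    rw [show (3 / 2 : ℝ) = 1 + 1 / 2 by norm_num, rpow_add hx, rpow_one,
      sqrt_eq_rpow]
  rw [e0, e3 _ (by positivity), e3 _ (by norm_num), sqrt_mul (by positivity),
    sqrt_mul (by norm_num)]
  field_simp

/-! ### Functions that are tame at `ε = 0` -/

/-- `ψ` is `C¹` on some interval `(0, ε₀)`, with bounded value and derivative there and with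
`ψ(ε) = ψ(0) + O(ε)`. -/
def TameAtZero (ψ : ℝ → ℝ) : Prop :=
  ∃ ε₀ > 0, ∃ C ≥ 0, ContDiffOn ℝ 1 ψ (Ioo 0 ε₀) ∧
    ∀ ε ∈ Ioo 0 ε₀, |ψ ε| ≤ C ∧ |deriv ψ ε| ≤ C ∧ |ψ ε - ψ 0| ≤ C * ε

lemma ContDiffOn.differentiableAt_of_Ioo {ψ : ℝ → ℝ} {ε₀ ε : ℝ} (h : ContDiffOn ℝ 1 ψ (Ioo 0 ε₀))
    (hε : ε ∈ Ioo 0 ε₀) : DifferentiableAt ℝ ψ ε :=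
  (h.contDiffAt (isOpen_Ioo.mem_nhds hε)).differentiableAt (by norm_num)

lemma lapInt_le_two_one {k s ε : ℝ} (hk : -1 < k) (hs : s ≤ 2) (hε : 0 ≤ ε) (hε1 : ε ≤ 1) :
    lapInt k s ε ≤ lapInt k 2 1 := by
  refine setIntegral_mono_on (lapInt_integrable hk hs hε)
    (lapInt_integrable hk le_rfl zero_le_one) measurableSet_Ioi fun x hx => ?_
  have hx : (0 : ℝ) < x := hx
  have h1 : 1 ≤ 2 + ε * x := by nlinarith [mul_nonneg hε hx.le]
  have h3 := rpow_le_sq h1 hs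
  rw [rpow_two]
  gcongr
  exact h3.trans (by gcongr)

lemma tameAtZero_lapInt {k s : ℝ} (hk : -1 < k) (hs : s ≤ 2) : TameAtZero (lapInt k s) := by
  have hd : ∀ ε ∈ Ioo (0 : ℝ) 1, HasDerivAt (lapInt k s) (s * lapInt (k + 1) (s - 1) ε) ε :=
    fun ε hε => hasDerivAt_lapInt hk hs hε.1
  have b0 := (lapInt_pos (k := k) (s := 2) (ε := 1) hk le_rfl zero_le_one).le
  have b1 := (lapInt_pos (k := k + 1) (s := 2) (ε := 1) (by linarith) le_rfl zero_le_one).le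
  refine ⟨1, one_pos, lapInt k 2 1 + |s| * lapInt (k + 1) 2 1, by positivity, ?_, fun ε hε => ?_⟩
  · rw [show (1 : WithTop ℕ∞) = 0 + 1 from rfl, contDiffOn_succ_iff_deriv_of_isOpen isOpen_Ioo]
    refine ⟨fun ε hε => (hd ε hε).differentiableAt.differentiableWithinAt, by simp, ?_⟩
    rw [contDiffOn_zero]
    have : ContinuousOn (fun ε => s * lapInt (k + 1) (s - 1) ε) (Ioo 0 1) := fun ε hε =>
      ((hasDerivAt_lapInt (k := k + 1) (s := s - 1) (by linarith) (by linarith)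
        hε.1).continuousAt.const_mul s).continuousWithinAt
    exact this.congr fun ε hε => (hd ε hε).deriv
  · have h0 := (lapInt_pos hk hs hε.1.le).le
    have h1 := (lapInt_pos (k := k + 1) (s := s - 1) (by linarith) (by linarith) hε.1.le).le
    have l0 := lapInt_le_two_one hk hs hε.1.le hε.2.le
    have l1 := lapInt_le_two_one (k := k + 1) (s := s - 1) (by linarith) (by linarith) hε.1.le hε.2.le
    have l2 := abs_lapInt_sub_le hk hs hε.1.le hε.2.le
    have p1 : 0 ≤ |s| * lapInt (k + 1) 2 1 := by positivity
    refine ⟨?_, ?_, ?_⟩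
    · rw [abs_of_nonneg h0]; linarith
    · rw [(hd ε hε).deriv, abs_mul, abs_of_nonneg h1]
      have : |s| * lapInt (k + 1) (s - 1) ε ≤ |s| * lapInt (k + 1) 2 1 := by gcongr
      linarith
    · refine l2.trans (mul_le_mul_of_nonneg_right (by linarith) hε.1.le)

namespace TameAtZero

variable {ψ χ : ℝ → ℝ}

lemma const (a : ℝ) : TameAtZero fun _ => a :=
  ⟨1, one_pos, |a|, abs_nonneg _, contDiffOn_const, fun ε hε => by
    simp only [sub_self, abs_zero, deriv_const]
    exact ⟨le_rfl, abs_nonneg _, mul_nonneg (abs_nonneg _) hε.1.le⟩⟩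

lemma id : TameAtZero fun ε => ε :=
  ⟨1, one_pos, 1, zero_le_one, contDiffOn_id, fun ε hε => by
    rw [deriv_id'', sub_zero, one_mul, abs_of_pos hε.1, abs_one]
    exact ⟨hε.2.le, le_rfl, le_rfl⟩⟩

lemma add (h : TameAtZero ψ) (h' : TameAtZero χ) : TameAtZero fun ε => ψ ε + χ ε := by
  obtain ⟨e, he, C, hC, hs, hb⟩ := h
  obtain ⟨e', he', C', hC', hs', hb'⟩ := h'
  refine ⟨min e e', lt_min he he', C + C', by positivity,
    (hs.mono (Ioo_subset_Ioo_right (min_le_left _ _))).add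
      (hs'.mono (Ioo_subset_Ioo_right (min_le_right _ _))), fun ε hε => ?_⟩
  have m : ε ∈ Ioo 0 e := ⟨hε.1, hε.2.trans_le (min_le_left _ _)⟩
  have m' : ε ∈ Ioo 0 e' := ⟨hε.1, hε.2.trans_le (min_le_right _ _)⟩
  obtain ⟨a, b, c⟩ := hb ε m
  obtain ⟨a', b', c'⟩ := hb' ε m'
  have hd : deriv (fun ε => ψ ε + χ ε) ε = deriv ψ ε + deriv χ ε :=
    deriv_fun_add (hs.differentiableAt_of_Ioo m) (hs'.differentiableAt_of_Ioo m')
  grind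

lemma mul (h : TameAtZero ψ) (h' : TameAtZero χ) : TameAtZero fun ε => ψ ε * χ ε := by
  obtain ⟨e, he, C, hC, hs, hb⟩ := h
  obtain ⟨e', he', C', hC', hs', hb'⟩ := h'
  refine ⟨min e e', lt_min he he', 2 * (C * C') + C * |χ 0|, by positivity,
    (hs.mono (Ioo_subset_Ioo_right (min_le_left _ _))).mul
      (hs'.mono (Ioo_subset_Ioo_right (min_le_right _ _))), fun ε hε => ?_⟩
  have m : ε ∈ Ioo 0 e := ⟨hε.1, hε.2.trans_le (min_le_left _ _)⟩
  have m' : ε ∈ Ioo 0 e' := ⟨hε.1, hε.2.trans_le (min_le_right _ _)⟩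
  obtain ⟨a, b, c⟩ := hb ε m
  obtain ⟨a', b', c'⟩ := hb' ε m'
  have hd : deriv (fun ε => ψ ε * χ ε) ε = deriv ψ ε * χ ε + ψ ε * deriv χ ε :=
    deriv_fun_mul (hs.differentiableAt_of_Ioo m) (hs'.differentiableAt_of_Ioo m')
  have hx : 0 ≤ C * |χ 0| := by positivity
  have hCC : 0 ≤ C * C' := by positivity
  have k1 : |ψ ε| * |χ ε| ≤ C * C' := by gcongr
  have k2 : |deriv ψ ε| * |χ ε| ≤ C * C' := by gcongr
  have k3 : |ψ ε| * |deriv χ ε| ≤ C * C' := by gcongr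
  rw [hd]
  refine ⟨?_, (abs_add_le _ _).trans ?_, ?_⟩
  · rw [abs_mul]; linarith
  · rw [abs_mul, abs_mul]; linarith
  · have e1 : ψ ε * χ ε - ψ 0 * χ 0 = ψ ε * (χ ε - χ 0) + (ψ ε - ψ 0) * χ 0 := by ring
    rw [e1]
    refine (abs_add_le _ _).trans ?_
    rw [abs_mul, abs_mul]
    have k4 : |ψ ε| * |χ ε - χ 0| ≤ C * (C' * ε) := by gcongr
    have k5 : |ψ ε - ψ 0| * |χ 0| ≤ C * ε * |χ 0| := by gcongr
    have k6 : 0 ≤ C * C' * ε := mul_nonneg hCC hε.1.le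
    nlinarith

lemma neg (h : TameAtZero ψ) : TameAtZero fun ε => -ψ ε := by
  simpa using (const (-1)).mul h

lemma sub (h : TameAtZero ψ) (h' : TameAtZero χ) : TameAtZero fun ε => ψ ε - χ ε := by
  simpa [sub_eq_add_neg] using h.add h'.neg

/-- Near `0` the values stay in a neighbourhood of `ψ 0`. -/
lemma near (h : TameAtZero ψ) {d : ℝ} (hd : 0 < d) :
    ∃ ε₀ > 0, ∃ C ≥ 0, ContDiffOn ℝ 1 ψ (Ioo 0 ε₀) ∧
      ∀ ε ∈ Ioo 0 ε₀, |ψ ε| ≤ C ∧ |deriv ψ ε| ≤ C ∧ |ψ ε - ψ 0| ≤ C * ε ∧ |ψ ε - ψ 0| < d := by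
  obtain ⟨e, he, C, hC, hs, hb⟩ := h
  have hC1 : 0 < C + 1 := by linarith
  refine ⟨min e (d / (C + 1)), lt_min he (by positivity), C, hC,
    hs.mono (Ioo_subset_Ioo_right (min_le_left _ _)), fun ε hε => ?_⟩
  obtain ⟨a, b, c⟩ := hb ε ⟨hε.1, hε.2.trans_le (min_le_left _ _)⟩
  refine ⟨a, b, c, c.trans_lt ?_⟩
  have := hε.2.trans_le (min_le_right _ _)
  rw [lt_div_iff₀ hC1] at this
  nlinarith [hε.1]

/-- Composition with a function that is `C¹` near `ψ 0`. -/
lemma comp {G G' : ℝ → ℝ} {d M : ℝ} (h : TameAtZero ψ) (hd : 0 < d)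
    (hG : ∀ y ∈ Metric.ball (ψ 0) d, HasDerivAt G (G' y) y)
    (hGc : ContDiffOn ℝ 1 G (Metric.ball (ψ 0) d))
    (hM : ∀ y ∈ Metric.ball (ψ 0) d, |G' y| ≤ M) : TameAtZero fun ε => G (ψ ε) := by
  obtain ⟨e, he, C, hC, hs, hb⟩ := h.near hd
  have hM0 : 0 ≤ M := (abs_nonneg _).trans (hM _ (Metric.mem_ball_self hd))
  have hin : ∀ ε ∈ Ioo 0 e, ψ ε ∈ Metric.ball (ψ 0) d := fun ε hε => by
    exact (hb ε hε).2.2.2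
  have hLip : ∀ ε ∈ Ioo 0 e, |G (ψ ε) - G (ψ 0)| ≤ M * |ψ ε - ψ 0| := fun ε hε => by
    have := (convex_ball (ψ 0) d).norm_image_sub_le_of_norm_hasDerivWithin_le (𝕜 := ℝ)
      (f := G) (f' := G') (C := M) (fun y hy => (hG y hy).hasDerivWithinAt)
      (fun y hy => hM y hy) (Metric.mem_ball_self hd) (hin ε hε)
    simpa using this
  refine ⟨e, he, |G (ψ 0)| + M * d + M * C, by positivity, hGc.comp hs hin, fun ε hε => ?_⟩
  obtain ⟨a, b, c, f⟩ := hb ε hε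
  have l := hLip ε hε
  have hp : 0 ≤ M * C := by positivity
  have hq : 0 ≤ M * d := by positivity
  refine ⟨?_, ?_, ?_⟩
  · have h1 : |G (ψ ε)| ≤ |G (ψ 0)| + |G (ψ ε) - G (ψ 0)| := by
      grind
    have h2 : M * |ψ ε - ψ 0| ≤ M * d := by gcongr
    linarith
  · have hdd := (hG _ (hin ε hε)).comp ε (hs.differentiableAt_of_Ioo hε).hasDerivAt
    have : deriv (fun ε => G (ψ ε)) ε = G' (ψ ε) * deriv ψ ε := hdd.deriv
    rw [this, abs_mul]
    have h2 : |G' (ψ ε)| * |deriv ψ ε| ≤ M * C := by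
      gcongr; exact hM _ (hin ε hε)
    have := abs_nonneg (G (ψ 0))
    linarith
  · have h3 : 0 ≤ (|G (ψ 0)| + M * d) * ε := mul_nonneg (by positivity) hε.1.le
    nlinarith

lemma half_lt_of_mem_ball {a y : ℝ} (hy : y ∈ Metric.ball a (a / 2)) : a / 2 < y := by
  rw [Metric.mem_ball, dist_eq] at hy
  have := (abs_lt.1 hy).1; linarith

lemma inv (h : TameAtZero ψ) (h0 : 0 < ψ 0) : TameAtZero fun ε => (ψ ε)⁻¹ := by
  have hlt : ∀ y ∈ Metric.ball (ψ 0) (ψ 0 / 2), ψ 0 / 2 < y := fun y hy => half_lt_of_mem_ball hy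
  refine h.comp (G := fun y => y⁻¹) (G' := fun y => -(y ^ 2)⁻¹) (M := ((ψ 0 / 2) ^ 2)⁻¹)
    (half_pos h0) (fun y hy => hasDerivAt_inv (by linarith [hlt y hy]))
    (contDiffOn_inv ℝ |>.mono fun y hy => ?_) fun y hy => ?_
  · grind
  · have := hlt y hy
    have hy0 : 0 < y := by linarith
    rw [abs_neg, abs_of_pos (by positivity)]
    gcongr

lemma log (h : TameAtZero ψ) (h0 : 0 < ψ 0) : TameAtZero fun ε => log (ψ ε) := by
  have hlt : ∀ y ∈ Metric.ball (ψ 0) (ψ 0 / 2), ψ 0 / 2 < y := fun y hy => half_lt_of_mem_ball hy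
  refine h.comp (G := Real.log) (G' := fun y => y⁻¹) (M := (ψ 0 / 2)⁻¹)
    (half_pos h0) (fun y hy => hasDerivAt_log (by linarith [hlt y hy]))
    (contDiffOn_log.mono fun y hy => ?_) fun y hy => ?_
  · grind
  · have := hlt y hy
    have hy0 : 0 < y := by linarith
    rw [abs_of_pos (by positivity)]
    gcongr

end TameAtZero

lemma tameAtZero_Q0 : TameAtZero Q0 := tameAtZero_lapInt (by norm_num) (by norm_num)

lemma tameAtZero_jfun : TameAtZero jfun := by
  have := (tameAtZero_lapInt (k := 5 / 2) (s := 3 / 2) (by norm_num) (by norm_num)).mul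
    (tameAtZero_Q0.inv (Q0_pos le_rfl))
  simpa only [← div_eq_mul_inv] using! this

lemma tameAtZero_mfun : TameAtZero mfun :=
  (TameAtZero.const 1).add (TameAtZero.id.mul tameAtZero_jfun)

lemma tameAtZero_cpfun : TameAtZero cpfun := by
  have := ((tameAtZero_lapInt (k := 7 / 2) (s := 3 / 2) (by norm_num) (by norm_num)).mul
    (tameAtZero_Q0.inv (Q0_pos le_rfl))).sub (tameAtZero_jfun.mul tameAtZero_jfun)
  simpa only [← div_eq_mul_inv] using! this

lemma tameAtZero_alfun : TameAtZero alfun :=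
  (TameAtZero.const 1).sub (tameAtZero_cpfun.inv (by rw [cpfun_zero]; norm_num))

lemma tameAtZero_psifun : TameAtZero psifun :=
  (tameAtZero_Q0.log (Q0_pos le_rfl)).add tameAtZero_jfun

lemma alfun_zero : alfun 0 = 3 / 5 := by unfold alfun; rw [cpfun_zero]; norm_num

lemma mfun_zero : mfun 0 = 1 := by unfold mfun; simp

/-! ### Space-time calculus -/

/-- The directions of space-time: time (`none`) and the axes of space (`some i`). -/
abbrev Dir : Type := Option (Fin 3)

/-- The time derivative (`none`) and the spatial partial derivatives (`some i`) together. -/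
def pd (T : ℝ) (k : Dir) (f : ℝ → E3 → ℝ) : ℝ → E3 → ℝ :=
  match k with
  | none => dt T f
  | some i => dx i f

/-- The direction in space-time belonging to `pd`. -/
def pdDir (k : Dir) : ℝ × E3 :=
  match k with
  | none => (1, 0)
  | some i => (0, single i 1)

lemma uniqueDiffOn_slab {T : ℝ} (hT : 0 < T) :
    UniqueDiffOn ℝ (Icc 0 T ×ˢ (univ : Set E3)) :=
  (uniqueDiffOn_Icc hT).prod uniqueDiffOn_univ

namespace C1On

variable {T : ℝ} {f g : ℝ → E3 → ℝ}

lemma hasFDerivWithinAt (hf : C1On T f) {t : ℝ} (ht : t ∈ Icc 0 T) (x : E3) :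
    HasFDerivWithinAt (fun z : ℝ × E3 => f z.1 z.2)
      (fderivWithin ℝ (fun z : ℝ × E3 => f z.1 z.2) (Icc 0 T ×ˢ univ) (t, x))
      (Icc 0 T ×ˢ univ) (t, x) :=
  (hf.differentiableOn (by norm_num) (t, x) ⟨ht, mem_univ _⟩).hasFDerivWithinAt

lemma contDiff (hf : C1On T f) {t : ℝ} (ht : t ∈ Icc 0 T) : ContDiff ℝ 1 (f t) := by
  have h : ContDiffOn ℝ 1 ((fun z : ℝ × E3 => f z.1 z.2) ∘ fun x => (t, x)) univ :=
    hf.comp (by fun_prop) fun x _ => ⟨ht, mem_univ _⟩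
  exact contDiffOn_univ.1 h

lemma hasDerivWithinAt (hf : C1On T f) {t : ℝ} (ht : t ∈ Icc 0 T) (x : E3) :
    HasDerivWithinAt (fun τ => f τ x)
      (fderivWithin ℝ (fun z : ℝ × E3 => f z.1 z.2) (Icc 0 T ×ˢ univ) (t, x) (1, 0))
      (Icc 0 T) t := by
  have h1 : HasDerivWithinAt (fun τ : ℝ => (τ, x)) (1, 0) (Icc 0 T) t :=
    (hasDerivWithinAt_id t _).prodMk (hasDerivWithinAt_const t _ x)
  exact (hf.hasFDerivWithinAt ht x).comp_hasDerivWithinAt t h1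
    (show MapsTo (fun τ : ℝ => (τ, x)) (Icc 0 T) (Icc 0 T ×ˢ univ) from fun τ hτ => ⟨hτ, mem_univ _⟩)

lemma pd_eq (hf : C1On T f) (hT : 0 < T) (k : Dir) {t : ℝ} (ht : t ∈ Icc 0 T)
    (x : E3) : pd T k f t x =
      fderivWithin ℝ (fun z : ℝ × E3 => f z.1 z.2) (Icc 0 T ×ˢ univ) (t, x) (pdDir k) := by
  cases k with
  | none => exact (hf.hasDerivWithinAt ht x).derivWithin (uniqueDiffOn_Icc hT t ht)
  | some i =>
    have h1 : HasFDerivWithinAt (fun y : E3 => (t, y)) (ContinuousLinearMap.inr ℝ ℝ E3) univ x :=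
      (hasFDerivAt_prodMk_right t x).hasFDerivWithinAt
    have h2 : HasFDerivWithinAt ((fun z : ℝ × E3 => f z.1 z.2) ∘ fun y : E3 => (t, y)) _ univ x :=
      (hf.hasFDerivWithinAt ht x).comp x h1 fun y _ => ⟨ht, mem_univ _⟩
    have h3 := (hasFDerivWithinAt_univ.1 h2).fderiv
    change fderiv ℝ ((fun z : ℝ × E3 => f z.1 z.2) ∘ fun y : E3 => (t, y)) x _ = _
    rw [h3]
    rfl

lemma continuousOn_pd (hf : C1On T f) (hT : 0 < T) (k : Dir) :
    ContinuousOn (fun z : ℝ × E3 => pd T k f z.1 z.2) (Icc 0 T ×ˢ univ) := by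
  have h := (ContDiffOn.continuousOn_fderivWithin hf (uniqueDiffOn_slab hT) (by norm_num))
  have h2 : ContinuousOn (fun z : ℝ × E3 =>
      fderivWithin ℝ (fun z : ℝ × E3 => f z.1 z.2) (Icc 0 T ×ˢ univ) z (pdDir k))
      (Icc 0 T ×ˢ univ) := h.clm_apply continuousOn_const
  exact h2.congr fun z hz => hf.pd_eq hT k hz.1 z.2

lemma continuous_pd (hf : C1On T f) (hT : 0 < T) (k : Dir) {t : ℝ}
    (ht : t ∈ Icc 0 T) : Continuous (pd T k f t) := by
  have h := (hf.continuousOn_pd hT k).comp_continuous (f := fun x : E3 => (t, x)) (by fun_prop)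
    (fun x => ⟨ht, mem_univ _⟩)
  exact h

lemma continuous (hf : C1On T f) {t : ℝ} (ht : t ∈ Icc 0 T) : Continuous (f t) :=
  (hf.contDiff ht).continuous

lemma add (hf : C1On T f) (hg : C1On T g) : C1On T fun t x => f t x + g t x :=
  ContDiffOn.add hf hg

lemma sub (hf : C1On T f) (hg : C1On T g) : C1On T fun t x => f t x - g t x :=
  ContDiffOn.sub hf hg

lemma mul (hf : C1On T f) (hg : C1On T g) : C1On T fun t x => f t x * g t x :=
  ContDiffOn.mul hf hg

lemma const (a : ℝ) : C1On T fun _ _ => a := contDiffOn_const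

lemma sum {α : Type*} {s : Finset α} {F : α → ℝ → E3 → ℝ} (h : ∀ a ∈ s, C1On T (F a)) :
    C1On T fun t x => ∑ a ∈ s, F a t x :=
  ContDiffOn.sum (f := fun a (z : ℝ × E3) => F a z.1 z.2) h

lemma comp {G : ℝ → ℝ} {s : Set ℝ} (hf : C1On T f) (hG : ContDiffOn ℝ 1 G s)
    (hs : ∀ t ∈ Icc 0 T, ∀ x, f t x ∈ s) : C1On T fun t x => G (f t x) :=
  ContDiffOn.comp hG hf fun z hz => hs z.1 hz.1 z.2

lemma pd_add (hf : C1On T f) (hg : C1On T g) (hT : 0 < T) (k : Dir) {t : ℝ}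
    (ht : t ∈ Icc 0 T) (x : E3) :
    pd T k (fun t x => f t x + g t x) t x = pd T k f t x + pd T k g t x := by
  rw [(hf.add hg).pd_eq hT k ht, hf.pd_eq hT k ht, hg.pd_eq hT k ht,
    ((hf.hasFDerivWithinAt ht x).fun_add (hg.hasFDerivWithinAt ht x)).fderivWithin
      (uniqueDiffOn_slab hT _ ⟨ht, mem_univ _⟩)]
  rfl

lemma pd_sub (hf : C1On T f) (hg : C1On T g) (hT : 0 < T) (k : Dir) {t : ℝ}
    (ht : t ∈ Icc 0 T) (x : E3) :
    pd T k (fun t x => f t x - g t x) t x = pd T k f t x - pd T k g t x := by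
  rw [(hf.sub hg).pd_eq hT k ht, hf.pd_eq hT k ht, hg.pd_eq hT k ht,
    ((hf.hasFDerivWithinAt ht x).fun_sub (hg.hasFDerivWithinAt ht x)).fderivWithin
      (uniqueDiffOn_slab hT _ ⟨ht, mem_univ _⟩)]
  rfl

lemma pd_mul (hf : C1On T f) (hg : C1On T g) (hT : 0 < T) (k : Dir) {t : ℝ}
    (ht : t ∈ Icc 0 T) (x : E3) :
    pd T k (fun t x => f t x * g t x) t x = pd T k f t x * g t x + f t x * pd T k g t x := by
  rw [(hf.mul hg).pd_eq hT k ht, hf.pd_eq hT k ht, hg.pd_eq hT k ht,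
    ((hf.hasFDerivWithinAt ht x).fun_mul (hg.hasFDerivWithinAt ht x)).fderivWithin
      (uniqueDiffOn_slab hT _ ⟨ht, mem_univ _⟩)]
  simp only [_root_.add_apply, _root_.smul_apply, smul_eq_mul]
  ring

lemma pd_const (a : ℝ) (hT : 0 < T) (k : Dir) {t : ℝ}
    (ht : t ∈ Icc 0 T) (x : E3) : pd T k (fun _ _ => a) t x = 0 := by
  rw [(C1On.const a).pd_eq hT k ht,
    (hasFDerivWithinAt_const a (t, x) _).fderivWithin (uniqueDiffOn_slab hT _ ⟨ht, mem_univ _⟩)]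
  rfl

lemma pd_sum {α : Type*} {s : Finset α} {F : α → ℝ → E3 → ℝ} (h : ∀ a ∈ s, C1On T (F a))
    (hT : 0 < T) (k : Dir) {t : ℝ} (ht : t ∈ Icc 0 T) (x : E3) :
    pd T k (fun t x => ∑ a ∈ s, F a t x) t x = ∑ a ∈ s, pd T k (F a) t x := by
  classical
  rw [(C1On.sum h).pd_eq hT k ht]
  rw [(HasFDerivWithinAt.fun_sum (A := fun a (z : ℝ × E3) => F a z.1 z.2) fun a ha =>
    (h a ha).hasFDerivWithinAt ht x).fderivWithin (uniqueDiffOn_slab hT _ ⟨ht, mem_univ _⟩)]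
  rw [_root_.sum_apply]
  exact sum_congr rfl fun a ha => ((h a ha).pd_eq hT k ht x).symm

lemma pd_comp {G : ℝ → ℝ} {s : Set ℝ} {G' : ℝ} (hf : C1On T f) (hG : ContDiffOn ℝ 1 G s)
    (hs : ∀ t ∈ Icc 0 T, ∀ x, f t x ∈ s) (hT : 0 < T) (k : Dir) {t : ℝ}
    (ht : t ∈ Icc 0 T) (x : E3) (hG' : HasDerivAt G G' (f t x)) :
    pd T k (fun t x => G (f t x)) t x = G' * pd T k f t x := by
  have h' : fderivWithin ℝ (fun z : ℝ × E3 => G (f z.1 z.2)) (Icc 0 T ×ˢ univ) (t, x) = _ :=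
    (hG'.comp_hasFDerivWithinAt (t, x) (hf.hasFDerivWithinAt ht x)).fderivWithin
      (uniqueDiffOn_slab hT _ ⟨ht, mem_univ _⟩)
  rw [(hf.comp hG hs).pd_eq hT k ht, hf.pd_eq hT k ht, h']
  rfl

lemma congr (hf : C1On T f) (h : ∀ t ∈ Icc 0 T, ∀ x, g t x = f t x) : C1On T g :=
  ContDiffOn.congr hf fun z hz => h z.1 hz.1 z.2

lemma pd_congr (hf : C1On T f) (h : ∀ t ∈ Icc 0 T, ∀ x, g t x = f t x) (hT : 0 < T)
    (k : Dir) {t : ℝ} (ht : t ∈ Icc 0 T) (x : E3) : pd T k g t x = pd T k f t x := by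
  rw [(hf.congr h).pd_eq hT k ht, hf.pd_eq hT k ht]
  congr 1
  exact fderivWithin_congr (fun z hz => h z.1 hz.1 z.2) (h t ht x)

/-- Translation in space. -/
lemma translate (hf : C1On T f) (v : E3) : C1On T fun t x => f t (x + v) :=
  ContDiffOn.comp (g := fun z : ℝ × E3 => f z.1 z.2) (f := fun z : ℝ × E3 => (z.1, z.2 + v)) hf
    (by fun_prop) fun z hz => ⟨hz.1, mem_univ _⟩

lemma pd_translate (v : E3) (k : Dir) (t : ℝ) (x : E3) :
    pd T k (fun t x => f t (x + v)) t x = pd T k f t (x + v) := by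
  cases k with
  | none => rfl
  | some i =>
    change fderiv ℝ (fun x => f t (x + v)) x _ = fderiv ℝ (f t) (x + v) _
    rw [fderiv_comp_add_right]

lemma integral_pd_none (hf : C1On T f) (hT : 0 < T) {t : ℝ} (ht : t ∈ Icc 0 T) (x : E3) :
    ∫ s in (0 : ℝ)..t, pd T none f s x = f t x - f 0 x := by
  have hc : ContinuousOn (fun τ => pd T none f τ x) (Icc 0 T) :=
    (hf.continuousOn_pd hT none).comp (f := fun τ : ℝ => (τ, x)) (by fun_prop)
      fun τ hτ => ⟨hτ, mem_univ _⟩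
  have hsub : Icc 0 t ⊆ Icc 0 T := Icc_subset_Icc_right ht.2
  refine intervalIntegral.integral_eq_sub_of_hasDerivAt_of_le (f := fun τ => f τ x) ht.1 ?_ ?_ ?_
  · exact fun τ hτ => ((hf.hasDerivWithinAt (hsub hτ) x).continuousWithinAt).mono hsub
  · intro τ hτ
    have hτ' : τ ∈ Icc 0 T := hsub ⟨hτ.1.le, hτ.2.le⟩
    have := hf.hasDerivWithinAt hτ' x
    rw [hf.pd_eq hT none hτ']
    exact this.hasDerivAt (Icc_mem_nhds hτ.1 (hτ.2.trans_le ht.2))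
  · rw [intervalIntegrable_iff_integrableOn_Icc_of_le ht.1]
    exact (hc.mono hsub).integrableOn_Icc

end C1On

/-! ### Square-integrable functions with a bound -/

/-- `f ∈ L²` with `‖f‖² ≤ M`. -/
def SqB (f : E3 → ℝ) (M : ℝ) : Prop :=
  AEStronglyMeasurable f volume ∧ Integrable (fun x => f x ^ 2) ∧ ∫ x, f x ^ 2 ≤ M

namespace SqB

variable {f g : E3 → ℝ} {M M' : ℝ}

lemma nonneg (h : SqB f M) : 0 ≤ M := (integral_nonneg fun _ => sq_nonneg _).trans h.2.2

lemma mono (h : SqB f M) (hM : M ≤ M') : SqB f M' := ⟨h.1, h.2.1, h.2.2.trans hM⟩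

lemma of_abs_le (h : SqB g M) (hf : AEStronglyMeasurable f volume) (hle : ∀ x, |f x| ≤ |g x|) :
    SqB f M := by
  have hi : Integrable (fun x => f x ^ 2) := h.2.1.mono' (hf.pow 2) (ae_of_all _ fun x => by
    rw [norm_of_nonneg (sq_nonneg _)]; exact sq_le_sq.2 (hle x))
  exact ⟨hf, hi, (integral_mono hi h.2.1 fun x => sq_le_sq.2 (hle x)).trans h.2.2⟩

lemma const_mul (h : SqB f M) (c : ℝ) : SqB (fun x => c * f x) (c ^ 2 * M) := by
  refine ⟨h.1.const_mul c, ?_, ?_⟩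
  · simp only [mul_pow]; exact h.2.1.const_mul _
  · simp only [mul_pow]; rw [integral_const_mul]
    gcongr; exact h.2.2

lemma add (h : SqB f M) (h' : SqB g M') : SqB (fun x => f x + g x) (2 * M + 2 * M') := by
  have hi := (h.2.1.const_mul 2).add (h'.2.1.const_mul 2)
  have hle : ∀ x, (f x + g x) ^ 2 ≤ 2 * f x ^ 2 + 2 * g x ^ 2 := fun x => by
    nlinarith [sq_nonneg (f x - g x)]
  have hi' : Integrable (fun x => (f x + g x) ^ 2) :=
    hi.mono' ((h.1.add h'.1).pow 2) (ae_of_all _ fun x => by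
      rw [norm_of_nonneg (sq_nonneg _)]; exact hle x)
  refine ⟨h.1.add h'.1, hi', (integral_mono hi' hi hle).trans ?_⟩
  simp only [Pi.add_apply]
  rw [integral_add (h.2.1.const_mul 2) (h'.2.1.const_mul 2), integral_const_mul,
    integral_const_mul]
  linarith [h.2.2, h'.2.2]

lemma abs (h : SqB f M) : SqB (fun x => |f x|) M :=
  h.of_abs_le h.1.norm fun _ => (abs_abs _).le

lemma sum {α : Type*} [Fintype α] {F : α → E3 → ℝ} {m : α → ℝ} (h : ∀ a, SqB (F a) (m a)) :
    SqB (fun x => ∑ a, F a x) (card α * ∑ a, m a) := by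
  have hm : AEStronglyMeasurable (fun x => ∑ a, F a x) volume :=
    Finset.aestronglyMeasurable_fun_sum _ fun a _ => (h a).1
  have hi : Integrable (fun x => (card α : ℝ) * ∑ a, F a x ^ 2) :=
    (integrable_finsetSum _ fun a _ => (h a).2.1).const_mul _
  have hle : ∀ x, (∑ a, F a x) ^ 2 ≤ (card α : ℝ) * ∑ a, F a x ^ 2 := fun x => by
    simpa using sq_sum_le_card_mul_sum_sq (s := Finset.univ) (f := fun a => F a x)
  have hi' : Integrable (fun x => (∑ a, F a x) ^ 2) :=
    hi.mono' (hm.pow 2) (ae_of_all _ fun x => by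
      rw [norm_of_nonneg (sq_nonneg _)]; exact hle x)
  refine ⟨hm, hi', (integral_mono hi' hi hle).trans ?_⟩
  rw [integral_const_mul, integral_finsetSum _ fun a _ => (h a).2.1]
  exact mul_le_mul_of_nonneg_left (sum_le_sum fun a _ => (h a).2.2) (Nat.cast_nonneg _)

lemma translate (h : SqB f M) (v : E3) : SqB (fun x => f (x + v)) M := by
  have hp := measurePreserving_add_right (volume : Measure E3) v
  refine ⟨h.1.comp_measurePreserving hp, h.2.1.comp_add_right v, ?_⟩
  rw [integral_add_right_eq_self (fun x => f x ^ 2)]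
  exact h.2.2

end SqB

lemma dq_eq_integral {f : E3 → ℝ} (hf : ContDiff ℝ 1 f) (j : Fin 3) {h : ℝ} (hh : h ≠ 0)
    (x : E3) : dq j h f x = ∫ s in (0 : ℝ)..1,
      fderiv ℝ f (x + (s * h) • single j 1) (single j 1) := by
  set e : E3 := single j 1
  have hd : ∀ s : ℝ, HasDerivAt (fun s : ℝ => f (x + (s * h) • e))
      (h * fderiv ℝ f (x + (s * h) • e) e) s := fun s => by
    have h1 : HasDerivAt (fun s : ℝ => x + (s * h) • e) (h • e) s := by
      have := ((hasDerivAt_id s).mul_const h).smul_const e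
      simpa using this.const_add x
    have h2 := ((hf.differentiable (by norm_num)) (x + (s * h) • e)).hasFDerivAt.comp_hasDerivAt s h1
    simpa using! h2
  have hc : Continuous fun s : ℝ => fderiv ℝ f (x + (s * h) • e) e :=
    ((hf.continuous_fderiv (by norm_num)).comp (by fun_prop)).clm_apply continuous_const
  have := intervalIntegral.integral_eq_sub_of_hasDerivAt (a := 0) (b := 1) (fun s _ => hd s)
    ((hc.const_mul h).intervalIntegrable 0 1)
  rw [intervalIntegral.integral_const_mul] at this
  simp only [one_mul, zero_mul, zero_smul, add_zero] at this
  unfold dq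
  rw [← this]
  field_simp

lemma abs_dq_le {f : E3 → ℝ} (hf : ContDiff ℝ 1 f) (j : Fin 3) {h : ℝ} (hh : h ≠ 0) {C : ℝ}
    (hC : ∀ x, |fderiv ℝ f x (single j 1)| ≤ C) (x : E3) : |dq j h f x| ≤ C := by
  rw [dq_eq_integral hf j hh, ← norm_eq_abs]
  have := intervalIntegral.norm_integral_le_of_norm_le_const (a := 0) (b := 1) (C := C)
    (f := fun s => fderiv ℝ f (x + (s * h) • single j 1) (single j 1))
    fun s _ => hC _
  simpa using this

lemma continuous_dq {f : E3 → ℝ} (hf : Continuous f) (j : Fin 3) (h : ℝ) :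
    Continuous (dq j h f) := by
  unfold dq; fun_prop

/-- Difference quotients are bounded in `L²` by the derivative. -/
lemma sqB_dq {f : E3 → ℝ} (hf : ContDiff ℝ 1 f) (j : Fin 3) {h : ℝ} (hh : h ≠ 0) {M : ℝ}
    (hM : SqB (fun x => fderiv ℝ f x (single j 1)) M) : SqB (dq j h f) M := by
  set e : E3 := single j 1 with he
  obtain ⟨D, hD⟩ : ∃ D : E3 → ℝ, ∀ x, fderiv ℝ f x e = D x := ⟨_, fun _ => rfl⟩
  simp only [hD] at hM
  have hDc : Continuous D := by
    have : Continuous fun x => fderiv ℝ f x e :=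
      (hf.continuous_fderiv (by norm_num)).clm_apply continuous_const
    simpa only [hD] using this
  set ν : Measure ℝ := volume.restrict (Ioc 0 1) with hν
  have hpt : ∀ x, dq j h f x ^ 2 ≤ ∫ s, D (x + (s * h) • e) ^ 2 ∂ν := fun x => by
    have hc : Continuous fun s : ℝ => D (x + (s * h) • e) := hDc.comp (by fun_prop)
    have key := integral_mul_le_sqrt (μ := ν) (f := fun s => D (x + (s * h) • e)) (g := fun _ => 1)
      hc.aestronglyMeasurable aestronglyMeasurable_const
      ((hc.pow 2).integrableOn_Icc.mono_set Ioc_subset_Icc_self)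
      (by simp)
    rw [dq_eq_integral hf j hh, intervalIntegral.integral_of_le zero_le_one]
    simp only [← he, hD]
    have h1 : |∫ s, D (x + (s * h) • e) ∂ν| ≤ √(∫ s, D (x + (s * h) • e) ^ 2 ∂ν) := by
      refine (norm_integral_le_integral_norm (fun s => D (x + (s * h) • e))).trans ?_
      simpa [hν] using key.2
    calc (∫ s, D (x + (s * h) • e) ∂ν) ^ 2 = |∫ s, D (x + (s * h) • e) ∂ν| ^ 2 := (sq_abs _).symm
      _ ≤ (√(∫ s, D (x + (s * h) • e) ^ 2 ∂ν)) ^ 2 := by gcongr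
      _ = _ := sq_sqrt (integral_nonneg fun s => sq_nonneg _)
  have hjoint : Integrable (fun z : ℝ × E3 => D (z.2 + (z.1 * h) • e) ^ 2) (ν.prod volume) := by
    have hcz : Continuous fun z : ℝ × E3 => D (z.2 + (z.1 * h) • e) ^ 2 :=
      (hDc.comp (by fun_prop)).pow 2
    rw [integrable_prod_iff hcz.aestronglyMeasurable]
    refine ⟨ae_of_all _ fun s => hM.2.1.comp_add_right ((s * h) • e), ?_⟩
    have : ∀ s : ℝ, ∫ x, ‖D (x + (s * h) • e) ^ 2‖ = ∫ x, D x ^ 2 := fun s => by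
      simp only [norm_of_nonneg (sq_nonneg _)]
      exact integral_add_right_eq_self (fun x => D x ^ 2) ((s * h) • e)
    simp only [this]
    simp [hν]
  have hint : Integrable fun x => ∫ s, D (x + (s * h) • e) ^ 2 ∂ν := hjoint.integral_prod_right
  have hm := (continuous_dq hf.continuous j h)
  have hi : Integrable fun x => dq j h f x ^ 2 :=
    hint.mono' (hm.pow 2).aestronglyMeasurable (ae_of_all _ fun x => by
      rw [norm_of_nonneg (sq_nonneg _)]; exact hpt x)
  refine ⟨hm.aestronglyMeasurable, hi, (integral_mono hi hint hpt).trans ?_⟩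
  rw [← integral_integral_swap (f := fun s x => D (x + (s * h) • e) ^ 2) hjoint]
  have : ∀ s : ℝ, ∫ x, D (x + (s * h) • e) ^ 2 = ∫ x, D x ^ 2 := fun s =>
    integral_add_right_eq_self (fun x => D x ^ 2) ((s * h) • e)
  simp only [this]
  simpa [hν] using hM.2.2

/-! ### The energy inequality for symmetric systems -/

lemma SqB.bdd_mul {f k : E3 → ℝ} {M C : ℝ} (h : SqB f M) (hk : AEStronglyMeasurable k volume)
    (hC : ∀ x, |k x| ≤ C) : SqB (fun x => k x * f x) (C ^ 2 * M) := by
  refine (h.const_mul C).of_abs_le (hk.mul h.1) fun x => ?_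
  have hC0 : 0 ≤ C := (abs_nonneg _).trans (hC x)
  rw [abs_mul, abs_mul, abs_of_nonneg hC0]
  gcongr; exact hC x

lemma sum_sum_mul_le {ι : Type*} [Fintype ι] {y z : ι → ℝ} {k : ι → ι → ℝ} {C : ℝ}
    (hk : ∀ a b, |k a b| ≤ C) :
    |∑ a, ∑ b, k a b * y a * z b| ≤ C * ((∑ a, |y a|) * ∑ b, |z b|) := by
  rw [Finset.sum_mul_sum, mul_sum]
  refine (abs_sum_le_sum_abs _ _).trans (sum_le_sum fun a _ => ?_)
  rw [mul_sum]
  refine (abs_sum_le_sum_abs _ _).trans (sum_le_sum fun b _ => ?_)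
  rw [abs_mul, abs_mul, mul_assoc]
  gcongr; exact hk a b

/-- The quadratic form of a coefficient matrix `A` in the unknown `Y`. -/
def quadForm {ι : Type*} [Fintype ι] (A : ι → ι → ℝ → E3 → ℝ) (Y : ι → ℝ → E3 → ℝ) :
    ℝ → E3 → ℝ := fun t x => ∑ a, ∑ b, A a b t x * Y a t x * Y b t x

section

variable {ι : Type*} [Fintype ι] {T : ℝ} {A : ι → ι → ℝ → E3 → ℝ} {Y : ι → ℝ → E3 → ℝ}

lemma c1On_quadForm (hA : ∀ a b, C1On T (A a b)) (hY : ∀ a, C1On T (Y a)) :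
    C1On T (quadForm A Y) :=
  C1On.sum fun a _ => C1On.sum fun b _ => ((hA a b).mul (hY a)).mul (hY b)

lemma pd_quadForm (hT : 0 < T) (hA : ∀ a b, C1On T (A a b)) (hY : ∀ a, C1On T (Y a))
    (k : Dir) {t : ℝ} (ht : t ∈ Icc 0 T) (x : E3) :
    pd T k (quadForm A Y) t x = ∑ a, ∑ b, (pd T k (A a b) t x * Y a t x * Y b t x +
      A a b t x * pd T k (Y a) t x * Y b t x + A a b t x * Y a t x * pd T k (Y b) t x) := by
  unfold quadForm
  rw [C1On.pd_sum (fun a _ => C1On.sum fun b _ => ((hA a b).mul (hY a)).mul (hY b)) hT k ht]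
  refine sum_congr rfl fun a _ => ?_
  rw [C1On.pd_sum (fun b _ => ((hA a b).mul (hY a)).mul (hY b)) hT k ht]
  refine sum_congr rfl fun b _ => ?_
  rw [((hA a b).mul (hY a)).pd_mul (hY b) hT k ht, (hA a b).pd_mul (hY a) hT k ht]
  ring

lemma pd_quadForm_of_symm (hT : 0 < T) (hA : ∀ a b, C1On T (A a b)) (hY : ∀ a, C1On T (Y a))
    (hs : ∀ a b t x, A a b t x = A b a t x)
    (k : Dir) {t : ℝ} (ht : t ∈ Icc 0 T) (x : E3) :
    pd T k (quadForm A Y) t x = (∑ a, ∑ b, pd T k (A a b) t x * Y a t x * Y b t x) +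
      2 * ∑ a, Y a t x * ∑ b, A a b t x * pd T k (Y b) t x := by
  rw [pd_quadForm hT hA hY k ht]
  have h1 : ∑ a, ∑ b, A a b t x * pd T k (Y a) t x * Y b t x =
      ∑ a, ∑ b, A a b t x * Y a t x * pd T k (Y b) t x := by
    rw [sum_comm]
    grind
  simp only [sum_add_distrib, h1, mul_sum]
  rw [add_assoc, ← sum_add_distrib]
  congr 1
  refine sum_congr rfl fun a _ => ?_
  rw [← sum_add_distrib]
  refine sum_congr rfl fun b _ => ?_
  ring

variable {C L : ℝ}

lemma sqB_sum_abs {F : ι → E3 → ℝ} (h : ∀ a, SqB (F a) L) :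
    SqB (fun x => ∑ a, |F a x|) (card ι * (card ι * L)) :=
  (SqB.sum fun a => (h a).abs).mono (by simp)

lemma integrable_quadForm {t : ℝ} (ht : t ∈ Icc 0 T) (hA : ∀ a b, C1On T (A a b))
    (hY : ∀ a, C1On T (Y a)) (hAb : ∀ a b x, |A a b t x| ≤ C) (hL : ∀ a, SqB (Y a t) L) :
    Integrable (quadForm A Y t) := by
  have hw := sqB_sum_abs hL
  refine (hw.2.1.const_mul C).mono'
    ((c1On_quadForm hA hY).continuous ht).aestronglyMeasurable (ae_of_all _ fun x => ?_)
  rw [norm_eq_abs, sq]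
  exact sum_sum_mul_le fun a b => hAb a b x

lemma integrable_pd_quadForm (hT : 0 < T) {t : ℝ} (ht : t ∈ Icc 0 T)
    (hA : ∀ a b, C1On T (A a b)) (hY : ∀ a, C1On T (Y a)) (k : Dir)
    (hAb : ∀ a b x, |A a b t x| ≤ C) (hAd : ∀ a b x, |pd T k (A a b) t x| ≤ C)
    (hL : ∀ a, SqB (Y a t) L) (hLd : ∀ a, SqB (pd T k (Y a) t) L) :
    Integrable (pd T k (quadForm A Y) t) ∧
      ∫ x, ‖pd T k (quadForm A Y) t x‖ ≤
        |C| * (4 * (card ι * (card ι * L))) := by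
  have hw := (sqB_sum_abs hL).add (sqB_sum_abs hLd)
  have hle : ∀ x, ‖pd T k (quadForm A Y) t x‖ ≤
      |C| * ((∑ a, |Y a t x|) + ∑ a, |pd T k (Y a) t x|) ^ 2 := fun x => by
    rw [pd_quadForm hT hA hY k ht, norm_eq_abs]
    simp only [sum_add_distrib]
    have b1 := sum_sum_mul_le (y := fun a => Y a t x) (z := fun a => Y a t x)
      fun a b => (hAd a b x).trans (le_abs_self C)
    have b2 := sum_sum_mul_le (y := fun a => pd T k (Y a) t x) (z := fun a => Y a t x)
      fun a b => (hAb a b x).trans (le_abs_self C)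
    have b3 := sum_sum_mul_le (y := fun a => Y a t x) (z := fun a => pd T k (Y a) t x)
      fun a b => (hAb a b x).trans (le_abs_self C)
    refine (abs_add_le _ _).trans ((add_le_add (abs_add_le _ _) le_rfl).trans
      ((add_le_add (add_le_add b1 b2) b3).trans ?_))
    have := mul_nonneg (abs_nonneg C) (sq_nonneg (∑ a, |pd T k (Y a) t x|))
    linarith
  have hi : Integrable (pd T k (quadForm A Y) t) := (hw.2.1.const_mul |C|).mono'
    ((c1On_quadForm hA hY).continuous_pd hT k ht).aestronglyMeasurable (ae_of_all _ hle)
  refine ⟨hi, (integral_mono hi.norm (hw.2.1.const_mul |C|) hle).trans ?_⟩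
  rw [integral_const_mul]
  refine mul_le_mul_of_nonneg_left (hw.2.2.trans (by linarith)) (abs_nonneg _)

lemma integral_pd_some {f : ℝ → E3 → ℝ} (hf : C1On T f) {t : ℝ} (ht : t ∈ Icc 0 T) (i : Fin 3)
    (h1 : Integrable (f t)) (h2 : Integrable (pd T (some i) f t)) :
    ∫ x, pd T (some i) f t x = 0 := by
  have h := integral_mul_fderiv_eq_neg_fderiv_mul_of_integrable (μ := (volume : Measure E3))
    (f := fun _ : E3 => (1 : ℝ)) (g := f t) (v := single i 1)
    (by simp) (by simpa using! h2) (by simpa using h1)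
    (fun x _ => by fun_prop) (fun x _ => (hf.contDiff ht).differentiable (by norm_num) x)
  simpa using! h

/-- The basic energy inequality: for a symmetric system `∑ₖ Kₖ ∂ₖ Y = R` with coercive `K₀` and
vanishing initial data, the spatial fluxes integrate to zero, so the energy `∫ K₀ Y · Y` grows at
most at the rate given by the derivatives of the coefficients and by `R`. -/
lemma energy_le (hT : 0 < T) {T1 : ℝ} (hT1 : T1 ≤ T) {K : Dir → ι → ι → ℝ → E3 → ℝ}
    {R : ι → ℝ → E3 → ℝ} {μ : ℝ → ℝ} {lam : ℝ}
    (hK : ∀ k a b, C1On T (K k a b)) (hY : ∀ a, C1On T (Y a))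
    (hs : ∀ k a b t x, K k a b t x = K k b a t x)
    (hKb : ∀ t ∈ Icc 0 T1, ∀ k a b x, |K k a b t x| ≤ C)
    (hKd : ∀ t ∈ Icc 0 T1, ∀ k a b x, |pd T k (K k a b) t x| ≤ C)
    (hL : ∀ a, ∃ L, ∀ t ∈ Icc 0 T1, SqB (Y a t) L)
    (hLd : ∀ k a, ∃ L, ∀ t ∈ Icc 0 T1, SqB (pd T k (Y a) t) L)
    (hlam : ∀ t ∈ Icc 0 T1, ∀ x, lam * ∑ a, Y a t x ^ 2 ≤ quadForm (K none) Y t x)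
    (h0 : ∀ a x, Y a 0 x = 0)
    (hR : ∀ t ∈ Icc 0 T1, ∀ a x, R a t x = ∑ k, ∑ b, K k a b t x * pd T k (Y b) t x)
    (hμ : ContinuousOn μ (Icc 0 T1))
    (hμR : ∀ t ∈ Icc 0 T1, (1 + 4 * card ι * C) * (∑ a, ∫ x, Y a t x ^ 2) +
      ∑ a, ∫ x, R a t x ^ 2 ≤ μ t) {t : ℝ} (ht : t ∈ Icc 0 T1) :
    lam * ∑ a, ∫ x, Y a t x ^ 2 ≤ ∫ s in (0 : ℝ)..t, μ s := by
  have hsub : Icc 0 T1 ⊆ Icc 0 T := Icc_subset_Icc_right hT1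
  choose L1 hL1 using hL
  choose L2 hL2 using hLd
  obtain ⟨L, hL'⟩ := Finite.exists_le (Sum.elim L1 fun z : Dir × ι => L2 z.1 z.2)
  have hL : ∀ t ∈ Icc 0 T1, ∀ a, SqB (Y a t) L := fun t ht a => (hL1 a t ht).mono (hL' (.inl a))
  have hLd : ∀ t ∈ Icc 0 T1, ∀ k a, SqB (pd T k (Y a) t) L := fun t ht k a =>
    (hL2 k a t ht).mono (hL' (.inr (k, a)))
  set e := fun k => quadForm (K k) Y with he
  have heC : ∀ k, C1On T (e k) := fun k => c1On_quadForm (hK k) hY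
  have hei : ∀ s ∈ Icc 0 T1, ∀ k, Integrable (e k s) := fun s hs' k =>
    integrable_quadForm (hsub hs') (hK k) hY (hKb s hs' k) (hL s hs')
  have hed : ∀ s ∈ Icc 0 T1, ∀ k, Integrable (pd T k (e k) s) ∧ _ := fun s hs' k =>
    integrable_pd_quadForm hT (hsub hs') (hK k) hY k (hKb s hs' k) (hKd s hs' k) (hL s hs')
      fun a => hLd s hs' k a
  -- the spatial integral of the time derivative of the energy density
  have hrate : ∀ s ∈ Icc 0 T1, ∫ x, pd T none (e none) s x ≤ μ s := fun s hs' => by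
    have hdiv : ∫ x, ∑ k, pd T k (e k) s x = ∫ x, pd T none (e none) s x := by
      rw [integral_finsetSum _ fun k _ => (hed s hs' k).1, sum_option]
      rw [sum_eq_zero, add_zero]
      exact fun i _ => integral_pd_some (heC _) (hsub hs') i (hei s hs' _) (hed s hs' _).1
    rw [← hdiv]
    have hRs : ∀ a, SqB (R a s) _ := fun a => by
      have : R a s = fun x => ∑ k, ∑ b, K k a b s x * pd T k (Y b) s x := by
        ext x; exact hR s hs' a x
      rw [this]
      exact SqB.sum fun k => SqB.sum fun b => (hLd s hs' k b).bdd_mul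
        ((hK k a b).continuous (hsub hs')).aestronglyMeasurable (hKb s hs' k a b)
    have hi1 : Integrable fun x => (1 + 4 * card ι * C) * (∑ a, Y a s x ^ 2) +
        ∑ a, R a s x ^ 2 :=
      ((integrable_finsetSum _ fun a _ => (hL s hs' a).2.1).const_mul _).add
        (integrable_finsetSum _ fun a _ => (hRs a).2.1)
    have hle : ∀ x, ∑ k, pd T k (e k) s x ≤ (1 + 4 * card ι * C) * (∑ a, Y a s x ^ 2) +
        ∑ a, R a s x ^ 2 := fun x => by
      have e1 : ∀ k, pd T k (e k) s x = _ := fun k =>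
        pd_quadForm_of_symm hT (hK k) hY (hs k) k (hsub hs') x
      simp only [e1, sum_add_distrib, ← mul_sum]
      have e2 : ∑ k, ∑ a, Y a s x * ∑ b, K k a b s x * pd T k (Y b) s x =
          ∑ a, Y a s x * R a s x := by
        rw [sum_comm]
        refine sum_congr rfl fun a _ => ?_
        rw [hR s hs' a x, mul_sum]
      have e3 : ∀ k, ∑ a, ∑ b, pd T k (K k a b) s x * Y a s x * Y b s x ≤
          C * (card ι * ∑ a, Y a s x ^ 2) := fun k => by
        refine (le_abs_self _).trans ((sum_sum_mul_le fun a b => hKd s hs' k a b x).trans ?_)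
        rcases isEmpty_or_nonempty ι with hι | ⟨⟨a0⟩⟩
        · simp
        have hC0 : 0 ≤ C := (abs_nonneg _).trans (hKb s hs' k a0 a0 x)
        refine mul_le_mul_of_nonneg_left ?_ hC0
        have := sq_sum_le_card_mul_sum_sq (s := Finset.univ) (f := fun a => |Y a s x|)
        simpa [sq] using this
      have e4 : 2 * ∑ a, Y a s x * R a s x ≤ ∑ a, Y a s x ^ 2 + ∑ a, R a s x ^ 2 := by
        rw [mul_sum, ← sum_add_distrib]
        exact sum_le_sum fun a _ => by nlinarith [sq_nonneg (Y a s x - R a s x)]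
      have e5 := sum_le_sum fun k (_ : k ∈ Finset.univ) => e3 k
      simp only [sum_const, card_univ, card_option, card_fin,
        nsmul_eq_mul] at e5
      push_cast at e5
      linarith
    refine ((integral_mono (integrable_finsetSum _ fun k _ => (hed s hs' k).1) hi1 hle).trans
      (le_of_eq ?_)).trans (hμR s hs')
    rw [integral_add ((integrable_finsetSum _ fun a _ => (hL s hs' a).2.1).const_mul _)
      (integrable_finsetSum _ fun a _ => (hRs a).2.1), integral_const_mul,
      integral_finsetSum _ fun a _ => (hL s hs' a).2.1,
      integral_finsetSum _ fun a _ => (hRs a).2.1]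
  have hsub' : Icc 0 t ⊆ Icc 0 T1 := Icc_subset_Icc_right ht.2
  have hz : ∀ x, e none 0 x = 0 := fun x => by simp [he, quadForm, h0]
  set ν : Measure ℝ := volume.restrict (Ioc 0 t) with hν
  have hjoint : Integrable (fun z : ℝ × E3 => pd T none (e none) z.1 z.2) (ν.prod volume) := by
    have hm : AEStronglyMeasurable (fun z : ℝ × E3 => pd T none (e none) z.1 z.2)
        (ν.prod volume) := by
      have h1 : ν.prod (volume : Measure E3) = volume.restrict (Ioc 0 t ×ˢ univ) := by
        rw [hν, Measure.volume_eq_prod, ← Measure.prod_restrict, Measure.restrict_univ]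
      rw [h1]
      refine (((heC none).continuousOn_pd hT none).mono (prod_mono ?_ le_rfl)).aestronglyMeasurable
        (measurableSet_Ioc.prod MeasurableSet.univ)
      exact Ioc_subset_Icc_self.trans (hsub'.trans hsub)
    rw [integrable_prod_iff hm]
    have hae : ∀ᵐ s ∂ν, s ∈ Ioc 0 t := ae_restrict_mem measurableSet_Ioc
    refine ⟨hae.mono fun s hs' => (hed s (hsub' (Ioc_subset_Icc_self hs')) none).1, ?_⟩
    refine Integrable.mono' (g := fun _ => |C| * (4 * (card ι * (card ι * L))))
      (integrable_const _) hm.norm.integral_prod_right' (hae.mono fun s hs' => ?_)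
    rw [norm_of_nonneg (integral_nonneg fun x => norm_nonneg _)]
    exact (hed s (hsub' (Ioc_subset_Icc_self hs')) none).2
  have hFTC : ∫ x, e none t x = ∫ s in (0 : ℝ)..t, ∫ x, pd T none (e none) s x := by
    rw [intervalIntegral.integral_of_le ht.1,
      integral_integral_swap (f := fun s x => pd T none (e none) s x) hjoint]
    refine integral_congr_ae (ae_of_all _ fun x => ?_)
    have := (heC none).integral_pd_none hT (hsub ht) x
    rw [intervalIntegral.integral_of_le ht.1, hz, sub_zero] at this
    exact this.symm
  calc lam * ∑ a, ∫ x, Y a t x ^ 2 = ∫ x, lam * ∑ a, Y a t x ^ 2 := by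
        rw [integral_const_mul, integral_finsetSum _ fun a _ => (hL t ht a).2.1]
    _ ≤ ∫ x, e none t x := integral_mono
        ((integrable_finsetSum _ fun a _ => (hL t ht a).2.1).const_mul _) (hei t ht none)
        fun x => hlam t ht x
    _ = ∫ s in (0 : ℝ)..t, ∫ x, pd T none (e none) s x := hFTC
    _ ≤ ∫ s in (0 : ℝ)..t, μ s := by
        refine intervalIntegral.integral_mono_on ht.1 ?_ ?_ fun s hs' => hrate s (hsub' hs')
        · rw [intervalIntegrable_iff_integrableOn_Ioc_of_le ht.1]
          exact hjoint.integral_prod_left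
        · exact (hμ.mono (by rw [uIcc_of_le ht.1]; exact hsub')).intervalIntegrable

end

/-! ### Stability of symmetric systems under perturbation -/

/-- The squared `H¹` norm of `f t`. -/
def sqH1 (f : ℝ → E3 → ℝ) (t : ℝ) : ℝ := (∫ x, f t x ^ 2) + ∑ i, ∫ x, dx i f t x ^ 2

lemma sqH1_nonneg (f : ℝ → E3 → ℝ) (t : ℝ) : 0 ≤ sqH1 f t :=
  add_nonneg (integral_nonneg fun _ => sq_nonneg _)
    (sum_nonneg fun _ _ => integral_nonneg fun _ => sq_nonneg _)

/-- A family of functions with `‖f a‖² ≤ D m a` in `L²`, with `D` independent of the index. -/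
def SqO {A : Type*} (m : A → ℝ) (f : A → E3 → ℝ) : Prop :=
  ∃ D, 0 ≤ D ∧ ∀ a, SqB (f a) (D * m a)

namespace SqO

variable {A : Type*} {m : A → ℝ} {f g : A → E3 → ℝ}

lemma of_le (hg : SqO m g) (hf : ∀ a, AEStronglyMeasurable (f a) volume)
    (hle : ∀ a x, |f a x| ≤ |g a x|) : SqO m f := by
  obtain ⟨D, hD, h⟩ := hg
  exact ⟨D, hD, fun a => (h a).of_abs_le (hf a) (hle a)⟩

lemma add (hf : SqO m f) (hg : SqO m g) : SqO m fun a x => f a x + g a x := by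
  obtain ⟨D, hD, h⟩ := hf
  obtain ⟨D', hD', h'⟩ := hg
  exact ⟨2 * D + 2 * D', by positivity, fun a => ((h a).add (h' a)).mono (by linarith)⟩

lemma const_mul (hf : SqO m f) (c : ℝ) : SqO m fun a x => c * f a x := by
  obtain ⟨D, hD, h⟩ := hf
  exact ⟨c ^ 2 * D, by positivity, fun a => ((h a).const_mul c).mono (by linarith)⟩

lemma sub (hf : SqO m f) (hg : SqO m g) : SqO m fun a x => f a x - g a x := by
  have := hf.add (hg.const_mul (-1))
  simpa [sub_eq_add_neg] using this

lemma abs (hf : SqO m f) : SqO m fun a x => |f a x| := by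
  obtain ⟨D, hD, h⟩ := hf
  exact ⟨D, hD, fun a => (h a).abs⟩

lemma sum {ι : Type*} [Fintype ι] {F : ι → A → E3 → ℝ} (hF : ∀ b, SqO m (F b)) :
    SqO m fun a x => ∑ b, F b a x := by
  choose D hD h using hF
  refine ⟨card ι * ∑ b, D b, mul_nonneg (Nat.cast_nonneg _)
    (sum_nonneg fun b _ => hD b), fun a => (SqB.sum fun b => h b a).mono ?_⟩
  rw [← sum_mul, mul_assoc]

lemma bdd_mul {k : A → E3 → ℝ} (hf : SqO m f) (hk : ∀ a, AEStronglyMeasurable (k a) volume)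
    {C : ℝ} (hC : ∀ a x, |k a x| ≤ C) : SqO m fun a x => k a x * f a x := by
  obtain ⟨D, hD, h⟩ := hf
  exact ⟨C ^ 2 * D, by positivity, fun a => ((h a).bdd_mul (hk a) (hC a)).mono (by linarith)⟩

lemma translate (hf : SqO m f) (v : A → E3) : SqO m fun a x => f a (x + v a) := by
  obtain ⟨D, hD, h⟩ := hf
  exact ⟨D, hD, fun a => (h a).translate (v a)⟩

end SqO

/-- The space-time version of the difference quotient `dq`. -/
lemma C1On.dq {T : ℝ} {f : ℝ → E3 → ℝ} (hf : C1On T f) (j : Fin 3) (h : ℝ) :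
    C1On T fun t => _root_.dq j h (f t) := by
  have := ((hf.translate (h • single j 1)).sub hf).mul (C1On.const h⁻¹)
  exact this.congr fun t _ x => div_eq_mul_inv _ _

lemma C1On.pd_dq {T : ℝ} {f : ℝ → E3 → ℝ} (hf : C1On T f) (hT : 0 < T) (j : Fin 3) (h : ℝ)
    (k : Dir) {t : ℝ} (ht : t ∈ Icc 0 T) (x : E3) :
    pd T k (fun t => _root_.dq j h (f t)) t x = _root_.dq j h (pd T k f t) x := by
  have hv := hf.translate (h • single j 1)
  have : (fun t => _root_.dq j h (f t)) = fun t x =>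
      (f t (x + h • single j 1) - f t x) * (fun _ _ => h⁻¹ : ℝ → E3 → ℝ) t x := by
    ext t x; rw [_root_.dq, div_eq_mul_inv]
  rw [this, (hv.sub hf).pd_mul (C1On.const h⁻¹) hT k ht, C1On.pd_const _ hT k ht,
    hv.pd_sub hf hT k ht, C1On.pd_translate, _root_.dq]
  ring

/-- Fatou's lemma for difference quotients. -/
lemma integral_sq_fderiv_le {f : E3 → ℝ} (hf : ContDiff ℝ 1 f) (j : Fin 3) {M : ℝ}
    (hM : ∀ h : ℝ, h ≠ 0 → SqB (dq j h f) M) :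
    ∫ x, fderiv ℝ f x (single j 1) ^ 2 ≤ M := by
  set e : E3 := single j 1
  set h : ℕ → ℝ := fun n => 1 / ((n : ℝ) + 1) with hh
  have hpos : ∀ n, h n ≠ 0 := fun n => by positivity
  have hlim : ∀ x, Tendsto (fun n => dq j (h n) f x) atTop
      (nhds (fderiv ℝ f x e)) := fun x => by
    have h1 : HasDerivAt (fun s : ℝ => f (x + s • e)) (fderiv ℝ f x e) 0 := by
      have h2 : HasDerivAt (fun s : ℝ => x + s • e) e 0 := by
        simpa using ((hasDerivAt_id (0 : ℝ)).smul_const e).const_add x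
      have h3 : HasFDerivAt f (fderiv ℝ f x) (x + (0 : ℝ) • e) := by
        simpa using ((hf.differentiable (by norm_num)) x).hasFDerivAt
      exact h3.comp_hasDerivAt (0 : ℝ) h2
    have h2 := (hasDerivAt_iff_tendsto_slope_zero.1 h1).comp
      (tendsto_nhdsWithin_iff.2 ⟨tendsto_one_div_add_atTop_nhds_zero_nat (𝕜 := ℝ),
        Eventually.of_forall fun n => hpos n⟩)
    refine h2.congr fun n => ?_
    change (h n)⁻¹ • (f (x + (0 + h n) • e) - f (x + (0 : ℝ) • e)) = (f (x + h n • e) - f x) / h n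
    rw [zero_add, zero_smul, add_zero, smul_eq_mul, div_eq_inv_mul]
  have hM0 : 0 ≤ M := (hM 1 one_ne_zero).nonneg
  have hD : Continuous fun x => fderiv ℝ f x e :=
    (hf.continuous_fderiv (by norm_num)).clm_apply continuous_const
  rw [integral_eq_lintegral_of_nonneg_ae (ae_of_all _ fun x => sq_nonneg _)
    (hD.pow 2).aestronglyMeasurable]
  refine ENNReal.toReal_le_of_le_ofReal hM0 ?_
  have hle : ∫⁻ x, ENNReal.ofReal (fderiv ℝ f x e ^ 2) ≤
      liminf (fun n => ∫⁻ x, ENNReal.ofReal (dq j (h n) f x ^ 2)) atTop := by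
    refine (le_of_eq ?_).trans (lintegral_liminf_le fun n =>
      ENNReal.measurable_ofReal.comp ((continuous_dq hf.continuous j (h n)).pow 2).measurable)
    refine lintegral_congr fun x => ?_
    exact ((ENNReal.continuous_ofReal.tendsto _).comp ((hlim x).pow 2)).liminf_eq.symm
  refine hle.trans ((liminf_le_liminf (v := fun _ => ENNReal.ofReal M)
    (Eventually.of_forall fun n => ?_)).trans (liminf_const _).le)
  obtain ⟨h1, h2, h3⟩ := hM (h n) (hpos n)
  rw [← ofReal_integral_eq_lintegral_ofReal h2 (ae_of_all _ fun x => sq_nonneg _)]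
  exact ENNReal.ofReal_le_ofReal h3

/-- A solution `X` of a symmetric system `∑ₖ Kₖ ∂ₖ X = ∑ᵢ Nᵢ gᵢ` with zero initial data, in which
the coefficients `N` are, together with their first derivatives, of the size of `X` and of a small
parameter `δ`, and `g` is a fixed profile. It describes the difference of two solutions of
neighbouring quasilinear systems; `g` is then the gradient of the reference solution. Only `X·∇g`
is controlled in `L²`, since `∇g` need not be bounded. -/
structure PerturbedSystem (ι : Type) [Fintype ι] (T C lam : ℝ) where
  T1 : ℝ
  δ : ℝ
  X : ι → ℝ → E3 → ℝ
  K : Dir → ι → ι → ℝ → E3 → ℝ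
  N : Fin 3 → ι → ι → ℝ → E3 → ℝ
  g : Fin 3 → ι → ℝ → E3 → ℝ
  w : ℝ → E3 → ℝ
  T1_le : T1 ≤ T
  δ_pos : 0 < δ
  δ_le : δ ≤ 1
  X_c1 : ∀ a, C1On T (X a)
  K_c1 : ∀ k a b, C1On T (K k a b)
  N_c1 : ∀ i a b, C1On T (N i a b)
  g_cont : ∀ i a, ∀ t ∈ Icc 0 T1, Continuous (g i a t)
  symm : ∀ k a b t x, K k a b t x = K k b a t x
  coercive : ∀ t ∈ Icc 0 T1, ∀ x (v : ι → ℝ),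
    lam * ∑ a, v a ^ 2 ≤ ∑ a, ∑ b, K none a b t x * v a * v b
  eqn : ∀ t ∈ Icc 0 T1, ∀ a x, ∑ k, ∑ b, K k a b t x * pd T k (X b) t x =
    ∑ i, ∑ b, N i a b t x * g i b t x
  init : ∀ a x, X a 0 x = 0
  K_le : ∀ t ∈ Icc 0 T1, ∀ k a b x, |K k a b t x| ≤ C
  dxK_le : ∀ t ∈ Icc 0 T1, ∀ k a b j x, |dx j (K k a b) t x| ≤ C
  dtK_le : ∀ t ∈ Icc 0 T1, ∀ k a b x, |dt T (K k a b) t x| ≤ C * (1 + ∑ b, |dt T (X b) t x|)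
  X_le : ∀ t ∈ Icc 0 T1, ∀ a x, |X a t x| ≤ C
  dxX_le : ∀ t ∈ Icc 0 T1, ∀ a j x, |dx j (X a) t x| ≤ C
  X_sq : ∀ t ∈ Icc 0 T1, ∀ a, SqB (X a t) C
  dxX_sq : ∀ t ∈ Icc 0 T1, ∀ a j, SqB (dx j (X a) t) C
  N_le : ∀ t ∈ Icc 0 T1, ∀ i a b x, |N i a b t x| ≤ C * ((∑ a, |X a t x|) + δ)
  dxN_le : ∀ t ∈ Icc 0 T1, ∀ i a b j x, |dx j (N i a b) t x| ≤
    C * ((∑ j, ∑ a, |dx j (X a) t x|) + (∑ a, |X a t x|) + δ * w t x)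
  g_le : ∀ t ∈ Icc 0 T1, ∀ i b x, |g i b t x| ≤ C
  g_sq : ∀ t ∈ Icc 0 T1, ∀ i b, SqB (g i b t) C
  dqg_sq : ∀ t ∈ Icc 0 T1, ∀ i b j h, h ≠ 0 → SqB (dq j h (g i b t)) C
  mul_dqg_sq : ∀ t ∈ Icc 0 T1, ∀ i a b j h, h ≠ 0 →
    SqB (fun x => X a t x * dq j h (g i b t) x) (C * sqH1 (X a) t)
  w_sq : ∀ t ∈ Icc 0 T1, SqB (w t) C

namespace PerturbedSystem

variable {ι : Type} [Fintype ι] {T C lam : ℝ}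

/-- The squared `H¹` norm of the solution. -/
def Z (s : PerturbedSystem ι T C lam) (t : ℝ) : ℝ := ∑ a, sqH1 (s.X a) t

lemma Z_nonneg (s : PerturbedSystem ι T C lam) (t : ℝ) : 0 ≤ s.Z t :=
  sum_nonneg fun _ _ => sqH1_nonneg _ _

variable (ι T C lam) in
/-- A system together with an admissible time and an admissible difference quotient; constants in
the estimates are uniform over this type. -/
structure Point where
  s : PerturbedSystem ι T C lam
  t : ℝ
  ht : t ∈ Icc 0 s.T1
  j : Fin 3
  h : ℝ
  hh : h ≠ 0

namespace Point

variable {p : Point ι T C lam}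

lemma ht' (p : Point ι T C lam) : p.t ∈ Icc 0 T := ⟨p.ht.1, p.ht.2.trans p.s.T1_le⟩

/-- The size `‖X‖²_{H¹} + δ²` in terms of which everything is estimated. -/
def m (p : Point ι T C lam) : ℝ := p.s.Z p.t + p.s.δ ^ 2

lemma C_nonneg (p : Point ι T C lam) : 0 ≤ C := (p.s.w_sq p.t p.ht).nonneg

lemma m_nonneg (p : Point ι T C lam) : 0 ≤ p.m := add_nonneg (p.s.Z_nonneg _) (sq_nonneg _)

lemma sqH1_le (p : Point ι T C lam) (a : ι) : sqH1 (p.s.X a) p.t ≤ p.m := by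
  have h1 : sqH1 (p.s.X a) p.t ≤ p.s.Z p.t :=
    single_le_sum (f := fun a => sqH1 (p.s.X a) p.t) (fun a _ => sqH1_nonneg _ _)
      (Finset.mem_univ a)
  exact h1.trans (le_add_of_nonneg_right (sq_nonneg _))

lemma sqO_X (a : ι) : SqO m fun p : Point ι T C lam => p.s.X a p.t := by
  refine ⟨1, zero_le_one, fun p => ?_⟩
  obtain ⟨h1, h2, -⟩ := p.s.X_sq p.t p.ht a
  refine ⟨h1, h2, ?_⟩
  rw [one_mul]
  refine le_trans ?_ (p.sqH1_le a)
  exact le_add_of_nonneg_right (sum_nonneg fun i _ => integral_nonneg fun x => sq_nonneg _)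

lemma sqO_dxX (a : ι) (j : Fin 3) : SqO m fun p : Point ι T C lam => dx j (p.s.X a) p.t := by
  refine ⟨1, zero_le_one, fun p => ?_⟩
  obtain ⟨h1, h2, -⟩ := p.s.dxX_sq p.t p.ht a j
  refine ⟨h1, h2, ?_⟩
  rw [one_mul]
  refine le_trans ?_ (p.sqH1_le a)
  refine le_trans ?_ (le_add_of_nonneg_left (integral_nonneg fun x => sq_nonneg _))
  exact single_le_sum (f := fun j => ∫ x, dx j (p.s.X a) p.t x ^ 2)
    (fun i _ => integral_nonneg fun x => sq_nonneg _) (Finset.mem_univ j)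

lemma sqO_delta {f : Point ι T C lam → E3 → ℝ} (hf : ∀ p, SqB (f p) C) :
    SqO m fun p x => p.s.δ * f p x := by
  refine ⟨|C|, abs_nonneg C, fun p => ((hf p).const_mul p.s.δ).mono ?_⟩
  rw [abs_of_nonneg p.C_nonneg, mul_comm]
  exact mul_le_mul_of_nonneg_left (le_add_of_nonneg_left (p.s.Z_nonneg _)) p.C_nonneg

lemma continuous_N (p : Point ι T C lam) (i : Fin 3) (a b : ι) : Continuous (p.s.N i a b p.t) :=
  (p.s.N_c1 i a b).continuous p.ht'

/-- Products of `N` with a profile. -/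
lemma sqO_N_mul {f : Point ι T C lam → E3 → ℝ} (hf : ∀ p, SqB (f p) C)
    (hX : ∀ a, SqO m fun p x => p.s.X a p.t x * f p x) (i : Fin 3) (a b : ι) :
    SqO m fun p x => p.s.N i a b p.t x * f p x := by
  have h := ((SqO.sum fun a => (hX a).abs).add (sqO_delta hf).abs).const_mul C
  refine h.of_le (fun p => (p.continuous_N i a b).aestronglyMeasurable.mul (hf p).1) fun p x => ?_
  have h1 := mul_le_mul_of_nonneg_right (p.s.N_le p.t p.ht i a b x) (abs_nonneg (f p x))
  rw [← abs_mul] at h1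
  refine h1.trans ((le_of_eq ?_).trans (le_abs_self _))
  simp only [abs_mul, abs_of_pos p.s.δ_pos]
  rw [← sum_mul]
  ring

/-- The right-hand side of the system. -/
def F (s : PerturbedSystem ι T C lam) (a : ι) (t : ℝ) (x : E3) : ℝ :=
  ∑ i, ∑ b, s.N i a b t x * s.g i b t x

lemma sqO_F (a : ι) : SqO m fun p : Point ι T C lam => F p.s a p.t :=
  SqO.sum fun i => SqO.sum fun b => sqO_N_mul (fun p => p.s.g_sq p.t p.ht i b) (fun a => by
    have := (sqO_X a).bdd_mul (k := fun p : Point ι T C lam => p.s.g i b p.t)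
      (fun p => (p.s.g_cont i b p.t p.ht).aestronglyMeasurable)
      fun p x => p.s.g_le p.t p.ht i b x
    simpa only [mul_comm] using this) i a b

lemma abs_F_le (a : ι) : ∃ D, ∀ (p : Point ι T C lam) x, |F p.s a p.t x| ≤ D := by
  refine ⟨∑ _i : Fin 3, ∑ _b : ι, C * ((∑ _a : ι, C) + 1) * C, fun p x => ?_⟩
  refine (abs_sum_le_sum_abs _ _).trans (sum_le_sum fun i _ => ?_)
  refine (abs_sum_le_sum_abs _ _).trans (sum_le_sum fun b _ => ?_)
  have hC := p.C_nonneg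
  rw [abs_mul]
  refine mul_le_mul ((p.s.N_le p.t p.ht i a b x).trans ?_) (p.s.g_le p.t p.ht i b x)
    (abs_nonneg _) (by positivity)
  exact mul_le_mul_of_nonneg_left (add_le_add
    (sum_le_sum fun a _ => p.s.X_le p.t p.ht a x) p.s.δ_le) hC

/-- The spatial derivatives control the time derivative. -/
lemma abs_dtX_le (hlam : 0 < lam) (p : Point ι T C lam) (a : ι) (x : E3) :
    |dt T (p.s.X a) p.t x| ≤ lam⁻¹ * ∑ a, |F p.s a p.t x -
      ∑ i, ∑ b, p.s.K (some i) a b p.t x * dx i (p.s.X b) p.t x| := by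
  set v : ι → ℝ := fun a => dt T (p.s.X a) p.t x with hv
  set r : ι → ℝ := fun a => F p.s a p.t x -
      ∑ i, ∑ b, p.s.K (some i) a b p.t x * dx i (p.s.X b) p.t x with hr
  have h1 : ∀ a, ∑ b, p.s.K none a b p.t x * v b = r a := fun a => by
    have := p.s.eqn p.t p.ht a x
    exact eq_sub_of_add_eq this
  have h2 : lam * ∑ a, v a ^ 2 ≤ ∑ a, v a * r a := by
    refine (p.s.coercive p.t p.ht x v).trans (le_of_eq ?_)
    refine sum_congr rfl fun a _ => ?_
    rw [← h1 a, mul_sum]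
    exact sum_congr rfl fun b _ => by ring
  have h3 : ∀ a, v a * r a ≤ lam / 2 * v a ^ 2 + lam⁻¹ / 2 * r a ^ 2 := fun a => by
    have : 0 ≤ lam⁻¹ / 2 * (lam * v a - r a) ^ 2 := by positivity
    have h4 : lam⁻¹ / 2 * (lam * v a - r a) ^ 2 =
        lam / 2 * v a ^ 2 - v a * r a + lam⁻¹ / 2 * r a ^ 2 := by field_simp; ring
    linarith
  have h4 := sum_le_sum fun a (_ : a ∈ Finset.univ) => h3 a
  rw [sum_add_distrib, ← mul_sum, ← mul_sum] at h4
  have h5 : v a ^ 2 ≤ ∑ a, v a ^ 2 :=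
    single_le_sum (f := fun a => v a ^ 2) (fun a _ => sq_nonneg _) (Finset.mem_univ a)
  have h6 : ∑ a, r a ^ 2 ≤ (∑ a, |r a|) ^ 2 := by
    have := Finset.sum_sq_le_sq_sum_of_nonneg (s := Finset.univ) (f := fun a => |r a|)
      fun a _ => abs_nonneg _
    simpa using this
  refine abs_le_of_sq_le_sq' ?_ (by positivity) |> abs_le.2
  have h7 : lam / 2 * ∑ a, v a ^ 2 ≤ lam⁻¹ / 2 * (∑ a, |r a|) ^ 2 := by
    have := mul_le_mul_of_nonneg_left h6 (show 0 ≤ lam⁻¹ / 2 by positivity)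
    linarith
  have h8 : ∑ a, v a ^ 2 ≤ (lam⁻¹ * ∑ a, |r a|) ^ 2 := by
    have := mul_le_mul_of_nonneg_left h7 (show 0 ≤ 2 * lam⁻¹ by positivity)
    have e1 : 2 * lam⁻¹ * (lam / 2 * ∑ a, v a ^ 2) = ∑ a, v a ^ 2 := by field_simp
    rw [e1] at this
    refine this.trans (le_of_eq ?_)
    ring
  exact h5.trans h8

lemma sqO_pdX (hT : 0 < T) (hlam : 0 < lam) (k : Dir) (a : ι) :
    SqO m fun p : Point ι T C lam => pd T k (p.s.X a) p.t := by
  cases k with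
  | some i => exact sqO_dxX a i
  | none =>
    have h : SqO m fun (p : Point ι T C lam) x => lam⁻¹ * ∑ a, |F p.s a p.t x -
        ∑ i, ∑ b, p.s.K (some i) a b p.t x * dx i (p.s.X b) p.t x| :=
      (SqO.sum fun a => ((sqO_F a).sub (SqO.sum fun i => SqO.sum fun b =>
        (sqO_dxX b i).bdd_mul (fun p => ((p.s.K_c1 (some i) a b).continuous
          p.ht').aestronglyMeasurable) fun p x => p.s.K_le p.t p.ht _ a b x)).abs).const_mul _
    exact h.of_le (fun p => ((p.s.X_c1 a).continuous_pd hT none p.ht').aestronglyMeasurable)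
      fun p x => (abs_dtX_le hlam p a x).trans (le_abs_self _)

lemma abs_pdX_le (hlam : 0 < lam) :
    ∃ D, ∀ (p : Point ι T C lam) (k : Dir) a x, |pd T k (p.s.X a) p.t x| ≤ D := by
  choose D hD using fun a : ι => abs_F_le (T := T) (C := C) (lam := lam) a
  refine ⟨max C (lam⁻¹ * ∑ a, (D a + ∑ _i : Fin 3, ∑ _b : ι, C * C)), fun p k a x => ?_⟩
  cases k with
  | some i => exact (p.s.dxX_le p.t p.ht a i x).trans (le_max_left _ _)
  | none =>
    refine le_trans ?_ (le_max_right _ _)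
    refine (abs_dtX_le hlam p a x).trans ?_
    refine mul_le_mul_of_nonneg_left (sum_le_sum fun a _ => ?_) (inv_nonneg.2 hlam.le)
    refine (abs_sub _ _).trans (add_le_add (hD a p x) ?_)
    refine (abs_sum_le_sum_abs _ _).trans (sum_le_sum fun i _ => ?_)
    refine (abs_sum_le_sum_abs _ _).trans (sum_le_sum fun b _ => ?_)
    rw [abs_mul]
    exact mul_le_mul (p.s.K_le p.t p.ht _ a b x) (p.s.dxX_le p.t p.ht b i x) (abs_nonneg _)
      p.C_nonneg

lemma abs_pdK_le (hlam : 0 < lam) :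
    ∃ D, ∀ (p : Point ι T C lam) (k l : Dir) a b x,
      |pd T l (p.s.K k a b) p.t x| ≤ D := by
  obtain ⟨D, hD⟩ := abs_pdX_le (ι := ι) (T := T) (C := C) hlam
  refine ⟨max C (C * (1 + ∑ _b : ι, D)), fun p k l a b x => ?_⟩
  cases l with
  | some i => exact (p.s.dxK_le p.t p.ht k a b i x).trans (le_max_left _ _)
  | none =>
    refine le_trans ?_ (le_max_right _ _)
    refine (p.s.dtK_le p.t p.ht k a b x).trans (mul_le_mul_of_nonneg_left ?_ p.C_nonneg)
    exact add_le_add le_rfl (sum_le_sum fun b _ => hD p none b x)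

lemma sqO_dxN (i : Fin 3) (a b : ι) (j : Fin 3) (hT : 0 < T) :
    SqO m fun p : Point ι T C lam => dx j (p.s.N i a b) p.t := by
  have h := (((SqO.sum fun j => SqO.sum fun a => (sqO_dxX (T := T) (C := C) (lam := lam)
    a j).abs).add (SqO.sum fun a => (sqO_X a).abs)).add
      (sqO_delta fun p : Point ι T C lam => p.s.w_sq p.t p.ht)).const_mul C
  exact h.of_le (fun p => ((p.s.N_c1 i a b).continuous_pd hT (some j) p.ht').aestronglyMeasurable)
    fun p x => (p.s.dxN_le p.t p.ht i a b j x).trans (le_abs_self _)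

lemma sqO_dq {f : PerturbedSystem ι T C lam → ℝ → E3 → ℝ} (hf : ∀ s, C1On T (f s))
    (h : ∀ j, SqO m fun p : Point ι T C lam => dx j (f p.s) p.t) :
    SqO m fun p : Point ι T C lam => dq p.j p.h (f p.s p.t) := by
  choose D hD0 hD using h
  refine ⟨∑ j, D j, sum_nonneg fun j _ => hD0 j, fun p => ?_⟩
  refine (sqB_dq ((hf p.s).contDiff p.ht') p.j p.hh (hD p.j p)).mono ?_
  exact mul_le_mul_of_nonneg_right
    (single_le_sum (fun j _ => hD0 j) (Finset.mem_univ p.j)) p.m_nonneg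

lemma sqO_dqF (hT : 0 < T) (a : ι) :
    SqO m fun p : Point ι T C lam => dq p.j p.h (F p.s a p.t) := by
  have h : SqO m fun (p : Point ι T C lam) x => ∑ i, ∑ b,
      (p.s.N i a b p.t x * dq p.j p.h (p.s.g i b p.t) x +
        p.s.g i b p.t (x + p.h • single p.j 1) *
          dq p.j p.h (p.s.N i a b p.t) x) := by
    refine SqO.sum fun i => SqO.sum fun b => SqO.add ?_ ?_
    · refine sqO_N_mul (fun p => p.s.dqg_sq p.t p.ht i b p.j p.h p.hh) (fun a => ?_) i a b
      refine ⟨|C|, abs_nonneg C, fun p => (p.s.mul_dqg_sq p.t p.ht i a b p.j p.h p.hh).mono ?_⟩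
      rw [abs_of_nonneg p.C_nonneg]
      exact mul_le_mul_of_nonneg_left (p.sqH1_le a) p.C_nonneg
    · refine (sqO_dq (f := fun s => s.N i a b) (fun s => s.N_c1 i a b)
        fun j => sqO_dxN i a b j hT).bdd_mul (fun p => ?_)
        fun p x => p.s.g_le p.t p.ht i b _
      exact ((p.s.g_cont i b p.t p.ht).comp (by fun_prop)).aestronglyMeasurable
  convert h using 3 with p x
  unfold dq F
  rw [← sum_sub_distrib, sum_div]
  refine sum_congr rfl fun i _ => ?_
  rw [← sum_sub_distrib, sum_div]
  refine sum_congr rfl fun b _ => ?_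
  ring

/-- The right-hand side of the system satisfied by the difference quotients of `X`. -/
def R (p : Point ι T C lam) (a : ι) (t : ℝ) (x : E3) : ℝ :=
  ∑ k, ∑ b, p.s.K k a b t x * pd T k (fun t => dq p.j p.h (p.s.X b t)) t x

/-- Differencing the system never produces second derivatives of `X`: the commutator involves only
the difference quotients of the coefficients. -/
lemma R_eq (hT : 0 < T) (p : Point ι T C lam) (a : ι) (x : E3) :
    R p a p.t x = dq p.j p.h (F p.s a p.t) x - ∑ k, ∑ b, dq p.j p.h (p.s.K k a b p.t) x *
      pd T k (p.s.X b) p.t (x + p.h • single p.j 1) := by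
  have hF : F p.s a p.t = fun x => ∑ k, ∑ b, p.s.K k a b p.t x * pd T k (p.s.X b) p.t x := by
    ext x; exact (p.s.eqn p.t p.ht a x).symm
  rw [R, hF, eq_sub_iff_add_eq, ← sum_add_distrib]
  unfold dq
  rw [← sum_sub_distrib, sum_div]
  refine sum_congr rfl fun k _ => ?_
  rw [← sum_add_distrib, ← sum_sub_distrib, sum_div]
  refine sum_congr rfl fun b _ => ?_
  have := (p.s.X_c1 b).pd_dq hT p.j p.h k p.ht' x
  unfold dq at this
  rw [this]
  ring

lemma sqO_R (hT : 0 < T) (hlam : 0 < lam) (a : ι) :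
    SqO m fun p : Point ι T C lam => R p a p.t := by
  have h : SqO m fun (p : Point ι T C lam) x =>
      dq p.j p.h (F p.s a p.t) x - ∑ k, ∑ b, dq p.j p.h (p.s.K k a b p.t) x *
        pd T k (p.s.X b) p.t (x + p.h • single p.j 1) := by
    refine (sqO_dqF hT a).sub (SqO.sum fun k => SqO.sum fun b => ?_)
    refine ((sqO_pdX hT hlam k b).translate fun p => p.h • single p.j 1).bdd_mul
      (fun p => (continuous_dq ((p.s.K_c1 k a b).continuous p.ht') _ _).aestronglyMeasurable)
      (C := C) fun p x => ?_
    exact abs_dq_le ((p.s.K_c1 k a b).contDiff p.ht') p.j p.hh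
      (fun y => p.s.dxK_le p.t p.ht k a b p.j y) x
  convert h using 3 with p x
  exact R_eq hT p a x

end Point
end PerturbedSystem

/-! ### Closing the energy estimate -/

lemma SqB.dq_of_ne {f : E3 → ℝ} {M : ℝ} (hf : SqB f M) (j : Fin 3) (h : ℝ) :
    SqB (dq j h f) (h⁻¹ ^ 2 * (2 * M + 2 * M)) := by
  have h1 := ((hf.translate (h • single j 1)).add
    (by simpa using hf.const_mul (-1) : SqB (fun x => -f x) M)).const_mul h⁻¹
  convert h1 using 2 with x
  rw [dq]; ring

lemma integral_exp_mul_le {a t : ℝ} (ha : 0 < a) (b : ℝ) (hb : 0 ≤ b) :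
    ∫ s in (0 : ℝ)..t, b * exp (a * s) ≤ b / a * exp (a * t) := by
  have hd : ∀ s : ℝ, HasDerivAt (fun s => b / a * exp (a * s)) (b * exp (a * s)) s :=
    fun s => by
      have h1 : HasDerivAt (fun s : ℝ => a * s) a s := by
        simpa using (hasDerivAt_id s).const_mul a
      have h2 := (h1.exp).const_mul (b / a)
      grind
  rw [intervalIntegral.integral_eq_sub_of_hasDerivAt (fun s _ => hd s)
    (Continuous.intervalIntegrable (by fun_prop) _ _)]
  have : 0 ≤ b / a * exp (a * 0) := by positivity
  linarith

namespace PerturbedSystem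

variable {ι : Type} [Fintype ι] {T C lam : ℝ}

lemma Z_le (s : PerturbedSystem ι T C lam) {t : ℝ} (ht : t ∈ Icc 0 s.T1) :
    s.Z t ≤ card ι * (4 * C) := by
  have h : ∀ a, sqH1 (s.X a) t ≤ 4 * C := fun a => by
    have h1 := (s.X_sq t ht a).2.2
    have h2 : ∑ i, ∫ x, dx i (s.X a) t x ^ 2 ≤ ∑ _i : Fin 3, C :=
      sum_le_sum fun i _ => (s.dxX_sq t ht a i).2.2
    simp at h2
    unfold sqH1
    linarith
  refine (sum_le_sum fun a _ => h a).trans ?_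
  simp

/-- If `Z + δ² ≤ G e^{κt}`, the energy inequalities for `X` and for its difference quotients give
the same bound with half the constant, up to `δ²`. -/
lemma halve (hT : 0 < T) (hlam : 0 < lam) : ∃ κ, 0 < κ ∧ ∀ (s : PerturbedSystem ι T C lam)
    (G : ℝ), 0 ≤ G → (∀ t ∈ Icc 0 s.T1, s.Z t + s.δ ^ 2 ≤ G * exp (κ * t)) →
    ∀ t ∈ Icc 0 s.T1, s.Z t + s.δ ^ 2 ≤ (s.δ ^ 2 + G / 2) * exp (κ * t) := by
  choose D1 hD1 h1 using fun a : ι => Point.sqO_X (T := T) (C := C) (lam := lam) a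
  choose D2 hD2 h2 using fun a : ι => Point.sqO_F (T := T) (C := C) (lam := lam) a
  choose D3 hD3 h3 using fun a : ι => Point.sqO_R (T := T) (C := C) (lam := lam) hT hlam a
  choose D4 hD4 h4 using fun a : ι => Point.sqO_dq (T := T) (C := C) (lam := lam)
    (f := fun s => s.X a) (fun s => s.X_c1 a) fun j => Point.sqO_dxX a j
  choose D5 hD5 h5 using fun (k : Dir) (a : ι) =>
    Point.sqO_pdX (T := T) (C := C) (lam := lam) hT hlam k a
  obtain ⟨D6, hD6⟩ := Point.abs_pdK_le (ι := ι) (T := T) (C := C) hlam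
  set n : ℝ := ((card ι : ℕ) : ℝ) with hn
  set Cb := max |C| D6 with hCb
  set C9 : ℝ := (1 + 4 * n * Cb) * ∑ a, (D1 a + D4 a) + ∑ a, (D2 a + D3 a) with hC9
  have hs14 : 0 ≤ ∑ a, (D1 a + D4 a) := sum_nonneg fun a _ => add_nonneg (hD1 a) (hD4 a)
  have hs23 : 0 ≤ ∑ a, (D2 a + D3 a) := sum_nonneg fun a _ => add_nonneg (hD2 a) (hD3 a)
  have hC90 : 0 ≤ C9 := by positivity
  set κ : ℝ := 8 * n * C9 / lam + 1 with hκ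
  have hκ0 : 0 < κ := by positivity
  refine ⟨κ, hκ0, fun s G hG hZ t ht => ?_⟩
  have hsub : Icc 0 s.T1 ⊆ Icc 0 T := Icc_subset_Icc_right s.T1_le
  -- a uniform, not small, bound for everything at hand
  set m₀ : ℝ := n * (4 * C) + 1 with hm₀
  have hm : ∀ p : Point ι T C lam, p.m ≤ m₀ := fun p => by
    have := p.s.Z_le p.ht
    have h7 : p.s.δ ^ 2 ≤ 1 := pow_le_one₀ p.s.δ_pos.le p.s.δ_le
    unfold Point.m; linarith
  have hKb : ∀ τ ∈ Icc 0 s.T1, ∀ k a b x, |s.K k a b τ x| ≤ Cb := fun τ hτ k a b x =>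
    ((s.K_le τ hτ k a b x).trans (le_abs_self C)).trans (le_max_left _ _)
  have hKd : ∀ τ ∈ Icc 0 s.T1, ∀ k a b x, |pd T k (s.K k a b) τ x| ≤ Cb := fun τ hτ k a b x =>
    (hD6 ⟨s, τ, hτ, 0, 1, one_ne_zero⟩ k k a b x).trans (le_max_right _ _)
  set M' : ℝ := lam⁻¹ * (C9 * G / κ * exp (κ * t)) with hM'
  have hfin : ∀ {y : ℝ}, lam * y ≤ ∫ s in (0 : ℝ)..t, C9 * G * exp (κ * s) → y ≤ M' :=
    fun {y} h => by
      have := h.trans (integral_exp_mul_le hκ0 (C9 * G) (by positivity))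
      rwa [hM', inv_mul_eq_div, le_div_iff₀ hlam, mul_comm]
  have hrate : ∀ {p : Point ι T C lam} {D D' : ι → ℝ} {Y Q : ι → E3 → ℝ},
      p.m ≤ G * exp (κ * p.t) → (∀ a, D a ≤ D1 a + D4 a) → (∀ a, D' a ≤ D2 a + D3 a) →
      (∀ a, SqB (Y a) (D a * p.m)) → (∀ a, SqB (Q a) (D' a * p.m)) →
      (1 + 4 * n * Cb) * (∑ a, ∫ x, Y a x ^ 2) + ∑ a, ∫ x, Q a x ^ 2 ≤
        C9 * G * exp (κ * p.t) := fun {p} {_} {_} {_} {_} hp hD hD' hY hQ => by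
    have hm0 := p.m_nonneg
    have h := mul_le_mul_of_nonneg_left hp hC90
    rw [← mul_assoc] at h
    refine le_trans ?_ h
    rw [hC9, add_mul ((1 + 4 * n * Cb) * _), mul_assoc (1 + 4 * n * Cb), sum_mul,
      sum_mul]
    gcongr with a _ a _
    · exact (hY a).2.2.trans (by gcongr; exact hD a)
    · exact (hQ a).2.2.trans (by gcongr; exact hD' a)
  -- the estimate for `X`
  have hX : ∑ a, ∫ x, s.X a t x ^ 2 ≤ M' := by
    let p : ∀ τ ∈ Icc 0 s.T1, Point ι T C lam := fun τ hτ => ⟨s, τ, hτ, 0, 1, one_ne_zero⟩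
    exact hfin (energy_le hT s.T1_le (R := Point.F s) s.K_c1 s.X_c1 s.symm hKb hKd
      (fun a => ⟨C, fun τ hτ => s.X_sq τ hτ a⟩)
      (fun k a => ⟨D5 k a * m₀, fun τ hτ => (h5 k a (p τ hτ)).mono
        (mul_le_mul_of_nonneg_left (hm _) (hD5 k a))⟩)
      (fun τ hτ x => s.coercive τ hτ x _) s.init (fun τ hτ a x => (s.eqn τ hτ a x).symm)
      (by fun_prop) (fun τ hτ => hrate (p := p τ hτ) (hZ τ hτ)
        (fun a => le_add_of_nonneg_right (hD4 a)) (fun a => le_add_of_nonneg_right (hD3 a))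
        (fun a => h1 a (p τ hτ)) fun a => h2 a (p τ hτ)) ht)
  -- the estimate for the difference quotients
  have hdq : ∀ (j : Fin 3) (h : ℝ), h ≠ 0 → ∑ a, ∫ x, dq j h (s.X a t) x ^ 2 ≤ M' := by
    intro j h hh
    let p : ∀ τ ∈ Icc 0 s.T1, Point ι T C lam := fun τ hτ => ⟨s, τ, hτ, j, h, hh⟩
    refine hfin (energy_le (Y := fun a t => dq j h (s.X a t)) hT s.T1_le
      (R := Point.R (p t ht)) s.K_c1 (fun a => (s.X_c1 a).dq j h) s.symm hKb hKd
      (fun a => ⟨D4 a * m₀, fun τ hτ => (h4 a (p τ hτ)).mono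
        (mul_le_mul_of_nonneg_left (hm _) (hD4 a))⟩)
      (fun k a => ⟨h⁻¹ ^ 2 * (2 * (D5 k a * m₀) + 2 * (D5 k a * m₀)), fun τ hτ => ?_⟩)
      (fun τ hτ x => s.coercive τ hτ x _) (fun a x => by simp [dq, s.init])
      (fun τ hτ a x => rfl) (by fun_prop) (fun τ hτ => hrate (p := p τ hτ) (hZ τ hτ)
        (fun a => le_add_of_nonneg_left (hD1 a)) (fun a => le_add_of_nonneg_left (hD2 a))
        (fun a => h4 a (p τ hτ)) fun a => h3 a (p τ hτ)) ht)
    have e1 : pd T k (fun t => dq j h (s.X a t)) τ = dq j h (pd T k (s.X a) τ) := by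
      ext x; exact (s.X_c1 a).pd_dq hT j h k (hsub hτ) x
    rw [e1]
    exact ((h5 k a (p τ hτ)).mono (mul_le_mul_of_nonneg_left (hm _) (hD5 k a))).dq_of_ne j h
  have hsq : ∀ a, sqH1 (s.X a) t ≤ 4 * M' := fun a => by
    have e1 : ∫ x, s.X a t x ^ 2 ≤ M' := (single_le_sum (f := fun a => ∫ x, s.X a t x ^ 2)
      (fun a _ => integral_nonneg fun x => sq_nonneg _) (Finset.mem_univ a)).trans hX
    have e2 : ∀ j, ∫ x, dx j (s.X a) t x ^ 2 ≤ M' := fun j =>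
      integral_sq_fderiv_le ((s.X_c1 a).contDiff (hsub ht)) j fun h hh => by
        obtain ⟨b1, b2, -⟩ := h4 a ⟨s, t, ht, j, h, hh⟩
        refine ⟨b1, b2, ?_⟩
        exact (single_le_sum (f := fun a => ∫ x, dq j h (s.X a t) x ^ 2)
          (fun a _ => integral_nonneg fun x => sq_nonneg _) (Finset.mem_univ a)).trans (hdq j h hh)
    have e3 := sum_le_sum fun j (_ : j ∈ Finset.univ) => e2 j
    simp at e3
    unfold sqH1
    linarith
  have hZt : s.Z t ≤ n * (4 * M') := by
    refine (sum_le_sum fun a _ => hsq a).trans ?_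
    simp [hn]
  have hhalf : n * (4 * M') ≤ G / 2 * exp (κ * t) := by
    have e1 : n * (4 * M') = (4 * n * C9 / (lam * κ)) * (G * exp (κ * t)) := by
      rw [hM']; field_simp
    have e2 : 4 * n * C9 / (lam * κ) ≤ 1 / 2 := by
      rw [div_le_iff₀ (by positivity), hκ]
      have : lam * (8 * n * C9 / lam + 1) = 8 * n * C9 + lam := by field_simp
      linarith
    have := mul_le_mul_of_nonneg_right e2 (show 0 ≤ G * exp (κ * t) by positivity)
    linarith
  have hexp : 1 ≤ exp (κ * t) := one_le_exp (mul_nonneg hκ0.le ht.1)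
  have := mul_le_mul_of_nonneg_left hexp (sq_nonneg s.δ)
  linarith

/-- The solution of a perturbed system is of size `δ` in `H¹`. -/
lemma stability (hT : 0 < T) (hlam : 0 < lam) : ∃ D, 0 ≤ D ∧
    ∀ s : PerturbedSystem ι T C lam, ∀ t ∈ Icc 0 s.T1, s.Z t ≤ D * s.δ ^ 2 := by
  obtain ⟨κ, hκ, H⟩ := halve (ι := ι) (C := C) hT hlam
  refine ⟨2 * exp (κ * T), by positivity, fun s t ht => ?_⟩
  set G₀ : ℝ := card ι * (4 * C) + 1 with hG₀
  have hG₀0 : 0 ≤ G₀ := by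
    have := (s.Z_nonneg t).trans (s.Z_le ht); linarith
  have hk : ∀ k : ℕ, ∀ t ∈ Icc 0 s.T1,
      s.Z t + s.δ ^ 2 ≤ (2 * s.δ ^ 2 + G₀ * (1 / 2) ^ k) * exp (κ * t) := fun k => by
    induction k with
    | zero =>
      intro t ht
      have h1 := s.Z_le ht
      have hexp : 1 ≤ exp (κ * t) := one_le_exp (mul_nonneg hκ.le ht.1)
      nlinarith
    | succ k ih =>
      intro t ht
      refine (H s _ (by positivity) ih t ht).trans (le_of_eq ?_)
      ring
  have hlim : Tendsto (fun k : ℕ => (2 * s.δ ^ 2 + G₀ * (1 / 2) ^ k) * exp (κ * t))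
      atTop (nhds ((2 * s.δ ^ 2 + G₀ * 0) * exp (κ * t))) :=
    (((tendsto_pow_atTop_nhds_zero_of_lt_one (by norm_num) (by norm_num)).const_mul
      G₀).const_add _).mul_const _
  have h1 := ge_of_tendsto' hlim fun k => hk k t ht
  have h2 : exp (κ * t) ≤ exp (κ * T) :=
    exp_le_exp.2 (by gcongr; exact ht.2.trans s.T1_le)
  nlinarith [sq_nonneg s.δ]

end PerturbedSystem

/-! ### Coefficients close to those of a reference solution -/

/-- The quantities in terms of which the coefficients of a family of perturbed systems (indexed by
`A`) are estimated: the time interval `[0, T1]`, the small parameter `δ`, the sizes `sX`, `sDX`,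
`sDt` of the difference of the solutions and of its first derivatives (`1` being added to the last),
and the size `w` of the spatial gradient of the reference solution. -/
structure Frame (A : Type) (T : ℝ) where
  T1 : A → ℝ
  δ : A → ℝ
  sX : A → ℝ → E3 → ℝ
  sDX : A → ℝ → E3 → ℝ
  sDt : A → ℝ → E3 → ℝ
  w : A → ℝ → E3 → ℝ
  B : ℝ
  T_pos : 0 < T
  T1_le : ∀ α, T1 α ≤ T
  δ_pos : ∀ α, 0 < δ α
  δ_le : ∀ α, δ α ≤ 1
  sX_nonneg : ∀ α, ∀ t ∈ Icc 0 (T1 α), ∀ x, 0 ≤ sX α t x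
  sX_le : ∀ α, ∀ t ∈ Icc 0 (T1 α), ∀ x, sX α t x ≤ B
  sDX_nonneg : ∀ α, ∀ t ∈ Icc 0 (T1 α), ∀ x, 0 ≤ sDX α t x
  sDX_le : ∀ α, ∀ t ∈ Icc 0 (T1 α), ∀ x, sDX α t x ≤ B
  w_nonneg : ∀ α, ∀ t ∈ Icc 0 (T1 α), ∀ x, 0 ≤ w α t x
  w_le : ∀ α, ∀ t ∈ Icc 0 (T1 α), ∀ x, w α t x ≤ B
  one_le_sDt : ∀ α, ∀ t ∈ Icc 0 (T1 α), ∀ x, 1 ≤ sDt α t x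

namespace Frame

variable {A : Type} {T : ℝ} (Φ : Frame A T)

/-- An index together with a point of space-time. -/
structure Pt where
  α : A
  t : ℝ
  ht : t ∈ Icc 0 (Φ.T1 α)
  x : E3

variable {Φ}

lemma Pt.ht' (q : Φ.Pt) : q.t ∈ Icc 0 T := ⟨q.ht.1, q.ht.2.trans (Φ.T1_le _)⟩

/-- A family of functions on space-time as a function on `Pt`. -/
def ev (f : A → ℝ → E3 → ℝ) (q : Φ.Pt) : ℝ := f q.α q.t q.x

/-- The size of a small coefficient. -/
def r0 (q : Φ.Pt) : ℝ := Φ.sX q.α q.t q.x + Φ.δ q.α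

/-- The size of the gradient of a small coefficient. The parameter `δ` comes with the square
integrable factor `w`. -/
def r1 (q : Φ.Pt) : ℝ := Φ.sDX q.α q.t q.x + Φ.sX q.α q.t q.x + Φ.δ q.α * Φ.w q.α q.t q.x

lemma le_top {X : Type*} {f g : X → ℝ} (C : ℝ) (h : ∀ x, |f x| ≤ C * |g x|) :
    f =O[⊤] g := IsBigO.of_bound C (Eventually.of_forall h)

lemma r0_bdd : (r0 : Φ.Pt → ℝ) =O[⊤] fun _ => (1 : ℝ) :=
  le_top (Φ.B + 1) fun q => by
    have h1 := Φ.sX_nonneg q.α q.t q.ht q.x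
    have h2 := Φ.sX_le q.α q.t q.ht q.x
    have h3 := Φ.δ_pos q.α
    have h4 := Φ.δ_le q.α
    rw [r0, abs_of_nonneg (by positivity)]; simp; linarith

lemma r1_bdd : (r1 : Φ.Pt → ℝ) =O[⊤] fun _ => (1 : ℝ) :=
  le_top (3 * Φ.B) fun q => by
    have h1 := Φ.sX_nonneg q.α q.t q.ht q.x
    have h2 := Φ.sX_le q.α q.t q.ht q.x
    have h3 := Φ.δ_pos q.α
    have h4 := Φ.δ_le q.α
    have h5 := Φ.sDX_nonneg q.α q.t q.ht q.x
    have h6 := Φ.sDX_le q.α q.t q.ht q.x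
    have h7 := Φ.w_nonneg q.α q.t q.ht q.x
    have h8 := Φ.w_le q.α q.t q.ht q.x
    rw [r1, abs_of_nonneg (by positivity)]
    have : Φ.δ q.α * Φ.w q.α q.t q.x ≤ 1 * Φ.w q.α q.t q.x := by gcongr
    simp; linarith

lemma w_bdd : (ev Φ.w : Φ.Pt → ℝ) =O[⊤] fun _ => (1 : ℝ) :=
  le_top Φ.B fun q => by
    have h7 := Φ.w_nonneg q.α q.t q.ht q.x
    have h8 := Φ.w_le q.α q.t q.ht q.x
    rw [ev, abs_of_nonneg h7]; simpa using h8

lemma r0_mul_w : (fun q : Φ.Pt => r0 q * ev Φ.w q) =O[⊤] r1 :=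
  le_top (Φ.B + 1) fun q => by
    have h1 := Φ.sX_nonneg q.α q.t q.ht q.x
    have h3 := Φ.δ_pos q.α
    have h5 := Φ.sDX_nonneg q.α q.t q.ht q.x
    have h7 := Φ.w_nonneg q.α q.t q.ht q.x
    have h8 := Φ.w_le q.α q.t q.ht q.x
    have hB : 0 ≤ Φ.B := h7.trans h8
    rw [r0, ev, r1, abs_of_nonneg (by positivity), abs_of_nonneg (by positivity)]
    have e3 : 0 ≤ Φ.B * (Φ.δ q.α * Φ.w q.α q.t q.x) := by positivity
    nlinarith

lemma delta_r0 : (fun q : Φ.Pt => Φ.δ q.α) =O[⊤] (r0 : Φ.Pt → ℝ) :=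
  le_top 1 fun q => by
    have h1 := Φ.sX_nonneg q.α q.t q.ht q.x
    have h3 := Φ.δ_pos q.α
    rw [r0, abs_of_pos h3, abs_of_nonneg (by positivity)]; linarith

variable (Φ) in
/-- `K` is a family of coefficients and `L` the corresponding one at the reference solution. -/
structure Good (K L : A → ℝ → E3 → ℝ) : Prop where
  cK : ∀ α, C1On T (K α)
  cL : ∀ α, C1On T (L α)
  L1 : (ev L : Φ.Pt → ℝ) =O[⊤] fun _ => (1 : ℝ)
  dL : ∀ j, (ev (fun α => pd T (some j) (L α)) : Φ.Pt → ℝ) =O[⊤] (ev Φ.w)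
  dtK : (ev (fun α => pd T none (K α)) : Φ.Pt → ℝ) =O[⊤] (ev Φ.sDt)
  diff : (fun q : Φ.Pt => ev K q - ev L q) =O[⊤] (r0 : Φ.Pt → ℝ)
  ddiff : ∀ j, (fun q : Φ.Pt => ev (fun α => pd T (some j) (K α)) q -
    ev (fun α => pd T (some j) (L α)) q) =O[⊤] (r1 : Φ.Pt → ℝ)

namespace Good

variable {K L K' L' : A → ℝ → E3 → ℝ}

lemma K1 (h : Φ.Good K L) : (ev K : Φ.Pt → ℝ) =O[⊤] fun _ => (1 : ℝ) := by
  simpa using (h.diff.trans r0_bdd).add h.L1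

lemma dK (h : Φ.Good K L) (j : Fin 3) :
    (ev (fun α => pd T (some j) (K α)) : Φ.Pt → ℝ) =O[⊤] fun _ => (1 : ℝ) := by
  simpa using ((h.ddiff j).trans r1_bdd).add ((h.dL j).trans w_bdd)

lemma const (a : ℝ) : Φ.Good (fun _ _ _ => a) fun _ _ _ => a where
  cK _ := C1On.const a
  cL _ := C1On.const a
  L1 := le_top |a| fun q => by simp [ev]
  dL j := le_top 0 fun q => by
    simp [ev, C1On.pd_const a Φ.T_pos (some j) q.ht' q.x]
  dtK := le_top 0 fun q => by simp [ev, C1On.pd_const a Φ.T_pos none q.ht' q.x]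
  diff := le_top 0 fun q => by simp [ev]
  ddiff j := le_top 0 fun q => by simp [ev]

lemma delta : Φ.Good (fun α _ _ => Φ.δ α) fun _ _ _ => 0 where
  cK _ := C1On.const _
  cL _ := C1On.const _
  L1 := le_top 0 fun q => by simp [ev]
  dL j := le_top 0 fun q => by
    simp [ev, C1On.pd_const _ Φ.T_pos (some j) q.ht' q.x]
  dtK := le_top 0 fun q => by simp [ev, C1On.pd_const _ Φ.T_pos none q.ht' q.x]
  diff := by simpa [ev] using delta_r0
  ddiff j := le_top 0 fun q => by
    simp [ev, C1On.pd_const _ Φ.T_pos (some j) q.ht' q.x]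

lemma add (h : Φ.Good K L) (h' : Φ.Good K' L') :
    Φ.Good (fun α t x => K α t x + K' α t x) fun α t x => L α t x + L' α t x where
  cK α := (h.cK α).add (h'.cK α)
  cL α := (h.cL α).add (h'.cL α)
  L1 := h.L1.add h'.L1
  dL j := ((h.dL j).add (h'.dL j)).congr_left fun q =>
    ((h.cL q.α).pd_add (h'.cL q.α) Φ.T_pos (some j) q.ht' q.x).symm
  dtK := (h.dtK.add h'.dtK).congr_left fun q =>
    ((h.cK q.α).pd_add (h'.cK q.α) Φ.T_pos none q.ht' q.x).symm
  diff := (h.diff.add h'.diff).congr_left fun q => by simp only [ev]; ring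
  ddiff j := ((h.ddiff j).add (h'.ddiff j)).congr_left fun q => by
    simp only [ev]
    rw [(h.cK q.α).pd_add (h'.cK q.α) Φ.T_pos _ q.ht' q.x,
      (h.cL q.α).pd_add (h'.cL q.α) Φ.T_pos _ q.ht' q.x]
    ring

lemma mul (h : Φ.Good K L) (h' : Φ.Good K' L') :
    Φ.Good (fun α t x => K α t x * K' α t x) fun α t x => L α t x * L' α t x where
  cK α := (h.cK α).mul (h'.cK α)
  cL α := (h.cL α).mul (h'.cL α)
  L1 := by
    have h1 := h.L1.mul h'.L1
    simp only [mul_one] at h1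
    exact h1
  dL j := by
    have h1 := (h.dL j).mul h'.L1
    have h2 := h.L1.mul (h'.dL j)
    simp only [mul_one, one_mul] at h1 h2
    exact (h1.add h2).congr_left fun q =>
      ((h.cL q.α).pd_mul (h'.cL q.α) Φ.T_pos (some j) q.ht' q.x).symm
  dtK := by
    have h1 := h.dtK.mul h'.K1
    have h2 := h.K1.mul h'.dtK
    simp only [mul_one, one_mul] at h1 h2
    exact (h1.add h2).congr_left fun q =>
      ((h.cK q.α).pd_mul (h'.cK q.α) Φ.T_pos none q.ht' q.x).symm
  diff := by
    have h1 := h.diff.mul h'.K1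
    have h2 := h.L1.mul h'.diff
    simp only [mul_one, one_mul] at h1 h2
    exact (h1.add h2).congr_left fun q => by simp only [ev]; ring
  ddiff j := by
    have h1 := (h.ddiff j).mul h'.K1
    have h2 := (h'.diff.mul (h.dL j)).trans r0_mul_w
    have h3 := h.K1.mul (h'.ddiff j)
    have h4 := (h.diff.mul (h'.dL j)).trans r0_mul_w
    simp only [mul_one, one_mul] at h1 h3
    refine (((h1.add h2).add h3).add h4).congr_left fun q => ?_
    simp only [ev]
    rw [(h.cK q.α).pd_mul (h'.cK q.α) Φ.T_pos _ q.ht' q.x,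
      (h.cL q.α).pd_mul (h'.cL q.α) Φ.T_pos _ q.ht' q.x]
    ring

lemma neg (h : Φ.Good K L) : Φ.Good (fun α t x => -K α t x) fun α t x => -L α t x := by
  simpa using (Good.const (-1)).mul h

lemma sub (h : Φ.Good K L) (h' : Φ.Good K' L') :
    Φ.Good (fun α t x => K α t x - K' α t x) fun α t x => L α t x - L' α t x := by
  simpa only [sub_eq_add_neg] using h.add h'.neg

lemma sum {β : Type*} {s : Finset β} {F G : β → A → ℝ → E3 → ℝ}
    (h : ∀ b ∈ s, Φ.Good (F b) (G b)) :
    Φ.Good (fun α t x => ∑ b ∈ s, F b α t x) fun α t x => ∑ b ∈ s, G b α t x := by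
  classical
  induction s using Finset.induction_on with
  | empty => simpa using Good.const 0
  | insert b s hb ih =>
    simp only [Finset.sum_insert hb]
    exact (h b (Finset.mem_insert_self b s)).add
      (ih fun b' hb' => h b' (Finset.mem_insert_of_mem hb'))

lemma ite {p : Prop} [Decidable p] (h : Φ.Good K L) (h' : Φ.Good K' L') :
    Φ.Good (fun α t x => if p then K α t x else K' α t x)
      fun α t x => if p then L α t x else L' α t x := by
  by_cases hp : p <;> simpa [hp]

/-- Composition with a fixed `C²` function. -/
lemma comp (h : Φ.Good K L) {G : ℝ → ℝ} {s : Set ℝ} (hs : IsOpen s) (hG : ContDiffOn ℝ 2 G s)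
    {a b : ℝ} (hab : Icc a b ⊆ s) (hK : ∀ α, ∀ t ∈ Icc 0 T, ∀ x, K α t x ∈ s)
    (hL : ∀ α, ∀ t ∈ Icc 0 T, ∀ x, L α t x ∈ s)
    (hKab : ∀ q : Φ.Pt, K q.α q.t q.x ∈ Icc a b)
    (hLab : ∀ q : Φ.Pt, L q.α q.t q.x ∈ Icc a b) :
    Φ.Good (fun α t x => G (K α t x)) fun α t x => G (L α t x) := by
  have hG1 : ContDiffOn ℝ 1 G s := hG.of_le (by norm_num)
  have hdG : ContDiffOn ℝ 1 (deriv G) s :=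
    ((contDiffOn_succ_iff_deriv_of_isOpen (n := 1) hs).1 (by simpa using! hG)).2.2
  have hd : ∀ y ∈ s, HasDerivAt G (deriv G y) y := fun y hy =>
    ((hG1.differentiableOn (by norm_num)).differentiableAt (hs.mem_nhds hy)).hasDerivAt
  have hd2 : ∀ y ∈ s, HasDerivAt (deriv G) (deriv (deriv G) y) y := fun y hy =>
    ((hdG.differentiableOn (by norm_num)).differentiableAt (hs.mem_nhds hy)).hasDerivAt
  obtain ⟨M0, hM0⟩ := isCompact_Icc.exists_bound_of_continuousOn (hG1.continuousOn.mono hab)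
  obtain ⟨M1, hM1⟩ := isCompact_Icc.exists_bound_of_continuousOn (hdG.continuousOn.mono hab)
  obtain ⟨M2, hM2⟩ := isCompact_Icc.exists_bound_of_continuousOn
    ((hdG.continuousOn_deriv_of_isOpen hs (by norm_num)).mono hab)
  have lip1 : ∀ y ∈ Icc a b, ∀ z ∈ Icc a b, |G y - G z| ≤ M1 * |y - z| := fun y hy z hz =>
    (convex_Icc a b).norm_image_sub_le_of_norm_hasDerivWithin_le
      (fun x hx => (hd x (hab hx)).hasDerivWithinAt) hM1 hz hy
  have lip2 : ∀ y ∈ Icc a b, ∀ z ∈ Icc a b, |deriv G y - deriv G z| ≤ M2 * |y - z| :=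
    fun y hy z hz => (convex_Icc a b).norm_image_sub_le_of_norm_hasDerivWithin_le
      (fun x hx => (hd2 x (hab hx)).hasDerivWithinAt) hM2 hz hy
  have pdK : ∀ (k : Dir) (q : Φ.Pt), pd T k (fun t x => G (K q.α t x)) q.t q.x =
      deriv G (K q.α q.t q.x) * pd T k (K q.α) q.t q.x := fun k q =>
    (h.cK q.α).pd_comp hG1 (hK q.α) Φ.T_pos k q.ht' q.x (hd _ (hab (hKab q)))
  have pdL : ∀ (k : Dir) (q : Φ.Pt), pd T k (fun t x => G (L q.α t x)) q.t q.x =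
      deriv G (L q.α q.t q.x) * pd T k (L q.α) q.t q.x := fun k q =>
    (h.cL q.α).pd_comp hG1 (hL q.α) Φ.T_pos k q.ht' q.x (hd _ (hab (hLab q)))
  have bK : (fun q : Φ.Pt => deriv G (K q.α q.t q.x)) =O[⊤] fun _ => (1 : ℝ) :=
    le_top M1 fun q => by simpa using hM1 _ (hKab q)
  have bL : (fun q : Φ.Pt => deriv G (L q.α q.t q.x)) =O[⊤] fun _ => (1 : ℝ) :=
    le_top M1 fun q => by simpa using hM1 _ (hLab q)
  exact
  { cK := fun α => (h.cK α).comp hG1 (hK α)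
    cL := fun α => (h.cL α).comp hG1 (hL α)
    L1 := le_top M0 fun q => by simpa using! hM0 _ (hLab q)
    dL := fun j => by
      have h1 := bL.mul (h.dL j)
      simp only [one_mul] at h1
      exact h1.congr_left fun q => (pdL (some j) q).symm
    dtK := by
      have h1 := bK.mul h.dtK
      simp only [one_mul] at h1
      exact h1.congr_left fun q => (pdK none q).symm
    diff := (le_top M1 fun q => lip1 _ (hKab q) _ (hLab q)).trans h.diff
    ddiff := fun j => by
      have h1 := bK.mul (h.ddiff j)
      have h2 := (((le_top M2 fun q : Φ.Pt =>
        lip2 _ (hKab q) _ (hLab q)).trans h.diff).mul (h.dL j)).trans r0_mul_w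
      simp only [one_mul] at h1
      refine (h1.add h2).congr_left fun q => ?_
      simp only [ev]
      rw [pdK, pdL]
      ring }

lemma inv (h : Φ.Good K L) {m : ℝ} (hm : 0 < m) (hK : ∀ α, ∀ t ∈ Icc 0 T, ∀ x, 0 < K α t x)
    (hL : ∀ α, ∀ t ∈ Icc 0 T, ∀ x, 0 < L α t x) (hKm : ∀ q : Φ.Pt, m ≤ K q.α q.t q.x)
    (hLm : ∀ q : Φ.Pt, m ≤ L q.α q.t q.x) :
    Φ.Good (fun α t x => (K α t x)⁻¹) fun α t x => (L α t x)⁻¹ := by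
  obtain ⟨C1, h1⟩ := isBigO_top.1 h.K1
  obtain ⟨C2, h2⟩ := isBigO_top.1 h.L1
  have hC1 : ∀ q : Φ.Pt, K q.α q.t q.x ≤ C1 := fun q => by
    simpa using! (le_abs_self _).trans (h1 q)
  have hC2 : ∀ q : Φ.Pt, L q.α q.t q.x ≤ C2 := fun q => by
    simpa using! (le_abs_self _).trans (h2 q)
  refine h.comp (G := fun y => y⁻¹) (s := Ioi 0) isOpen_Ioi ?_ (a := m) (b := max C1 C2)
    (fun y hy => hm.trans_le hy.1) hK hL (fun q => ⟨hKm q, (hC1 q).trans (le_max_left _ _)⟩)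
    fun q => ⟨hLm q, (hC2 q).trans (le_max_right _ _)⟩
  exact contDiffOn_id.inv fun y hy => (ne_of_gt hy)

/-- Composition of a tame function with `δ K`; at the reference solution it is evaluated at `0`. -/
lemma tame (h : Φ.Good K L) {ψ : ℝ → ℝ} {ε₀ C : ℝ} (hψ : ContDiffOn ℝ 1 ψ (Ioo 0 ε₀))
    (hC : ∀ ε ∈ Ioo 0 ε₀, |ψ ε| ≤ C ∧ |deriv ψ ε| ≤ C ∧ |ψ ε - ψ 0| ≤ C * ε)
    (hK : ∀ α, ∀ t ∈ Icc 0 T, ∀ x, Φ.δ α * K α t x ∈ Ioo 0 ε₀) :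
    Φ.Good (fun α t x => ψ (Φ.δ α * K α t x)) fun α t x => ψ (0 * L α t x) := by
  have cδK : ∀ α, C1On T fun t x => Φ.δ α * K α t x := fun α => (C1On.const _).mul (h.cK α)
  have pdK : ∀ (k : Dir) (q : Φ.Pt), pd T k (fun t x => ψ (Φ.δ q.α * K q.α t x)) q.t q.x
      = deriv ψ (Φ.δ q.α * K q.α q.t q.x) * (Φ.δ q.α * pd T k (K q.α) q.t q.x) := fun k q => by
    have hmem := hK q.α q.t q.ht' q.x
    rw [(cδK q.α).pd_comp hψ (hK q.α) Φ.T_pos k q.ht' q.x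
      ((hψ.differentiableOn (by norm_num)).differentiableAt (isOpen_Ioo.mem_nhds hmem)).hasDerivAt,
      (C1On.const _).pd_mul (h.cK q.α) Φ.T_pos k q.ht' q.x, C1On.pd_const _ Φ.T_pos k q.ht' q.x]
    ring
  have pdL : ∀ (k : Dir) (q : Φ.Pt), pd T k (fun t x => ψ (0 * L q.α t x)) q.t q.x = 0 :=
    fun k q => by
      simp only [zero_mul]
      exact C1On.pd_const _ Φ.T_pos k q.ht' q.x
  have bψ : (fun q : Φ.Pt => deriv ψ (Φ.δ q.α * K q.α q.t q.x)) =O[⊤] fun _ => (1 : ℝ) :=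
    le_top C fun q => by simpa using (hC _ (hK q.α q.t q.ht' q.x)).2.1
  have bδ : (fun q : Φ.Pt => Φ.δ q.α) =O[⊤] fun _ => (1 : ℝ) := delta_r0.trans r0_bdd
  exact
  { cK := fun α => (cδK α).comp hψ (hK α)
    cL := fun α => by simpa only [zero_mul] using C1On.const (ψ 0)
    L1 := le_top |ψ 0| fun q => by simp [ev]
    dL := fun j => le_top 0 fun q => by
      simp only [ev]; rw [pdL]; simp
    dtK := by
      have h1 := bψ.mul (bδ.mul h.dtK)
      simp only [one_mul] at h1
      exact h1.congr_left fun q => (pdK none q).symm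
    diff := by
      have h1 : (fun q : Φ.Pt => Φ.δ q.α * ev K q) =O[⊤] (r0 : Φ.Pt → ℝ) := by
        simpa using delta_r0.mul h.K1
      refine (le_top C fun q => ?_).trans h1
      have h2 := hK q.α q.t q.ht' q.x
      have h3 := (hC _ h2).2.2
      simp only [ev, zero_mul]
      rwa [abs_of_pos h2.1]
    ddiff := fun j => by
      have h1 := bψ.mul (bδ.mul (h.ddiff j))
      have h2 := bψ.mul ((delta_r0.mul (h.dL j)).trans r0_mul_w)
      simp only [one_mul] at h1 h2
      refine (h1.add h2).congr_left fun q => ?_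
      simp only [ev]
      rw [pdK, pdL]
      ring }

end Good
end Frame

/-! ### The Euler equations in symmetric form -/

/-- The material derivative `∑ₖ vₖ ∂ₖ f` along the space-time velocity `v`. -/
def matD (T : ℝ) (v : Dir → ℝ → E3 → ℝ) (f : ℝ → E3 → ℝ) (t : ℝ) (x : E3) : ℝ :=
  ∑ k, v k t x * pd T k f t x

/-- The space-time divergence of `v`. -/
def stDiv (T : ℝ) (v : Dir → ℝ → E3 → ℝ) (t : ℝ) (x : E3) : ℝ :=
  ∑ k, pd T k (v k) t x

section

variable {T : ℝ} {v : Dir → ℝ → E3 → ℝ} {f g : ℝ → E3 → ℝ} {t : ℝ}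

lemma matD_mul (hf : C1On T f) (hg : C1On T g) (hT : 0 < T) (ht : t ∈ Icc 0 T) (x : E3) :
    matD T v (fun t x => f t x * g t x) t x = matD T v f t x * g t x + f t x * matD T v g t x := by
  unfold matD
  rw [sum_mul, mul_sum, ← sum_add_distrib]
  refine sum_congr rfl fun k _ => ?_
  rw [hf.pd_mul hg hT k ht]; ring

lemma matD_add (hf : C1On T f) (hg : C1On T g) (hT : 0 < T) (ht : t ∈ Icc 0 T) (x : E3) :
    matD T v (fun t x => f t x + g t x) t x = matD T v f t x + matD T v g t x := by
  unfold matD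
  rw [← sum_add_distrib]
  refine sum_congr rfl fun k _ => ?_
  rw [hf.pd_add hg hT k ht]; ring

lemma matD_const (a : ℝ) (hT : 0 < T) (ht : t ∈ Icc 0 T) (x : E3) :
    matD T v (fun _ _ => a) t x = 0 := by
  exact sum_eq_zero fun k _ => by rw [C1On.pd_const a hT k ht, mul_zero]

lemma matD_const_mul (a : ℝ) (hf : C1On T f) (hT : 0 < T) (ht : t ∈ Icc 0 T) (x : E3) :
    matD T v (fun t x => a * f t x) t x = a * matD T v f t x := by
  rw [matD_mul (C1On.const a) hf hT ht, matD_const a hT ht]; ring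

lemma matD_sum {F : Fin 3 → ℝ → E3 → ℝ} (hF : ∀ i, C1On T (F i)) (hT : 0 < T)
    (ht : t ∈ Icc 0 T) (x : E3) :
    matD T v (fun t x => ∑ i, F i t x) t x = ∑ i, matD T v (F i) t x := by
  unfold matD
  rw [sum_comm]
  refine sum_congr rfl fun k _ => ?_
  rw [C1On.pd_sum (fun i _ => hF i) hT k ht, mul_sum]

lemma matD_congr (hf : C1On T f) (h : ∀ t ∈ Icc 0 T, ∀ x, g t x = f t x) (hT : 0 < T)
    (ht : t ∈ Icc 0 T) (x : E3) : matD T v g t x = matD T v f t x :=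
  sum_congr rfl fun k _ => by rw [hf.pd_congr h hT k ht]

lemma matD_comp {G : ℝ → ℝ} {s : Set ℝ} {G' : ℝ} (hf : C1On T f) (hG : ContDiffOn ℝ 1 G s)
    (hs : ∀ t ∈ Icc 0 T, ∀ x, f t x ∈ s) (hT : 0 < T) (ht : t ∈ Icc 0 T) (x : E3)
    (hG' : HasDerivAt G G' (f t x)) :
    matD T v (fun t x => G (f t x)) t x = G' * matD T v f t x := by
  unfold matD
  rw [mul_sum]
  refine sum_congr rfl fun k _ => ?_
  rw [hf.pd_comp hG hs hT k ht x hG']; ring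

/-- The conservation law with density `f` and velocity `v`, in material form. -/
lemma sum_pd_mul (hv : ∀ k, C1On T (v k)) (hf : C1On T f) (hT : 0 < T) (ht : t ∈ Icc 0 T)
    (x : E3) : ∑ k, pd T k (fun t x => f t x * v k t x) t x =
      matD T v f t x + f t x * stDiv T v t x := by
  unfold matD stDiv
  rw [mul_sum, ← sum_add_distrib]
  refine sum_congr rfl fun k _ => ?_
  rw [hf.pd_mul (hv k) hT k ht]; ring

lemma C1On.const_mul (a : ℝ) (hf : C1On T f) : C1On T fun t x => a * f t x :=
  (C1On.const a).mul hf

lemma C1On.pd_const_mul (a : ℝ) (hf : C1On T f) (hT : 0 < T) (k : Dir)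
    (ht : t ∈ Icc 0 T) (x : E3) : pd T k (fun t x => a * f t x) t x = a * pd T k f t x := by
  rw [(C1On.const a).pd_mul hf hT k ht, C1On.pd_const a hT k ht]; ring

end

namespace Fluid

/-- The space-time velocity `(u⁰/c, u)`, with `δ = c⁻²`; for `δ = 0` it is `(1, u)`. -/
def vel (δ : ℝ) (V : Fluid) : Dir → ℝ → E3 → ℝ
  | none => fun t x => √(1 + δ * ∑ j, V.u t x j * V.u t x j)
  | some i => fun t x => V.u t x i

variable {T c δ : ℝ} {V : Fluid}

lemma Regular.c1On_u (hV : V.Regular T) (j : Fin 3) : C1On T fun t x => V.u t x j := by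
  have h : ContDiff ℝ 1 fun y : E3 => y j := (EuclideanSpace.proj (𝕜 := ℝ) j).contDiff
  exact h.comp_contDiffOn hV.2.2.1

lemma Regular.c1On_P (hV : V.Regular T) : C1On T V.P := hV.2.1.mul hV.2.2.2

lemma P_pos (hV : V.Regular T) {t : ℝ} (ht : t ∈ Icc 0 T) (x : E3) : 0 < V.P t x :=
  mul_pos (hV.1 t ht x).1 (hV.1 t ht x).2

lemma one_le_vel_radicand (hδ : 0 ≤ δ) (t : ℝ) (x : E3) :
    1 ≤ 1 + δ * ∑ j, V.u t x j * V.u t x j :=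
  le_add_of_nonneg_right (mul_nonneg hδ (sum_nonneg fun _ _ => mul_self_nonneg _))

lemma one_le_vel_none (hδ : 0 ≤ δ) (t : ℝ) (x : E3) : 1 ≤ V.vel δ none t x :=
  one_le_sqrt.2 (one_le_vel_radicand hδ t x)

lemma vel_none_mul_self (hδ : 0 ≤ δ) (t : ℝ) (x : E3) :
    V.vel δ none t x * V.vel δ none t x = 1 + δ * ∑ j, V.u t x j * V.u t x j :=
  mul_self_sqrt (zero_le_one.trans (one_le_vel_radicand hδ t x))

lemma Regular.c1On_vel (hV : V.Regular T) (hδ : 0 ≤ δ) (k : Dir) :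
    C1On T (V.vel δ k) := by
  cases k with
  | some i => exact hV.c1On_u i
  | none =>
    have h : C1On T fun t x => 1 + δ * ∑ j, V.u t x j * V.u t x j :=
      (C1On.const 1).add (C1On.const_mul δ (C1On.sum fun j _ => (hV.c1On_u j).mul (hV.c1On_u j)))
    exact ContDiffOn.sqrt h fun z _ => (zero_lt_one.trans_le (one_le_vel_radicand hδ _ _)).ne'

lemma u0_eq (hc : 0 < c) (t : ℝ) (x : E3) : V.u0 c t x = c * V.vel (c ^ 2)⁻¹ none t x := by
  unfold u0 energy vel
  rw [← sqrt_sq hc.le, ← sqrt_mul (sq_nonneg _), sqrt_sq hc.le]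
  rw [EuclideanSpace.norm_sq_eq]
  have : ∑ j, V.u t x j * V.u t x j = ∑ j, ‖V.u t x j‖ ^ 2 :=
    sum_congr rfl fun j _ => by rw [norm_eq_abs, sq_abs, sq]
  rw [this]
  field_simp

lemma matD_vel_none (hV : V.Regular T) (hδ : 0 ≤ δ) (hT : 0 < T) {t : ℝ} (ht : t ∈ Icc 0 T)
    (x : E3) (v : Dir → ℝ → E3 → ℝ) :
    V.vel δ none t x * matD T v (V.vel δ none) t x =
      δ * ∑ j, V.u t x j * matD T v (fun t x => V.u t x j) t x := by
  have he := hV.c1On_vel hδ none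
  have h1 : matD T v (fun t x => V.vel δ none t x * V.vel δ none t x) t x = _ :=
    matD_mul he he hT ht x
  have hs : ∀ j, C1On T fun t x => V.u t x j * V.u t x j := fun j =>
    (hV.c1On_u j).mul (hV.c1On_u j)
  have h2 : matD T v (fun t x => V.vel δ none t x * V.vel δ none t x) t x =
      matD T v (fun t x => 1 + δ * ∑ j, V.u t x j * V.u t x j) t x :=
    matD_congr ((C1On.const 1).add (C1On.const_mul δ (C1On.sum fun j _ => hs j)))
      (fun t _ x => vel_none_mul_self hδ t x) hT ht x
  rw [matD_add (C1On.const 1) (C1On.const_mul δ (C1On.sum fun j _ => hs j)) hT ht,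
    matD_const _ hT ht, matD_const_mul _ (C1On.sum fun j _ => hs j) hT ht,
    matD_sum hs hT ht] at h2
  have h3 : ∀ j, matD T v (fun t x => V.u t x j * V.u t x j) t x =
      2 * (V.u t x j * matD T v (fun t x => V.u t x j) t x) := fun j => by
    rw [matD_mul (hV.c1On_u j) (hV.c1On_u j) hT ht]; ring
  simp only [h3, ← mul_sum] at h2
  linarith

/-- The equations of motion for the primitive variables. Here `D` is the derivative along the
four-velocity, `B` the enthalpy density divided by `c²` and `δ = c⁻²`. -/
lemma IsRelEuler.primitive (hV : V.IsRelEuler c T) (hc : 0 < c) (hT : 0 < T)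
    {B : ℝ → E3 → ℝ} (hB : C1On T B) (hBh : ∀ t ∈ Icc 0 T, ∀ x, V.h c t x = c ^ 2 * B t x)
    (hδ : δ = (c ^ 2)⁻¹) {t : ℝ} (ht : t ∈ Icc 0 T) (x : E3) :
    matD T (V.vel δ) V.n t x + V.n t x * stDiv T (V.vel δ) t x = 0 ∧
    matD T (V.vel δ) B t x + B t x * stDiv T (V.vel δ) t x = δ * matD T (V.vel δ) V.P t x ∧
    ∀ j, B t x * matD T (V.vel δ) (fun t x => V.u t x j) t x +
      δ * V.u t x j * matD T (V.vel δ) V.P t x + pd T (some j) V.P t x = 0 := by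
  obtain ⟨hr, heq⟩ := hV
  obtain ⟨h1, h2, h3⟩ := heq t ht x
  have hδ0 : 0 ≤ δ := by rw [hδ]; positivity
  have hv := hr.c1On_vel (δ := δ) hδ0
  have hu := hr.c1On_u
  have hP := hr.c1On_P
  set D := matD T (V.vel δ) with hD
  set Θ := stDiv T (V.vel δ) t x with hΘ
  set e := V.vel δ none t x with he
  have hu0 : ∀ t x, V.u0 c t x = c * V.vel δ none t x := fun t x => by rw [u0_eq hc, hδ]
  have E1 : D V.n t x + V.n t x * Θ = 0 := by
    have k1 := sum_pd_mul hv hr.2.1 hT ht x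
    rw [sum_option] at k1
    rw [← k1, ← h1]
    congr 1
    have k2 := (hr.2.1.mul (hv none)).const_mul c |>.pd_congr
      (g := fun t x => V.n t x * V.u0 c t x) (fun t _ x => by rw [hu0]; ring) hT none ht x
    rw [(hr.2.1.mul (hv none)).pd_const_mul c hT none ht] at k2
    change _ = 1 / c * pd T none (fun t x => V.n t x * V.u0 c t x) t x
    rw [k2]
    field_simp
  have E2 : ∀ j, D (fun t x => B t x * V.u t x j) t x + B t x * V.u t x j * Θ +
      pd T (some j) V.P t x = 0 := fun j => by
    have hBu := hB.mul (hu j)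
    have k1 := sum_pd_mul hv hBu hT ht x
    rw [← k1]
    have k2 := (hBu.mul (hv none)).const_mul (c ^ 3) |>.pd_congr
      (g := fun t x => V.h c t x * V.u0 c t x * V.u t x j)
      (fun t ht x => by rw [hu0, hBh t ht]; ring) hT none ht x
    rw [(hBu.mul (hv none)).pd_const_mul (c ^ 3) hT none ht] at k2
    have k3 : ∀ i, pd T (some i) (fun t x => V.h c t x * V.u t x i * V.u t x j) t x =
        c ^ 2 * pd T (some i) (fun t x => B t x * V.u t x j * V.vel δ (some i) t x) t x :=
      fun i => by
        rw [← (hBu.mul (hv (some i))).pd_const_mul (c ^ 2) hT (some i) ht]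
        exact ((hBu.mul (hv (some i))).const_mul (c ^ 2)).pd_congr
          (fun t ht x => by rw [hBh t ht]; simp only [vel]; ring) hT (some i) ht x
    have k4 := h2 j
    change 1 / c * pd T none (fun t x => V.h c t x * V.u0 c t x * V.u t x j) t x +
      ∑ i, pd T (some i) (fun t x => V.h c t x * V.u t x i * V.u t x j) t x +
      c ^ 2 * pd T (some j) V.P t x = 0 at k4
    simp only [k2, k3] at k4
    rw [← mul_sum] at k4
    have k5 : 1 / c * (c ^ 3 * pd T none (fun t x => B t x * V.u t x j * V.vel δ none t x) t x) =
      c ^ 2 * pd T none (fun t x => B t x * V.u t x j * V.vel δ none t x) t x := by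
      field_simp
    rw [k5, ← mul_add, ← mul_add] at k4
    exact (mul_eq_zero.1 k4).resolve_left (by positivity)
  have E3' : D (fun t x => B t x * V.vel δ none t x) t x + B t x * e * Θ -
      δ * pd T none V.P t x = 0 := by
    have hBe := hB.mul (hv none)
    have k1 := sum_pd_mul hv hBe hT ht x
    rw [← k1]
    have k2 := (((hBe.mul (hv none)).const_mul (c ^ 4)).sub (hP.const_mul (c ^ 2))).pd_congr
      (g := fun t x => V.h c t x * V.u0 c t x ^ 2 - c ^ 2 * V.P t x)
      (fun t ht x => by rw [hu0, hBh t ht]; ring) hT none ht x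
    rw [((hBe.mul (hv none)).const_mul (c ^ 4)).pd_sub (hP.const_mul (c ^ 2)) hT none ht,
      (hBe.mul (hv none)).pd_const_mul (c ^ 4) hT none ht, hP.pd_const_mul (c ^ 2) hT none ht] at k2
    have k3 : ∀ i, pd T (some i) (fun t x => V.h c t x * V.u0 c t x * V.u t x i) t x =
        c ^ 3 * pd T (some i) (fun t x => B t x * V.vel δ none t x * V.vel δ (some i) t x) t x :=
      fun i => by
        rw [← (hBe.mul (hv (some i))).pd_const_mul (c ^ 3) hT (some i) ht]
        exact ((hBe.mul (hv (some i))).const_mul (c ^ 3)).pd_congr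
          (fun t ht x => by rw [hBh t ht, hu0]; simp only [vel]; ring) hT (some i) ht x
    change 1 / c * pd T none (fun t x => V.h c t x * V.u0 c t x ^ 2 - c ^ 2 * V.P t x) t x +
      ∑ i, pd T (some i) (fun t x => V.h c t x * V.u0 c t x * V.u t x i) t x = 0 at h3
    simp only [k2, k3] at h3
    rw [← mul_sum] at h3
    have k6 : 1 / c * (c ^ 4 * pd T none (fun t x => B t x * V.vel δ none t x * V.vel δ none t x)
        t x - c ^ 2 * pd T none V.P t x) + c ^ 3 * ∑ i, pd T (some i) (fun t x =>
          B t x * V.vel δ none t x * V.vel δ (some i) t x) t x =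
      c ^ 3 * (pd T none (fun t x => B t x * V.vel δ none t x * V.vel δ none t x) t x +
        ∑ i, pd T (some i) (fun t x => B t x * V.vel δ none t x * V.vel δ (some i) t x) t x -
        δ * pd T none V.P t x) := by
      rw [hδ]; field_simp; ring
    rw [k6] at h3
    exact (mul_eq_zero.1 h3).resolve_left (by positivity)
  have hee : e * e = 1 + δ * ∑ j, V.u t x j * V.u t x j := vel_none_mul_self hδ0 t x
  have heD : e * D (V.vel δ none) t x = δ * ∑ j, V.u t x j * D (fun t x => V.u t x j) t x :=
    matD_vel_none hr hδ0 hT ht x _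
  have hDBu : ∀ j, D (fun t x => B t x * V.u t x j) t x =
    D B t x * V.u t x j + B t x * D (fun t x => V.u t x j) t x := fun j =>
      matD_mul hB (hu j) hT ht x
  have hDBe : D (fun t x => B t x * V.vel δ none t x) t x =
    D B t x * e + B t x * D (V.vel δ none) t x := matD_mul hB (hv none) hT ht x
  have hDP : D V.P t x = e * pd T none V.P t x + ∑ j, V.u t x j * pd T (some j) V.P t x := by
    rfl
  have hE2 : ∑ j, V.u t x j * (D (fun t x => B t x * V.u t x j) t x + B t x * V.u t x j * Θ +
      pd T (some j) V.P t x) = 0 := sum_eq_zero fun j _ => by rw [E2, mul_zero]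
  have E4 : D B t x + B t x * Θ = δ * D V.P t x := by
    simp only [hDBu] at hE2
    rw [hDBe] at E3'
    rw [hDP]
    simp only [Fin.sum_univ_three] at hE2 hee heD ⊢
    linear_combination e * E3' - δ * hE2 - (D B t x + B t x * Θ) * hee - B t x * heD
  refine ⟨E1, E4, fun j => ?_⟩
  have := E2 j
  rw [hDBu] at this
  linear_combination this - V.u t x j * E4

end Fluid

/-! ### The symmetric system in `(P, u, S)` -/

/-- Index of the unknowns `(P, u, S)`: `none` for the pressure, `some none` for the entropy and
`some (some j)` for the components of the velocity. -/
abbrev Idx : Type := Option Dir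

namespace Fluid

/-- The unknowns `(P, u, S)`; the entropy field `s` is passed as an argument. -/
def vars (s : ℝ → E3 → ℝ) (V : Fluid) : Idx → ℝ → E3 → ℝ
  | none => V.P
  | some none => s
  | some (some j) => fun t x => V.u t x j

/-- The coupling between pressure and velocity in the symmetric form. -/
def crossCoef (δ : ℝ) (V : Fluid) (j : Fin 3) : Dir → ℝ → E3 → ℝ
  | none => fun t x => δ * V.u t x j * (V.vel δ none t x)⁻¹
  | some i => fun _ _ => if i = j then 1 else 0

/-- The coefficients of the symmetric form of the Euler equations in the unknowns `(P, u, S)`. For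
`δ = c⁻²` this is the relativistic system and for `δ = 0` the classical one. -/
def symCoef (δ : ℝ) (V : Fluid) (k : Dir) : Idx → Idx → ℝ → E3 → ℝ
  | none, none => fun t x => alfun (δ * V.θ t x) * (V.P t x)⁻¹ * V.vel δ k t x
  | none, some none => fun _ _ => 0
  | none, some (some j) => crossCoef δ V j k
  | some none, none => fun _ _ => 0
  | some none, some none => V.vel δ k
  | some none, some (some _) => fun _ _ => 0
  | some (some j), none => crossCoef δ V j k
  | some (some _), some none => fun _ _ => 0
  | some (some j), some (some l) => fun t x =>
      V.P t x * mfun (δ * V.θ t x) * (V.θ t x)⁻¹ * V.vel δ k t x *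
        ((if j = l then 1 else 0) - δ * (V.u t x j * V.u t x l) *
          ((V.vel δ none t x)⁻¹ * (V.vel δ none t x)⁻¹))

lemma symCoef_symm (δ : ℝ) (V : Fluid) (k : Dir) (a b : Idx) (t : ℝ) (x : E3) :
    symCoef δ V k a b t x = symCoef δ V k b a t x := by
  rcases a with _ | _ | j <;> rcases b with _ | _ | l <;> try rfl
  simp only [symCoef, eq_comm (a := j), mul_comm (V.u t x j)]

variable {T c δ : ℝ} {V W : Fluid}

lemma pd_vel_none (hV : V.Regular T) (hδ : 0 ≤ δ) (hT : 0 < T) {t : ℝ} (ht : t ∈ Icc 0 T)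
    (x : E3) : V.vel δ none t x * pd T none (V.vel δ none) t x =
      δ * ∑ j, V.u t x j * pd T none (fun t x => V.u t x j) t x := by
  have h := matD_vel_none hV hδ hT ht x (fun k _ _ => if k = none then 1 else 0)
  simpa [matD, sum_option] using h

/-- The symmetric form follows from the equations of motion for the primitive variables. -/
lemma symmetric_of_primitive (hr : V.Regular T) (hδ : 0 ≤ δ) (hT : 0 < T) {t : ℝ}
    (ht : t ∈ Icc 0 T) (x : E3) (s : ℝ → E3 → ℝ)
    (h1 : alfun (δ * V.θ t x) * (V.P t x)⁻¹ * matD T (V.vel δ) V.P t x +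
      stDiv T (V.vel δ) t x = 0)
    (h2 : ∀ j, V.P t x * mfun (δ * V.θ t x) * (V.θ t x)⁻¹ *
      matD T (V.vel δ) (fun t x => V.u t x j) t x +
      δ * V.u t x j * matD T (V.vel δ) V.P t x + pd T (some j) V.P t x = 0)
    (h3 : matD T (V.vel δ) s t x = 0) (a : Idx) :
    ∑ k, ∑ b, symCoef δ V k a b t x * pd T k (vars s V b) t x = 0 := by
  have he1 := one_le_vel_none (V := V) hδ t x
  have he : V.vel δ none t x ≠ 0 := (zero_lt_one.trans_le he1).ne'
  have hpe := pd_vel_none hr hδ hT ht x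
  have hee : V.vel δ none t x * V.vel δ none t x = _ := vel_none_mul_self (V := V) hδ t x
  rcases a with _ | _ | j
  · rw [← h1]
    unfold matD stDiv
    simp only [sum_option, symCoef, vars, crossCoef, zero_mul, zero_add,
      sum_add_distrib, ite_mul, one_mul, Finset.sum_ite_eq,
      Finset.mem_univ, if_true]
    have e1 : pd T none (V.vel δ none) t x = ∑ j, δ * V.u t x j * (V.vel δ none t x)⁻¹ *
        pd T none (fun t x => V.u t x j) t x := by
      rw [eq_comm, ← mul_right_inj' he, hpe, mul_sum, mul_sum]
      field_simp
    rw [e1]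
    simp only [mul_add, mul_sum, ← mul_assoc]
    simp only [vel]
  · rw [← h3]
    unfold matD
    simp [sum_option, symCoef, vars]
  · have hDP : ∀ f, matD T (V.vel δ) f t x = V.vel δ none t x * pd T none f t x +
        ∑ i, V.u t x i * pd T (some i) f t x := fun f => by
      rfl
    have hsum : ∑ k, ∑ b, symCoef δ V k (some (some j)) b t x * pd T k (vars s V b) t x =
        δ * V.u t x j * (V.vel δ none t x)⁻¹ * pd T none V.P t x + pd T (some j) V.P t x +
        V.P t x * mfun (δ * V.θ t x) * (V.θ t x)⁻¹ *
          (matD T (V.vel δ) (fun t x => V.u t x j) t x - δ * V.u t x j *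
            ((V.vel δ none t x)⁻¹ * (V.vel δ none t x)⁻¹) *
            ∑ l, V.u t x l * matD T (V.vel δ) (fun t x => V.u t x l) t x) := by
      unfold matD
      simp only [sum_option, symCoef, vars, crossCoef, Fin.sum_univ_three]
      fin_cases j <;> simp <;> ring
    rw [hsum]
    have h2s : ∑ l, V.u t x l * (V.P t x * mfun (δ * V.θ t x) * (V.θ t x)⁻¹ *
      matD T (V.vel δ) (fun t x => V.u t x l) t x +
      δ * V.u t x l * matD T (V.vel δ) V.P t x + pd T (some l) V.P t x) = 0 :=
      sum_eq_zero fun l _ => by rw [h2, mul_zero]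
    have h2j := h2 j
    have hP := hDP V.P
    simp only [Fin.sum_univ_three] at h2s hee hP ⊢
    set e := V.vel δ none t x
    have hi : e * e⁻¹ = 1 := mul_inv_cancel₀ he
    set ei := e⁻¹
    set DP := matD T (V.vel δ) V.P t x
    linear_combination h2j - δ * V.u t x j * (ei * ei) * h2s +
      δ * V.u t x j * ei ^ 2 * DP * hee * (-1) +
      δ * V.u t x j * (-(ei ^ 2)) * hP - δ * V.u t x j * (ei * pd T none V.P t x) * hi +
      δ * V.u t x j * DP * (e * ei + 1) * hi

/-- The relativistic Euler equations in symmetric form. -/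
lemma IsRelEuler.symmetric (hV : V.IsRelEuler c T) (hc : 0 < c) (hT : 0 < T)
    (hδ : δ = (c ^ 2)⁻¹) {ε₀ : ℝ} (hε : ∀ t ∈ Icc 0 T, ∀ x, δ * V.θ t x ∈ Ioo 0 ε₀)
    (hm : ContDiffOn ℝ 1 mfun (Ioo 0 ε₀)) (hψ : ContDiffOn ℝ 1 psifun (Ioo 0 ε₀))
    (hcp : ∀ ε ∈ Ioo 0 ε₀, 0 < cpfun ε) {t : ℝ} (ht : t ∈ Icc 0 T) (x : E3) (a : Idx) :
    ∑ k, ∑ b, symCoef δ V k a b t x * pd T k (vars (V.S c) V b) t x = 0 := by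
  have hr := hV.1
  have hδ0 : 0 < δ := by rw [hδ]; positivity
  have cθ := hr.2.2.2
  have cδθ : C1On T fun t x => δ * V.θ t x := cθ.const_mul δ
  have cm : C1On T fun t x => mfun (δ * V.θ t x) := cδθ.comp hm hε
  have cB : C1On T fun t x => V.n t x * mfun (δ * V.θ t x) := hr.2.1.mul cm
  have hθc : ∀ t x, V.θ t x / c ^ 2 = δ * V.θ t x := fun t x => by
    rw [hδ, div_eq_inv_mul]
  obtain ⟨g1, g2, g3⟩ := hV.primitive hc hT cB (fun t ht x => by
    unfold Fluid.h Fluid.P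
    rw [relEnthalpy_eq hc (hr.1 t ht x).2, hθc]; ring) hδ ht x
  obtain ⟨hn, hθ⟩ := hr.1 t ht x
  set D := matD T (V.vel δ) with hD
  have hcp0 := hcp _ (hε t ht x)
  have Dm : D (fun t x => mfun (δ * V.θ t x)) t x = cpfun (δ * V.θ t x) * (δ * D V.θ t x) := by
    rw [← matD_const_mul δ cθ hT ht]
    exact matD_comp cδθ hm hε hT ht x (hasDerivAt_mfun (hε t ht x).1)
  have DB : D (fun t x => V.n t x * mfun (δ * V.θ t x)) t x = D V.n t x * mfun (δ * V.θ t x) +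
      V.n t x * D (fun t x => mfun (δ * V.θ t x)) t x := matD_mul hr.2.1 cm hT ht x
  have DP : D V.P t x = D V.n t x * V.θ t x + V.n t x * D V.θ t x :=
    matD_mul (v := V.vel δ) hr.2.1 cθ hT ht x
  rw [DB, Dm] at g2
  have k1 : δ * (V.n t x * cpfun (δ * V.θ t x) * D V.θ t x) = δ * D V.P t x := by
    linear_combination g2 - mfun (δ * V.θ t x) * g1
  have k2 := mul_left_cancel₀ hδ0.ne' k1
  have hPe : V.P t x = V.n t x * V.θ t x := rfl
  refine symmetric_of_primitive hr hδ0.le hT ht x _ ?_ (fun j => ?_) ?_ a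
  · rw [alfun, ← hD, ← k2, hPe]
    rw [← k2] at DP
    generalize cpfun (δ * V.θ t x) = cp at *
    have h4 : V.n t x * (V.θ t x * stDiv T (V.vel δ) t x) =
        V.n t x * -(cp * D V.θ t x - D V.θ t x) := by
      linear_combination V.θ t x * g1 + DP
    have h5 := mul_left_cancel₀ hn.ne' h4
    field_simp
    linear_combination h5
  · rw [← g3 j]
    congr 3
    rw [hPe]
    field_simp
  · have hlog : ContDiffOn ℝ 1 log (Ioi 0) :=
      contDiffOn_log.mono fun y hy => (ne_of_gt hy : y ≠ 0)
    have clog : C1On T fun t x => log (V.θ t x) := cθ.comp hlog fun t ht x => (hr.1 t ht x).2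
    have clogP : C1On T fun t x => log (V.P t x) := hr.c1On_P.comp hlog
      fun t ht x => P_pos hr ht x
    have cψ : C1On T fun t x => psifun (δ * V.θ t x) := cδθ.comp hψ hε
    have e1 : ∀ t ∈ Icc 0 T, ∀ x, V.S c t x = 5 / 2 * log (V.θ t x) +
        psifun (δ * V.θ t x) + log (4 * π / 3) + (-1) * log (V.P t x) :=
      fun t ht x => by
        have := log_add_relEntropy hc (hr.1 t ht x).1 (hr.1 t ht x).2
        rw [hθc] at this
        unfold Fluid.S Fluid.P
        linarith
    have c1 := (clog.const_mul (5 / 2)).add cψ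
    have c2 := c1.add (C1On.const (T := T) (log (4 * π / 3)))
    rw [matD_congr (c2.add (clogP.const_mul (-1))) e1 hT ht,
      matD_add c2 (clogP.const_mul (-1)) hT ht, matD_add c1 (C1On.const _) hT ht,
      matD_add (clog.const_mul (5 / 2)) cψ hT ht, matD_const_mul _ clog hT ht,
      matD_const_mul _ clogP hT ht, matD_const _ hT ht,
      matD_comp cθ hlog (fun t ht x => (hr.1 t ht x).2) hT ht x (hasDerivAt_log hθ.ne'),
      matD_comp hr.c1On_P hlog (fun t ht x => P_pos hr ht x) hT ht x (hasDerivAt_log (P_pos hr ht x).ne'),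
      matD_comp cδθ hψ hε hT ht x (hasDerivAt_psifun (hε t ht x).1),
      matD_const_mul _ cθ hT ht, ← hD, ← k2, hPe]
    field_simp
    ring

/-- The classical Euler equations for the primitive variables. -/
lemma IsClEuler.primitive (hW : W.IsClEuler T) (hT : 0 < T) {t : ℝ} (ht : t ∈ Icc 0 T) (x : E3) :
    matD T (W.vel 0) W.n t x + W.n t x * stDiv T (W.vel 0) t x = 0 ∧
    (∀ j, W.n t x * matD T (W.vel 0) (fun t x => W.u t x j) t x + pd T (some j) W.P t x = 0) ∧
    3 / 2 * W.n t x * matD T (W.vel 0) W.θ t x + W.P t x * stDiv T (W.vel 0) t x = 0 := by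
  obtain ⟨hr, heq⟩ := hW
  obtain ⟨h1, h2, h3⟩ := heq t ht x
  have hv := hr.c1On_vel (δ := 0) le_rfl
  have hu := hr.c1On_u
  have hP := hr.c1On_P
  have hn := hr.2.1
  have cθ := hr.2.2.2
  have hv1 : ∀ t x, W.vel 0 none t x = 1 := fun t x => by simp [vel]
  have cons : ∀ f, C1On T f → pd T none f t x + ∑ i, pd T (some i)
      (fun t x => f t x * W.u t x i) t x =
      matD T (W.vel 0) f t x + f t x * stDiv T (W.vel 0) t x := fun f hf => by
    rw [← sum_pd_mul hv hf hT ht x, sum_option]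
    congr 1
    exact (hf.pd_congr (fun t _ x => by rw [hv1, mul_one]) hT none ht x).symm
  have E1 : matD T (W.vel 0) W.n t x + W.n t x * stDiv T (W.vel 0) t x = 0 := by
    rw [← cons _ hn]; exact h1
  have E2 : ∀ j, W.n t x * matD T (W.vel 0) (fun t x => W.u t x j) t x +
      pd T (some j) W.P t x = 0 := fun j => by
    have k1 := cons _ (hn.mul (hu j))
    have k2 : pd T none (fun t x => W.n t x * W.u t x j) t x + ∑ i, pd T (some i)
        (fun t x => W.n t x * W.u t x i * W.u t x j) t x + pd T (some j) W.P t x = 0 := h2 j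
    have k3 : ∀ i, (fun t x => W.n t x * W.u t x i * W.u t x j) =
        fun t x => W.n t x * W.u t x j * W.u t x i := fun i => by ext t x; ring
    simp only [k3] at k2
    rw [k1, matD_mul hn (hu j) hT ht] at k2
    linear_combination k2 - W.u t x j * E1
  refine ⟨E1, E2, ?_⟩
  have cq : C1On T fun t x => ∑ j, W.u t x j * W.u t x j :=
    C1On.sum fun j _ => (hu j).mul (hu j)
  have cF : C1On T fun t x => 1 / 2 * (∑ j, W.u t x j * W.u t x j) + 3 / 2 * W.θ t x :=
    (cq.const_mul (1 / 2)).add (cθ.const_mul (3 / 2))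
  have hE : ∀ t ∈ Icc 0 T, ∀ x, W.E t x = W.n t x * (1 / 2 * (∑ j, W.u t x j * W.u t x j) +
      3 / 2 * W.θ t x) := fun t _ x => by
    have : ‖W.u t x‖ ^ 2 = ∑ j, W.u t x j * W.u t x j := by
      rw [EuclideanSpace.norm_sq_eq]
      exact sum_congr rfl fun j _ => by rw [norm_eq_abs, sq_abs, sq]
    rw [Fluid.E, this]; ring
  have cE : C1On T W.E := (hn.mul cF).congr hE
  have k0 : pd T none W.E t x + ∑ i, pd T (some i)
      (fun t x => (W.E t x + W.P t x) * W.u t x i) t x = 0 := h3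
  have k1 : ∀ i, pd T (some i) (fun t x => (W.E t x + W.P t x) * W.u t x i) t x =
      pd T (some i) (fun t x => W.E t x * W.u t x i) t x +
      pd T (some i) (fun t x => W.P t x * W.u t x i) t x := fun i => by
    rw [← (cE.mul (hu i)).pd_add (hP.mul (hu i)) hT (some i) ht]
    simp only [add_mul]
  have k2 := cons _ cE
  have k3 := cons _ hP
  simp only [k1, sum_add_distrib] at k0
  have hDP : matD T (W.vel 0) W.P t x = pd T none W.P t x +
      ∑ i, W.u t x i * pd T (some i) W.P t x := by
    rw [matD, sum_option, hv1, one_mul]; rfl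
  have hDE : matD T (W.vel 0) W.E t x = matD T (W.vel 0) W.n t x *
      (1 / 2 * (∑ j, W.u t x j * W.u t x j) + 3 / 2 * W.θ t x) + W.n t x *
      (∑ j, W.u t x j * matD T (W.vel 0) (fun t x => W.u t x j) t x +
        3 / 2 * matD T (W.vel 0) W.θ t x) := by
    rw [matD_congr (hn.mul cF) hE hT ht, matD_mul hn cF hT ht,
      matD_add (cq.const_mul (1 / 2)) (cθ.const_mul (3 / 2)) hT ht,
      matD_const_mul _ cq hT ht, matD_const_mul _ cθ hT ht,
      matD_sum (fun j => (hu j).mul (hu j)) hT ht]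
    simp only [matD_mul (hu _) (hu _) hT ht, Fin.sum_univ_three]
    ring
  have hE2 : ∑ j, W.u t x j * (W.n t x * matD T (W.vel 0) (fun t x => W.u t x j) t x +
      pd T (some j) W.P t x) = 0 := sum_eq_zero fun j _ => by rw [E2, mul_zero]
  have hEe := hE t ht x
  simp only [Fin.sum_univ_three] at *
  linear_combination k0 - k2 - k3 - hDE - hDP - hE2 -
    (1 / 2 * (W.u t x 0 * W.u t x 0 + W.u t x 1 * W.u t x 1 + W.u t x 2 * W.u t x 2) +
      3 / 2 * W.θ t x) * E1 - stDiv T (W.vel 0) t x * hEe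

end Fluid

/-! ### The classical system solved for the time derivatives -/

namespace Fluid

variable {T : ℝ} {W : Fluid}

lemma vel_zero_none (W : Fluid) (t : ℝ) (x : E3) : W.vel 0 none t x = 1 := by simp [vel]

lemma log_theta_eq {t : ℝ} (hW : W.Regular T) (ht : t ∈ Icc 0 T) (x : E3) :
    W.η t x = 5 / 2 * log (W.θ t x) + (psifun 0 + log (4 * π / 3)) +
      (-1) * log (W.P t x) := by
  have := log_add_clEntropy (hW.1 t ht x).1 (hW.1 t ht x).2
  unfold Fluid.η Fluid.P
  linarith

lemma contDiffOn_log_Ioi {n : WithTop ℕ∞} : ContDiffOn ℝ n log (Ioi 0) :=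
  contDiffOn_log.mono fun y hy => (ne_of_gt hy : y ≠ 0)

lemma Regular.c1On_log_theta (hW : W.Regular T) : C1On T fun t x => log (W.θ t x) :=
  hW.2.2.2.comp contDiffOn_log_Ioi fun t ht x => (hW.1 t ht x).2

lemma Regular.c1On_log_P (hW : W.Regular T) : C1On T fun t x => log (W.P t x) :=
  hW.c1On_P.comp contDiffOn_log_Ioi fun _ ht x => P_pos hW ht x

lemma Regular.c1On_eta (hW : W.Regular T) : C1On T W.η :=
  (((hW.c1On_log_theta.const_mul (5 / 2)).add (C1On.const _)).add
    (hW.c1On_log_P.const_mul (-1))).congr fun _ ht x => log_theta_eq hW ht x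

/-- The classical equations for pressure, velocity and entropy. -/
lemma IsClEuler.primitive' (hW : W.IsClEuler T) (hT : 0 < T) {t : ℝ} (ht : t ∈ Icc 0 T)
    (x : E3) :
    3 / 5 * (W.P t x)⁻¹ * matD T (W.vel 0) W.P t x + stDiv T (W.vel 0) t x = 0 ∧
    (∀ j, W.P t x * (W.θ t x)⁻¹ * matD T (W.vel 0) (fun t x => W.u t x j) t x +
      pd T (some j) W.P t x = 0) ∧ matD T (W.vel 0) W.η t x = 0 := by
  have hr := hW.1
  obtain ⟨g1, g2, g3⟩ := hW.primitive hT ht x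
  obtain ⟨hn, hθ⟩ := hr.1 t ht x
  have hPe : W.P t x = W.n t x * W.θ t x := rfl
  have DP : matD T (W.vel 0) W.P t x = matD T (W.vel 0) W.n t x * W.θ t x +
    W.n t x * matD T (W.vel 0) W.θ t x := matD_mul hr.2.1 hr.2.2.2 hT ht x
  have h1 : 3 / 5 * (W.P t x)⁻¹ * matD T (W.vel 0) W.P t x + stDiv T (W.vel 0) t x = 0 := by
    rw [hPe] at g3 ⊢
    have : 3 * matD T (W.vel 0) W.P t x + 5 * (W.n t x * W.θ t x) * stDiv T (W.vel 0) t x = 0 := by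
      linear_combination 3 * DP + 3 * W.θ t x * g1 + 2 * g3
    field_simp
    linear_combination this
  refine ⟨h1, fun j => ?_, ?_⟩
  · have h2 := g2 j
    rw [hPe, mul_inv_cancel_right₀ hθ.ne']
    exact h2
  · have c1 := (hr.c1On_log_theta.const_mul (5 / 2)).add
      (C1On.const (T := T) (psifun 0 + log (4 * π / 3)))
    rw [matD_congr (c1.add (hr.c1On_log_P.const_mul (-1))) (fun t ht x => log_theta_eq hr ht x)
        hT ht, matD_add c1 (hr.c1On_log_P.const_mul (-1)) hT ht,
      matD_add (hr.c1On_log_theta.const_mul (5 / 2)) (C1On.const _) hT ht,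
      matD_const_mul _ hr.c1On_log_theta hT ht, matD_const_mul _ hr.c1On_log_P hT ht,
      matD_const _ hT ht,
      matD_comp hr.2.2.2 contDiffOn_log_Ioi (fun t ht x => (hr.1 t ht x).2) hT ht x
        (hasDerivAt_log hθ.ne'),
      matD_comp hr.c1On_P contDiffOn_log_Ioi (fun t ht x => P_pos hr ht x) hT ht x
        (hasDerivAt_log (P_pos hr ht x).ne')]
    rw [hPe] at g3 ⊢
    have h2 : 3 / 2 * matD T (W.vel 0) W.θ t x + W.θ t x * stDiv T (W.vel 0) t x = 0 := by
      have : W.n t x * (3 / 2 * matD T (W.vel 0) W.θ t x + W.θ t x * stDiv T (W.vel 0) t x) = 0 := by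
        linear_combination g3
      exact (mul_eq_zero.1 this).resolve_left hn.ne'
    rw [DP]
    field_simp
    linear_combination 2 * W.n t x * h2 - 2 * W.θ t x * g1

/-- The classical Euler equations in symmetric form. -/
lemma IsClEuler.symmetric (hW : W.IsClEuler T) (hT : 0 < T) {t : ℝ} (ht : t ∈ Icc 0 T) (x : E3)
    (a : Idx) : ∑ k, ∑ b, symCoef 0 W k a b t x * pd T k (vars W.η W b) t x = 0 := by
  obtain ⟨g1, g2, g3⟩ := hW.primitive' hT ht x
  refine symmetric_of_primitive hW.1 le_rfl hT ht x _ ?_ (fun j => ?_) g3 a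
  · rw [zero_mul, alfun_zero]; exact g1
  · have h2 := g2 j
    rw [zero_mul, mfun_zero]
    linear_combination h2

/-- The coefficients expressing the time derivatives of the classical fields through the spatial
ones. -/
def clCoef (W : Fluid) (i : Fin 3) : Idx → Idx → ℝ → E3 → ℝ
  | none, none => fun t x => -W.u t x i
  | none, some none => fun _ _ => 0
  | none, some (some j) => fun t x => if i = j then -(5 / 3) * W.P t x else 0
  | some none, none => fun _ _ => 0
  | some none, some none => fun t x => -W.u t x i
  | some none, some (some _) => fun _ _ => 0
  | some (some j), none => fun t x => if i = j then -(W.θ t x * (W.P t x)⁻¹) else 0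
  | some (some _), some none => fun _ _ => 0
  | some (some j), some (some l) => fun t x => if j = l then -W.u t x i else 0

lemma IsClEuler.dt_eq (hW : W.IsClEuler T) (hT : 0 < T) {t : ℝ} (ht : t ∈ Icc 0 T) (x : E3)
    (a : Idx) : pd T none (vars W.η W a) t x =
      ∑ i, ∑ b, clCoef W i a b t x * pd T (some i) (vars W.η W b) t x := by
  obtain ⟨g1, g2, g3⟩ := hW.primitive' hT ht x
  have hP := (P_pos hW.1 ht x).ne'
  have hθ := (hW.1.1 t ht x).2.ne'
  have hD : ∀ f, matD T (W.vel 0) f t x = pd T none f t x +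
      ∑ i, W.u t x i * pd T (some i) f t x := fun f => by
    rw [matD, sum_option, vel_zero_none, one_mul]; rfl
  have hΘ : stDiv T (W.vel 0) t x = ∑ i, pd T (some i) (fun t x => W.u t x i) t x := by
    rw [stDiv, sum_option]
    have : pd T none (W.vel 0 none) t x = 0 := by
      rw [(C1On.const (T := T) 1).pd_congr (fun t _ x => vel_zero_none W t x) hT none ht x,
        C1On.pd_const _ hT none ht]
    rw [this, zero_add]; rfl
  rcases a with _ | _ | j
  · have h1 : matD T (W.vel 0) W.P t x = -(5 / 3) * W.P t x * stDiv T (W.vel 0) t x := by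
      field_simp at g1
      linear_combination 1 / 3 * g1
    rw [hD, hΘ] at h1
    simp only [sum_option, clCoef, vars, Fin.sum_univ_three] at h1 ⊢
    simp
    linear_combination h1
  · rw [hD] at g3
    simp only [sum_option, clCoef, vars, Fin.sum_univ_three] at g3 ⊢
    linear_combination g3
  · have h1 : matD T (W.vel 0) (fun t x => W.u t x j) t x =
        -(W.θ t x * (W.P t x)⁻¹) * pd T (some j) W.P t x := by
      have := g2 j
      field_simp at this ⊢
      linear_combination this
    rw [hD] at h1
    simp only [sum_option, clCoef, vars, Fin.sum_univ_three] at h1 ⊢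
    fin_cases j <;> simp at h1 ⊢ <;> linear_combination h1

end Fluid

/-! ### Bounds for a function with a given spectrum -/

/-- The constant of the embedding of `H³` into `C¹`. -/
def embConst : ℝ := (1 + 2 * π) * √(∫ ξ : E3, (wt ξ ^ 2)⁻¹)

lemma embConst_nonneg : 0 ≤ embConst :=
  mul_nonneg (by positivity) (sqrt_nonneg _)

lemma sqrt_le_embConst : √(∫ ξ : E3, (wt ξ ^ 2)⁻¹) ≤ embConst :=
  le_mul_of_one_le_left (sqrt_nonneg _) (by linarith [pi_pos])

section

variable {f : E3 → ℝ} {φ : E3 → ℂ} {a B : ℝ}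

lemma HasSpectrum.mono {B' : ℝ} (h : HasSpectrum f φ B) (hB : 0 ≤ B) (hBB : B ≤ B') :
    HasSpectrum f φ B' :=
  ⟨h.meas, h.int, h.le.trans (pow_le_pow_left₀ hB hBB 2), h.eq⟩

lemma fderiv_sub_const_eq (f : E3 → ℝ) (a : ℝ) (x : E3) :
    fderiv ℝ (fun x => f x - a) x = fderiv ℝ f x := fderiv_sub_const a

lemma HasSpectrum.abs_sub_le (h : HasSpectrum (fun x => f x - a) φ B) (hB : 0 ≤ B) (x : E3) :
    |f x - a| ≤ embConst * B :=
  (h.abs_le hB x).trans (by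
    rw [mul_comm]; exact mul_le_mul_of_nonneg_right sqrt_le_embConst hB)

lemma HasSpectrum.abs_dx_le' (h : HasSpectrum (fun x => f x - a) φ B) (hB : 0 ≤ B) (i : Fin 3)
    (x : E3) : |fderiv ℝ f x (single i 1)| ≤ embConst * B := by
  rw [← fderiv_sub_const_eq f a]
  refine (h.abs_dx_le hB i x).trans ?_
  have : 0 ≤ B * √(∫ ξ : E3, (wt ξ ^ 2)⁻¹) := mul_nonneg hB (sqrt_nonneg _)
  unfold embConst
  linarith

lemma HasSpectrum.sqB_dx (h : HasSpectrum (fun x => f x - a) φ B) (hf : ContDiff ℝ 1 f)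
    (i : Fin 3) :
    SqB (fun x => fderiv ℝ f x (single i 1)) (4 * π ^ 2 * B ^ 2) := by
  have h1 := h.integral_sq_dx i
  have h2 := h.integral_sq_dx_le i
  simp only [fderiv_sub_const_eq] at h1 h2
  exact ⟨((hf.continuous_fderiv (by norm_num)).clm_apply continuous_const).aestronglyMeasurable,
    h1.1, h2⟩

end

/-! ### Relativistic solutions near a classical one -/

/-- Uniform bounds near `ε = 0` for the functions entering the relativistic equation of state. -/
structure TameConst (ε₀ C : ℝ) : Prop where
  pos : 0 < ε₀
  C_nonneg : 0 ≤ C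
  m : ContDiffOn ℝ 1 mfun (Ioo 0 ε₀)
  m_le : ∀ ε ∈ Ioo 0 ε₀, |mfun ε| ≤ C ∧ |deriv mfun ε| ≤ C ∧ |mfun ε - mfun 0| ≤ C * ε
  al : ContDiffOn ℝ 1 alfun (Ioo 0 ε₀)
  al_le : ∀ ε ∈ Ioo 0 ε₀, |alfun ε| ≤ C ∧ |deriv alfun ε| ≤ C ∧ |alfun ε - alfun 0| ≤ C * ε
  psi : ContDiffOn ℝ 1 psifun (Ioo 0 ε₀)
  psi_le : ∀ ε ∈ Ioo 0 ε₀, |psifun ε| ≤ C ∧ |deriv psifun ε| ≤ C ∧ |psifun ε - psifun 0| ≤ C * ε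
  cp : ∀ ε ∈ Ioo 0 ε₀, 2 ≤ cpfun ε

lemma exists_tameConst : ∃ ε₀ C, TameConst ε₀ C := by
  obtain ⟨e1, he1, C1, hC1, h1, b1⟩ := tameAtZero_mfun
  obtain ⟨e2, he2, C2, hC2, h2, b2⟩ := tameAtZero_alfun
  obtain ⟨e3, he3, C3, hC3, h3, b3⟩ := tameAtZero_psifun
  obtain ⟨e4, he4, _, _, _, b4⟩ := tameAtZero_cpfun.near (d := 1 / 2) (by norm_num)
  set e := min (min e1 e2) (min e3 e4) with he
  set C := max C1 (max C2 C3) with hC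
  have s1 : Ioo 0 e ⊆ Ioo 0 e1 := Ioo_subset_Ioo_right (by simp [he])
  have s2 : Ioo 0 e ⊆ Ioo 0 e2 := Ioo_subset_Ioo_right (by simp [he])
  have s3 : Ioo 0 e ⊆ Ioo 0 e3 := Ioo_subset_Ioo_right (by simp [he])
  have s4 : Ioo 0 e ⊆ Ioo 0 e4 := Ioo_subset_Ioo_right (by simp [he])
  have l1 : C1 ≤ C := by simp [hC]
  have l2 : C2 ≤ C := by simp [hC]
  have l3 : C3 ≤ C := by simp [hC]
  have aux : ∀ {ψ : ℝ → ℝ} {C' ε : ℝ}, C' ≤ C → 0 < ε →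
      (|ψ ε| ≤ C' ∧ |deriv ψ ε| ≤ C' ∧ |ψ ε - ψ 0| ≤ C' * ε) →
      (|ψ ε| ≤ C ∧ |deriv ψ ε| ≤ C ∧ |ψ ε - ψ 0| ≤ C * ε) := fun hl hε h =>
    ⟨h.1.trans hl, h.2.1.trans hl, h.2.2.trans (by gcongr)⟩
  refine ⟨e, C, lt_min (lt_min he1 he2) (lt_min he3 he4), hC1.trans l1, h1.mono s1,
    fun ε hε => aux l1 hε.1 (b1 ε (s1 hε)), h2.mono s2, fun ε hε => aux l2 hε.1 (b2 ε (s2 hε)),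
    h3.mono s3, fun ε hε => aux l3 hε.1 (b3 ε (s3 hε)), fun ε hε => ?_⟩
  have := (b4 ε (s4 hε)).2.2.2
  rw [cpfun_zero] at this
  have := (abs_lt.1 this).1
  linarith

lemma log_Q0_le_psifun {ε : ℝ} (hε : 0 ≤ ε) : log (Q0 0) ≤ psifun ε := by
  have h1 : log (Q0 0) ≤ log (Q0 ε) :=
    log_le_log (Q0_pos le_rfl) (lapInt_zero_le (by norm_num) (by norm_num) (by norm_num) hε)
  have := jfun_pos hε
  unfold psifun; linarith

/-- The constant states of `(P, u, S)` at infinity. -/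
def bar (Pbar Sbar : ℝ) : Idx → ℝ
  | none => Pbar
  | some none => Sbar
  | some (some _) => 0

/-- A classical solution with pressure bounded below, together with a bound `B` for Sobolev norms. -/
structure RefSol where
  T : ℝ
  B : ℝ
  Pbar : ℝ
  Sbar : ℝ
  m : ℝ
  W : Fluid
  T_pos : 0 < T
  B_nonneg : 0 ≤ B
  m_pos : 0 < m
  sol : W.IsClEuler T
  P_ge : ∀ t ∈ Icc 0 T, ∀ x, m ≤ W.P t x
  spec : ∀ t ∈ Icc 0 T, ∀ b, ∃ φ,
    HasSpectrum (fun x => W.vars W.η b t x - bar Pbar Sbar b) φ B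

namespace RefSol

variable (R : RefSol)

/-- The unknowns `(P, η, u)` of the classical solution. -/
abbrev vars : Idx → ℝ → E3 → ℝ := R.W.vars R.W.η

/-- A relativistic solution with the same data and with Sobolev norms bounded by `R.B`. -/
structure Rel (c : ℝ) (V : Fluid) : Prop where
  sol : V.IsRelEuler c R.T
  data : V.SameData c R.W
  spec : ∀ t ∈ Icc 0 R.T, ∀ b, ∃ φ,
    HasSpectrum (fun x => V.vars (V.S c) b t x - bar R.Pbar R.Sbar b) φ R.B

/-- A common bound for the unknowns and their spatial derivatives. -/
def M : ℝ := |R.Pbar| + |R.Sbar| + embConst * R.B + 1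

/-- An upper bound for the temperature. -/
def U : ℝ := exp (2 / 5 * (log R.M + R.M - log (4 * π / 3) - log (Q0 0)))

/-- A relativistic solution on a time interval on which the pressure is bounded below. -/
structure Adm (c₁ : ℝ) where
  c : ℝ
  V : Fluid
  T1 : ℝ
  hc : c₁ ≤ c
  rel : R.Rel c V
  T1_le : T1 ≤ R.T
  P_ge : ∀ t ∈ Icc 0 T1, ∀ x, R.m / 2 ≤ V.P t x

/-- The unknowns `(P, S, u)` of the relativistic solution. -/
abbrev Adm.vars {R : RefSol} {c₁ : ℝ} (α : R.Adm c₁) : Idx → ℝ → E3 → ℝ := α.V.vars (α.V.S α.c)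

variable {R}

lemma one_le_M : 1 ≤ R.M := by
  have := mul_nonneg embConst_nonneg R.B_nonneg
  have := abs_nonneg R.Pbar
  have := abs_nonneg R.Sbar
  unfold M; linarith

lemma emb_le_M : embConst * R.B ≤ R.M := by
  have := abs_nonneg R.Pbar
  have := abs_nonneg R.Sbar
  unfold M; linarith

lemma abs_bar_le (b : Idx) : |bar R.Pbar R.Sbar b| + embConst * R.B ≤ R.M := by
  have := abs_nonneg R.Pbar
  have := abs_nonneg R.Sbar
  rcases b with _ | _ | j <;> simp only [bar, M, abs_zero] <;> linarith

section bounds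

variable {f : E3 → ℝ} {b : Idx} {φ : E3 → ℂ}
  (h : HasSpectrum (fun x => f x - bar R.Pbar R.Sbar b) φ R.B)
include h

lemma abs_le_M (x : E3) : |f x| ≤ R.M := by
  have h1 := h.abs_sub_le R.B_nonneg x
  have h2 := abs_sub_abs_le_abs_sub (f x) (bar R.Pbar R.Sbar b)
  have := R.abs_bar_le b
  linarith

lemma abs_dx_le_M (i : Fin 3) (x : E3) :
    |fderiv ℝ f x (single i 1)| ≤ R.M :=
  (h.abs_dx_le' R.B_nonneg i x).trans emb_le_M

end bounds

lemma theta_le {P s θ ψ : ℝ} (hP : 0 < P) (hθ : 0 < θ) (hPM : P ≤ R.M) (hs : s ≤ R.M)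
    (hψ : log (Q0 0) ≤ ψ)
    (h : log P + s = 5 / 2 * log θ + ψ + log (4 * π / 3)) : θ ≤ R.U := by
  rw [← exp_log hθ, U]
  have := log_le_log hP hPM
  exact exp_le_exp.2 (by linarith)

lemma W_vars_le {t : ℝ} (ht : t ∈ Icc 0 R.T) (b : Idx) (x : E3) :
    |R.vars b t x| ≤ R.M := by
  obtain ⟨φ, h⟩ := R.spec t ht b
  exact abs_le_M h x

lemma W_dx_le {t : ℝ} (ht : t ∈ Icc 0 R.T) (b : Idx) (i : Fin 3) (x : E3) :
    |pd R.T (some i) (R.vars b) t x| ≤ R.M := by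
  obtain ⟨φ, h⟩ := R.spec t ht b
  exact abs_dx_le_M h i x

lemma W_theta_le {t : ℝ} (ht : t ∈ Icc 0 R.T) (x : E3) : R.W.θ t x ≤ R.U := by
  obtain ⟨hn, hθ⟩ := R.sol.1.1 t ht x
  exact theta_le (Fluid.P_pos R.sol.1 ht x) hθ ((le_abs_self _).trans (W_vars_le ht none x))
    ((le_abs_self _).trans (W_vars_le ht (some none) x)) (log_Q0_le_psifun le_rfl)
    (log_add_clEntropy hn hθ)

namespace Rel

variable {c : ℝ} {V : Fluid} (h : R.Rel c V)
include h

lemma vars_le {t : ℝ} (ht : t ∈ Icc 0 R.T) (b : Idx) (x : E3) :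
    |V.vars (V.S c) b t x| ≤ R.M := by
  obtain ⟨φ, h⟩ := h.spec t ht b
  exact abs_le_M h x

lemma dx_le {t : ℝ} (ht : t ∈ Icc 0 R.T) (b : Idx) (i : Fin 3) (x : E3) :
    |pd R.T (some i) (V.vars (V.S c) b) t x| ≤ R.M := by
  obtain ⟨φ, h⟩ := h.spec t ht b
  exact abs_dx_le_M h i x

lemma state (hc : 0 < c) {t : ℝ} (ht : t ∈ Icc 0 R.T) (x : E3) :
    log (V.P t x) + V.S c t x = 5 / 2 * log (V.θ t x) +
      psifun ((c ^ 2)⁻¹ * V.θ t x) + log (4 * π / 3) := by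
  obtain ⟨hn, hθ⟩ := h.sol.1.1 t ht x
  have := log_add_relEntropy hc hn hθ
  rw [div_eq_inv_mul (V.θ t x)] at this
  exact this

lemma theta_le (hc : 0 < c) {t : ℝ} (ht : t ∈ Icc 0 R.T) (x : E3) : V.θ t x ≤ R.U := by
  obtain ⟨hn, hθ⟩ := h.sol.1.1 t ht x
  refine RefSol.theta_le (Fluid.P_pos h.sol.1 ht x) hθ
    ((le_abs_self _).trans (h.vars_le ht none x))
    ((le_abs_self _).trans (h.vars_le ht (some none) x)) (log_Q0_le_psifun ?_) (h.state hc ht x)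
  positivity

lemma eps_mem {ε₀ c₁ : ℝ} (h1 : 1 ≤ c₁) (hU : R.U / c₁ ^ 2 < ε₀) (hc : c₁ ≤ c) {t : ℝ}
    (ht : t ∈ Icc 0 R.T) (x : E3) : (c ^ 2)⁻¹ * V.θ t x ∈ Ioo 0 ε₀ := by
  have hc1 : 0 < c₁ := by linarith
  have hc0 : 0 < c := by linarith
  obtain ⟨hn, hθ⟩ := h.sol.1.1 t ht x
  refine ⟨by positivity, lt_of_le_of_lt ?_ hU⟩
  rw [← div_eq_inv_mul]
  exact div_le_div₀ (exp_pos _).le (h.theta_le hc0 ht x) (by positivity)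
    (pow_le_pow_left₀ hc1.le hc 2)

end Rel

/-- The frame measuring the difference of the relativistic solutions and the classical one. -/
def frame (R : RefSol) {c₁ : ℝ} (h1 : 1 ≤ c₁) : Frame (R.Adm c₁) R.T where
  T1 α := α.T1
  δ α := (α.c ^ 2)⁻¹
  sX α t x := ∑ b, |α.vars b t x - R.vars b t x|
  sDX α t x := ∑ j, ∑ b, |pd R.T (some j) (α.vars b) t x -
    pd R.T (some j) (R.vars b) t x|
  sDt α t x := 1 + ∑ b, |pd R.T none (α.vars b) t x -
    pd R.T none (R.vars b) t x|
  w _ t x := ∑ j, ∑ b, |pd R.T (some j) (R.vars b) t x|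
  B := 30 * R.M
  T_pos := R.T_pos
  T1_le α := α.T1_le
  δ_pos α := by have := α.hc; have : 0 < α.c := by linarith
                positivity
  δ_le α := by
    have := α.hc
    have : 1 ≤ α.c := by linarith
    exact inv_le_one_of_one_le₀ (one_le_pow₀ this)
  sX_nonneg _ _ _ _ := sum_nonneg fun b _ => abs_nonneg _
  sX_le α t ht x := by
    have ht' : t ∈ Icc 0 R.T := ⟨ht.1, ht.2.trans α.T1_le⟩
    have h : ∀ b ∈ (Finset.univ : Finset Idx),
        |α.vars b t x - R.vars b t x| ≤ 2 * R.M := fun b _ => by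
      have := abs_sub (α.vars b t x) (R.vars b t x)
      linarith [α.rel.vars_le ht' b x, R.W_vars_le ht' b x]
    have h2 := sum_le_sum h
    simp only [sum_const, card_univ, card_option, card_fin,
      nsmul_eq_mul] at h2
    push_cast at h2
    linarith [R.one_le_M]
  sDX_nonneg _ _ _ _ := sum_nonneg fun b _ => sum_nonneg fun b _ => abs_nonneg _
  sDX_le α t ht x := by
    have ht' : t ∈ Icc 0 R.T := ⟨ht.1, ht.2.trans α.T1_le⟩
    have h : ∀ j ∈ (Finset.univ : Finset (Fin 3)), ∑ b : Idx,
        |pd R.T (some j) (α.vars b) t x - pd R.T (some j) (R.vars b) t x| ≤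
          ∑ _b : Idx, 2 * R.M := fun j _ => sum_le_sum fun b _ => by
      have := abs_sub (pd R.T (some j) (α.vars b) t x)
        (pd R.T (some j) (R.vars b) t x)
      linarith [α.rel.dx_le ht' b j x, R.W_dx_le ht' b j x]
    have h2 := sum_le_sum h
    simp only [sum_const, card_univ, card_option, card_fin,
      nsmul_eq_mul] at h2
    push_cast at h2
    linarith
  w_nonneg _ _ _ _ := sum_nonneg fun b _ => sum_nonneg fun b _ => abs_nonneg _
  w_le α t ht x := by
    have ht' : t ∈ Icc 0 R.T := ⟨ht.1, ht.2.trans α.T1_le⟩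
    have h : ∀ j ∈ (Finset.univ : Finset (Fin 3)), ∑ b : Idx,
        |pd R.T (some j) (R.vars b) t x| ≤ ∑ _b : Idx, R.M := fun j _ =>
      sum_le_sum fun b _ => R.W_dx_le ht' b j x
    have h2 := sum_le_sum h
    simp only [sum_const, card_univ, card_option, card_fin,
      nsmul_eq_mul] at h2
    push_cast at h2
    linarith [R.one_le_M]
  one_le_sDt _ _ _ _ := le_add_of_nonneg_right (sum_nonneg fun b _ => abs_nonneg _)

end RefSol

namespace Fluid

variable {T : ℝ} {V : Fluid}

lemma Regular.c1On_S (hV : V.Regular T) {c ε₀ : ℝ} (hc : 0 < c)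
    (hε : ∀ t ∈ Icc 0 T, ∀ x, (c ^ 2)⁻¹ * V.θ t x ∈ Ioo 0 ε₀)
    (hψ : ContDiffOn ℝ 1 psifun (Ioo 0 ε₀)) : C1On T (V.S c) := by
  have c1 : C1On T fun t x => psifun ((c ^ 2)⁻¹ * V.θ t x) :=
    (hV.2.2.2.const_mul (c ^ 2)⁻¹).comp hψ hε
  refine ((((hV.c1On_log_theta.const_mul (5 / 2)).add c1).add
    (C1On.const (log (4 * π / 3)))).sub hV.c1On_log_P).congr fun t ht x => ?_
  have := log_add_relEntropy hc (hV.1 t ht x).1 (hV.1 t ht x).2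
  rw [div_eq_inv_mul (V.θ t x)] at this
  unfold Fluid.S Fluid.P
  linarith

lemma Regular.c1On_vars (hV : V.Regular T) {s : ℝ → E3 → ℝ} (hs : C1On T s) (b : Idx) :
    C1On T (V.vars s b) := by
  rcases b with _ | _ | j
  · exact hV.c1On_P
  · exact hs
  · exact hV.c1On_u j

end Fluid

/-! ### Coefficients along relativistic solutions -/

namespace RefSol

variable {R : RefSol} {ε₀ C c₁ : ℝ} (hC : TameConst ε₀ C) (h1 : 1 ≤ c₁) (hU : R.U / c₁ ^ 2 < ε₀)

namespace Adm

lemma c_pos (h1 : 1 ≤ c₁) (α : R.Adm c₁) : 0 < α.c := by have := α.hc; linarith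

include hC h1 hU in
lemma c1On_vars (α : R.Adm c₁) (b : Idx) : C1On R.T (α.vars b) :=
  α.rel.sol.1.c1On_vars (α.rel.sol.1.c1On_S (α.c_pos h1)
    (fun _ ht x => α.rel.eps_mem h1 hU α.hc ht x) hC.psi) b

end Adm

lemma W_c1On_vars (R : RefSol) (b : Idx) : C1On R.T (R.vars b) :=
  R.sol.1.c1On_vars R.sol.1.c1On_eta b

/-- The time derivatives of the classical fields are bounded, by the equations. -/
lemma W_dt_le (R : RefSol) : ∃ D, ∀ t ∈ Icc 0 R.T, ∀ b x,
    |pd R.T none (R.vars b) t x| ≤ D := by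
  set k := 3 * R.M + R.U * R.m⁻¹ with hk
  have hM := R.one_le_M
  have hU0 : 0 < R.U := exp_pos _
  have hm := R.m_pos
  have hUm : 0 < R.U * R.m⁻¹ := by positivity
  refine ⟨∑ _i : Fin 3, ∑ _b : Idx, k * R.M, fun t ht b x => ?_⟩
  rw [R.sol.dt_eq R.T_pos ht x b]
  refine (abs_sum_le_sum_abs _ _).trans (sum_le_sum fun i _ => ?_)
  refine (abs_sum_le_sum_abs _ _).trans (sum_le_sum fun b' _ => ?_)
  rw [abs_mul]
  refine mul_le_mul ?_ (W_dx_le ht b' i x) (abs_nonneg _) (by positivity)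
  have hu : |R.W.u t x i| ≤ R.M := W_vars_le ht (some (some i)) x
  have hP : |R.W.P t x| ≤ R.M := W_vars_le ht none x
  have hθ : |R.W.θ t x * (R.W.P t x)⁻¹| ≤ R.U * R.m⁻¹ := by
    rw [abs_of_pos (mul_pos (R.sol.1.1 t ht x).2 (inv_pos.2 (Fluid.P_pos R.sol.1 ht x)))]
    exact mul_le_mul (W_theta_le ht x) (inv_anti₀ hm (R.P_ge t ht x))
      (inv_pos.2 (Fluid.P_pos R.sol.1 ht x)).le hU0.le
  have hu' : |-R.W.u t x i| ≤ k := by rw [abs_neg]; linarith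
  have h0 : |(0 : ℝ)| ≤ k := by rw [abs_zero]; positivity
  rcases b with _ | _ | j <;> rcases b' with _ | _ | l <;> simp only [Fluid.clCoef] <;>
    try first | exact h0 | exact hu'
  · split_ifs
    · rw [abs_mul, abs_neg, abs_of_pos (by norm_num : (0 : ℝ) < 5 / 3)]; linarith
    · exact h0
  · split_ifs
    · rw [abs_neg]; linarith
    · exact h0
  · split_ifs
    · exact hu'
    · exact h0

section good

include hC h1 hU

/-- The unknowns. -/
lemma good_vars (b : Idx) : (R.frame h1).Good (fun α => α.vars b)
    fun _ => R.vars b where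
  cK α := α.c1On_vars hC h1 hU b
  cL _ := R.W_c1On_vars b
  L1 := Frame.le_top R.M fun q => by simpa using! W_vars_le q.ht' b q.x
  dL j := Frame.le_top 1 fun q => by
    rw [one_mul]
    refine le_trans ?_ (le_abs_self _)
    refine (single_le_sum (f := fun b =>
      |pd R.T (some j) (R.vars b) q.t q.x|) (fun _ _ => abs_nonneg _)
      (Finset.mem_univ b)).trans ?_
    exact single_le_sum (f := fun j => ∑ b,
      |pd R.T (some j) (R.vars b) q.t q.x|)
      (fun _ _ => sum_nonneg fun _ _ => abs_nonneg _) (Finset.mem_univ j)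
  dtK := by
    obtain ⟨D, hD⟩ := R.W_dt_le
    refine Frame.le_top (max D 1) fun q => ?_
    have e1 := hD q.t q.ht' b q.x
    have e2 := single_le_sum (f := fun b => |pd R.T none (q.α.V.vars (q.α.V.S q.α.c) b) q.t
      q.x - pd R.T none (R.vars b) q.t q.x|) (fun _ _ => abs_nonneg _) (Finset.mem_univ b)
    have e3 := abs_sub_abs_le_abs_sub (pd R.T none (q.α.V.vars (q.α.V.S q.α.c) b) q.t q.x)
      (pd R.T none (R.vars b) q.t q.x)
    have e4 : 0 ≤ ∑ b, |pd R.T none (q.α.V.vars (q.α.V.S q.α.c) b) q.t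
      q.x - pd R.T none (R.vars b) q.t q.x| := sum_nonneg fun _ _ => abs_nonneg _
    refine le_trans ?_ (mul_le_mul_of_nonneg_left (le_abs_self _)
      (zero_le_one.trans (le_max_right D 1)))
    change |pd R.T none (q.α.V.vars (q.α.V.S q.α.c) b) q.t q.x| ≤ max D 1 * (1 + ∑ b,
      |pd R.T none (q.α.V.vars (q.α.V.S q.α.c) b) q.t q.x -
        pd R.T none (R.vars b) q.t q.x|)
    have e5 := le_max_left D 1
    have e6 := mul_le_mul_of_nonneg_right (le_max_right D 1) e4
    linarith
  diff := Frame.le_top 1 fun q => by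
    rw [one_mul]
    refine le_trans ?_ (le_abs_self _)
    refine (single_le_sum (f := fun b => |q.α.V.vars (q.α.V.S q.α.c) b q.t q.x -
      R.vars b q.t q.x|) (fun _ _ => abs_nonneg _) (Finset.mem_univ b)).trans ?_
    exact le_add_of_nonneg_right ((R.frame h1).δ_pos q.α).le
  ddiff j := Frame.le_top 1 fun q => by
    rw [one_mul]
    refine le_trans ?_ (le_abs_self _)
    have e1 := single_le_sum (f := fun b => |pd R.T (some j) (q.α.V.vars (q.α.V.S q.α.c) b)
      q.t q.x - pd R.T (some j) (R.vars b) q.t q.x|) (fun _ _ => abs_nonneg _)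
      (Finset.mem_univ b)
    have e2 := single_le_sum (f := fun j => ∑ b, |pd R.T (some j)
      (q.α.V.vars (q.α.V.S q.α.c) b) q.t q.x - pd R.T (some j) (R.vars b) q.t q.x|)
      (fun _ _ => sum_nonneg fun _ _ => abs_nonneg _) (Finset.mem_univ j)
    refine (e1.trans e2).trans ?_
    have e3 := (R.frame h1).sX_nonneg q.α q.t q.ht q.x
    have e4 := mul_nonneg ((R.frame h1).δ_pos q.α).le ((R.frame h1).w_nonneg q.α q.t q.ht q.x)
    change (R.frame h1).sDX q.α q.t q.x ≤ _
    unfold Frame.r1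
    linarith

lemma good_P : (R.frame h1).Good (fun α => α.V.P) fun _ => R.W.P := good_vars hC h1 hU none

lemma good_u (j : Fin 3) : (R.frame h1).Good (fun α t x => α.V.u t x j)
    fun _ t x => R.W.u t x j := good_vars hC h1 hU (some (some j))

lemma good_S : (R.frame h1).Good (fun α => α.V.S α.c) fun _ => R.W.η :=
  good_vars hC h1 hU (some none)

omit hC hU in
lemma P_mem (q : (R.frame h1).Pt) : q.α.V.P q.t q.x ∈ Icc (R.m / 2) R.M ∧
    R.W.P q.t q.x ∈ Icc (R.m / 2) R.M := by
  have := R.m_pos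
  exact ⟨⟨q.α.P_ge q.t q.ht q.x, (le_abs_self _).trans (q.α.rel.vars_le q.ht' none q.x)⟩,
    ⟨(by linarith : R.m / 2 ≤ R.m).trans (R.P_ge q.t q.ht' q.x),
      (le_abs_self _).trans (R.W_vars_le q.ht' none q.x)⟩⟩

/-- The sum `log P + S`, a function of the temperature alone. -/
lemma good_y : (R.frame h1).Good (fun α t x => log (α.V.P t x) + α.V.S α.c t x)
    fun _ t x => log (R.W.P t x) + R.W.η t x := by
  refine ((good_P hC h1 hU).comp isOpen_Ioi Fluid.contDiffOn_log_Ioi (a := R.m / 2) (b := R.M)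
    (fun y hy => (half_pos R.m_pos).trans_le hy.1)
    (fun α t ht x => Fluid.P_pos α.rel.sol.1 ht x) (fun _ t ht x => Fluid.P_pos R.sol.1 ht x)
    (fun q => (P_mem h1 q).1) (fun q => (P_mem h1 q).2)).add (good_S hC h1 hU)

lemma pd_y_eq (α : R.Adm c₁) (k : Dir) {t : ℝ} (ht : t ∈ Icc 0 R.T) (x : E3) :
    pd R.T k (fun t x => log (α.V.P t x) + α.V.S α.c t x) t x =
      cpfun ((α.c ^ 2)⁻¹ * α.V.θ t x) * pd R.T k (fun t x => log (α.V.θ t x)) t x := by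
  have hT := R.T_pos
  have hr := α.rel.sol.1
  have hε : ∀ t ∈ Icc 0 R.T, ∀ x, (α.c ^ 2)⁻¹ * α.V.θ t x ∈ Ioo 0 ε₀ :=
    fun _ ht x => α.rel.eps_mem h1 hU α.hc ht x
  have cθ := hr.2.2.2
  have cδθ := cθ.const_mul (α.c ^ 2)⁻¹
  have c1 : C1On R.T fun t x => psifun ((α.c ^ 2)⁻¹ * α.V.θ t x) := cδθ.comp hC.psi hε
  have cl := hr.c1On_log_theta
  have c2 := (cl.const_mul (5 / 2)).add c1
  rw [(c2.add (C1On.const (log (4 * π / 3)))).pd_congr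
      (fun t ht x => α.rel.state (α.c_pos h1) ht x) hT k ht,
    c2.pd_add (C1On.const _) hT k ht, (cl.const_mul (5 / 2)).pd_add c1 hT k ht,
    cl.pd_const_mul _ hT k ht, C1On.pd_const _ hT k ht,
    cδθ.pd_comp hC.psi hε hT k ht x (hasDerivAt_psifun (hε t ht x).1),
    cθ.pd_const_mul _ hT k ht, cθ.pd_comp Fluid.contDiffOn_log_Ioi
      (fun t ht x => (hr.1 t ht x).2) hT k ht x (hasDerivAt_log (hr.1 t ht x).2.ne')]
  have := α.c_pos h1
  field_simp
  ring

/-- The logarithm of the temperature. -/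
lemma good_log_theta : (R.frame h1).Good (fun α t x => log (α.V.θ t x))
    fun _ t x => log (R.W.θ t x) := by
  have hy := good_y hC h1 hU
  have hT := R.T_pos
  have hcp : ∀ q : (R.frame h1).Pt, (q.α.c ^ 2)⁻¹ * q.α.V.θ q.t q.x ∈ Ioo 0 ε₀ := fun q =>
    q.α.rel.eps_mem h1 hU q.α.hc q.ht' q.x
  have pdK : ∀ (k : Dir) (q : (R.frame h1).Pt),
      pd R.T k (fun t x => log (q.α.V.θ t x)) q.t q.x =
        (1 - alfun ((q.α.c ^ 2)⁻¹ * q.α.V.θ q.t q.x)) *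
          pd R.T k (fun t x => log (q.α.V.P t x) + q.α.V.S q.α.c t x) q.t q.x := fun k q => by
    have := hC.cp _ (hcp q)
    rw [pd_y_eq hC h1 hU q.α k q.ht' q.x, alfun, sub_sub_cancel, inv_mul_cancel_left₀]
    linarith
  have pdL : ∀ (k : Dir) (q : (R.frame h1).Pt),
      pd R.T k (fun t x => log (R.W.θ t x)) q.t q.x =
        2 / 5 * pd R.T k (fun t x => log (R.W.P t x) + R.W.η t x) q.t q.x := fun k q => by
    have cl := R.sol.1.c1On_log_theta
    have : ∀ t ∈ Icc 0 R.T, ∀ x, log (R.W.P t x) + R.W.η t x =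
        5 / 2 * log (R.W.θ t x) + (psifun 0 + log (4 * π / 3)) := fun t ht x => by
      rw [Fluid.log_theta_eq R.sol.1 ht x]; ring
    rw [((cl.const_mul (5 / 2)).add (C1On.const _)).pd_congr this hT k q.ht',
      (cl.const_mul (5 / 2)).pd_add (C1On.const _) hT k q.ht', cl.pd_const_mul _ hT k q.ht',
      C1On.pd_const _ hT k q.ht']
    ring
  have bcp : (fun q : (R.frame h1).Pt => 1 - alfun ((q.α.c ^ 2)⁻¹ * q.α.V.θ q.t q.x)) =O[⊤]
      fun _ => (1 : ℝ) := Frame.le_top 1 fun q => by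
    have h2 := hC.cp _ (hcp q)
    rw [alfun, sub_sub_cancel, abs_of_pos (by positivity)]
    simpa using inv_le_one_of_one_le₀ (by linarith : 1 ≤ cpfun ((q.α.c ^ 2)⁻¹ * q.α.V.θ q.t q.x))
  have hδθ : ∀ {ψ : ℝ → ℝ}, (∀ ε ∈ Ioo 0 ε₀, |ψ ε| ≤ C ∧ |deriv ψ ε| ≤ C ∧ |ψ ε - ψ 0| ≤ C * ε) →
      (fun q : (R.frame h1).Pt => ψ ((q.α.c ^ 2)⁻¹ * q.α.V.θ q.t q.x) - ψ 0) =O[⊤]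
        fun q => (R.frame h1).δ q.α := fun hψ => Frame.le_top (C * R.U) fun q => by
    refine (hψ _ (hcp q)).2.2.trans ?_
    have h2 : 0 < (q.α.c ^ 2)⁻¹ := (R.frame h1).δ_pos q.α
    change C * ((q.α.c ^ 2)⁻¹ * q.α.V.θ q.t q.x) ≤ C * R.U * |(q.α.c ^ 2)⁻¹|
    rw [abs_of_pos h2, mul_assoc, mul_comm R.U]
    exact mul_le_mul_of_nonneg_left (mul_le_mul_of_nonneg_left
      (q.α.rel.theta_le (q.α.c_pos h1) q.ht' q.x) h2.le) hC.C_nonneg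
  have hL1 : (Frame.ev (fun _ t x => log (R.W.θ t x)) : (R.frame h1).Pt → ℝ) =O[⊤]
      fun _ => (1 : ℝ) := by
    have h2 := (hy.L1.add (Frame.Good.const (Φ := R.frame h1)
      (-(psifun 0 + log (4 * π / 3)))).L1).const_mul_left (2 / 5)
    refine h2.congr_left fun q => ?_
    simp only [Frame.ev]
    rw [Fluid.log_theta_eq R.sol.1 q.ht' q.x]
    ring
  exact
  { cK := fun α => α.rel.sol.1.c1On_log_theta
    cL := fun _ => R.sol.1.c1On_log_theta
    L1 := hL1
    dL := fun j => ((hy.dL j).const_mul_left (2 / 5)).congr_left fun q => (pdL (some j) q).symm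
    dtK := by
      have h2 := bcp.mul hy.dtK
      simp only [one_mul] at h2
      exact h2.congr_left fun q => (pdK none q).symm
    diff := by
      have h2 := (hδθ hC.psi_le).trans Frame.delta_r0
      refine ((hy.diff.sub h2).const_mul_left (2 / 5)).congr_left fun q => ?_
      simp only [Frame.ev]
      rw [q.α.rel.state (q.α.c_pos h1) q.ht' q.x, Fluid.log_theta_eq R.sol.1 q.ht' q.x]
      ring
    ddiff := fun j => by
      have h2 := bcp.mul (hy.ddiff j)
      have h3 := (((hδθ hC.al_le).trans Frame.delta_r0).mul (hy.dL j)).trans Frame.r0_mul_w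
      simp only [one_mul] at h2
      refine (h2.sub h3).congr_left fun q => ?_
      simp only [Frame.ev]
      rw [pdK, pdL, alfun_zero]
      ring }

omit hC hU in
lemma Icc_of_good {K L : R.Adm c₁ → ℝ → E3 → ℝ} (h : (R.frame h1).Good K L) :
    ∃ a, ∀ q : (R.frame h1).Pt, K q.α q.t q.x ∈ Icc (-a) a ∧ L q.α q.t q.x ∈ Icc (-a) a := by
  obtain ⟨C1, b1⟩ := isBigO_top.1 h.K1
  obtain ⟨C2, b2⟩ := isBigO_top.1 h.L1
  refine ⟨max C1 C2, fun q => ⟨abs_le.1 ?_, abs_le.1 ?_⟩⟩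
  · have := b1 q
    simp only [norm_one, mul_one] at this
    exact this.trans (le_max_left _ _)
  · have := b2 q
    simp only [norm_one, mul_one] at this
    exact this.trans (le_max_right _ _)

lemma good_exp_log_theta (s : ℝ) : (R.frame h1).Good
    (fun α t x => exp (s * log (α.V.θ t x)))
    fun _ t x => exp (s * log (R.W.θ t x)) := by
  have h := (Frame.Good.const (Φ := R.frame h1) s).mul (good_log_theta hC h1 hU)
  obtain ⟨a, ha⟩ := Icc_of_good h1 h
  exact h.comp isOpen_univ contDiff_exp.contDiffOn (subset_univ _)
    (fun _ _ _ _ => mem_univ _) (fun _ _ _ _ => mem_univ _) (fun q => (ha q).1)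
    fun q => (ha q).2

omit hC hU in
lemma congr_good {K L K' L' : R.Adm c₁ → ℝ → E3 → ℝ} (h : (R.frame h1).Good K L)
    (hK : ∀ α, ∀ t ∈ Icc 0 R.T, ∀ x, K' α t x = K α t x)
    (hL : ∀ α, ∀ t ∈ Icc 0 R.T, ∀ x, L' α t x = L α t x) : (R.frame h1).Good K' L' where
  cK α := (h.cK α).congr (hK α)
  cL α := (h.cL α).congr (hL α)
  L1 := h.L1.congr_left fun q => (hL q.α q.t q.ht' q.x).symm
  dL j := (h.dL j).congr_left fun q =>
    ((h.cL q.α).pd_congr (hL q.α) R.T_pos (some j) q.ht' q.x).symm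
  dtK := h.dtK.congr_left fun q => ((h.cK q.α).pd_congr (hK q.α) R.T_pos none q.ht' q.x).symm
  diff := h.diff.congr_left fun q => by
    simp only [Frame.ev]; rw [hK q.α q.t q.ht', hL q.α q.t q.ht']
  ddiff j := (h.ddiff j).congr_left fun q => by
    simp only [Frame.ev]
    rw [(h.cK q.α).pd_congr (hK q.α) R.T_pos (some j) q.ht' q.x,
      (h.cL q.α).pd_congr (hL q.α) R.T_pos (some j) q.ht' q.x]

lemma good_theta : (R.frame h1).Good (fun α => α.V.θ) fun _ => R.W.θ :=
  congr_good h1 (good_exp_log_theta hC h1 hU 1)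
    (fun α t ht x => by rw [one_mul, exp_log (α.rel.sol.1.1 t ht x).2])
    fun _ t ht x => by rw [one_mul, exp_log (R.sol.1.1 t ht x).2]

lemma good_theta_inv : (R.frame h1).Good (fun α t x => (α.V.θ t x)⁻¹)
    fun _ t x => (R.W.θ t x)⁻¹ :=
  congr_good h1 (good_exp_log_theta hC h1 hU (-1))
    (fun α t ht x => by rw [neg_one_mul, exp_neg, exp_log (α.rel.sol.1.1 t ht x).2])
    fun _ t ht x => by rw [neg_one_mul, exp_neg, exp_log (R.sol.1.1 t ht x).2]

lemma good_P_inv : (R.frame h1).Good (fun α t x => (α.V.P t x)⁻¹) fun _ t x => (R.W.P t x)⁻¹ :=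
  (good_P hC h1 hU).inv (half_pos R.m_pos) (fun α _ ht x => Fluid.P_pos α.rel.sol.1 ht x)
    (fun _ _ ht x => Fluid.P_pos R.sol.1 ht x) (fun q => (P_mem h1 q).1.1)
    fun q => (P_mem h1 q).2.1

lemma good_vel (k : Dir) : (R.frame h1).Good (fun α => α.V.vel (α.c ^ 2)⁻¹ k)
    fun _ => R.W.vel 0 k := by
  cases k with
  | some i => exact good_u hC h1 hU i
  | none =>
    have h := (Frame.Good.const (Φ := R.frame h1) 1).add ((Frame.Good.delta (Φ := R.frame h1)).mul
      (Frame.Good.sum (s := Finset.univ) fun j _ => (good_u hC h1 hU j).mul (good_u hC h1 hU j)))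
    obtain ⟨a, ha⟩ := Icc_of_good h1 h
    have hp : ∀ (α : R.Adm c₁) t x, 1 ≤ 1 + (α.c ^ 2)⁻¹ * ∑ j, α.V.u t x j * α.V.u t x j :=
      fun α t x => Fluid.one_le_vel_radicand ((R.frame h1).δ_pos α).le t x
    have hp0 : ∀ t x, 1 ≤ 1 + 0 * ∑ j, R.W.u t x j * R.W.u t x j :=
      fun t x => Fluid.one_le_vel_radicand le_rfl t x
    exact h.comp (G := sqrt) (s := Ioi 0) isOpen_Ioi
      (contDiffOn_id.sqrt fun y hy => (ne_of_gt hy : y ≠ 0)) (a := 1) (b := a)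
      (fun y hy => zero_lt_one.trans_le hy.1) (fun α t _ x => zero_lt_one.trans_le (hp α t x))
      (fun _ t _ x => zero_lt_one.trans_le (hp0 t x)) (fun q => ⟨hp _ _ _, (ha q).1.2⟩)
      fun q => ⟨hp0 _ _, (ha q).2.2⟩

lemma good_vel_inv : (R.frame h1).Good (fun α t x => (α.V.vel (α.c ^ 2)⁻¹ none t x)⁻¹)
    fun _ t x => (R.W.vel 0 none t x)⁻¹ := by
  have hp : ∀ (α : R.Adm c₁) t x, 1 ≤ α.V.vel (α.c ^ 2)⁻¹ none t x :=
    fun α t x => Fluid.one_le_vel_none ((R.frame h1).δ_pos α).le t x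
  have hp0 : ∀ t x, 1 ≤ R.W.vel 0 none t x := fun t x => Fluid.one_le_vel_none le_rfl t x
  exact (good_vel hC h1 hU none).inv one_pos (fun α t _ x => zero_lt_one.trans_le (hp α t x))
    (fun _ t _ x => zero_lt_one.trans_le (hp0 t x)) (fun q => hp _ _ _) fun q => hp0 _ _

lemma good_symCoef (k : Dir) (a b : Idx) :
    (R.frame h1).Good (fun α => α.V.symCoef (α.c ^ 2)⁻¹ k a b) fun _ => R.W.symCoef 0 k a b := by
  have h0 : (R.frame h1).Good (fun _ _ _ => 0) fun _ _ _ => 0 := Frame.Good.const 0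
  have hd : (R.frame h1).Good (fun α _ _ => (α.c ^ 2)⁻¹) fun _ _ _ => 0 := Frame.Good.delta
  have hε : ∀ (α : R.Adm c₁), ∀ t ∈ Icc 0 R.T, ∀ x,
      (R.frame h1).δ α * α.V.θ t x ∈ Ioo 0 ε₀ := fun α t ht x => α.rel.eps_mem h1 hU α.hc ht x
  have hcross : ∀ j, (R.frame h1).Good (fun α => α.V.crossCoef (α.c ^ 2)⁻¹ j k)
      fun _ => R.W.crossCoef 0 j k := fun j => by
    cases k with
    | none => exact (hd.mul (good_u hC h1 hU j)).mul (good_vel_inv hC h1 hU)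
    | some i => exact Frame.Good.const _
  rcases a with _ | _ | j <;> rcases b with _ | _ | l
  · exact (((good_theta hC h1 hU).tame hC.al hC.al_le hε).mul (good_P_inv hC h1 hU)).mul
      (good_vel hC h1 hU k)
  · exact h0
  · exact hcross l
  · exact h0
  · exact good_vel hC h1 hU k
  · exact h0
  · exact hcross j
  · exact h0
  · exact ((((good_P hC h1 hU).mul ((good_theta hC h1 hU).tame hC.m hC.m_le hε)).mul
      (good_theta_inv hC h1 hU)).mul (good_vel hC h1 hU k)).mul
      ((Frame.Good.const (if j = l then 1 else 0)).sub ((hd.mul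
        ((good_u hC h1 hU j).mul (good_u hC h1 hU l))).mul
          ((good_vel_inv hC h1 hU).mul (good_vel_inv hC h1 hU))))

lemma good_clCoef (i : Fin 3) (a b : Idx) :
    (R.frame h1).Good (fun α => α.V.clCoef i a b) fun _ => R.W.clCoef i a b := by
  have h0 : (R.frame h1).Good (fun _ _ _ => 0) fun _ _ _ => 0 := Frame.Good.const 0
  have hu := (good_u hC h1 hU i).neg
  rcases a with _ | _ | j <;> rcases b with _ | _ | l
  · exact hu
  · exact h0
  · exact ((Frame.Good.const (-(5 / 3))).mul (good_P hC h1 hU)).ite h0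
  · exact h0
  · exact hu
  · exact h0
  · exact ((good_theta hC h1 hU).mul (good_P_inv hC h1 hU)).neg.ite h0
  · exact h0
  · exact hu.ite h0

end good
end RefSol

/-! ### Small coefficients and coercivity -/

namespace Frame

variable {A : Type} {T : ℝ} {Φ : Frame A T}

variable (Φ) in
/-- A family of coefficients that is small, with small spatial gradient. -/
structure Small (f : A → ℝ → E3 → ℝ) : Prop where
  c1 : ∀ α, C1On T (f α)
  le : (ev f : Φ.Pt → ℝ) =O[⊤] (r0 : Φ.Pt → ℝ)
  dle : ∀ j, (ev (fun α => pd T (some j) (f α)) : Φ.Pt → ℝ) =O[⊤] (r1 : Φ.Pt → ℝ)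

lemma Good.small {K L : A → ℝ → E3 → ℝ} (h : Φ.Good K L) :
    Φ.Small fun α t x => K α t x - L α t x where
  c1 α := (h.cK α).sub (h.cL α)
  le := h.diff
  dle j := (h.ddiff j).congr_left fun q =>
    ((h.cK q.α).pd_sub (h.cL q.α) Φ.T_pos (some j) q.ht' q.x).symm

namespace Small

variable {f g K L : A → ℝ → E3 → ℝ}

lemma add (hf : Φ.Small f) (hg : Φ.Small g) : Φ.Small fun α t x => f α t x + g α t x where
  c1 α := (hf.c1 α).add (hg.c1 α)
  le := hf.le.add hg.le
  dle j := ((hf.dle j).add (hg.dle j)).congr_left fun q =>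
    ((hf.c1 q.α).pd_add (hg.c1 q.α) Φ.T_pos (some j) q.ht' q.x).symm

lemma mul_ref (hf : Φ.Small f) (h : Φ.Good K L) : Φ.Small fun α t x => f α t x * L α t x where
  c1 α := (hf.c1 α).mul (h.cL α)
  le := by
    have h1 := hf.le.mul h.L1
    simp only [mul_one] at h1
    exact h1
  dle j := by
    have h1 := (hf.dle j).mul h.L1
    have h2 := (hf.le.mul (h.dL j)).trans r0_mul_w
    simp only [mul_one] at h1
    exact (h1.add h2).congr_left fun q =>
      ((hf.c1 q.α).pd_mul (h.cL q.α) Φ.T_pos (some j) q.ht' q.x).symm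

lemma neg (hf : Φ.Small f) : Φ.Small fun α t x => -f α t x := by
  have := hf.mul_ref (Good.const (-1))
  simpa using this

lemma zero : Φ.Small fun _ _ _ => 0 where
  c1 _ := C1On.const 0
  le := le_top 0 fun q => by simp [ev]
  dle j := le_top 0 fun q => by
    simp [ev, C1On.pd_const 0 Φ.T_pos (some j) q.ht' q.x]

lemma sum {β : Type*} {s : Finset β} {F : β → A → ℝ → E3 → ℝ} (h : ∀ b ∈ s, Φ.Small (F b)) :
    Φ.Small fun α t x => ∑ b ∈ s, F b α t x := by
  classical
  induction s using Finset.induction_on with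
  | empty => simpa using zero
  | insert b s hb ih =>
    simp only [Finset.sum_insert hb]
    exact (h b (Finset.mem_insert_self b s)).add
      (ih fun b' hb' => h b' (Finset.mem_insert_of_mem hb'))

end Small

/-- A common constant for finitely many bounds. -/
lemma exists_common_bound {β X : Type*} [Fintype β] {f : β → X → ℝ} {g : X → ℝ}
    (h : ∀ b, f b =O[⊤] g) : ∃ C, 0 ≤ C ∧ ∀ b x, |f b x| ≤ C * |g x| := by
  choose D hD using fun b => isBigO_top.1 (h b)
  refine ⟨∑ b, |D b|, sum_nonneg fun _ _ => abs_nonneg _, fun b x => ?_⟩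
  refine (hD b x).trans (mul_le_mul_of_nonneg_right ?_ (abs_nonneg _))
  exact (le_abs_self _).trans (single_le_sum (f := fun b => |D b|)
    (fun _ _ => abs_nonneg _) (Finset.mem_univ b))

end Frame

namespace Fluid

lemma abs_coupling_le {δ D U2 W2 μ r : ℝ} (hCS : D ^ 2 ≤ U2 * W2) (hμ : δ ^ 2 * U2 ≤ μ ^ 2)
    (hW0 : 0 ≤ W2) (hr : r ≤ 1) (hr0 : 0 ≤ r) (hμ0 : 0 ≤ μ) (p : ℝ) :
    |2 * (δ * r * p * D)| ≤ μ * (p ^ 2 + W2) := by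
  refine abs_le_of_sq_le_sq ?_ (by positivity)
  have k2 : (δ * D) ^ 2 ≤ μ ^ 2 * W2 := by
    have := mul_le_mul_of_nonneg_left hCS (sq_nonneg δ)
    have := mul_le_mul_of_nonneg_right hμ hW0
    linarith [mul_pow δ D 2]
  have k3 : r ^ 2 ≤ 1 := pow_le_one₀ hr0 hr
  have k5 : r ^ 2 * (4 * p ^ 2 * (δ * D) ^ 2) ≤ 1 * (4 * p ^ 2 * (δ * D) ^ 2) :=
    mul_le_mul_of_nonneg_right k3 (by positivity)
  have k6 : 4 * p ^ 2 * (δ * D) ^ 2 ≤ 4 * p ^ 2 * (μ ^ 2 * W2) :=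
    mul_le_mul_of_nonneg_left k2 (by positivity)
  linarith [sq_nonneg (μ * (p ^ 2 - W2))]

/-- For small `δ` the coefficient of the time derivative is positive definite. -/
lemma symCoef_coercive {V : Fluid} {δ a₀ b₀ μ : ℝ} {t : ℝ} {x : E3} (hδ : 0 ≤ δ)
    (hb₀ : 0 ≤ b₀) (hμ0 : 0 ≤ μ)
    (ha : a₀ ≤ alfun (δ * V.θ t x) * (V.P t x)⁻¹) (ha₀ : 0 ≤ a₀)
    (hb : b₀ ≤ V.P t x * mfun (δ * V.θ t x) * (V.θ t x)⁻¹)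
    (hμ : δ ^ 2 * ∑ j, V.u t x j * V.u t x j ≤ μ ^ 2) (hu : δ * ∑ j, V.u t x j * V.u t x j ≤ 3)
    (ha' : 2 * μ ≤ a₀) (hb' : 4 * μ ≤ b₀) (v : Idx → ℝ) :
    min 1 (min (a₀ / 2) (b₀ / 4)) * ∑ a, v a ^ 2 ≤
      ∑ a, ∑ b, symCoef δ V none a b t x * v a * v b := by
  set e := V.vel δ none t x with he
  have he1 : 1 ≤ e := one_le_vel_none hδ t x
  have hee : e * e = 1 + δ * ∑ j, V.u t x j * V.u t x j := vel_none_mul_self hδ t x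
  set U2 := ∑ j, V.u t x j * V.u t x j with hU2
  set p := v none
  set s := v (some none)
  set w : Fin 3 → ℝ := fun j => v (some (some j)) with hw
  set W2 := ∑ j, w j ^ 2 with hW2
  set D := ∑ j, V.u t x j * w j with hD
  set aa := alfun (δ * V.θ t x) * (V.P t x)⁻¹
  set bb := V.P t x * mfun (δ * V.θ t x) * (V.θ t x)⁻¹
  have hCS : D ^ 2 ≤ U2 * W2 := by
    have := Finset.sum_mul_sq_le_sq_mul_sq Finset.univ (fun j => V.u t x j) w
    simp only [← sq (V.u t x _)] at hU2
    rw [hU2]; exact this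
  have hW0 : 0 ≤ W2 := sum_nonneg fun j _ => sq_nonneg _
  have hform : ∑ a, ∑ b, symCoef δ V none a b t x * v a * v b =
      aa * e * p ^ 2 + 2 * (δ * e⁻¹ * p * D) + bb * e * (W2 - δ * D ^ 2 * (e⁻¹ * e⁻¹)) +
        e * s ^ 2 := by
    simp only [sum_option, symCoef, crossCoef, Fin.sum_univ_three, hW2, hD, hw]
    simp
    ring
  have hsum : ∑ a, v a ^ 2 = p ^ 2 + s ^ 2 + W2 := by
    simp only [sum_option, hW2, hw]; ring
  rw [hform, hsum]
  have he0 : 0 < e := by linarith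
  have he2 : e ≤ 2 := by nlinarith
  have hinv : e⁻¹ ≤ 1 := inv_le_one_of_one_le₀ he1
  have hinv2 : 1 / 2 ≤ e⁻¹ := by
    rw [one_div]; exact inv_anti₀ he0 he2
  have hi : e * e⁻¹ = 1 := mul_inv_cancel₀ he0.ne'
  -- the velocity block
  have h1 : W2 * (e⁻¹ * e⁻¹) ≤ W2 - δ * D ^ 2 * (e⁻¹ * e⁻¹) := by
    have h2 : δ * D ^ 2 ≤ (e * e - 1) * W2 := by
      nlinarith [mul_le_mul_of_nonneg_left hCS hδ]
    have h3 := mul_le_mul_of_nonneg_right h2 (show 0 ≤ e⁻¹ * e⁻¹ by positivity)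
    have h4 : (e * e - 1) * W2 * (e⁻¹ * e⁻¹) = W2 - W2 * (e⁻¹ * e⁻¹) := by
      linear_combination W2 * (e * e⁻¹ + 1) * hi
    linarith
  have h2 : b₀ / 2 * W2 ≤ bb * e * (W2 - δ * D ^ 2 * (e⁻¹ * e⁻¹)) := by
    have h3 : b₀ * (W2 * e⁻¹) ≤ bb * (W2 * e⁻¹) :=
      mul_le_mul_of_nonneg_right hb (by positivity)
    have h4 : bb * e * (W2 * (e⁻¹ * e⁻¹)) = bb * (W2 * e⁻¹) := by
      linear_combination bb * W2 * e⁻¹ * hi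
    have h5 := mul_le_mul_of_nonneg_left h1 (show 0 ≤ bb * e from
      mul_nonneg (hb₀.trans hb) he0.le)
    have h6 : b₀ * (W2 * (1 / 2)) ≤ b₀ * (W2 * e⁻¹) := by gcongr
    linarith
  -- the coupling term
  have h3 := abs_coupling_le hCS hμ hW0 hinv (by positivity) hμ0 p
  have h4 := (abs_le.1 h3).1
  have h5 : a₀ * p ^ 2 ≤ aa * e * p ^ 2 := by
    refine mul_le_mul_of_nonneg_right ?_ (sq_nonneg p)
    nlinarith
  have m1 : min 1 (min (a₀ / 2) (b₀ / 4)) * p ^ 2 ≤ a₀ / 2 * p ^ 2 :=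
    mul_le_mul_of_nonneg_right ((min_le_right _ _).trans (min_le_left _ _)) (sq_nonneg p)
  have m2 : min 1 (min (a₀ / 2) (b₀ / 4)) * s ^ 2 ≤ 1 * s ^ 2 :=
    mul_le_mul_of_nonneg_right (min_le_left _ _) (sq_nonneg s)
  have m3 : min 1 (min (a₀ / 2) (b₀ / 4)) * W2 ≤ b₀ / 4 * W2 :=
    mul_le_mul_of_nonneg_right ((min_le_right _ _).trans (min_le_right _ _)) hW0
  have m4 : 1 * s ^ 2 ≤ e * s ^ 2 := by gcongr
  have m5 : μ * p ^ 2 ≤ a₀ / 2 * p ^ 2 := by gcongr; linarith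
  have m6 : μ * W2 ≤ b₀ / 4 * W2 := by gcongr; linarith
  linarith

end Fluid

/-! ### The system for the difference of the solutions -/

namespace RefSol

variable {R : RefSol} {ε₀ C c₁ : ℝ}

/-- The difference of the unknowns of the relativistic and the classical solution. -/
def Adm.X (α : R.Adm c₁) (b : Idx) (t : ℝ) (x : E3) : ℝ :=
  α.vars b t x - R.vars b t x

/-- The coefficients of the gradient of the classical solution in the system for `X`. -/
def Adm.N (α : R.Adm c₁) (i : Fin 3) (a b : Idx) (t : ℝ) (x : E3) : ℝ :=
  -((∑ b' : Idx, (α.V.symCoef (α.c ^ 2)⁻¹ none a b' t x - R.W.symCoef 0 none a b' t x) *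
      R.W.clCoef i b' b t x) +
    (α.V.symCoef (α.c ^ 2)⁻¹ (some i) a b t x - R.W.symCoef 0 (some i) a b t x))

lemma Adm.ht' (α : R.Adm c₁) {t : ℝ} (ht : t ∈ Icc 0 α.T1) : t ∈ Icc 0 R.T :=
  ⟨ht.1, ht.2.trans α.T1_le⟩

lemma Adm.exists_spectrum_X (α : R.Adm c₁) {t : ℝ} (ht : t ∈ Icc 0 α.T1) (b : Idx) :
    ∃ φ, HasSpectrum (α.X b t) φ (4 * R.B) := by
  obtain ⟨φ, h⟩ := α.rel.spec t (α.ht' ht) b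
  obtain ⟨ψ, h'⟩ := R.spec t (α.ht' ht) b
  refine ⟨_, (h.sub h' R.B_nonneg R.B_nonneg).meas, ?_, ?_, fun x => ?_⟩
  · exact (h.sub h' R.B_nonneg R.B_nonneg).int
  · refine (h.sub h' R.B_nonneg R.B_nonneg).le.trans (le_of_eq ?_); ring
  · rw [← (h.sub h' R.B_nonneg R.B_nonneg).eq x]
    simp only [Adm.X, sub_sub_sub_cancel_right]

/-- The lower bound in the coercivity of the system. -/
def lam₀ (R : RefSol) : ℝ :=
  min 1 (min (1 / (2 * R.M) / 2) (R.m / 2 / R.U / 4))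

lemma lam₀_pos (R : RefSol) : 0 < R.lam₀ := by
  have := R.one_le_M
  have := R.m_pos
  have : 0 < R.U := exp_pos _
  unfold lam₀
  positivity

/-- The light speed is large enough for the relativistic equations to be symmetric hyperbolic. -/
structure Large (R : RefSol) (ε₀ c₁ : ℝ) : Prop where
  one_le : 1 ≤ c₁
  U_lt : R.U / c₁ ^ 2 < ε₀
  M_le : (c₁ ^ 2)⁻¹ * (3 * R.M ^ 2) ≤ min 3 (R.lam₀ ^ 2)

lemma exists_large (R : RefSol) (hε : 0 < ε₀) : ∃ c₁, R.Large ε₀ c₁ := by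
  have hpos : 0 < min 3 (R.lam₀ ^ 2) := lt_min (by norm_num) (pow_pos R.lam₀_pos 2)
  have hlim : Tendsto (fun c : ℝ => (c ^ 2)⁻¹) atTop (nhds 0) :=
    (tendsto_pow_atTop two_ne_zero).inv_tendsto_atTop
  have h1 : ∀ᶠ c : ℝ in atTop, R.U * (c ^ 2)⁻¹ < ε₀ :=
    (hlim.const_mul R.U).eventually_lt_const (by simpa using hε)
  have h2 : ∀ᶠ c : ℝ in atTop, (c ^ 2)⁻¹ * (3 * R.M ^ 2) < min 3 (R.lam₀ ^ 2) :=
    (hlim.mul_const _).eventually_lt_const (by simpa using! hpos)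
  obtain ⟨c, h1, h2, h3⟩ := (h1.and (h2.and (eventually_ge_atTop 1))).exists
  exact ⟨c, h3, h1, h2.le⟩

variable (hC : TameConst ε₀ C) (hL : R.Large ε₀ c₁)
include hC hL

lemma Adm.coercive (α : R.Adm c₁) {t : ℝ} (ht : t ∈ Icc 0 α.T1) (x : E3) (v : Idx → ℝ) :
    R.lam₀ * ∑ a, v a ^ 2 ≤
      ∑ a, ∑ b, α.V.symCoef (α.c ^ 2)⁻¹ none a b t x * v a * v b := by
  have hM := R.one_le_M
  have hm := R.m_pos
  have hU : 0 < R.U := exp_pos _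
  have hc := α.c_pos hL.one_le
  have hc1 : 0 < c₁ := zero_lt_one.trans_le hL.one_le
  have ht' := α.ht' ht
  have hε := α.rel.eps_mem hL.one_le hL.U_lt α.hc ht' x
  have hδ : (α.c ^ 2)⁻¹ ≤ (c₁ ^ 2)⁻¹ := inv_anti₀ (by positivity)
    (pow_le_pow_left₀ hc1.le α.hc 2)
  have hδ1 : (α.c ^ 2)⁻¹ ≤ 1 :=
    inv_le_one_of_one_le₀ (one_le_pow₀ (hL.one_le.trans α.hc))
  have hδ0 : 0 < (α.c ^ 2)⁻¹ := by positivity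
  have hθ := (α.rel.sol.1.1 t ht' x).2
  have hP : α.V.P t x ≤ R.M := (le_abs_self _).trans (α.rel.vars_le ht' none x)
  have hP0 := α.P_ge t ht x
  have hPpos : 0 < α.V.P t x := by linarith
  have hu : ∑ j, α.V.u t x j * α.V.u t x j ≤ 3 * R.M ^ 2 := by
    have : ∀ j ∈ (Finset.univ : Finset (Fin 3)), α.V.u t x j * α.V.u t x j ≤ R.M ^ 2 :=
      fun j _ => by
        rw [← sq]
        exact sq_le_sq.2 ((α.rel.vars_le ht' (some (some j)) x).trans (le_abs_self _))
    refine (sum_le_sum this).trans (le_of_eq ?_)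
    simp
  have hsmall : (α.c ^ 2)⁻¹ * ∑ j, α.V.u t x j * α.V.u t x j ≤ min 3 (R.lam₀ ^ 2) :=
    (mul_le_mul hδ hu (sum_nonneg fun j _ => mul_self_nonneg _) (by positivity)).trans
      hL.M_le
  have hal : 1 / 2 ≤ alfun ((α.c ^ 2)⁻¹ * α.V.θ t x) := by
    have h2 := inv_anti₀ two_pos (hC.cp _ hε)
    unfold alfun; linarith
  have hmf : 1 ≤ mfun ((α.c ^ 2)⁻¹ * α.V.θ t x) := by
    have := mul_nonneg hε.1.le (jfun_pos hε.1.le).le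
    unfold mfun; linarith
  have hl1 : R.lam₀ ≤ 1 / (2 * R.M) / 2 := (min_le_right _ _).trans (min_le_left _ _)
  have hl2 : R.lam₀ ≤ R.m / 2 / R.U / 4 := (min_le_right _ _).trans (min_le_right _ _)
  refine Fluid.symCoef_coercive hδ0.le (by positivity) R.lam₀_pos.le ?_ (by positivity) ?_ ?_ ?_ ?_
    ?_ v
  · rw [show 1 / (2 * R.M) = 1 / 2 * R.M⁻¹ by rw [one_div, mul_inv, one_div]]
    exact mul_le_mul hal (inv_anti₀ hPpos hP) (by positivity) (by linarith)
  · refine mul_le_mul ?_ (inv_anti₀ hθ (α.rel.theta_le hc ht' x)) (by positivity) (by positivity)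
    calc R.m / 2 ≤ α.V.P t x * 1 := by rw [mul_one]; exact hP0
      _ ≤ _ := by gcongr
  · rw [sq, mul_assoc]
    refine (mul_le_of_le_one_left ?_ hδ1).trans (hsmall.trans (min_le_right _ _))
    exact mul_nonneg hδ0.le (sum_nonneg fun j _ => mul_self_nonneg _)
  · exact hsmall.trans (min_le_left _ _)
  · linarith
  · linarith

lemma Adm.small_N (i : Fin 3) (a b : Idx) :
    (R.frame hL.one_le).Small fun α => α.N i a b := by
  have hK := fun k b => (good_symCoef hC hL.one_le hL.U_lt k a b).small
  exact ((Frame.Small.sum (s := Finset.univ) fun b' _ =>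
    (hK none b').mul_ref (good_clCoef hC hL.one_le hL.U_lt i b' b)).add (hK (some i) b)).neg

lemma Adm.eqn (α : R.Adm c₁) {t : ℝ} (ht : t ∈ Icc 0 R.T) (a : Idx) (x : E3) :
    ∑ k, ∑ b, α.V.symCoef (α.c ^ 2)⁻¹ k a b t x * pd R.T k (α.X b) t x =
      ∑ i, ∑ b, α.N i a b t x * pd R.T (some i) (R.vars b) t x := by
  have e1 := α.rel.sol.symmetric (α.c_pos hL.one_le) R.T_pos rfl
    (fun _ ht x => α.rel.eps_mem hL.one_le hL.U_lt α.hc ht x) hC.m hC.psi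
    (fun ε hε => two_pos.trans_le (hC.cp ε hε)) ht x a
  have e2 := R.sol.symmetric R.T_pos ht x a
  have hX : ∀ k b, pd R.T k (α.X b) t x = pd R.T k (α.vars b) t x -
      pd R.T k (R.vars b) t x := fun k b =>
    (α.c1On_vars hC hL.one_le hL.U_lt b).pd_sub (R.W_c1On_vars b) R.T_pos k ht x
  have e3 : ∑ k, ∑ b, α.V.symCoef (α.c ^ 2)⁻¹ k a b t x * pd R.T k (α.X b) t x =
      -∑ k, ∑ b, (α.V.symCoef (α.c ^ 2)⁻¹ k a b t x - R.W.symCoef 0 k a b t x) *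
        pd R.T k (R.vars b) t x := by
    simp only [hX, mul_sub, sub_mul, sum_sub_distrib, e1, e2]
    ring
  rw [e3, sum_option]
  simp only [R.sol.dt_eq R.T_pos ht x, Adm.N, neg_mul, Finset.sum_neg_distrib, add_mul,
    sum_add_distrib, sum_mul, mul_sum]
  congr 2
  rw [sum_comm]
  refine sum_congr rfl fun i _ => ?_
  rw [sum_comm]
  ring_nf

/-- The differences of the unknowns solve perturbed systems with uniform constants. -/
lemma exists_perturbedSystem : ∃ D, ∀ α : R.Adm c₁, ∃ s : PerturbedSystem Idx R.T D R.lam₀,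
    s.T1 = α.T1 ∧ s.δ = (α.c ^ 2)⁻¹ ∧ s.X = α.X := by
  have h1 := hL.one_le
  have hg := fun p : Dir × Idx × Idx => good_symCoef hC h1 hL.U_lt p.1 p.2.1 p.2.2
  have hN := fun p : Fin 3 × Idx × Idx => Adm.small_N hC hL p.1 p.2.1 p.2.2
  obtain ⟨D1, hD1, b1⟩ := Frame.exists_common_bound fun p => (hg p).K1
  obtain ⟨D2, hD2, b2⟩ := Frame.exists_common_bound
    fun p : (Dir × Idx × Idx) × Fin 3 => (hg p.1).dK p.2
  obtain ⟨D3, hD3, b3⟩ := Frame.exists_common_bound fun p => (hg p).dtK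
  obtain ⟨D4, hD4, b4⟩ := Frame.exists_common_bound fun p => (hN p).le
  obtain ⟨D5, hD5, b5⟩ := Frame.exists_common_bound
    fun p : (Fin 3 × Idx × Idx) × Fin 3 => (hN p.1).dle p.2
  set E1 := 2 * R.M
  set E2 := (1 + 4 * π ^ 2) * (4 * R.B) ^ 2
  set E3' := 16 * π ^ 4 * R.B ^ 2
  set E4 := sobConst * E3'
  set E5 := (card (Fin 3) : ℝ) * ∑ _j : Fin 3,
    ((card Idx : ℝ) * ∑ _b : Idx, 4 * π ^ 2 * R.B ^ 2)
  have hM := R.one_le_M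
  have hE3 : 0 ≤ E3' := by positivity
  have hE4 : 0 ≤ E4 := mul_nonneg sobConst_nonneg hE3
  have hE5 : 0 ≤ E5 := by positivity
  set D := D1 + D2 + D3 + D4 + D5 + E1 + E2 + E3' + E4 + E5 with hD
  have hπ : 0 ≤ 4 * π ^ 2 * (4 * R.B) ^ 2 := by positivity
  have hB2 : (0 : ℝ) ≤ (4 * R.B) ^ 2 := by positivity
  have hWsq : ∀ t ∈ Icc 0 R.T, ∀ i b,
      SqB (pd R.T (some i) (R.vars b) t) (4 * π ^ 2 * R.B ^ 2) := fun t ht i b => by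
    obtain ⟨φ, h⟩ := R.spec t ht b
    exact h.sqB_dx ((R.W_c1On_vars b).contDiff ht) i
  refine ⟨D, fun α => ?_⟩
  have cX : ∀ b, C1On R.T (α.X b) := fun b =>
    (α.c1On_vars hC h1 hL.U_lt b).sub (R.W_c1On_vars b)
  have hX : ∀ k b, ∀ t ∈ Icc 0 R.T, ∀ x, pd R.T k (α.X b) t x =
      pd R.T k (α.vars b) t x - pd R.T k (R.vars b) t x :=
    fun k b t ht x => (α.c1On_vars hC h1 hL.U_lt b).pd_sub (R.W_c1On_vars b) R.T_pos k ht x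
  have hc := α.c_pos h1
  have hδ1 : (α.c ^ 2)⁻¹ ≤ 1 := inv_le_one_of_one_le₀ (one_le_pow₀ (h1.trans α.hc))
  refine ⟨{
    T1 := α.T1
    δ := (α.c ^ 2)⁻¹
    X := α.X
    K := fun k a b => α.V.symCoef (α.c ^ 2)⁻¹ k a b
    N := α.N
    g := fun i b => pd R.T (some i) (R.vars b)
    w := (R.frame h1).w α
    T1_le := α.T1_le
    δ_pos := by positivity
    δ_le := hδ1
    X_c1 := cX
    K_c1 := fun k a b => (hg (k, a, b)).cK α
    N_c1 := fun i a b => (hN (i, a, b)).c1 α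
    g_cont := fun i b t ht => (R.W_c1On_vars b).continuous_pd R.T_pos (some i) (α.ht' ht)
    symm := fun k a b t x => Fluid.symCoef_symm _ _ k a b t x
    coercive := fun t ht x v => α.coercive hC hL ht x v
    eqn := fun t ht a x => α.eqn hC hL (α.ht' ht) a x
    init := fun a x => by
      obtain ⟨g1, g2, g3⟩ := α.rel.data x
      rcases a with _ | _ | j <;> simp [Adm.X, Fluid.vars, g1, g2, g3]
    K_le := fun t ht k a b x => by
      have := b1 (k, a, b) ⟨α, t, ht, x⟩
      simp only [abs_one, mul_one] at this
      exact this.trans (by linarith)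
    dxK_le := fun t ht k a b j x => by
      have := b2 ((k, a, b), j) ⟨α, t, ht, x⟩
      simp only [abs_one, mul_one] at this
      exact this.trans (by linarith)
    dtK_le := fun t ht k a b x => by
      have h2 := b3 (k, a, b) ⟨α, t, ht, x⟩
      have h3 := (R.frame h1).one_le_sDt α t ht x
      refine h2.trans ?_
      simp only [Frame.ev]
      rw [abs_of_nonneg (by linarith)]
      refine (mul_le_mul_of_nonneg_right (by linarith : D3 ≤ D) (by linarith)).trans (le_of_eq ?_)
      congr 1
      change 1 + ∑ b, |pd R.T none (α.vars b) t x -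
        pd R.T none (R.vars b) t x| = 1 + ∑ b, |pd R.T none (α.X b) t x|
      simp only [hX none _ t (α.ht' ht) x]
    X_le := fun t ht a x => by
      have := abs_sub (α.vars a t x) (R.vars a t x)
      have := α.rel.vars_le (α.ht' ht) a x
      have := R.W_vars_le (α.ht' ht) a x
      have : |α.X a t x| ≤ E1 := by unfold Adm.X; linarith
      linarith
    dxX_le := fun t ht a j x => by
      have := hX (some j) a t (α.ht' ht) x
      change |pd R.T (some j) (α.X a) t x| ≤ D
      rw [this]
      have := abs_sub (pd R.T (some j) (α.vars a) t x)
        (pd R.T (some j) (R.vars a) t x)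
      have := α.rel.dx_le (α.ht' ht) a j x
      have := R.W_dx_le (α.ht' ht) a j x
      linarith
    X_sq := fun t ht a => by
      obtain ⟨φ, h⟩ := α.exists_spectrum_X ht a
      refine ⟨((cX a).continuous (α.ht' ht)).aestronglyMeasurable, h.integral_sq.1,
        h.integral_sq_le.trans ?_⟩
      linarith
    dxX_sq := fun t ht a j => by
      obtain ⟨φ, h⟩ := α.exists_spectrum_X ht a
      refine ⟨((cX a).continuous_pd R.T_pos (some j) (α.ht' ht)).aestronglyMeasurable,
        (h.integral_sq_dx j).1, (h.integral_sq_dx_le j).trans ?_⟩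
      linarith
    N_le := fun t ht i a b x => by
      have h2 := b4 (i, a, b) ⟨α, t, ht, x⟩
      have h3 := (R.frame h1).sX_nonneg α t ht x
      have h4 := (R.frame h1).δ_pos α
      refine h2.trans ?_
      simp only [Frame.r0]
      rw [abs_of_nonneg (by positivity)]
      exact mul_le_mul_of_nonneg_right (by linarith : D4 ≤ D) (by positivity)
    dxN_le := fun t ht i a b j x => by
      have h2 := b5 ((i, a, b), j) ⟨α, t, ht, x⟩
      have h3 := (R.frame h1).sX_nonneg α t ht x
      have h4 := (R.frame h1).δ_pos α
      have h5 := (R.frame h1).sDX_nonneg α t ht x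
      have h6 := (R.frame h1).w_nonneg α t ht x
      refine h2.trans ?_
      simp only [Frame.r1]
      rw [abs_of_nonneg (by positivity)]
      refine (mul_le_mul_of_nonneg_right (by linarith : D5 ≤ D) (by positivity)).trans
        (le_of_eq ?_)
      congr 3
      change ∑ j, ∑ b, |pd R.T (some j) (α.vars b) t x -
        pd R.T (some j) (R.vars b) t x| = ∑ j, ∑ b, |pd R.T (some j) (α.X b) t x|
      simp only [hX (some _) _ t (α.ht' ht) x]
    g_le := fun t ht i b x => (R.W_dx_le (α.ht' ht) b i x).trans (by linarith)
    g_sq := fun t ht i b => (hWsq t (α.ht' ht) i b).mono (by nlinarith)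
    dqg_sq := fun t ht i b j h hh => by
      obtain ⟨ψ, h'⟩ := R.spec t (α.ht' ht) b
      have h2 := h'.integral_sq_dq_dx_le i j hh
      simp only [fderiv_sub_const_eq] at h2
      exact ⟨(continuous_dq ((R.W_c1On_vars b).continuous_pd R.T_pos (some i) (α.ht' ht)) j
        h).aestronglyMeasurable, h2.1, h2.2.trans (by linarith)⟩
    mul_dqg_sq := fun t ht i a b j h hh => by
      obtain ⟨φ, hφ⟩ := α.exists_spectrum_X ht a
      obtain ⟨ψ, h'⟩ := R.spec t (α.ht' ht) b
      have h2 := hφ.integral_sq_mul_dq_dx_le h' i j hh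
      simp only [fderiv_sub_const_eq] at h2
      exact ⟨(((cX a).continuous (α.ht' ht)).mul (continuous_dq ((R.W_c1On_vars b).continuous_pd
        R.T_pos (some i) (α.ht' ht)) j h)).aestronglyMeasurable, h2.1, h2.2.trans
          (mul_le_mul_of_nonneg_right (by linarith) (sqH1_nonneg _ _))⟩
    w_sq := fun t ht => (SqB.sum fun j => SqB.sum fun b =>
      (hWsq t (α.ht' ht) j b).abs).mono (by linarith) }, rfl, rfl, rfl⟩

/-- The fluid variables of the relativistic and the classical solution differ by `O(c^{-3/2})`. -/
lemma exists_X_le : ∃ D, 0 ≤ D ∧ ∀ α : R.Adm c₁, ∀ t ∈ Icc 0 α.T1, ∀ b x,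
    |α.X b t x| ≤ D * α.c ^ (-(3 / 2) : ℝ) := by
  obtain ⟨D, hD⟩ := exists_perturbedSystem hC hL
  obtain ⟨K, hK0, hK⟩ := PerturbedSystem.stability (ι := Idx) (C := D) R.T_pos R.lam₀_pos
  refine ⟨√(K + (4 * R.B) ^ 2) * √(∫ ζ : E3, (‖ζ‖ ^ 2 + ‖ζ‖ ^ 6)⁻¹),
    by positivity, fun α t ht b x => ?_⟩
  obtain ⟨s, e1, e2, e3⟩ := hD α
  have hc := α.c_pos hL.one_le
  have hZ := hK s t (by rwa [e1])
  rw [e2] at hZ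
  obtain ⟨φ, h⟩ := α.exists_spectrum_X ht b
  have h1 : sqH1 (α.X b) t ≤ s.Z t := by
    unfold PerturbedSystem.Z
    rw [e3]
    exact single_le_sum (f := fun a => sqH1 (α.X a) t) (fun a _ => sqH1_nonneg _ _)
      (Finset.mem_univ b)
  refine (h.abs_le_interp (by positivity) (h1.trans hZ) x).trans (le_of_eq ?_)
  have : (α.c ^ 2)⁻¹ = α.c ^ (-2 : ℝ) := by
    norm_num
  rw [this, ← rpow_mul hc.le]
  norm_num

/-- Bounds for the states of the relativistic and the classical solution. -/
lemma exists_state_bounds : ∃ D, 0 < D ∧ ∀ α : R.Adm c₁, ∀ t ∈ Icc 0 α.T1, ∀ x,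
    |α.V.P t x - R.W.P t x| ≤ D * α.c ^ (-(3 / 2) : ℝ) ∧
    |α.V.θ t x - R.W.θ t x| ≤ D * α.c ^ (-(3 / 2) : ℝ) ∧
    (∀ j, |α.V.u t x j - R.W.u t x j| ≤ D * α.c ^ (-(3 / 2) : ℝ)) ∧
    (α.V.θ t x)⁻¹ ≤ D ∧ (R.W.θ t x)⁻¹ ≤ D := by
  obtain ⟨D1, hD1, h1⟩ := exists_X_le hC hL
  obtain ⟨D2, hD2, h2⟩ := Frame.exists_common_bound fun _ : Unit =>
    (good_theta hC hL.one_le hL.U_lt).diff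
  obtain ⟨D3, hD3, h3⟩ := Frame.exists_common_bound fun _ : Unit =>
    (good_theta_inv hC hL.one_le hL.U_lt).K1
  obtain ⟨D4, hD4, h4⟩ := Frame.exists_common_bound fun _ : Unit =>
    (good_theta_inv hC hL.one_le hL.U_lt).L1
  set D := D1 + D2 * ((∑ _b : Idx, D1) + 1) + D3 + D4 + 1 with hD
  have hs : 0 ≤ ∑ _b : Idx, D1 := sum_nonneg fun _ _ => hD1
  have hs2 := mul_nonneg hD2 (by linarith : 0 ≤ (∑ _b : Idx, D1) + 1)
  refine ⟨D, by positivity, fun α t ht x => ?_⟩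
  have hc := α.c_pos hL.one_le
  have hr : 0 ≤ α.c ^ (-(3 / 2) : ℝ) := (rpow_pos_of_pos hc _).le
  have hX : ∀ b, |α.X b t x| ≤ D * α.c ^ (-(3 / 2) : ℝ) := fun b =>
    (h1 α t ht b x).trans (by gcongr; linarith)
  refine ⟨hX none, ?_, fun j => hX (some (some j)), ?_, ?_⟩
  · refine (h2 () ⟨α, t, ht, x⟩).trans ?_
    have h5 := (R.frame hL.one_le).sX_nonneg α t ht x
    have h6 := (R.frame hL.one_le).δ_pos α
    have h7 : (R.frame hL.one_le).sX α t x ≤ (∑ _b : Idx, D1) * α.c ^ (-(3 / 2) : ℝ) := by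
      rw [sum_mul]
      change ∑ b, |α.X b t x| ≤ _
      exact sum_le_sum fun b _ => h1 α t ht b x
    have h8 : (R.frame hL.one_le).δ α ≤ 1 * α.c ^ (-(3 / 2) : ℝ) := by
      rw [one_mul]
      change (α.c ^ 2)⁻¹ ≤ _
      rw [← rpow_natCast, ← rpow_neg hc.le]
      exact rpow_le_rpow_of_exponent_le (hL.one_le.trans α.hc) (by norm_num)
    simp only [Frame.r0]
    rw [abs_of_nonneg (by positivity)]
    calc D2 * ((R.frame hL.one_le).sX α t x + (R.frame hL.one_le).δ α)
        ≤ D2 * (((∑ _b : Idx, D1) + 1) * α.c ^ (-(3 / 2) : ℝ)) := by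
          refine mul_le_mul_of_nonneg_left ?_ hD2
          rw [add_mul]; exact add_le_add h7 h8
      _ ≤ _ := by
          rw [← mul_assoc]; gcongr; linarith
  · have := h3 () ⟨α, t, ht, x⟩
    simp only [abs_one, mul_one] at this
    exact (le_abs_self _).trans (this.trans (by linarith))
  · have := h4 () ⟨α, t, ht, x⟩
    simp only [abs_one, mul_one] at this
    exact (le_abs_self _).trans (this.trans (by linarith))

end RefSol

/-! ### Global closeness of the two solutions -/

namespace SobolevPath

variable {N : ℕ} {T B : ℝ} {f : ℝ → E3 → ℝ}

lemma exists_spectrum (hN : 3 ≤ N) (h : SobolevPath N T B f) {t : ℝ} (ht : t ∈ Icc 0 T)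
    (hc : Continuous (f t)) {B' : ℝ} (hB : B ≤ B') : ∃ φ, HasSpectrum (f t) φ B' := by
  obtain ⟨⟨k, -, hk⟩, -⟩ := h
  obtain ⟨φ, hφ⟩ := (hk t ht).1.hasSpectrum hN hc
  exact ⟨φ, hφ.mono (norm_nonneg _) ((hk t ht).2.trans hB)⟩

/-- Continuity in time, uniformly in space. -/
lemma exists_delta (hN : 3 ≤ N) (h : SobolevPath N T B f) (hc : ∀ t ∈ Icc 0 T, Continuous (f t))
    {t : ℝ} (ht : t ∈ Icc 0 T) {ε : ℝ} (hε : 0 < ε) :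
    ∃ d > 0, ∀ s ∈ Icc 0 T, |s - t| < d → ∀ x, |f s x - f t x| ≤ ε := by
  obtain ⟨⟨k, hk1, hk⟩, -⟩ := h
  have he : 0 < embConst + 1 := by linarith [embConst_nonneg]
  obtain ⟨d, hd, H⟩ := Metric.continuousOn_iff.1 hk1 t ht (ε / (embConst + 1)) (by positivity)
  refine ⟨d, hd, fun s hs hst x => ?_⟩
  have h1 := H s hs (by rwa [dist_eq])
  obtain ⟨φ, hφ⟩ := ((hk s hs).1.sub (hk t ht).1).hasSpectrum hN ((hc s hs).sub (hc t ht))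
  refine (hφ.abs_le (norm_nonneg _) x).trans ?_
  rw [dist_eq_norm] at h1
  calc _ ≤ ε / (embConst + 1) * (embConst + 1) := mul_le_mul h1.le
        (sqrt_le_embConst.trans (by linarith)) (sqrt_nonneg _) (by positivity)
    _ = ε := div_mul_cancel₀ _ he.ne'

/-- A positive function converging to a positive constant at infinity is bounded below. -/
lemma exists_lower_bound (hN : 3 ≤ N) {Pbar : ℝ} (hP : 0 < Pbar)
    (h : SobolevPath N T B fun t x => f t x - Pbar) (hc : ∀ t ∈ Icc 0 T, Continuous (f t))
    (hpos : ∀ t ∈ Icc 0 T, ∀ x, 0 < f t x) : ∃ m > 0, ∀ t ∈ Icc 0 T, ∀ x, m ≤ f t x := by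
  have hc' : ∀ t ∈ Icc 0 T, Continuous fun x => f t x - Pbar := fun t ht =>
    (hc t ht).sub continuous_const
  have hfix : ∀ t ∈ Icc 0 T, ∃ m > 0, ∀ x, m ≤ f t x := fun t ht => by
    obtain ⟨φ, hφ⟩ := h.exists_spectrum hN ht (hc' t ht) le_rfl
    have h1 : ∀ᶠ x in cocompact E3, -(Pbar / 2) < f t x - Pbar :=
      hφ.tendsto_zero.eventually_const_lt (by linarith)
    obtain ⟨K, hK, hKs⟩ := mem_cocompact.1 h1
    rcases K.eq_empty_or_nonempty with rfl | hne
    · refine ⟨Pbar / 2, by linarith, fun x => ?_⟩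
      have : -(Pbar / 2) < f t x - Pbar := hKs (by simp)
      linarith
    · obtain ⟨y, -, hy⟩ := hK.exists_isMinOn hne (hc t ht).continuousOn
      refine ⟨min (f t y) (Pbar / 2), lt_min (hpos t ht y) (by linarith), fun x => ?_⟩
      by_cases hx : x ∈ K
      · exact (min_le_left _ _).trans (hy hx)
      · have : -(Pbar / 2) < f t x - Pbar := hKs hx
        exact (min_le_right _ _).trans (by linarith)
  refine isCompact_Icc.induction_on (p := fun s => ∃ m > 0, ∀ t ∈ s, t ∈ Icc 0 T → ∀ x, m ≤ f t x)
    ⟨1, one_pos, fun t ht => ht.elim⟩ (fun s s' hs ⟨m, hm, H⟩ => ⟨m, hm, fun t ht => H t (hs ht)⟩)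
    (fun s s' ⟨m, hm, H⟩ ⟨m', hm', H'⟩ => ⟨min m m', lt_min hm hm', fun t ht ht' x => ?_⟩)
    (fun t ht => ?_) |>.imp fun m hm => ⟨hm.1, fun t ht => hm.2 t ht ht⟩
  · rcases ht with ht | ht
    · exact (min_le_left _ _).trans (H t ht ht' x)
    · exact (min_le_right _ _).trans (H' t ht ht' x)
  · obtain ⟨m, hm, H⟩ := hfix t ht
    obtain ⟨d, hd, H'⟩ := h.exists_delta hN hc' ht (half_pos hm)
    refine ⟨Metric.ball t d, mem_nhdsWithin_of_mem_nhds (Metric.ball_mem_nhds t hd), m / 2,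
      half_pos hm, fun s hs hs' x => ?_⟩
    have h1 := (abs_le.1 (H' s hs' (by rwa [← dist_eq]) x)).1
    have := H x
    linarith

end SobolevPath

/-- States of the two fluids in a fixed compact set, at distance `O(c^{-3/2})`. -/
structure StateClose (D c n : ℝ) (u : E3) (θ ρ : ℝ) (v : E3) (θ' : ℝ) : Prop where
  n_pos : 0 < n
  θ_pos : 0 < θ
  ρ_pos : 0 < ρ
  θ'_pos : 0 < θ'
  n_le : n ≤ D
  ρ_le : ρ ≤ D
  θ_le : θ ≤ D
  θ'_le : θ' ≤ D
  θ_inv_le : θ⁻¹ ≤ D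
  θ'_inv_le : θ'⁻¹ ≤ D
  u_le : ‖u‖ ≤ D
  v_le : ‖v‖ ≤ D
  n_sub : |n - ρ| ≤ D * c ^ (-(3 / 2) : ℝ)
  u_sub : ‖u - v‖ ≤ D * c ^ (-(3 / 2) : ℝ)
  θ_sub : |θ - θ'| ≤ D * c ^ (-(3 / 2) : ℝ)

lemma norm_le_of_abs_le {v : E3} {a : ℝ} (h : ∀ j, |v j| ≤ a) : ‖v‖ ≤ 3 * a := by
  have ha : 0 ≤ a := (abs_nonneg _).trans (h 0)
  rw [EuclideanSpace.norm_eq]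
  refine sqrt_le_iff.2 ⟨by positivity, ?_⟩
  have : ∀ j ∈ (Finset.univ : Finset (Fin 3)), ‖v j‖ ^ 2 ≤ a ^ 2 := fun j _ =>
    pow_le_pow_left₀ (norm_nonneg _) (h j) 2
  refine (sum_le_sum this).trans ?_
  simp
  nlinarith

namespace RefSol

/-- The lower bound for the pressure of the relativistic fluid propagates over the whole time
interval, by continuous induction: as long as it holds the two pressures are close, so it holds
with room to spare. -/
lemma Rel.P_ge {R : RefSol} {c₁ c D : ℝ} {V : Fluid} (hV : R.Rel c V) (hc : c₁ ≤ c)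
    (hD : ∀ α : R.Adm c₁, ∀ t ∈ Icc 0 α.T1, ∀ x,
      |α.V.P t x - R.W.P t x| ≤ D * α.c ^ (-(3 / 2) : ℝ))
    (hm : D * c ^ (-(3 / 2) : ℝ) ≤ R.m / 4)
    (hd : ∀ t ∈ Icc 0 R.T, ∃ d > 0, ∀ s ∈ Icc 0 R.T, |s - t| < d → ∀ x,
      |V.P s x - V.P t x| ≤ R.m / 4) :
    ∀ t ∈ Icc 0 R.T, ∀ x, R.m / 2 ≤ V.P t x := by
  have hm0 := R.m_pos
  have key : ∀ t' ∈ Icc 0 R.T, (∀ t ∈ Icc 0 t', ∀ x, R.m / 2 ≤ V.P t x) →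
      ∀ t ∈ Icc 0 t', ∀ x, 3 * R.m / 4 ≤ V.P t x := fun t' ht' H t ht x => by
    have h1 := (abs_le.1 ((hD ⟨c, V, t', hc, hV, ht'.2, H⟩ t ht x).trans hm)).1
    have h2 := R.P_ge t ⟨ht.1, ht.2.trans ht'.2⟩ x
    linarith
  set s : Set ℝ := {t | ∀ τ ∈ Icc 0 R.T, ∀ x, 3 * R.m / 4 ≤ V.P (min τ t) x} with hs
  have hcont : ∀ x, ContinuousOn (fun t => V.P t x) (Icc 0 R.T) := fun x =>
    hV.sol.1.c1On_P.continuousOn.comp (by fun_prop : ContinuousOn (fun t : ℝ => (t, x)) _)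
      fun t ht => ⟨ht, mem_univ _⟩
  have hclosed : IsClosed (s ∩ Icc 0 R.T) := by
    have : s ∩ Icc 0 R.T = Icc 0 R.T ∩ ⋂ τ ∈ Icc 0 R.T, ⋂ x,
        (Icc 0 R.T ∩ (fun t => V.P (min τ t) x) ⁻¹' Ici (3 * R.m / 4)) := by
      ext t
      simp only [hs, mem_inter_iff, mem_iInter, mem_ofPred_eq, mem_preimage, mem_Ici]
      exact ⟨fun h => ⟨h.2, fun τ hτ x => ⟨h.2, h.1 τ hτ x⟩⟩,
        fun h => ⟨fun τ hτ x => (h.2 τ hτ x).2, h.1⟩⟩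
    rw [this]
    refine isClosed_Icc.inter (isClosed_biInter fun τ hτ => isClosed_iInter fun x => ?_)
    refine ContinuousOn.preimage_isClosed_of_isClosed ?_ isClosed_Icc isClosed_Ici
    exact (hcont x).comp (by fun_prop : ContinuousOn (fun t : ℝ => min τ t) _)
      fun t ht => ⟨le_min hτ.1 ht.1, (min_le_left _ _).trans hτ.2⟩
  have h0 : (0 : ℝ) ∈ s := fun τ hτ x => by
    rw [min_eq_right hτ.1, (hV.data x).1]
    exact (by linarith : 3 * R.m / 4 ≤ R.m).trans (R.P_ge 0 ⟨le_rfl, R.T_pos.le⟩ x)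
  have hsub := hclosed.Icc_subset_of_forall_exists_gt h0 fun t ht y hy => by
    have htT : t ∈ Icc 0 R.T := Ico_subset_Icc_self ht.2
    obtain ⟨d, hd0, H⟩ := hd t htT
    set t' := min (t + d / 2) (min y R.T) with ht'
    have hlt : t < t' := lt_min (by linarith) (lt_min hy ht.2.2)
    have ht'T : t' ∈ Icc 0 R.T := ⟨htT.1.trans hlt.le, (min_le_right _ _).trans (min_le_right _ _)⟩
    have hold : ∀ τ ∈ Icc 0 t, ∀ x, 3 * R.m / 4 ≤ V.P τ x := fun τ hτ x => by
      have := ht.1 τ ⟨hτ.1, hτ.2.trans htT.2⟩ x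
      rwa [min_eq_left hτ.2] at this
    refine ⟨t', fun τ hτ x => key t' ht'T (fun τ hτ x => ?_) (min τ t')
      ⟨le_min hτ.1 ht'T.1, min_le_right _ _⟩ x, hlt,
      (min_le_right _ _).trans (min_le_left _ _)⟩
    rcases le_total τ t with h | h
    · exact (by linarith : R.m / 2 ≤ 3 * R.m / 4).trans (hold τ ⟨hτ.1, h⟩ x)
    · have h1 : τ ≤ t + d / 2 := hτ.2.trans (min_le_left _ _)
      have h2 := (abs_le.1 (H τ ⟨hτ.1, hτ.2.trans ht'T.2⟩
        (by rw [abs_of_nonneg (by linarith)]; linarith) x)).1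
      have h3 := hold t ⟨htT.1, le_rfl⟩ x
      linarith
  intro t ht x
  have := hsub ht t ht x
  rw [min_self] at this
  linarith

end RefSol

open Fluid in
/-- Relativistic solutions with the same data stay close to the classical one. -/
lemma exists_stateClose {N : ℕ} (hN : 3 ≤ N) {T : ℝ} (hT : 0 < T) {Pbar Sbar : ℝ}
    (hP : 0 < Pbar) {W : Fluid} (hW : W.IsClEuler T) {B' : ℝ} (hWN : W.ClSobolev N T B' Pbar Sbar)
    (B : ℝ) : ∃ D ≥ 1, ∃ c₀ ≥ 1, ∀ c : ℝ, c₀ ≤ c → ∀ V : Fluid, V.IsRelEuler c T →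
      V.RelSobolev c N T B Pbar Sbar → V.SameData c W → ∀ t ∈ Icc 0 T, ∀ x,
        StateClose D c (V.n t x) (V.u t x) (V.θ t x) (W.n t x) (W.u t x) (W.θ t x) := by
  obtain ⟨ε₀, C, hC⟩ := exists_tameConst
  obtain ⟨m, hm, hPm⟩ := hWN.1.exists_lower_bound hN hP (fun t ht => hW.1.c1On_P.continuous ht)
    fun t ht x => P_pos hW.1 ht x
  set Bm := max (max B B') 0
  have hB1 : B ≤ Bm := (le_max_left _ _).trans (le_max_left _ _)
  have hB2 : B' ≤ Bm := (le_max_right _ _).trans (le_max_left _ _)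
  have spec : ∀ {V : Fluid} {s : ℝ → E3 → ℝ} {B : ℝ}, V.Regular T → (∀ t ∈ Icc 0 T, Continuous (s t)) →
      B ≤ Bm →
      SobolevPath N T B (fun t x => V.P t x - Pbar) →
      (∀ i, SobolevPath N T B fun t x => V.u t x i) →
      SobolevPath N T B (fun t x => s t x - Sbar) → ∀ t ∈ Icc 0 T, ∀ b,
        ∃ φ, HasSpectrum (fun x => V.vars s b t x - bar Pbar Sbar b) φ Bm :=
    fun {V s B} hr hs hB g1 g2 g3 t ht b => by
      rcases b with _ | _ | j
      · exact g1.exists_spectrum hN ht ((hr.c1On_P.continuous ht).sub continuous_const) hB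
      · exact g3.exists_spectrum hN ht ((hs t ht).sub continuous_const) hB
      · simp only [bar, sub_zero]
        exact (g2 j).exists_spectrum hN ht ((hr.c1On_u j).continuous ht) hB
  let R : RefSol :=
    { T := T, B := Bm, Pbar := Pbar, Sbar := Sbar, m := m, W := W, T_pos := hT
      B_nonneg := le_max_right _ _, m_pos := hm, sol := hW, P_ge := hPm
      spec := spec hW.1 (fun t ht => hW.1.c1On_eta.continuous ht) hB2 hWN.1 hWN.2.1 hWN.2.2 }
  obtain ⟨c₁, hL⟩ := R.exists_large hC.pos
  obtain ⟨D, hD, hst⟩ := RefSol.exists_state_bounds hC hL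
  have hlim : Tendsto (fun c : ℝ => D * c ^ (-(3 / 2) : ℝ)) atTop (nhds (D * 0)) :=
    (tendsto_rpow_neg_atTop (by norm_num)).const_mul D
  have hev : ∀ᶠ c : ℝ in atTop, D * c ^ (-(3 / 2) : ℝ) < m / 4 :=
    hlim.eventually_lt_const (by linarith)
  obtain ⟨c₂, hc₂⟩ := eventually_atTop.1 hev
  have hM := R.one_le_M
  have hU : 0 < R.U := exp_pos _
  set D' := 1 + D + 3 * R.M + 3 * D + R.U + R.M * D + (D * D + R.M * D * D * D) with hD'
  refine ⟨D', ?_, max c₁ c₂, hL.one_le.trans (le_max_left _ _), fun c hc V hV hVN hdat t ht x => ?_⟩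
  · have : 0 ≤ R.M * D := by positivity
    have : 0 ≤ R.M * D * D * D := by positivity
    have : 0 ≤ D * D := by positivity
    linarith
  have hc1 : c₁ ≤ c := (le_max_left _ _).trans hc
  have hc0 : 0 < c := by linarith [hL.one_le]
  have hS : ∀ t ∈ Icc 0 T, Continuous (V.S c t) := fun t ht => by
    have h1 : Continuous fun x => psifun ((c ^ 2)⁻¹ * V.θ t x) :=
      continuous_iff_continuousAt.2 fun x => by
        have := (hV.1.1 t ht x).2
        exact (hasDerivAt_psifun (by positivity)).continuousAt.comp (f := fun x =>
          (c ^ 2)⁻¹ * V.θ t x) ((hV.1.2.2.2.continuous ht).const_mul (c ^ 2)⁻¹).continuousAt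
    have h2 : V.S c t = fun x => 5 / 2 * log (V.θ t x) + psifun ((c ^ 2)⁻¹ * V.θ t x) +
        log (4 * π / 3) - log (V.P t x) := funext fun x => by
      have := log_add_relEntropy hc0 (hV.1.1 t ht x).1 (hV.1.1 t ht x).2
      rw [div_eq_inv_mul (V.θ t x)] at this
      unfold Fluid.S Fluid.P
      linarith
    rw [h2]
    exact ((((hV.1.c1On_log_theta.continuous ht).const_mul _).add h1).add continuous_const).sub
      (hV.1.c1On_log_P.continuous ht)
  have hrel : R.Rel c V :=
    ⟨hV, hdat, spec hV.1 hS hB1 hVN.1 hVN.2.1 hVN.2.2⟩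
  have hPc : ∀ t ∈ Icc 0 T, Continuous fun x => V.P t x - Pbar := fun t ht =>
    (hV.1.c1On_P.continuous ht).sub continuous_const
  have hPge := hrel.P_ge hc1 (fun α t ht x => (hst α t ht x).1)
    (hc₂ c ((le_max_right _ _).trans hc)).le fun t ht => by
      have := hVN.1.exists_delta hN hPc ht (ε := m / 4) (by linarith)
      simpa only [sub_sub_sub_cancel_right] using this
  set r := c ^ (-(3 / 2) : ℝ) with hr
  have hr0 : 0 < r := rpow_pos_of_pos hc0 _
  obtain ⟨s1, s2, s3, s4, s5⟩ := hst ⟨c, V, T, hc1, hrel, le_rfl, hPge⟩ t ht x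
  obtain ⟨hn, hθ⟩ := hV.1.1 t ht x
  obtain ⟨hρ, hθ'⟩ := hW.1.1 t ht x
  have hP1 : V.P t x ≤ R.M := (le_abs_self _).trans (hrel.vars_le ht none x)
  have hP2 : W.P t x ≤ R.M := (le_abs_self _).trans (R.W_vars_le ht none x)
  have hp2 : 0 < W.P t x := P_pos hW.1 ht x
  have en : V.n t x = V.P t x * (V.θ t x)⁻¹ := by unfold Fluid.P relPressure; field_simp
  have eρ : W.n t x = W.P t x * (W.θ t x)⁻¹ := by unfold Fluid.P relPressure; field_simp
  have hMD : 0 ≤ R.M * D := by positivity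
  have hMD3 : 0 ≤ R.M * D * D * D := by positivity
  have hDD : 0 ≤ D * D := by positivity
  have hDD' : D * r ≤ D' * r := by gcongr; linarith
  refine ⟨hn, hθ, hρ, hθ', ?_, ?_, ?_, ?_, ?_, ?_, ?_, ?_, ?_, ?_, ?_⟩
  · rw [en]
    exact (mul_le_mul hP1 s4 (inv_pos.2 hθ).le (by linarith)).trans (by linarith)
  · rw [eρ]
    exact (mul_le_mul hP2 s5 (inv_pos.2 hθ').le (by linarith)).trans (by linarith)
  · exact (hrel.theta_le hc0 ht x).trans (by linarith)
  · exact (R.W_theta_le ht x).trans (by linarith)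
  · linarith
  · linarith
  · exact (norm_le_of_abs_le fun j => hrel.vars_le ht (some (some j)) x).trans (by linarith)
  · exact (norm_le_of_abs_le fun j => R.W_vars_le ht (some (some j)) x).trans (by linarith)
  · have e : V.n t x - W.n t x = (V.P t x - W.P t x) * (V.θ t x)⁻¹ -
        W.P t x * (V.θ t x)⁻¹ * (W.θ t x)⁻¹ * (V.θ t x - W.θ t x) := by
      rw [en, eρ]; field_simp; ring
    have a1 : |(V.P t x - W.P t x) * (V.θ t x)⁻¹| ≤ D * r * D := by
      rw [abs_mul, abs_of_pos (inv_pos.2 hθ)]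
      exact mul_le_mul s1 s4 (inv_pos.2 hθ).le (by positivity)
    have a2 : |W.P t x * (V.θ t x)⁻¹ * (W.θ t x)⁻¹ * (V.θ t x - W.θ t x)| ≤
        R.M * D * D * (D * r) := by
      rw [abs_mul, abs_of_pos (by positivity : 0 < W.P t x * (V.θ t x)⁻¹ * (W.θ t x)⁻¹)]
      exact mul_le_mul (mul_le_mul (mul_le_mul hP2 s4 (inv_pos.2 hθ).le (by linarith)) s5
        (inv_pos.2 hθ').le (by positivity)) s2 (abs_nonneg _) (by positivity)
    rw [e]
    refine (abs_sub _ _).trans ?_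
    have : (D * D + R.M * D * D * D) * r ≤ D' * r :=
      mul_le_mul_of_nonneg_right (by linarith) hr0.le
    linarith
  · exact (norm_le_of_abs_le fun j => s3 j).trans (by
      have : 3 * D * r ≤ D' * r := by gcongr; linarith
      linarith)
  · exact s2.trans hDD'

/-! ### Relativistic kinematics -/

section kinematics

variable {c : ℝ} (p q u : E3)

lemma energy_sq (c : ℝ) (p : E3) : energy c p ^ 2 = c ^ 2 + ‖p‖ ^ 2 := sq_sqrt (by positivity)

lemma le_energy (c : ℝ) (p : E3) : c ≤ energy c p :=
  le_sqrt_of_sq_le (le_add_of_nonneg_right (sq_nonneg _))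

lemma norm_le_energy (c : ℝ) (p : E3) : ‖p‖ ≤ energy c p :=
  le_sqrt_of_sq_le (le_add_of_nonneg_left (sq_nonneg _))

lemma energy_pos (hc : 0 < c) : 0 < energy c p := hc.trans_le (le_energy c p)

lemma energy_sub_le (hc : 0 < c) : energy c p - c ≤ ‖p‖ ^ 2 / (2 * c) := by
  rw [le_div_iff₀ (by positivity)]
  nlinarith [energy_sq c p, le_energy c p]

lemma norm_mul_add_le (c : ℝ) (p q : E3) : ‖p‖ * ‖q‖ + c ^ 2 ≤ energy c p * energy c q := by
  refine (le_abs_self _).trans (abs_le_of_sq_le_sq ?_ (mul_nonneg (sqrt_nonneg _) (sqrt_nonneg _)))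
  rw [mul_pow, energy_sq, energy_sq]
  nlinarith [mul_nonneg (sq_nonneg c) (sq_nonneg (‖p‖ - ‖q‖))]

lemma norm_sub_sq_eq : ‖p - q‖ ^ 2 = ‖p‖ ^ 2 + ‖q‖ ^ 2 - 2 * inner ℝ p q := by
  rw [norm_sub_sq_real]; ring

lemma gInv_sq' : gInv c p q ^ 2 = 2 * (energy c p * energy c q - inner ℝ p q - c ^ 2) := by
  refine sq_sqrt ?_
  have := norm_mul_add_le c p q
  have := real_inner_le_norm p q
  linarith

lemma gInv_sq : gInv c p q ^ 2 = ‖p - q‖ ^ 2 - (energy c p - energy c q) ^ 2 := by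
  rw [gInv_sq', norm_sub_sq_eq]
  linear_combination energy_sq c p + energy_sq c q

lemma gInv_nonneg : 0 ≤ gInv c p q := sqrt_nonneg _

lemma gInv_le : gInv c p q ≤ ‖p - q‖ := by
  refine (le_abs_self _).trans (abs_le_of_sq_le_sq ?_ (norm_nonneg _))
  rw [gInv_sq]; linarith [sq_nonneg (energy c p - energy c q)]

lemma sInv_eq : sInv c p q = gInv c p q ^ 2 + 4 * c ^ 2 := by rw [gInv_sq', sInv]; ring

lemma sInv_le : sInv c p q ≤ 4 * (energy c p * energy c q) := by
  have := norm_mul_add_le c p q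
  have := (abs_le.1 (abs_real_inner_le_norm p q)).1
  unfold sInv; linarith

lemma le_gInv_sq_mul : c ^ 2 * ‖p - q‖ ^ 2 ≤ gInv c p q ^ 2 * (energy c p * energy c q) := by
  have h2 := real_inner_le_norm p q
  have h3 : inner ℝ p q ^ 2 ≤ (‖p‖ * ‖q‖) ^ 2 := sq_le_sq.2 (by
    rw [abs_of_nonneg (by positivity : 0 ≤ ‖p‖ * ‖q‖)]; exact abs_real_inner_le_norm p q)
  have h4 : (energy c p * energy c q) ^ 2 = (c ^ 2 + ‖p‖ ^ 2) * (c ^ 2 + ‖q‖ ^ 2) := by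
    rw [mul_pow, energy_sq, energy_sq]
  rw [gInv_sq', norm_sub_sq_eq]
  set x : ℝ := inner ℝ p q
  set e := energy c p * energy c q
  have h5 : 0 ≤ (e - (x + c ^ 2)) * (e - (x + c ^ 2)) := mul_self_nonneg _
  nlinarith

lemma gInv_pos (hc : 0 < c) {p q : E3} (h : p ≠ q) : 0 < gInv c p q := by
  have h1 := le_gInv_sq_mul (c := c) p q
  have h2 : 0 < ‖p - q‖ := norm_pos_iff.2 (sub_ne_zero.2 h)
  refine (gInv_nonneg p q).lt_of_ne' fun h0 => ?_
  rw [h0] at h1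
  have : 0 < c ^ 2 * ‖p - q‖ ^ 2 := by positivity
  linarith

lemma energy_sub_energy_mul : (energy c p - energy c q) * (energy c p + energy c q) =
    ‖p‖ ^ 2 - ‖q‖ ^ 2 := by
  linear_combination energy_sq c p - energy_sq c q

lemma abs_energy_sub_le : |energy c p - energy c q| ≤ ‖p - q‖ := by
  refine abs_le_of_sq_le_sq ?_ (norm_nonneg _)
  linarith [gInv_sq (c := c) p q, sq_nonneg (gInv c p q)]

/-- `c` times the energy transferred in the rest frame of the fluid. -/
def transfer (c : ℝ) (u p q : E3) : ℝ :=
  energy c u * (energy c p - energy c q) - inner ℝ u (p - q)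

lemma boostEnergy_sub :
    boostEnergy c u p - boostEnergy c u q = transfer c u p q / c := by
  rw [boostEnergy, boostEnergy, transfer, inner_sub_right]; ring

/-- The boost preserves the Minkowski product. -/
lemma inner_boost (hc : 0 < c) : inner ℝ (boost c u p) (boost c u q) =
    boostEnergy c u p * boostEnergy c u q - (energy c p * energy c q - inner ℝ p q) := by
  have hU := energy_sq c u
  rcases eq_or_ne u 0 with rfl | hu
  · have : energy c (0 : E3) = c := by simp [energy, sqrt_sq hc.le]
    simp [boost, boostEnergy, this]
    field_simp
    ring
  · simp only [boost, boostEnergy, inner_add_left, inner_add_right, inner_sub_left,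
      inner_sub_right, inner_smul_left, inner_smul_right, real_inner_self_eq_norm_sq,
      real_inner_comm u, RCLike.conj_to_real]
    field_simp
    grind

lemma norm_cross_sq : ‖cross p q‖ ^ 2 = ‖p‖ ^ 2 * ‖q‖ ^ 2 - inner ℝ p q ^ 2 := by
  simp only [EuclideanSpace.norm_sq_eq, Fin.sum_univ_three, cross, cross_apply, PiLp.inner_apply,
    norm_eq_abs, sq_abs]
  simp
  ring

/-- The square of the momentum transfer in the rest frame of the fluid, plus the term with the
energy transfer: the exponent of the kernel is a function of it. -/
def zFun (c : ℝ) (u p q : E3) : ℝ :=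
  (gInv c p q ^ 2 + (transfer c u p q / c) ^ 2) / 4 + transfer c u p q ^ 2 / gInv c p q ^ 2

lemma zFun_nonneg : 0 ≤ zFun c u p q := by unfold zFun; positivity

lemma ellBar_sq_sub_jBar_sq (hc : 0 < c) {θ : ℝ} (hθ : 0 < θ) {p q : E3} (h : p ≠ q) :
    ellBar c u θ p q ^ 2 - jBar c u θ p q ^ 2 =
      (c ^ 2 / θ) ^ 2 * (1 + zFun c u p q / c ^ 2) := by
  have hg := gInv_pos hc h
  have h1 : energy c p * energy c q - inner ℝ p q = gInv c p q ^ 2 / 2 + c ^ 2 := by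
    rw [gInv_sq']; ring
  have hN : ‖cross (boost c u p) (boost c u q)‖ ^ 2 =
      (boostEnergy c u p ^ 2 - c ^ 2) * (boostEnergy c u q ^ 2 - c ^ 2) -
        (boostEnergy c u p * boostEnergy c u q - (gInv c p q ^ 2 / 2 + c ^ 2)) ^ 2 := by
    have e : ∀ p : E3, ‖boost c u p‖ ^ 2 = boostEnergy c u p ^ 2 - c ^ 2 := fun p => by
      rw [← real_inner_self_eq_norm_sq, inner_boost _ _ _ hc, real_inner_self_eq_norm_sq]
      linear_combination -energy_sq c p
    rw [norm_cross_sq, e, e, inner_boost _ _ _ hc, h1]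
  have hΛ : transfer c u p q = c * (boostEnergy c u p - boostEnergy c u q) := by
    rw [boostEnergy_sub p q u]; field_simp
  rw [ellBar, jBar, zFun, hΛ]
  simp only [mul_pow, div_pow, hN]
  field_simp
  ring

lemma exp_gamma_kernel_exponent (hc : 0 < c) {θ : ℝ} (hθ : 0 < θ) {p q : E3} (h : p ≠ q) :
    √(ellBar c u θ p q ^ 2 - jBar c u θ p q ^ 2) =
      c ^ 2 / θ * √(1 + zFun c u p q / c ^ 2) := by
  rw [ellBar_sq_sub_jBar_sq u hc hθ h, sqrt_mul (sq_nonneg _),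
    sqrt_sq (by positivity)]

/-- The momentum transfer in the rest frame of the fluid controls the momentum transfer. -/
lemma norm_sub_sq_le (hc : 0 < c) (hu : 4 * ‖u‖ ≤ c) :
    ‖p - q‖ ^ 2 ≤ 4 * (gInv c p q ^ 2 + (transfer c u p q / c) ^ 2) := by
  have hU := le_energy c u
  have h1 := gInv_sq (c := c) p q
  set x := energy c p - energy c q with hx
  have h2 : |c * x| ≤ |transfer c u p q| + ‖u‖ * ‖p - q‖ := by
    have h3 : |c * x| ≤ |energy c u * x| := by
      rw [abs_mul, abs_mul]
      gcongr
    have h4 : energy c u * x = transfer c u p q + inner ℝ u (p - q) := by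
      rw [transfer]; ring
    rw [h4] at h3
    exact h3.trans ((abs_add_le _ _).trans (add_le_add le_rfl (abs_real_inner_le_norm _ _)))
  have h5 : |x| ≤ |transfer c u p q / c| + ‖p - q‖ / 4 := by
    rw [abs_mul, abs_of_pos hc] at h2
    rw [abs_div, abs_of_pos hc]
    have : ‖u‖ * ‖p - q‖ ≤ c / 4 * ‖p - q‖ :=
      mul_le_mul_of_nonneg_right (by linarith) (norm_nonneg _)
    have h6 : c * |x| ≤ c * (|transfer c u p q| / c + ‖p - q‖ / 4) := by
      rw [mul_add, mul_div_cancel₀ _ hc.ne']; linarith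
    exact le_of_mul_le_mul_left h6 hc
  have h6 : x ^ 2 ≤ (|transfer c u p q / c| + ‖p - q‖ / 4) ^ 2 := by
    rw [← sq_abs x]; exact pow_le_pow_left₀ (abs_nonneg _) h5 2
  have h7 := sq_abs (transfer c u p q / c)
  nlinarith

end kinematics

/-! ### The first kernel -/

lemma StateClose.mono {D D' c n θ ρ θ' : ℝ} {u v : E3} (h : StateClose D c n u θ ρ v θ')
    (hD : D ≤ D') (hc : 0 < c) : StateClose D' c n u θ ρ v θ' := by
  have : D * c ^ (-(3 / 2) : ℝ) ≤ D' * c ^ (-(3 / 2) : ℝ) :=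
    mul_le_mul_of_nonneg_right hD (rpow_pos_of_pos hc _).le
  exact ⟨h.1, h.2, h.3, h.4, h.5.trans hD, h.6.trans hD, h.7.trans hD, h.8.trans hD, h.9.trans hD,
    h.10.trans hD, h.11.trans hD, h.12.trans hD, h.13.trans this, h.14.trans this, h.15.trans this⟩

/-- A light speed, a pair of close fluid states and a pair of different momenta. Estimates uniform
in all of these are expressed as `O`-relations between functions on this type. -/
structure KPt (D : ℝ) where
  (c n θ ρ θ' : ℝ)
  (u v p q : E3)
  hD : 1 ≤ D
  hc : 1000 * D ^ 2 ≤ c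
  hQ : |Q0 0 / Q0 (θ / c ^ 2) - 1| ≤ D * c ^ (-(3 / 2) : ℝ)
  st : StateClose D c n u θ ρ v θ'
  hpq : p ≠ q

lemma abs_exp_sub_exp_le (x y : ℝ) :
    |exp x - exp y| ≤ |x - y| * (exp x + exp y) := by
  wlog h : x ≤ y generalizing x y
  · rw [abs_sub_comm, abs_sub_comm x, add_comm]; exact this y x (le_of_not_ge h)
  have h1 := add_one_le_exp (x - y)
  have h2 : exp x = exp y * exp (x - y) := by rw [← exp_add]; ring_nf
  rw [abs_of_nonpos (by linarith [exp_le_exp.2 h]), abs_of_nonpos (by linarith)]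
  nlinarith [exp_pos x, exp_pos y]

lemma isBigO_exp_sub {X : Type*} {l : Filter X} {a b f h : X → ℝ}
    (hab : (fun x => a x - b x) =O[l] f) (ha : (fun x => exp (-a x)) =O[l] h)
    (hb : (fun x => exp (-b x)) =O[l] h) :
    (fun x => exp (-a x) - exp (-b x)) =O[l] fun x => f x * h x := by
  refine IsBigO.trans ?_ (hab.mul (ha.add hb))
  refine IsBigO.of_bound 1 (Eventually.of_forall fun x => ?_)
  rw [one_mul, norm_mul, norm_eq_abs, norm_eq_abs, norm_eq_abs,
    abs_of_pos (by positivity : 0 < exp (-a x) + exp (-b x))]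
  refine (abs_exp_sub_exp_le _ _).trans (le_of_eq ?_)
  rw [neg_sub_neg, abs_sub_comm]

lemma abs_energy_mul_sub_le {c : ℝ} (hc : 0 < c) (u p : E3) :
    |energy c u * energy c p - c ^ 2 - (‖u‖ ^ 2 + ‖p‖ ^ 2) / 2| ≤
      (‖u‖ ^ 2 + ‖p‖ ^ 2) ^ 2 / (8 * c ^ 2) := by
  have h1 := energy_sq c u
  have h2 := energy_sq c p
  have h3 := norm_mul_add_le c u p
  have h4 : 0 ≤ ‖u‖ * ‖p‖ := by positivity
  set y := energy c u * energy c p - c ^ 2 with hy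
  have h5 : y ≤ (‖u‖ ^ 2 + ‖p‖ ^ 2) / 2 := by
    nlinarith [sq_nonneg (energy c u - energy c p)]
  have h6 : (y + c ^ 2) ^ 2 = (c ^ 2 + ‖u‖ ^ 2) * (c ^ 2 + ‖p‖ ^ 2) := by
    rw [← h1, ← h2, hy]; ring
  have h7 : y - (‖u‖ ^ 2 + ‖p‖ ^ 2) / 2 = ((‖u‖ * ‖p‖) ^ 2 - y ^ 2) / (2 * c ^ 2) := by
    field_simp; linear_combination h6
  have h8 : ‖u‖ * ‖p‖ ≤ (‖u‖ ^ 2 + ‖p‖ ^ 2) / 2 := by nlinarith [sq_nonneg (‖u‖ - ‖p‖)]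
  have h9 : (‖u‖ ^ 2 + ‖p‖ ^ 2) ^ 2 / (8 * c ^ 2) =
      ((‖u‖ ^ 2 + ‖p‖ ^ 2) / 2) ^ 2 / (2 * c ^ 2) := by ring
  rw [h7, h9, abs_div, abs_of_pos (by positivity : 0 < 2 * c ^ 2)]
  refine div_le_div_of_nonneg_right (abs_le.2 ⟨?_, ?_⟩) (by positivity)
  · nlinarith [pow_le_pow_left₀ (by linarith : 0 ≤ y) h5 2, sq_nonneg (‖u‖ * ‖p‖)]
  · nlinarith [pow_le_pow_left₀ h4 h8 2, sq_nonneg y]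

/-- The kinetic energy in the rest frame of a fluid with velocity `u`. -/
def kinetic (c : ℝ) (u p : E3) : ℝ := energy c u * energy c p - inner ℝ u p - c ^ 2

lemma kinetic_nonneg (c : ℝ) (u p : E3) : 0 ≤ kinetic c u p := by
  have := norm_mul_add_le c u p
  have := real_inner_le_norm u p
  unfold kinetic; linarith

lemma le_kinetic {c K : ℝ} (hc : 0 < c) (hKc : 2 * K ≤ c) (u p : E3) :
    (K - ‖u‖) * ‖p‖ - 2 * K ^ 2 ≤ kinetic c u p := by
  have h1 := le_energy c u
  have h2 := le_energy c p
  have h3 := real_inner_le_norm u p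
  have h4 := energy_sq c p
  have h5 : energy c p ≤ c + ‖p‖ := by
    nlinarith [norm_nonneg p]
  have hp := norm_nonneg p
  have h6 : K * ‖p‖ - 2 * K ^ 2 ≤ c * (energy c p - c) := by
    have h7 : c * (energy c p - c) * (energy c p + c) = c * ‖p‖ ^ 2 := by
      linear_combination c * h4
    have h8 : c * ‖p‖ ^ 2 ≤ c * (energy c p - c) * (2 * c + ‖p‖) := by
      rw [← h7]
      exact mul_le_mul_of_nonneg_left (by linarith) (mul_nonneg hc.le (by linarith))
    have h9 : (K * ‖p‖ - 2 * K ^ 2) * (2 * c + ‖p‖) ≤ c * ‖p‖ ^ 2 := by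
      nlinarith [mul_nonneg hc.le (sq_nonneg (‖p‖ - 2 * K)), mul_nonneg (sub_nonneg.2 hKc)
        (sq_nonneg ‖p‖), mul_nonneg (sq_nonneg K) hp, mul_nonneg hc.le (sq_nonneg K)]
    exact le_of_mul_le_mul_right (h9.trans h8) (by positivity)
  unfold kinetic
  nlinarith [mul_le_mul_of_nonneg_right h1 (hc.le.trans h2)]

/-- The prefactor of the first kernel is close to `2 |p - q|`. -/
lemma abs_prefactor_sub_le {c : ℝ} (hc : 0 < c) (p q : E3) :
    |c * gInv c p q * √(sInv c p q) / (energy c p * energy c q) - 2 * ‖p - q‖| ≤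
      2 * ‖p - q‖ * ((‖p‖ ^ 2 + ‖q‖ ^ 2) / c ^ 2) := by
  have hE := energy_pos p hc
  have hF := energy_pos q hc
  set e := energy c p * energy c q with he
  have he0 : 0 < e := mul_pos hE hF
  have hce : c ^ 2 ≤ e := by
    rw [sq]; exact mul_le_mul (le_energy c p) (le_energy c q) hc.le hE.le
  have he2 : e ≤ c ^ 2 + (‖p‖ ^ 2 + ‖q‖ ^ 2) / 2 := by
    nlinarith [sq_nonneg (energy c p - energy c q), energy_sq c p, energy_sq c q]
  set r := ‖p - q‖
  have hg0 := gInv_nonneg (c := c) p q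
  have hgr : gInv c p q ≤ r := gInv_le p q
  have hs := sInv_eq (c := c) p q
  have hs4 : sInv c p q ≤ 4 * e := sInv_le p q
  set σ := √(sInv c p q)
  have hσ : σ ^ 2 = sInv c p q := sq_sqrt (by rw [hs]; positivity)
  have hσc : 2 * c ≤ σ := le_sqrt_of_sq_le (by nlinarith)
  have hcσ : c * σ ≤ 2 * e := by
    refine (le_abs_self _).trans (abs_le_of_sq_le_sq ?_ (by positivity))
    nlinarith
  have hup : c * gInv c p q * σ / e ≤ 2 * r := by
    rw [div_le_iff₀ he0]
    nlinarith [mul_le_mul hcσ hgr hg0 (by positivity)]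
  have hlow : 2 * r * (1 - (‖p‖ ^ 2 + ‖q‖ ^ 2) / c ^ 2) ≤ c * gInv c p q * σ / e := by
    -- `g ≥ (c² / e) r`, since `c² ≤ e`
    have h1 : c ^ 2 * r ≤ e * gInv c p q := by
      refine (le_abs_self _).trans (abs_le_of_sq_le_sq ?_ (by positivity))
      have := le_gInv_sq_mul (c := c) p q
      calc (c ^ 2 * r) ^ 2 = c ^ 2 * (c ^ 2 * r ^ 2) := by ring
        _ ≤ c ^ 2 * (gInv c p q ^ 2 * e) := by gcongr
        _ ≤ e * (gInv c p q ^ 2 * e) := by gcongr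
        _ = _ := by ring
    have h2 : 2 * r * (c ^ 2 / e) ^ 2 ≤ c * gInv c p q * σ / e := by
      rw [div_pow, mul_div_assoc', div_le_div_iff₀ (by positivity) he0]
      have h3 : c ^ 2 * (2 * c) * (c * r * e) ≤ c ^ 2 * σ * (c * r * e) := by gcongr
      nlinarith [mul_le_mul_of_nonneg_right h1 (by positivity : 0 ≤ c * σ * e)]
    have h4 : 1 - (‖p‖ ^ 2 + ‖q‖ ^ 2) / c ^ 2 ≤ 1 - 2 * (1 - c ^ 2 / e) := by
      have : 1 - c ^ 2 / e ≤ (‖p‖ ^ 2 + ‖q‖ ^ 2) / 2 / c ^ 2 := by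
        rw [le_div_iff₀ (by positivity), one_sub_mul, div_mul_eq_mul_div, sub_le_iff_le_add,
          ← sub_le_iff_le_add', le_div_iff₀ he0]
        nlinarith
      have e1 : (‖p‖ ^ 2 + ‖q‖ ^ 2) / 2 / c ^ 2 = (‖p‖ ^ 2 + ‖q‖ ^ 2) / c ^ 2 / 2 := by ring
      linarith
    nlinarith [sq_nonneg (1 - c ^ 2 / e)]
  rw [abs_le]
  constructor <;> nlinarith [(by positivity : 0 ≤ 2 * r * ((‖p‖ ^ 2 + ‖q‖ ^ 2) / c ^ 2))]

namespace KPt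

variable {D : ℝ}

lemma c_pos (k : KPt D) : 0 < k.c := by nlinarith [k.hc, k.hD]
lemma one_le_c (k : KPt D) : 1 ≤ k.c := by nlinarith [k.hc, k.hD]
lemma c_ge (k : KPt D) : 1000 * D ≤ k.c := by nlinarith [k.hc, k.hD]

/-- The size of the distance of the two states. -/
def δ (k : KPt D) : ℝ := k.c ^ (-(3 / 2) : ℝ)

lemma δ_pos (k : KPt D) : 0 < k.δ := rpow_pos_of_pos k.c_pos _

lemma inv_sq_le_δ (k : KPt D) : (k.c ^ 2)⁻¹ ≤ k.δ := by
  rw [← rpow_natCast, ← rpow_neg k.c_pos.le]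
  exact rpow_le_rpow_of_exponent_le k.one_le_c (by norm_num)

/-- The normalization factor of the relativistic Maxwellian, up to `exp (c² / θ)`. -/
def A (k : KPt D) : ℝ :=
  k.n / (2 * π * k.θ) ^ (3 / 2 : ℝ) * (Q0 0 / Q0 (k.θ / k.c ^ 2))

/-- The normalization factor of the classical Maxwellian. -/
def A' (k : KPt D) : ℝ := k.ρ / (2 * π * k.θ') ^ (3 / 2 : ℝ)

lemma juttnerFactor_eq_A (k : KPt D) :
    juttnerFactor k.c k.n k.θ = k.A * exp (k.c ^ 2 / k.θ) := juttnerFactor_eq k.c_pos k.st.θ_pos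

lemma A_pos (k : KPt D) : 0 < k.A := by
  have h1 := k.st.n_pos
  have h2 := k.st.θ_pos
  have h3 := Q0_pos (ε := 0) le_rfl
  have h4 := Q0_pos (ε := k.θ / k.c ^ 2) (by positivity)
  unfold A; positivity

lemma bdd {f : KPt D → ℝ} (C : ℝ) (h : ∀ k, |f k| ≤ C) {l : Filter (KPt D)} :
    f =O[l] fun _ => (1 : ℝ) :=
  (Frame.le_top C (by simpa using h)).mono le_top

lemma inv_θ_sub : (fun k : KPt D => k.θ⁻¹ - k.θ'⁻¹) =O[⊤] δ := by
  refine Frame.le_top (D * D * D) fun k => ?_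
  have h1 := k.st.θ_pos
  have h2 := k.st.θ'_pos
  have hD := k.hD
  have e : k.θ⁻¹ - k.θ'⁻¹ = k.θ⁻¹ * k.θ'⁻¹ * -(k.θ - k.θ') := by field_simp; ring
  rw [e, abs_mul, abs_neg, abs_of_pos (by positivity : 0 < k.θ⁻¹ * k.θ'⁻¹), abs_of_pos k.δ_pos,
    mul_assoc (D * D)]
  exact mul_le_mul (mul_le_mul k.st.θ_inv_le k.st.θ'_inv_le (by positivity) (by positivity))
    k.st.θ_sub (abs_nonneg _) (by positivity)

lemma bdd_inv_θ {l : Filter (KPt D)} : (fun k : KPt D => k.θ⁻¹) =O[l] fun _ => (1 : ℝ) :=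
  bdd D fun k => by rw [abs_of_pos (inv_pos.2 k.st.θ_pos)]; exact k.st.θ_inv_le

lemma bdd_θ {l : Filter (KPt D)} : (fun k : KPt D => k.θ) =O[l] fun _ => (1 : ℝ) :=
  bdd D fun k => by rw [abs_of_pos k.st.θ_pos]; exact k.st.θ_le

lemma bdd_θ' {l : Filter (KPt D)} : (fun k : KPt D => k.θ') =O[l] fun _ => (1 : ℝ) :=
  bdd D fun k => by rw [abs_of_pos k.st.θ'_pos]; exact k.st.θ'_le

/-- The normalization factors are bounded and close to each other. -/
lemma bdd_A_sub : ((A : KPt D → ℝ) =O[⊤] fun _ => (1 : ℝ)) ∧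
    ((A' : KPt D → ℝ) =O[⊤] fun _ => (1 : ℝ)) ∧ (fun k : KPt D => k.A - k.A') =O[⊤] δ := by
  set F : ℝ → ℝ := fun x => ((2 * π * x) ^ (3 / 2 : ℝ))⁻¹ with hF
  have hpos : ∀ x ∈ Ioi (0 : ℝ), 0 < 2 * π * x := fun x hx => by
    have : 0 < x := hx
    positivity
  have hFc : ContDiffOn ℝ 1 F (Ioi 0) := by
    refine ContDiffOn.inv (ContDiffOn.rpow_const_of_ne (by fun_prop) fun x hx => (hpos x hx).ne')
      fun x hx => (rpow_pos_of_pos (hpos x hx) _).ne'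
  have hsub : Icc D⁻¹ D ⊆ Ioi 0 ∨ IsEmpty (KPt D) := by
    by_cases hD : 1 ≤ D
    · exact Or.inl fun x hx => (inv_pos.2 (by linarith)).trans_le hx.1
    · exact Or.inr ⟨fun k => hD k.hD⟩
  rcases hsub with hsub | he
  swap
  · exact ⟨Frame.le_top 0 fun k => (he.false k).elim,
      Frame.le_top 0 fun k => (he.false k).elim,
      Frame.le_top 0 fun k => (he.false k).elim⟩
  obtain ⟨M0, hM0⟩ := isCompact_Icc.exists_bound_of_continuousOn (hFc.continuousOn.mono hsub)
  obtain ⟨M1, hM1⟩ := isCompact_Icc.exists_bound_of_continuousOn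
    ((hFc.continuousOn_deriv_of_isOpen isOpen_Ioi (by norm_num)).mono hsub)
  have lip : ∀ y ∈ Icc D⁻¹ D, ∀ z ∈ Icc D⁻¹ D, |F y - F z| ≤ M1 * |y - z| := fun y hy z hz =>
    (convex_Icc D⁻¹ D).norm_image_sub_le_of_norm_hasDerivWithin_le
      (fun x hx => ((hFc.differentiableOn (by norm_num)).differentiableAt
        (isOpen_Ioi.mem_nhds (hsub hx))).hasDerivAt.hasDerivWithinAt) hM1 hz hy
  have m1 : ∀ k : KPt D, k.θ ∈ Icc D⁻¹ D := fun k =>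
    ⟨inv_le_of_inv_le₀ k.st.θ_pos k.st.θ_inv_le, k.st.θ_le⟩
  have m2 : ∀ k : KPt D, k.θ' ∈ Icc D⁻¹ D := fun k =>
    ⟨inv_le_of_inv_le₀ k.st.θ'_pos k.st.θ'_inv_le, k.st.θ'_le⟩
  have bF : (fun k : KPt D => F k.θ) =O[⊤] fun _ => (1 : ℝ) := bdd M0 fun k => hM0 _ (m1 k)
  have bF' : (fun k : KPt D => F k.θ') =O[⊤] fun _ => (1 : ℝ) := bdd M0 fun k => hM0 _ (m2 k)
  have bFs : (fun k : KPt D => F k.θ - F k.θ') =O[⊤] δ :=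
    (Frame.le_top M1 fun k : KPt D => lip _ (m1 k) _ (m2 k)).trans
      (Frame.le_top D fun k => by rw [abs_of_pos k.δ_pos]; exact k.st.θ_sub)
  have bn : (fun k : KPt D => k.n - k.ρ) =O[⊤] δ :=
    Frame.le_top D fun k => by rw [abs_of_pos k.δ_pos]; exact k.st.n_sub
  have bρ : (fun k : KPt D => k.ρ) =O[⊤] fun _ => (1 : ℝ) :=
    bdd D fun k => by rw [abs_of_pos k.st.ρ_pos]; exact k.st.ρ_le
  have bn' : (fun k : KPt D => k.n) =O[⊤] fun _ => (1 : ℝ) :=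
    bdd D fun k => by rw [abs_of_pos k.st.n_pos]; exact k.st.n_le
  have bQs : (fun k : KPt D => Q0 0 / Q0 (k.θ / k.c ^ 2) - 1) =O[⊤] δ :=
    Frame.le_top D fun k => by rw [abs_of_pos k.δ_pos]; exact k.hQ
  have bQ : (fun k : KPt D => Q0 0 / Q0 (k.θ / k.c ^ 2)) =O[⊤] fun _ => (1 : ℝ) :=
    bdd 1 fun k => by
      have h0 := Q0_pos (ε := 0) le_rfl
      have hε : 0 ≤ k.θ / k.c ^ 2 := div_nonneg k.st.θ_pos.le (sq_nonneg _)
      have h1 := Q0_pos hε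
      rw [abs_of_pos (by positivity), div_le_one h1]
      exact lapInt_zero_le (by norm_num) (by norm_num) (by norm_num) hε
  refine ⟨?_, ?_, ?_⟩
  · have := (bn'.mul bF).mul bQ
    simp only [mul_one] at this
    exact this
  · have := bρ.mul bF'
    simp only [mul_one] at this
    exact this
  · have h1 := (bn.mul bF).mul bQ
    have h2 := (bρ.mul bFs).mul bQ
    have h3 := (bρ.mul bF').mul bQs
    simp only [mul_one, one_mul] at h1 h2 h3
    refine ((h1.add h2).add h3).congr_left fun k => ?_
    simp only [A, A', hF]
    ring

/-- The weight in which the first kernel is estimated. -/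
def s1 (k : KPt D) : ℝ := ‖k.p‖ + ‖k.q‖

lemma s1_nonneg (k : KPt D) : 0 ≤ k.s1 := by unfold s1; positivity

lemma kc1_eq (k : KPt D) : kc1 k.c k.n k.u k.θ k.p k.q = π *
    (k.c * gInv k.c k.p k.q * √(sInv k.c k.p k.q) /
      (energy k.c k.p * energy k.c k.q)) *
    (k.A * exp (-((kinetic k.c k.u k.p + kinetic k.c k.u k.q) / (2 * k.θ)))) := by
  have h : juttner k.c k.n k.u k.θ k.p * juttner k.c k.n k.u k.θ k.q =
      (k.A * exp (-((kinetic k.c k.u k.p + kinetic k.c k.u k.q) / (2 * k.θ)))) ^ 2 := by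
    rw [juttner, juttner, juttnerFactor_eq_A, mul_pow, ← exp_nat_mul]
    have e : ∀ a b d f : ℝ, k.A * exp a * exp b * (k.A * exp d * exp f) =
        k.A ^ 2 * exp (a + b + d + f) := fun a b d f => by
      rw [exp_add, exp_add, exp_add]; ring
    rw [e]
    unfold kinetic
    ring_nf
  have := k.A_pos
  rw [kc1, h, sqrt_sq (by positivity)]
  ring

lemma k1_eq (k : KPt D) : k1 k.ρ k.v k.θ' k.p k.q = π * (2 * ‖k.p - k.q‖) *
    (k.A' * exp (-((‖k.p - k.v‖ ^ 2 + ‖k.q - k.v‖ ^ 2) / (4 * k.θ')))) := by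
  rw [k1, A', add_div, neg_add']; ring

lemma le_kinetic_div (k : KPt D) (p : E3) : 2 * ‖p‖ - 25 * D ≤ kinetic k.c k.u p / (2 * k.θ) := by
  have hD := k.hD
  have h1 := le_kinetic (K := 5 * D) k.c_pos (by linarith [k.c_ge]) k.u p
  have h2 := kinetic_nonneg k.c k.u p
  have h3 : kinetic k.c k.u p / (2 * D) ≤ kinetic k.c k.u p / (2 * k.θ) :=
    div_le_div_of_nonneg_left h2 (by have := k.st.θ_pos; positivity) (by linarith [k.st.θ_le])
  refine le_trans ?_ h3
  rw [le_div_iff₀ (by positivity)]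
  nlinarith [mul_le_mul_of_nonneg_right k.st.u_le (norm_nonneg p)]

lemma le_sq_div (k : KPt D) (p : E3) : 2 * ‖p‖ - 6 * D ≤ ‖p - k.v‖ ^ 2 / (4 * k.θ') := by
  have hD := k.hD
  have h1 := norm_sub_norm_le p k.v
  have h2 := k.st.v_le
  have h3 : ‖p - k.v‖ ^ 2 / (4 * D) ≤ ‖p - k.v‖ ^ 2 / (4 * k.θ') :=
    div_le_div_of_nonneg_left (by positivity) (by have := k.st.θ'_pos; positivity)
      (by linarith [k.st.θ'_le])
  refine le_trans ?_ h3
  rw [le_div_iff₀ (by positivity)]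
  nlinarith [sq_nonneg (‖p - k.v‖ - 4 * D)]

lemma exp_neg_le {f h : KPt D → ℝ} (C : ℝ) (H : ∀ k, h k - C ≤ f k) :
    (fun k => exp (-f k)) =O[⊤] fun k => exp (-h k) :=
  Frame.le_top (exp C) fun k => by
    rw [abs_exp, abs_exp, ← exp_add]
    exact exp_le_exp.2 (by linarith [H k])

lemma kinetic_sub (p : KPt D → E3) (hp : ∀ k, ‖p k‖ ≤ 1 + k.s1) :
    (fun k : KPt D => kinetic k.c k.u (p k) / (2 * k.θ) - ‖p k - k.v‖ ^ 2 / (4 * k.θ')) =O[⊤]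
      fun k => k.δ * (1 + k.s1) ^ 4 := by
  have b1 : (fun k : KPt D => kinetic k.c k.u (p k) - ‖p k - k.u‖ ^ 2 / 2) =O[⊤]
      fun k => k.δ * (1 + k.s1) ^ 4 := Frame.le_top ((D ^ 2 + 1) ^ 2) fun k => by
    have hs := k.s1_nonneg
    have hδ := k.δ_pos
    have h1 := abs_energy_mul_sub_le k.c_pos k.u (p k)
    have h2 : ‖k.u‖ ^ 2 + ‖p k‖ ^ 2 ≤ (D ^ 2 + 1) * (1 + k.s1) ^ 2 := by
      have := pow_le_pow_left₀ (norm_nonneg _) k.st.u_le 2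
      have := pow_le_pow_left₀ (norm_nonneg _) (hp k) 2
      have : D ^ 2 * 1 ≤ D ^ 2 * (1 + k.s1) ^ 2 :=
        mul_le_mul_of_nonneg_left (one_le_pow₀ (by linarith)) (sq_nonneg D)
      linarith
    have h3 : (‖k.u‖ ^ 2 + ‖p k‖ ^ 2) ^ 2 / (8 * k.c ^ 2) ≤
        ((D ^ 2 + 1) * (1 + k.s1) ^ 2) ^ 2 * k.δ := by
      refine mul_le_mul (pow_le_pow_left₀ (by positivity) h2 2) (le_trans ?_ k.inv_sq_le_δ)
        (by positivity) (by positivity)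
      have := k.c_pos
      exact inv_anti₀ (by positivity) (by nlinarith)
    rw [abs_of_nonneg (by positivity : 0 ≤ k.δ * (1 + k.s1) ^ 4)]
    have e : kinetic k.c k.u (p k) - ‖p k - k.u‖ ^ 2 / 2 =
        energy k.c k.u * energy k.c (p k) - k.c ^ 2 - (‖k.u‖ ^ 2 + ‖p k‖ ^ 2) / 2 := by
      rw [norm_sub_sq_eq, kinetic, real_inner_comm]; ring
    rw [e]
    refine (h1.trans h3).trans (le_of_eq ?_)
    ring
  have b2 : (fun k : KPt D => ‖p k - k.u‖ ^ 2 - ‖p k - k.v‖ ^ 2) =O[⊤]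
      fun k => k.δ * (1 + k.s1) ^ 4 := Frame.le_top (D * (2 + 2 * D)) fun k => by
    have hs := k.s1_nonneg
    have hδ := k.δ_pos
    have hD := k.hD
    have e : ‖p k - k.u‖ ^ 2 - ‖p k - k.v‖ ^ 2 =
        (‖p k - k.u‖ - ‖p k - k.v‖) * (‖p k - k.u‖ + ‖p k - k.v‖) := by ring
    have h1 : |‖p k - k.u‖ - ‖p k - k.v‖| ≤ D * k.δ := by
      refine (abs_norm_sub_norm_le _ _).trans ?_
      rw [sub_sub_sub_cancel_left, norm_sub_rev]
      exact k.st.u_sub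
    have h2 : ‖p k - k.u‖ + ‖p k - k.v‖ ≤ (2 + 2 * D) * (1 + k.s1) ^ 4 := by
      have h3 : (1 + k.s1) ≤ (1 + k.s1) ^ 4 := le_self_pow₀ (by linarith) (by norm_num)
      nlinarith [norm_sub_le (p k) k.u, norm_sub_le (p k) k.v, hp k, k.st.u_le, k.st.v_le]
    rw [e, abs_mul, abs_of_nonneg (by positivity : 0 ≤ ‖p k - k.u‖ + ‖p k - k.v‖),
      abs_of_nonneg (by positivity : 0 ≤ k.δ * (1 + k.s1) ^ 4)]
    refine (mul_le_mul h1 h2 (by positivity) (by positivity)).trans (le_of_eq ?_)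
    ring
  have b3 : (fun k : KPt D => ‖p k - k.v‖ ^ 2) =O[⊤] fun k => (1 + k.s1) ^ 4 :=
    Frame.le_top ((1 + D) ^ 2) fun k => by
      have hs := k.s1_nonneg
      have hD := k.hD
      have h1 : ‖p k - k.v‖ ≤ (1 + D) * (1 + k.s1) ^ 2 := by
        have h3 : (1 + k.s1) ≤ (1 + k.s1) ^ 2 := le_self_pow₀ (by linarith) (by norm_num)
        nlinarith [norm_sub_le (p k) k.v, hp k, k.st.v_le]
      rw [abs_of_nonneg (by positivity), abs_of_nonneg (by positivity)]
      refine (pow_le_pow_left₀ (norm_nonneg _) h1 2).trans (le_of_eq ?_)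
      ring
  have h1 := (b1.mul (bdd_inv_θ (D := D))).const_mul_left (1 / 2)
  have h2 := (b2.mul (bdd_inv_θ (D := D))).const_mul_left (1 / 4)
  have h3 := ((inv_θ_sub (D := D)).mul b3).const_mul_left (1 / 4)
  simp only [mul_one] at h1 h2
  refine ((h1.add h2).add h3).congr_left fun k => ?_
  ring

/-- The first kernels differ by `O(c^{-3/2})`. -/
lemma kc1_sub_k1 :
    (fun k : KPt D => kc1 k.c k.n k.u k.θ k.p k.q - k1 k.ρ k.v k.θ' k.p k.q) =O[⊤]
      fun k => k.δ * exp (-k.s1) := by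
  obtain ⟨bA, bA', bAs⟩ := bdd_A_sub (D := D)
  set X : KPt D → ℝ := fun k => (kinetic k.c k.u k.p + kinetic k.c k.u k.q) / (2 * k.θ) with hX
  set Y : KPt D → ℝ := fun k => (‖k.p - k.v‖ ^ 2 + ‖k.q - k.v‖ ^ 2) / (4 * k.θ') with hY
  have eX : (fun k => exp (-X k)) =O[⊤] fun k => exp (-(2 * k.s1)) :=
    exp_neg_le (50 * D) fun k => by
      simp only [hX, add_div, s1]; linarith [k.le_kinetic_div k.p, k.le_kinetic_div k.q]
  have eY : (fun k => exp (-Y k)) =O[⊤] fun k => exp (-(2 * k.s1)) :=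
    exp_neg_le (50 * D) fun k => by
      simp only [hY, add_div, s1]; linarith [k.le_sq_div k.p, k.le_sq_div k.q, k.hD]
  have hXY : (fun k => X k - Y k) =O[⊤] fun k => k.δ * (1 + k.s1) ^ 4 :=
    ((kinetic_sub (fun k : KPt D => k.p) fun k => by
      unfold s1; linarith [norm_nonneg k.p, norm_nonneg k.q]).add
      (kinetic_sub (fun k : KPt D => k.q) fun k => by
        unfold s1; linarith [norm_nonneg k.p, norm_nonneg k.q])).congr_left fun k => by
      ring
  have hE := isBigO_exp_sub hXY eX eY
  set w : KPt D → ℝ := fun k => k.c * gInv k.c k.p k.q * √(sInv k.c k.p k.q) /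
    (energy k.c k.p * energy k.c k.q) with hw
  have br : (fun k : KPt D => 2 * ‖k.p - k.q‖) =O[⊤] fun k => 1 + k.s1 :=
    Frame.le_top 2 fun k => by
      have := norm_sub_le k.p k.q
      have := k.s1_nonneg
      rw [abs_of_nonneg (by positivity), abs_of_nonneg (by positivity)]
      unfold s1; linarith
  have bw : (fun k : KPt D => w k - 2 * ‖k.p - k.q‖) =O[⊤] fun k => (1 + k.s1) ^ 3 * k.δ :=
    Frame.le_top 2 fun k => by
      have hs := k.s1_nonneg
      have hδ := k.δ_pos
      refine (abs_prefactor_sub_le k.c_pos k.p k.q).trans ?_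
      rw [abs_of_nonneg (by positivity)]
      have h1 : ‖k.p - k.q‖ ≤ 1 + k.s1 := by
        have := norm_sub_le k.p k.q
        unfold s1; linarith
      have h2 : (‖k.p‖ ^ 2 + ‖k.q‖ ^ 2) / k.c ^ 2 ≤ (1 + k.s1) ^ 2 * k.δ := by
        refine mul_le_mul ?_ k.inv_sq_le_δ (by positivity) (by positivity)
        unfold s1; nlinarith [norm_nonneg k.p, norm_nonneg k.q]
      calc _ ≤ 2 * (1 + k.s1) * ((1 + k.s1) ^ 2 * k.δ) := by gcongr
        _ = _ := by ring
  have key : (fun k : KPt D => k.δ * ((1 + k.s1) ^ 5 * exp (-(2 * k.s1)))) =O[⊤]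
      fun k => k.δ * exp (-k.s1) := by
    refine (isBigO_refl δ ⊤).mul (Frame.le_top (120 * exp 1) fun k => ?_)
    have hs := k.s1_nonneg
    have h1 := pow_div_factorial_le_exp (1 + k.s1) (by linarith) 5
    have h2 : (1 + k.s1) ^ 5 ≤ 120 * exp (1 + k.s1) := by
      norm_num [Nat.factorial] at h1
      linarith
    rw [abs_of_nonneg (by positivity), abs_exp]
    calc _ ≤ 120 * exp (1 + k.s1) * exp (-(2 * k.s1)) := by gcongr
      _ = _ := by rw [mul_assoc, mul_assoc, ← exp_add, ← exp_add]; ring_nf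
  have wle : ∀ m ≤ 5, ∀ f : KPt D → ℝ,
      (f =O[⊤] fun k => k.δ * ((1 + k.s1) ^ m * exp (-(2 * k.s1)))) →
      f =O[⊤] fun k => k.δ * exp (-k.s1) := fun m hm f hf => by
    refine (hf.trans ((isBigO_refl δ ⊤).mul ?_)).trans key
    refine Frame.le_top 1 fun k => ?_
    have hs := k.s1_nonneg
    rw [one_mul, abs_of_nonneg (by positivity), abs_of_nonneg (by positivity)]
    have := pow_le_pow_right₀ (by linarith : 1 ≤ 1 + k.s1) hm
    gcongr
  have t1 := wle 3 (by norm_num) _ (((bw.mul bA).mul eX).congr_right fun k => by ring)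
  have t2 := wle 1 (by norm_num) _ (((br.mul bAs).mul eX).congr_right fun k => by ring)
  have t3 := wle 5 (by norm_num) _ (((br.mul bA').mul hE).congr_right fun k => by ring)
  refine (((t1.add t2).add t3).const_mul_left π).congr_left fun k => ?_
  rw [kc1_eq, k1_eq]
  ring

end KPt

/-! ### The second kernel: explicit form and global bounds -/

namespace KPt

variable {D : ℝ} (k : KPt D)

/-- The component `p⁰`. -/
def E : ℝ := energy k.c k.p
/-- The component `q⁰`. -/
def F : ℝ := energy k.c k.q
/-- The component `u⁰` of the relativistic velocity. -/
def U : ℝ := energy k.c k.u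
/-- The distance of the momenta. -/
def r : ℝ := ‖k.p - k.q‖
/-- The relative momentum. -/
def g : ℝ := gInv k.c k.p k.q
/-- The centre-of-mass energy `√s`. -/
def σ : ℝ := √(sInv k.c k.p k.q)
/-- The energy transfer, times `c`, in the rest frame of the relativistic fluid. -/
def Λ : ℝ := transfer k.c k.u k.p k.q
/-- The function through which the exponent of the relativistic kernel depends on the momenta. -/
def z : ℝ := zFun k.c k.u k.p k.q

/-- The momentum transfer in the rest frame of the relativistic fluid. -/
def rb : ℝ := √(k.g ^ 2 + (k.Λ / k.c) ^ 2)

/-- The total energy, divided by `c`, in the rest frame of the relativistic fluid. -/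
def b : ℝ := boostEnergy k.c k.u k.p + boostEnergy k.c k.u k.q

/-- The argument of the exponential in the second relativistic kernel. -/
def G : ℝ := k.c ^ 2 / k.θ * √(1 + k.z / k.c ^ 2)

/-- The exponent of the second relativistic kernel, normalized by its value at `p = q = u`. -/
def X : ℝ := k.c ^ 2 / k.θ * (√(1 + k.z / k.c ^ 2) - 1)

/-- Half the difference of the squared distances from the classical velocity. -/
def Λ' : ℝ := (‖k.p - k.v‖ ^ 2 - ‖k.q - k.v‖ ^ 2) / 2

/-- The exponent of the second classical kernel. -/
def Y : ℝ := (k.r ^ 2 / 4 + (k.Λ' / k.r) ^ 2) / (2 * k.θ')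

/-- The prefactor of the second relativistic kernel, multiplied by `|p - q|`. -/
def H : ℝ := π / 2 * (k.A * k.θ) *
  (k.σ * k.g * k.b * k.r / (k.E * k.F * k.rb ^ 2) * (1 + 1 / k.G) +
    k.σ ^ 2 * k.r / (k.E * k.F * k.rb))

lemma r_pos : 0 < k.r := norm_pos_iff.2 (sub_ne_zero.2 k.hpq)
lemma g_pos : 0 < k.g := gInv_pos k.c_pos k.hpq
lemma g_le : k.g ≤ k.r := gInv_le _ _
lemma c_le_E : k.c ≤ k.E := le_energy _ _
lemma c_le_F : k.c ≤ k.F := le_energy _ _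
lemma c_le_U : k.c ≤ k.U := le_energy _ _
lemma E_pos : 0 < k.E := energy_pos _ k.c_pos
lemma F_pos : 0 < k.F := energy_pos _ k.c_pos
lemma z_nonneg : 0 ≤ k.z := zFun_nonneg _ _ _
lemma σ_sq : k.σ ^ 2 = k.g ^ 2 + 4 * k.c ^ 2 := by
  rw [σ, sq_sqrt (by rw [sInv_eq]; positivity), sInv_eq]; rfl
lemma σ_pos : 0 < k.σ :=
  sqrt_pos.2 (by rw [sInv_eq]; have := k.c_pos; positivity)
lemma σ_sq_le : k.σ ^ 2 ≤ 4 * (k.E * k.F) := by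
  rw [σ, sq_sqrt (by rw [sInv_eq]; positivity)]; exact sInv_le _ _
lemma rb_sq : k.rb ^ 2 = k.g ^ 2 + (k.Λ / k.c) ^ 2 := sq_sqrt (by positivity)
lemma rb_pos : 0 < k.rb := sqrt_pos.2 (by have := k.g_pos; positivity)
lemma g_le_rb : k.g ≤ k.rb := le_sqrt_of_sq_le (le_add_of_nonneg_right (sq_nonneg _))
lemma z_eq : k.z = k.rb ^ 2 / 4 + k.Λ ^ 2 / k.g ^ 2 := by rw [rb_sq]; rfl
lemma u_le_c : 4 * ‖k.u‖ ≤ k.c := by linarith [k.st.u_le, k.c_ge, k.hD]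

lemma r_le_rb : k.r ≤ 2 * k.rb := by
  refine (le_abs_self _).trans (abs_le_of_sq_le_sq ?_ (by have := k.rb_pos; positivity))
  rw [mul_pow, rb_sq]
  have := norm_sub_sq_le k.p k.q k.u k.c_pos k.u_le_c
  unfold r g Λ
  linarith

lemma G_eq : k.G = k.c * k.σ * k.rb / (2 * k.θ * k.g) := by
  have hc := k.c_pos
  have hg := k.g_pos
  have h : 1 + k.z / k.c ^ 2 = (k.σ * k.rb / (2 * k.c * k.g)) ^ 2 := by
    rw [div_pow, mul_pow, k.σ_sq, z_eq, k.rb_sq]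
    field_simp
    ring
  rw [G, h, sqrt_sq (by have := k.σ_pos; have := k.rb_pos; positivity)]
  field_simp

lemma one_le_sqrt : 1 ≤ √(1 + k.z / k.c ^ 2) :=
  Real.one_le_sqrt.2 (le_add_of_nonneg_right (div_nonneg k.z_nonneg (sq_nonneg _)))

lemma inv_G_le : 1 / k.G ≤ D * (k.c ^ 2)⁻¹ := by
  have hθ := k.st.θ_pos
  rw [one_div, G, mul_inv, inv_div]
  calc k.θ / k.c ^ 2 * (√(1 + k.z / k.c ^ 2))⁻¹ ≤ k.θ / k.c ^ 2 * 1 := by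
        gcongr; exact inv_le_one_of_one_le₀ k.one_le_sqrt
    _ ≤ _ := by
        rw [mul_one, div_eq_mul_inv]
        gcongr; exact k.st.θ_le

lemma G_pos : 0 < k.G :=
  mul_pos (div_pos (pow_pos k.c_pos 2) k.st.θ_pos) (zero_lt_one.trans_le k.one_le_sqrt)

lemma kc2_eq : kc2 k.c k.n k.u k.θ k.p k.q = k.H * k.r⁻¹ * exp (-k.X) := by
  have hc := k.c_pos
  have hθ := k.st.θ_pos
  have hg := k.g_pos
  have hr := k.r_pos
  have hD : √(ellBar k.c k.u k.θ k.p k.q ^ 2 - jBar k.c k.u k.θ k.p k.q ^ 2) = k.G :=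
    exp_gamma_kernel_exponent k.u hc hθ k.hpq
  have hD2 : ellBar k.c k.u k.θ k.p k.q ^ 2 - jBar k.c k.u k.θ k.p k.q ^ 2 = k.G ^ 2 := by
    rw [ellBar_sq_sub_jBar_sq k.u hc hθ k.hpq, G, mul_pow, sq_sqrt]
    · rfl
    · have := k.z_nonneg; positivity
  have hs : sInv k.c k.p k.q ^ (3 / 2 : ℝ) = k.σ ^ 3 := by
    rw [σ, sqrt_eq_rpow, ← rpow_natCast, ← rpow_mul (by rw [sInv_eq]; positivity)]
    norm_num
  have hX : exp (-k.X) = exp (k.c ^ 2 / k.θ) * exp (-k.G) := by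
    rw [← exp_add, X, G]; ring_nf
  have hl : ellBar k.c k.u k.θ k.p k.q = k.c / 2 * k.b / k.θ := rfl
  rw [kc2, J1, J2, hD, hD2, hs, hX, juttnerFactor_eq_A, hl, H]
  change k.c * (k.A * _) * π * k.σ ^ 3 / (4 * k.g * k.E * k.F) * _ = _
  have hG := k.G_eq
  have e1 : k.c / 2 * k.b / k.θ / k.G ^ 2 =
      2 * k.θ * k.g ^ 2 * k.b / (k.c * k.σ ^ 2 * k.rb ^ 2) := by
    rw [hG]; field_simp
  have e2 : ∀ x : ℝ, 1 / k.G * x = 2 * k.θ * k.g / (k.c * k.σ * k.rb) * x := fun x => by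
    rw [hG]; field_simp
  rw [e1, e2 (exp (-k.G))]
  field_simp
  ring

lemma k2_eq : k2 k.ρ k.v k.θ' k.p k.q =
    4 * π * (k.A' * k.θ') * k.r⁻¹ * exp (-k.Y) := by
  have hθ := k.st.θ'_pos
  have hx : (0 : ℝ) < 2 * π * k.θ' := by positivity
  have h1 : (2 * π * k.θ') ^ (3 / 2 : ℝ) =
      2 * π * k.θ' * √(2 * π * k.θ') := by
    rw [show (3 / 2 : ℝ) = 1 + 1 / 2 by norm_num, rpow_add hx, rpow_one,
      ← sqrt_eq_rpow]
  have h2 : -(‖k.p - k.q‖ ^ 2 / (8 * k.θ')) - (‖k.p - k.v‖ ^ 2 - ‖k.q - k.v‖ ^ 2) ^ 2 /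
      (8 * k.θ' * ‖k.p - k.q‖ ^ 2) = -k.Y := by
    change -(k.r ^ 2 / (8 * k.θ')) - (‖k.p - k.v‖ ^ 2 - ‖k.q - k.v‖ ^ 2) ^ 2 /
      (8 * k.θ' * k.r ^ 2) = _
    rw [Y, Λ']; ring
  rw [k2, h2, A', h1]
  change 2 / k.r * _ * _ = _
  field_simp
  ring

lemma boostEnergy_le (p : E3) : |boostEnergy k.c k.u p| ≤ 2 * energy k.c p := by
  have hc := k.c_pos
  have h1 : |inner ℝ k.u p| ≤ ‖k.u‖ * energy k.c p := (abs_real_inner_le_norm _ _).trans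
    (by gcongr; exact norm_le_energy _ _)
  have h2 : energy k.c k.u ≤ k.c + ‖k.u‖ := by
    nlinarith [energy_sq k.c k.u, norm_nonneg k.u]
  have hE := energy_pos p hc
  have hU := energy_pos k.u hc
  rw [boostEnergy, abs_div, abs_of_pos hc, div_le_iff₀ hc]
  refine (abs_sub _ _).trans ?_
  rw [abs_of_pos (mul_pos hU hE)]
  nlinarith [k.u_le_c, mul_le_mul_of_nonneg_right h2 hE.le]

lemma bdd_H : (H : KPt D → ℝ) =O[⊤] fun k => 1 + k.r := by
  have hb : (fun k : KPt D => π / 2 * (k.A * k.θ)) =O[⊤] fun _ => (1 : ℝ) := by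
    simpa using (((bdd_A_sub (D := D)).1.mul bdd_θ).const_mul_left (π / 2))
  refine (hb.mul (Frame.le_top 40 fun k => ?_)).congr_right (fun k => one_mul (1 + k.r))
  have hc := k.c_pos
  have hg := k.g_pos
  have hσ := k.σ_pos
  have hrb := k.rb_pos
  have hE := k.E_pos
  have hF := k.F_pos
  have hr := k.r_pos
  have hEF : |k.E - k.F| ≤ k.r := abs_energy_sub_le _ _
  have hE1 : 1 ≤ k.E := k.one_le_c.trans k.c_le_E
  have hF1 : 1 ≤ k.F := k.one_le_c.trans k.c_le_F
  have hb : |k.b| ≤ 2 * (k.E + k.F) := (abs_add_le _ _).trans (by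
    have := k.boostEnergy_le k.p
    have := k.boostEnergy_le k.q
    unfold E F; linarith)
  have hsum : (k.E + k.F) ^ 2 ≤ 4 * (k.E * k.F) * (1 + k.r) ^ 2 := by
    have e2 : (k.E - k.F) ^ 2 ≤ k.r ^ 2 := by
      rw [← sq_abs (k.E - k.F)]; exact pow_le_pow_left₀ (abs_nonneg _) hEF 2
    have e3 : 1 ≤ k.E * k.F := one_le_mul_of_one_le_of_one_le hE1 hF1
    have e4 : k.r ^ 2 ≤ k.E * k.F * k.r ^ 2 := le_mul_of_one_le_left (sq_nonneg _) e3
    nlinarith [mul_pos (mul_pos hE hF) hr]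
  have hσb : k.σ * |k.b| ≤ 8 * (1 + k.r) * (k.E * k.F) := by
    refine (le_abs_self _).trans (abs_le_of_sq_le_sq ?_ (by positivity))
    calc (k.σ * |k.b|) ^ 2 = k.σ ^ 2 * |k.b| ^ 2 := by ring
      _ ≤ 4 * (k.E * k.F) * (2 * (k.E + k.F)) ^ 2 := by
        gcongr
        exact k.σ_sq_le
      _ = 16 * (k.E * k.F) * (k.E + k.F) ^ 2 := by ring
      _ ≤ 16 * (k.E * k.F) * (4 * (k.E * k.F) * (1 + k.r) ^ 2) := by gcongr
      _ = _ := by ring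
  have hG : |1 + 1 / k.G| ≤ 2 := by
    have h3 := k.inv_G_le
    have h4 := k.G_pos
    have h5 : D * (k.c ^ 2)⁻¹ ≤ 1 := by
      rw [← div_eq_mul_inv, div_le_one (by positivity)]
      nlinarith [k.c_ge, k.hD, k.one_le_c]
    rw [abs_of_pos (by positivity)]; linarith
  rw [abs_of_pos (by positivity : 0 < 1 + k.r)]
  refine (abs_add_le _ _).trans ?_
  have t1 : |k.σ * k.g * k.b * k.r / (k.E * k.F * k.rb ^ 2) * (1 + 1 / k.G)| ≤
      16 * (1 + k.r) * 2 := by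
    rw [abs_mul]
    refine mul_le_mul ?_ hG (abs_nonneg _) (by positivity)
    rw [abs_div, abs_of_pos (by positivity : 0 < k.E * k.F * k.rb ^ 2),
      div_le_iff₀ (by positivity), abs_mul, abs_mul, abs_mul, abs_of_pos hσ, abs_of_pos hg,
      abs_of_pos hr]
    calc k.σ * k.g * |k.b| * k.r = k.σ * |k.b| * (k.g * k.r) := by ring
      _ ≤ 8 * (1 + k.r) * (k.E * k.F) * (k.rb * (2 * k.rb)) := by
        gcongr
        · exact k.g_le_rb
        · exact k.r_le_rb
      _ = _ := by ring
  have t2 : |k.σ ^ 2 * k.r / (k.E * k.F * k.rb)| ≤ 8 := by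
    rw [abs_of_pos (by positivity), div_le_iff₀ (by positivity)]
    calc k.σ ^ 2 * k.r ≤ 4 * (k.E * k.F) * (2 * k.rb) := by
          gcongr
          · exact k.σ_sq_le
          · exact k.r_le_rb
      _ = _ := by ring
  linarith

/-- The basic lower bound for the relativistic exponent. -/
lemma le_X {t : ℝ} (ht : 0 ≤ t) (h : t ^ 2 ≤ k.z) : t ^ 2 / (t / k.c + 2) / D ≤ k.X := by
  have hc := k.c_pos
  have hθ := k.st.θ_pos
  set w := t / k.c with hw
  have hw0 : 0 ≤ w := by positivity
  have htw : t = k.c * w := by rw [hw]; field_simp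
  have h1 : w ^ 2 / (w + 2) ≤ √(1 + k.z / k.c ^ 2) - 1 := by
    rw [le_sub_iff_add_le]
    refine le_sqrt_of_sq_le ?_
    have h2 : w ^ 2 ≤ k.z / k.c ^ 2 := by
      rw [hw, div_pow]; exact div_le_div_of_nonneg_right h (by positivity)
    have h3 : (w ^ 2 / (w + 2) + 1) ^ 2 ≤ 1 + w ^ 2 := by
      rw [div_add_one (by positivity), div_pow, div_le_iff₀ (by positivity)]
      nlinarith [pow_nonneg hw0 3, pow_nonneg hw0 2]
    linarith
  have h0 : 0 ≤ w ^ 2 / (w + 2) := by positivity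
  rw [htw, X]
  calc (k.c * w) ^ 2 / (w + 2) / D = k.c ^ 2 / D * (w ^ 2 / (w + 2)) := by ring
    _ ≤ k.c ^ 2 / k.θ * (w ^ 2 / (w + 2)) :=
      mul_le_mul_of_nonneg_right (div_le_div_of_nonneg_left (by positivity) hθ k.st.θ_le) h0
    _ ≤ _ := by gcongr

lemma r_le_X : 2 * k.r - 64 * D ≤ k.X := by
  have hc := k.c_pos
  have hD := k.hD
  have hrb := k.rb_pos
  have h := k.le_X (t := k.rb / 2) (by positivity) (by
    rw [z_eq]
    have : 0 ≤ k.Λ ^ 2 / k.g ^ 2 := by positivity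
    nlinarith)
  refine le_trans ?_ h
  rw [le_div_iff₀ (by positivity), le_div_iff₀ (by positivity)]
  set t := k.rb / 2 with ht
  have h1 : 2 * k.r - 64 * D ≤ 8 * t - 64 * D := by linarith [k.r_le_rb]
  have h2 : D * (t / k.c) * t ≤ t ^ 2 / 16 := by
    have : D / k.c ≤ 1 / 16 := by
      rw [div_le_div_iff₀ hc (by norm_num)]; linarith [k.c_ge]
    calc D * (t / k.c) * t = D / k.c * t ^ 2 := by ring
      _ ≤ 1 / 16 * t ^ 2 := by gcongr
      _ = _ := by ring
  have h3 : 0 ≤ D * D * (t / k.c) := by positivity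
  nlinarith [sq_nonneg (t - 16 * D)]

lemma r_le_Y : 2 * k.r - 64 * D ≤ k.Y := by
  have hD := k.hD
  have hθ := k.st.θ'_pos
  have h1 : k.r ^ 2 / 4 / (2 * D) ≤ k.Y :=
    div_le_div₀ (by positivity) (le_add_of_nonneg_right (sq_nonneg _)) (by positivity)
      (by linarith [k.st.θ'_le])
  refine le_trans ?_ h1
  rw [le_div_iff₀ (by positivity)]
  nlinarith [sq_nonneg (k.r - 8 * D)]

end KPt

/-! ### The second kernel at moderate momenta -/

namespace KPt

variable {D : ℝ} (k : KPt D)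

/-- The bound `c^{3/8}` for the momenta that are regarded as moderate. -/
def R : ℝ := k.c ^ (3 / 8 : ℝ)

/-- The relative size `R² / c²` of the relativistic corrections at moderate momenta. -/
def m : ℝ := (k.R / k.c) ^ 2

lemma one_le_R : 1 ≤ k.R := one_le_rpow k.one_le_c (by norm_num)

lemma R_le_c : k.R ≤ k.c := by
  have := rpow_le_rpow_of_exponent_le k.one_le_c (by norm_num : (3 / 8 : ℝ) ≤ 1)
  rwa [rpow_one] at this

lemma m_pos : 0 < k.m := by have := k.one_le_R; have := k.c_pos; unfold m; positivity

lemma m_le : k.m ≤ 1 := by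
  have := k.one_le_R
  have := k.c_pos
  exact pow_le_one₀ (by positivity) ((div_le_one k.c_pos).2 k.R_le_c)

lemma m_eq : k.m = k.c ^ (-(5 / 4) : ℝ) := by
  have hc := k.c_pos
  rw [m, R, ← rpow_sub_one hc.ne', ← rpow_natCast, ← rpow_mul hc.le]
  norm_num

lemma δ_le_m : k.δ ≤ k.m := by
  rw [m_eq]; exact rpow_le_rpow_of_exponent_le k.one_le_c (by norm_num)

lemma R_sq_mul_m_le : k.R ^ 2 * k.m ≤ k.R⁻¹ := by
  have hc := k.c_pos
  rw [m_eq, R, ← rpow_natCast, ← rpow_mul hc.le, ← rpow_add hc, ← rpow_neg hc.le]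
  exact rpow_le_rpow_of_exponent_le k.one_le_c (by norm_num)

variable (D) in
/-- The region of moderate momenta. -/
def reg : Set (KPt D) := {k | ‖k.p‖ ≤ k.R ∧ k.r ≤ k.R}

/-- The filter whose asymptotic relations are uniform estimates on `reg`. -/
abbrev mod : Filter (KPt D) := 𝓟 (reg D)

lemma reg_of_le {f h : KPt D → ℝ} (C : ℝ) (H : ∀ k ∈ reg D, |f k| ≤ C * |h k|) :
    f =O[mod] h := isBigO_principal.2 ⟨C, H⟩

/-- Functions of the form `1 + O(R² / c²)` at moderate momenta. -/
def Near (f : KPt D → ℝ) : Prop := (fun k => f k - 1) =O[mod] m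

namespace Near

variable {f h : KPt D → ℝ}

lemma of_le (C : ℝ) (H : ∀ k ∈ reg D, |f k - 1| ≤ C * k.m) : Near f :=
  reg_of_le C fun k hk => by rw [abs_of_pos k.m_pos]; exact H k hk

lemma bdd_m : (m : KPt D → ℝ) =O[mod] fun _ => (1 : ℝ) :=
  bdd 1 fun k => by rw [abs_of_pos k.m_pos]; exact k.m_le

lemma bdd (hf : Near f) : f =O[mod] fun _ => (1 : ℝ) := by
  simpa using (IsBigO.trans hf bdd_m).add (isBigO_refl (fun _ : KPt D => (1 : ℝ)) mod)

lemma mul (hf : Near f) (hh : Near h) : Near fun k => f k * h k := by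
  have h1 := IsBigO.mul hf hh.bdd
  simp only [mul_one] at h1
  exact (h1.add hh).congr_left fun k => by ring

lemma inv (hf : Near f) {a : ℝ} (ha : 0 < a) (H : ∀ k ∈ reg D, a ≤ f k) :
    Near fun k => (f k)⁻¹ := by
  refine IsBigO.trans (reg_of_le a⁻¹ fun k hk => ?_) hf
  have h0 := ha.trans_le (H k hk)
  have e : (f k)⁻¹ - 1 = (f k)⁻¹ * -(f k - 1) := by field_simp; ring
  rw [e, abs_mul, abs_neg, abs_of_pos (inv_pos.2 h0)]
  exact mul_le_mul_of_nonneg_right (inv_anti₀ ha (H k hk)) (abs_nonneg _)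

lemma of_sq (hf : Near fun k => f k ^ 2) (H : ∀ k ∈ reg D, 0 ≤ f k) : Near f := by
  refine IsBigO.trans (reg_of_le 1 fun k hk => ?_) hf
  have e : f k ^ 2 - 1 = (f k - 1) * (f k + 1) := by ring
  rw [e, one_mul, abs_mul]
  refine le_mul_of_one_le_right (abs_nonneg _) ?_
  rw [abs_of_nonneg] <;> linarith [H k hk]

end Near

lemma norm_q_le (hk : k ∈ reg D) : ‖k.q‖ ≤ 2 * k.R := by
  have := norm_sub_norm_le k.q k.p
  rw [norm_sub_rev] at this
  have h1 := hk.1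
  have h2 : ‖k.p - k.q‖ ≤ k.R := hk.2
  linarith

lemma near_energy (p : KPt D → E3) {C : ℝ} (hp : ∀ k ∈ reg D, ‖p k‖ ≤ C * k.R) :
    Near fun k => energy k.c (p k) / k.c := by
  refine Near.of_le (C ^ 2) fun k hk => ?_
  have hc := k.c_pos
  have h1 := energy_sub_le (p k) hc
  have h2 := le_energy k.c (p k)
  have e : energy k.c (p k) / k.c - 1 = (energy k.c (p k) - k.c) / k.c := by field_simp
  rw [e, abs_of_nonneg (div_nonneg (by linarith) hc.le), m]
  calc (energy k.c (p k) - k.c) / k.c ≤ (C * k.R) ^ 2 / (2 * k.c) / k.c := by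
        gcongr
        exact h1.trans (by gcongr; exact hp k hk)
    _ ≤ C ^ 2 * (k.R / k.c) ^ 2 := by
      have : 0 ≤ C ^ 2 * (k.R / k.c) ^ 2 := by positivity
      have e2 : (C * k.R) ^ 2 / (2 * k.c) / k.c = C ^ 2 * (k.R / k.c) ^ 2 / 2 := by
        field_simp
      linarith

lemma near_E : Near fun k : KPt D => k.E / k.c :=
  near_energy _ fun k hk => by rw [one_mul]; exact hk.1

lemma near_F : Near fun k : KPt D => k.F / k.c :=
  near_energy _ fun k hk => k.norm_q_le hk

lemma near_U : Near fun k : KPt D => k.U / k.c := by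
  by_cases hD : 0 ≤ D
  · exact near_energy _ fun k _ => k.st.u_le.trans (le_mul_of_one_le_right hD k.one_le_R)
  · exact Near.of_le 0 fun k => absurd (zero_le_one.trans k.hD) hD

lemma abs_E_sub_F_le (hk : k ∈ reg D) : |k.E - k.F| ≤ 2 * (k.R / k.c) * k.r := by
  have hc := k.c_pos
  have hR := k.one_le_R
  have h1 : |k.E - k.F| * (k.E + k.F) ≤ k.r * (3 * k.R) := by
    rw [← abs_of_pos (add_pos k.E_pos k.F_pos), ← abs_mul]
    have e : (k.E - k.F) * (k.E + k.F) = (‖k.p‖ - ‖k.q‖) * (‖k.p‖ + ‖k.q‖) := by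
      have := energy_sub_energy_mul (c := k.c) k.p k.q
      change (k.E - k.F) * (k.E + k.F) = _ at this
      rw [this]; ring
    rw [e, abs_mul]
    refine mul_le_mul (abs_norm_sub_norm_le _ _) ?_ (abs_nonneg _) k.r_pos.le
    rw [abs_of_nonneg (by positivity)]
    linarith [hk.1, k.norm_q_le hk]
  have h2 : |k.E - k.F| * (2 * k.c) ≤ k.r * (3 * k.R) := le_trans
    (by gcongr; linarith [k.c_le_E, k.c_le_F]) h1
  rw [mul_div_assoc', div_mul_eq_mul_div, le_div_iff₀ hc]
  nlinarith [mul_pos k.r_pos (by linarith : 0 < k.R)]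

lemma E_sub_F : (fun k : KPt D => (k.E - k.F) / k.r) =O[mod] fun k => k.R / k.c :=
  reg_of_le 2 fun k hk => by
    have hc := k.c_pos
    have hR := k.one_le_R
    rw [abs_div, abs_of_pos k.r_pos, div_le_iff₀ k.r_pos,
      abs_of_pos (div_pos (by linarith) hc : 0 < k.R / k.c)]
    exact k.abs_E_sub_F_le hk

lemma bdd_Λ : (fun k : KPt D => k.Λ / k.r) =O[mod] R := by
  have h1 : (fun k : KPt D => k.R / k.c * k.c) =O[mod] R :=
    reg_of_le 1 fun k _ => by rw [one_mul, div_mul_cancel₀ _ k.c_pos.ne']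
  have h2 : (fun k : KPt D => (k.E - k.F) / k.r * (k.U / k.c * k.c)) =O[mod] R := by
    have := (E_sub_F (D := D)).mul (near_U.bdd.mul (isBigO_refl (fun k : KPt D => k.c) _))
    simp only [one_mul] at this
    exact this.trans h1
  have h3 : (fun k : KPt D => inner ℝ k.u (k.p - k.q) / k.r) =O[mod] R :=
    reg_of_le D fun k _ => by
      have hR := k.one_le_R
      have hD := k.hD
      rw [abs_div, abs_of_pos k.r_pos, div_le_iff₀ k.r_pos,
        abs_of_pos (by linarith : 0 < k.R)]
      refine (abs_real_inner_le_norm _ _).trans (mul_le_mul_of_nonneg_right ?_ k.r_pos.le)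
      exact k.st.u_le.trans (le_mul_of_one_le_right (by linarith) hR)
  refine (h2.sub h3).congr_left fun k => ?_
  have := k.c_pos
  change (k.E - k.F) / k.r * (k.U / k.c * k.c) - _ =
    (k.U * (k.E - k.F) - inner ℝ k.u (k.p - k.q)) / k.r
  field_simp

lemma near_g_sq : Near fun k : KPt D => (k.g / k.r) ^ 2 := by
  have h := (E_sub_F (D := D)).pow 2
  refine (h.neg_left).congr_left fun k => ?_
  have hr := k.r_pos
  have : k.g ^ 2 = k.r ^ 2 - (k.E - k.F) ^ 2 := gInv_sq _ _
  change -((k.E - k.F) / k.r) ^ 2 = (k.g / k.r) ^ 2 - 1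
  rw [div_pow, div_pow, this]
  field_simp
  ring

lemma near_rb_sq : Near fun k : KPt D => (k.rb / k.r) ^ 2 := by
  have h : (fun k : KPt D => (k.Λ / k.r * k.c⁻¹) ^ 2) =O[mod] m :=
    ((bdd_Λ (D := D)).mul (isBigO_refl (fun k : KPt D => k.c⁻¹) _)).pow 2
  refine (IsBigO.add near_g_sq h).congr_left fun k => ?_
  change (k.g / k.r) ^ 2 - 1 + (k.Λ / k.r * k.c⁻¹) ^ 2 = (k.rb / k.r) ^ 2 - 1
  rw [div_pow k.rb, k.rb_sq]
  ring

lemma near_g : Near fun k : KPt D => k.g / k.r :=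
  near_g_sq.of_sq fun k _ => (div_pos k.g_pos k.r_pos).le

lemma near_rb : Near fun k : KPt D => k.rb / k.r :=
  near_rb_sq.of_sq fun k _ => (div_pos k.rb_pos k.r_pos).le

lemma near_inv_rb : Near fun k : KPt D => (k.rb / k.r)⁻¹ :=
  near_rb.inv (a := 1 / 2) (by norm_num) fun k _ => by
    rw [le_div_iff₀ k.r_pos]; linarith [k.r_le_rb]

lemma near_σ : Near fun k : KPt D => k.σ / (2 * k.c) := by
  refine Near.of_sq (Near.of_le 1 fun k hk => ?_) fun k _ =>
    (div_pos k.σ_pos (by have := k.c_pos; positivity)).le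
  have hc := k.c_pos
  have e : (k.σ / (2 * k.c)) ^ 2 - 1 = (k.g / k.c) ^ 2 / 4 := by
    rw [div_pow, k.σ_sq]; field_simp; ring
  rw [e, abs_of_nonneg (by positivity), one_mul, m]
  have h1 : k.g / k.c ≤ k.R / k.c := by
    gcongr; exact k.g_le.trans hk.2
  have := pow_le_pow_left₀ (div_pos k.g_pos hc).le h1 2
  have := sq_nonneg (k.R / k.c)
  linarith

lemma near_inv_EF : Near fun k : KPt D => (k.E / k.c * (k.F / k.c))⁻¹ :=
  (near_E.mul near_F).inv one_pos fun k _ =>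
    one_le_mul_of_one_le_of_one_le ((one_le_div k.c_pos).2 k.c_le_E)
      ((one_le_div k.c_pos).2 k.c_le_F)

lemma near_b : Near fun k : KPt D => k.b / (2 * k.c) := by
  have h1 : (fun k : KPt D => inner ℝ k.u (k.p + k.q) / (2 * k.c ^ 2)) =O[mod] m :=
    reg_of_le (3 * D) fun k hk => by
      have hc := k.c_pos
      have hR := k.one_le_R
      have hD := k.hD
      have h2 : |inner ℝ k.u (k.p + k.q)| ≤ D * (3 * k.R) :=
        (abs_real_inner_le_norm _ _).trans (mul_le_mul k.st.u_le ((norm_add_le _ _).trans (by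
          linarith [hk.1, k.norm_q_le hk])) (norm_nonneg _) (by positivity))
      rw [abs_div, abs_of_pos (by positivity : 0 < 2 * k.c ^ 2), div_le_iff₀ (by positivity),
        abs_of_pos k.m_pos, m, div_pow]
      field_simp
      nlinarith [mul_pos (by linarith : 0 < D) (by linarith : 0 < k.R)]
  have h3 := ((IsBigO.add (near_U.mul near_E) (near_U.mul near_F)).const_mul_left (1 / 2)).sub h1
  refine h3.congr_left fun k => ?_
  have hb : k.b = (k.U * k.E - inner ℝ k.u k.p) / k.c + (k.U * k.F - inner ℝ k.u k.q) / k.c := rfl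
  simp only [hb, inner_add_right]
  ring

lemma near_G : Near fun k : KPt D => 1 + 1 / k.G := by
  refine Near.of_le D fun k _ => ?_
  rw [add_sub_cancel_left, abs_of_pos (one_div_pos.2 k.G_pos)]
  have hD := k.hD
  refine k.inv_G_le.trans (mul_le_mul_of_nonneg_left ?_ (by linarith))
  rw [m, div_pow, div_eq_mul_inv]
  exact le_mul_of_one_le_left (by positivity) (one_le_pow₀ k.one_le_R)

/-- The prefactors are close at moderate momenta. -/
lemma H_sub : (fun k : KPt D => k.H - 4 * π * (k.A' * k.θ')) =O[mod] m := by
  obtain ⟨bA, bA', bAs⟩ := bdd_A_sub (D := D)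
  have bδ : (δ : KPt D → ℝ) =O[mod] m := reg_of_le 1 fun k _ => by
    rw [one_mul, abs_of_pos k.δ_pos, abs_of_pos k.m_pos]; exact k.δ_le_m
  have h1 := ((((near_σ (D := D)).mul near_g).mul near_b).mul near_inv_EF).mul
    ((near_inv_rb.mul near_inv_rb).mul near_G)
  have h2 := (((near_σ (D := D)).mul near_σ).mul near_inv_EF).mul near_inv_rb
  have h3 := ((bA.mono le_top).mul bdd_θ).mul ((IsBigO.add h1 h2).const_mul_left (2 * π))
  have h4 := (((bAs.mono le_top).trans bδ).mul bdd_θ).const_mul_left (4 * π)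
  have bθ : (fun k : KPt D => k.θ - k.θ') =O[mod] m :=
    (reg_of_le D fun k _ => by rw [abs_of_pos k.δ_pos]; exact k.st.θ_sub).trans bδ
  have h5 := ((bA'.mono le_top).mul bθ).const_mul_left (4 * π)
  simp only [mul_one, one_mul] at h3 h4 h5
  refine ((h3.add h4).add h5).congr_left fun k => ?_
  have hc := k.c_pos
  have hrb := k.rb_pos
  rw [H]
  field_simp
  ring

/-- The exponents are close at moderate momenta. -/
lemma X_sub_Y : (fun k : KPt D => k.X - k.Y) =O[mod] fun k => k.R ^ 2 * k.m := by
  have rR := isBigO_refl (R : KPt D → ℝ) mod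
  have rm := isBigO_refl (m : KPt D → ℝ) mod
  have one_R : (fun _ : KPt D => (1 : ℝ)) =O[mod] R := reg_of_le 1 fun k _ => by
    rw [abs_one, one_mul]; exact k.one_le_R.trans (le_abs_self _)
  have bδ : (δ : KPt D → ℝ) =O[mod] m := reg_of_le 1 fun k _ => by
    rw [one_mul, abs_of_pos k.δ_pos, abs_of_pos k.m_pos]; exact k.δ_le_m
  have br : (r : KPt D → ℝ) =O[mod] R := reg_of_le 1 fun k hk => by
    rw [one_mul, abs_of_pos k.r_pos]; exact hk.2.trans (le_abs_self _)
  -- the energy transfers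
  have dΛ : (fun k : KPt D => k.Λ / k.r - k.Λ' / k.r) =O[mod] fun k => k.R * k.m := by
    have h1 : (fun k : KPt D => k.U / k.c - (k.E / k.c + k.F / k.c) / 2) =O[mod] m :=
      (near_U.sub ((IsBigO.add near_E near_F).const_mul_left (1 / 2))).congr_left
        fun k => by ring
    have h2 : (fun k : KPt D => (k.E - k.F) / k.r * ((k.U / k.c - (k.E / k.c + k.F / k.c) / 2) *
        k.c)) =O[mod] fun k => k.R * k.m :=
      ((E_sub_F (D := D)).mul (h1.mul (isBigO_refl (fun k : KPt D => k.c) _))).congr_right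
        fun k => by have := k.c_pos; field_simp
    have h3 : (fun k : KPt D => inner ℝ (k.u - k.v) (k.p - k.q) / k.r) =O[mod] m := by
      refine (reg_of_le D fun k _ => ?_).trans bδ
      rw [abs_div, abs_of_pos k.r_pos, div_le_iff₀ k.r_pos, abs_of_pos k.δ_pos]
      exact (abs_real_inner_le_norm _ _).trans
        (mul_le_mul_of_nonneg_right k.st.u_sub (norm_nonneg _))
    have h4 := (one_R.mul rm).congr_left (fun k => one_mul k.m)
    refine (h2.sub (h3.trans h4)).congr_left fun k => ?_
    have hc := k.c_pos
    have e1 : k.Λ = k.U * (k.E - k.F) - inner ℝ k.u (k.p - k.q) := rfl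
    have e2 : k.Λ' = (k.E - k.F) * (k.E + k.F) / 2 - inner ℝ k.v (k.p - k.q) := by
      have : (k.E - k.F) * (k.E + k.F) = ‖k.p‖ ^ 2 - ‖k.q‖ ^ 2 := energy_sub_energy_mul _ _
      rw [this, Λ', norm_sub_sq_eq, norm_sub_sq_eq, inner_sub_right, real_inner_comm k.v k.p,
        real_inner_comm k.v k.q]
      ring
    rw [e1, e2, inner_sub_left]
    field_simp
    ring
  have bRm : (fun k : KPt D => k.R * k.m) =O[mod] R := by
    simpa using rR.mul (Near.bdd_m (D := D))
  have bΛ' : (fun k : KPt D => k.Λ' / k.r) =O[mod] R :=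
    ((bdd_Λ (D := D)).sub (dΛ.trans bRm)).congr_left fun k => by ring
  -- the arguments of the exponents
  set Z' : KPt D → ℝ := fun k => k.r ^ 2 / 4 + (k.Λ' / k.r) ^ 2 with hZ'
  have bZ' : Z' =O[mod] fun k => k.R ^ 2 :=
    (((br.pow 2).const_mul_left (1 / 4)).add (bΛ'.pow 2)).congr_left fun k => by
      ring
  have dz : (fun k => k.z - Z' k) =O[mod] fun k => k.R ^ 2 * k.m := by
    have h1 := ((br.pow 2).mul (near_rb_sq (D := D))).const_mul_left (1 / 4)
    have ig : Near fun k : KPt D => ((k.g / k.r) ^ 2)⁻¹ := by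
      have h0 := (near_E (D := D).mul near_F).bdd.mul near_g_sq
      simp only [one_mul] at h0
      refine IsBigO.trans (reg_of_le 1 fun k _ => ?_) h0
      have hg := k.g_pos
      have hr := k.r_pos
      have hc := k.c_pos
      have h0 : (0 : ℝ) < (k.g / k.r) ^ 2 := by positivity
      have e : ((k.g / k.r) ^ 2)⁻¹ - 1 = -(((k.g / k.r) ^ 2)⁻¹ * ((k.g / k.r) ^ 2 - 1)) := by
        field_simp; ring
      rw [e, one_mul, abs_neg, abs_mul, abs_mul]
      refine mul_le_mul_of_nonneg_right ?_ (abs_nonneg _)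
      rw [abs_of_pos (inv_pos.2 h0), abs_of_nonneg
        (by have := k.E_pos; have := k.F_pos; positivity), inv_le_iff_one_le_mul₀ h0]
      have := le_gInv_sq_mul (c := k.c) k.p k.q
      change k.c ^ 2 * k.r ^ 2 ≤ k.g ^ 2 * (k.E * k.F) at this
      rw [div_pow, div_mul_div_comm, div_mul_div_comm, le_div_iff₀ (by positivity)]
      linarith
    have h2 := ((bdd_Λ (D := D)).pow 2).mul ig
    have h3 := (dΛ.mul ((bdd_Λ (D := D)).add bΛ')).congr_right
      (fun k => show _ = k.R ^ 2 * k.m by ring)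
    refine ((h1.add h2).add h3).congr_left fun k => ?_
    have hr := k.r_pos
    simp only [hZ']
    rw [z_eq]
    field_simp
    ring
  have bz : (z : KPt D → ℝ) =O[mod] fun k => k.R ^ 2 := by
    have h1 : (fun k : KPt D => k.R ^ 2 * k.m) =O[mod] fun k => k.R ^ 2 := by
      simpa using (rR.pow 2).mul (Near.bdd_m (D := D))
    exact ((dz.trans h1).add bZ').congr_left fun k => by ring
  -- the expansion of the square root
  have hX : (fun k : KPt D => k.X - k.z / (2 * k.θ)) =O[mod] fun k => k.R ^ 2 * k.m := by
    have h1 : (fun k : KPt D => k.θ⁻¹ * (k.z ^ 2 * (k.c ^ 2)⁻¹)) =O[mod]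
        fun k => k.R ^ 2 * k.m := by
      refine (bdd_inv_θ.mul ((bz.pow 2).mul
        (isBigO_refl (fun k : KPt D => (k.c ^ 2)⁻¹) _))).congr_right fun k => ?_
      rw [m, div_pow]; ring
    refine (reg_of_le 1 fun k _ => ?_).trans h1
    have hc := k.c_pos
    have hθ := k.st.θ_pos
    have hz := k.z_nonneg
    set y := k.z / k.c ^ 2 with hy
    have hsq : √(1 + y) ^ 2 = 1 + y := sq_sqrt (by positivity)
    have h1s : 1 ≤ √(1 + y) := k.one_le_sqrt
    have e : k.X - k.z / (2 * k.θ) = -(k.c ^ 2 / k.θ * ((√(1 + y) - 1) ^ 2 / 2)) := by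
      have : k.z = k.c ^ 2 * y := by rw [hy]; field_simp
      have hX' : k.X = k.c ^ 2 / k.θ * (√(1 + y) - 1) := rfl
      rw [hX', this]
      field_simp
      linear_combination hsq
    have e2 : k.θ⁻¹ * (k.z ^ 2 * (k.c ^ 2)⁻¹) = k.c ^ 2 / k.θ * y ^ 2 := by
      rw [hy]; field_simp
    rw [e, abs_neg, e2, abs_of_nonneg (by positivity), abs_of_nonneg (by positivity), one_mul]
    refine mul_le_mul_of_nonneg_left ?_ (by positivity)
    nlinarith [pow_le_pow_left₀ (by linarith : 0 ≤ √(1 + y) - 1)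
      (by nlinarith : √(1 + y) - 1 ≤ y) 2]
  have h2 := (bdd_inv_θ.mul dz).const_mul_left (1 / 2)
  have h3 := ((((inv_θ_sub (D := D)).mono le_top).trans bδ).mul bZ').const_mul_left (1 / 2)
  simp only [one_mul] at h2
  refine ((hX.add h2).add (h3.congr_right fun k => mul_comm _ _)).congr_left fun k => ?_
  rw [Y]
  simp only [hZ']
  ring

lemma exp_X : (fun k : KPt D => exp (-k.X)) =O[⊤] fun k => exp (-(2 * k.r)) :=
  exp_neg_le (64 * D) fun k => k.r_le_X

lemma exp_Y : (fun k : KPt D => exp (-k.Y)) =O[⊤] fun k => exp (-(2 * k.r)) :=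
  exp_neg_le (64 * D) fun k => k.r_le_Y

/-- At moderate momenta the second kernels are close. -/
lemma kc2_sub_k2 : (fun k : KPt D => kc2 k.c k.n k.u k.θ k.p k.q - k2 k.ρ k.v k.θ' k.p k.q)
    =O[mod] fun k => k.R⁻¹ * (k.r⁻¹ * exp (-k.r)) := by
  have ri := isBigO_refl (fun k : KPt D => k.r⁻¹) mod
  have bm : (m : KPt D → ℝ) =O[mod] fun k => k.R⁻¹ := reg_of_le 1 fun k _ => by
    have hR := k.one_le_R
    rw [one_mul, abs_of_pos k.m_pos]
    refine le_trans ?_ (k.R_sq_mul_m_le.trans (le_abs_self _))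
    exact le_mul_of_one_le_left k.m_pos.le (one_le_pow₀ hR)
  have bRm : (fun k : KPt D => k.R ^ 2 * k.m) =O[mod] fun k => k.R⁻¹ :=
    reg_of_le 1 fun k _ => by
      rw [one_mul, abs_of_nonneg (mul_nonneg (sq_nonneg _) k.m_pos.le)]
      exact k.R_sq_mul_m_le.trans (le_abs_self _)
  have he : (fun k : KPt D => exp (-(2 * k.r))) =O[mod] fun k => exp (-k.r) :=
    reg_of_le 1 fun k _ => by
      rw [one_mul, abs_exp, abs_exp]
      exact exp_le_exp.2 (by linarith [k.r_pos])
  have eX := (exp_X.mono le_top).trans he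
  have eY := (exp_Y.mono le_top).trans he
  have hE := isBigO_exp_sub (X_sub_Y.trans bRm) eX eY
  have bA : (fun k : KPt D => 4 * π * (k.A' * k.θ')) =O[mod] fun _ => (1 : ℝ) := by
    simpa using ((((bdd_A_sub (D := D)).2.1.mono le_top).mul bdd_θ').const_mul_left
      (4 * π))
  have h1 := ((H_sub.trans bm).mul ri).mul eX
  have h2 := (bA.mul ri).mul hE
  refine ((h1.congr_right fun k => ?_).add (h2.congr_right fun k => ?_)).congr_left fun k => ?_
  · ring
  · ring
  · rw [kc2_eq, k2_eq]; ring

end KPt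

/-! ### Integrals over thin shells -/

lemma integrable_inv_mul_exp {b : ℝ} (hb : 0 < b) :
    Integrable fun w : E3 => ‖w‖⁻¹ * exp (-(b * ‖w‖)) := by
  refine integrable_radial (f := fun y => y⁻¹ * exp (-(b * y))) ?_
  refine (integrableOn_rpow_mul_exp_neg_mul_rpow (p := 1) (s := 1) (b := b) (by norm_num)
    one_pos hb).congr_fun (fun y hy => ?_) measurableSet_Ioi
  simp only [rpow_one]
  field_simp

lemma integrable_exp_neg_norm {b : ℝ} (hb : 0 < b) :
    Integrable fun w : E3 => exp (-(b * ‖w‖)) := by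
  refine integrable_radial (f := fun y => exp (-(b * y))) ?_
  refine (integrableOn_rpow_mul_exp_neg_mul_rpow (p := 1) (s := 2) (b := b) (by norm_num)
    one_pos hb).congr_fun (fun y _ => ?_) measurableSet_Ioi
  simp only [rpow_one, rpow_two, neg_mul]

/-- The weight `e^{-|w|/2} / |w|`, concentrated in the shell of thickness `1/β` around the sphere
`⟪a, w⟫ + |w|² = 0`. -/
def shell (a : E3) (β : ℝ) (w : E3) : ℝ :=
  ‖w‖⁻¹ * exp (-(‖w‖ / 2)) * exp (-(β * (inner ℝ a w / ‖w‖ + ‖w‖)) ^ 2)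

lemma shell_nonneg (a : E3) (β : ℝ) (w : E3) : 0 ≤ shell a β w := by unfold shell; positivity

lemma measurable_shell (a : E3) (β : ℝ) : Measurable (shell a β) := by
  unfold shell; fun_prop

/-- The length of the last two coordinates. -/
def planar (y : Fin 2 → ℝ) : ℝ := √(y 0 ^ 2 + y 1 ^ 2)

lemma measurable_planar : Measurable planar := by unfold planar; fun_prop

lemma integrable_exp_planar : Integrable fun y : Fin 2 → ℝ => exp (-(planar y / 2)) := by
  have h0 : Integrable fun y : Fin 2 → ℝ => (1 + ‖y‖) ^ (-3 : ℝ) :=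
    integrable_one_add_norm (by norm_num)
  refine (h0.const_mul 216).mono' (by have := measurable_planar; fun_prop)
    (Eventually.of_forall fun y => ?_)
  have h1 : ‖y‖ ≤ planar y := by
    refine (pi_norm_le_iff_of_nonneg (sqrt_nonneg _)).2 fun i => le_sqrt_of_sq_le ?_
    rw [norm_eq_abs, sq_abs]
    fin_cases i
    · exact le_add_of_nonneg_right (sq_nonneg _)
    · exact le_add_of_nonneg_left (sq_nonneg _)
  have h2 : 0 < 1 + ‖y‖ := by positivity
  have h3 : (1 + ‖y‖) ^ 3 ≤ 216 * exp (planar y / 2) := by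
    have h4 := add_one_le_exp (planar y / 6)
    have h5 : (1 + ‖y‖) / 6 ≤ exp (planar y / 6) := by linarith [norm_nonneg y]
    have h6 := pow_le_pow_left₀ (by positivity) h5 3
    rw [← exp_nat_mul, div_pow] at h6
    have e : ((3 : ℕ) : ℝ) * (planar y / 6) = planar y / 2 := by ring
    rw [e, div_le_iff₀ (by norm_num)] at h6
    linarith
  rw [norm_of_nonneg (exp_pos _).le, exp_neg, rpow_neg h2.le,
    ← div_eq_mul_inv, le_div_iff₀ (by positivity), inv_mul_le_iff₀ (exp_pos _)]
  rw [show (3 : ℝ) = ((3 : ℕ) : ℝ) by norm_num, rpow_natCast]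
  linarith

lemma lintegral_gaussian {b : ℝ} (hb : 0 < b) (x₀ : ℝ) :
    ∫⁻ x : ℝ, ENNReal.ofReal (exp (-(b * (x - x₀)) ^ 2)) =
      ENNReal.ofReal (√π / b) := by
  have e : ∀ x : ℝ, -(b * x) ^ 2 = -b ^ 2 * x ^ 2 := fun x => by ring
  have h := lintegral_sub_right_eq_self (μ := (volume : Measure ℝ))
    (fun x : ℝ => ENNReal.ofReal (exp (-(b * x) ^ 2))) x₀
  rw [h]
  simp only [e]
  rw [← ofReal_integral_eq_lintegral_ofReal (integrable_exp_neg_mul_sq (by positivity))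
    (Eventually.of_forall fun _ => (exp_pos _).le), integral_gaussian,
    sqrt_div' _ (by positivity), sqrt_sq hb.le]

/-- Near the equator the shell is, up to constants, the graph `x = x₀ y` thickened by
`planar y / (β α)`. -/
lemma shell_le {α β : ℝ} (hα : 0 < α) (hβ : 0 < β) (hβ1 : β ≤ 1) (w : E3) :
    shell (single 0 α) β w ≤
      32 / (β * α) * (‖w‖⁻¹ * exp (-(1 / 4 * ‖w‖))) +
      (planar (fun i => w i.succ))⁻¹ * exp (-(planar (fun i => w i.succ) / 2)) *
        exp (-(β * α / (8 * planar (fun i => w i.succ)) *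
          (w 0 - (√(α ^ 2 / 4 - planar (fun i => w i.succ) ^ 2) - α / 2))) ^ 2) := by
  have hin : inner ℝ (single 0 α) w = α * w 0 := by
    rw [EuclideanSpace.inner_single_left]; rfl
  set s := planar (fun i => w i.succ) with hs
  set x := w 0
  set r := ‖w‖ with hr
  have hs0 : 0 ≤ s := sqrt_nonneg _
  have hrs : r ^ 2 = x ^ 2 + s ^ 2 := by
    rw [hr, hs, planar, sq_sqrt (by positivity), EuclideanSpace.norm_sq_eq,
      Fin.sum_univ_three]
    simp only [norm_eq_abs, sq_abs]
    ring_nf; rfl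
  rw [shell, hin, ← hr]
  rcases (norm_nonneg w).eq_or_lt with h0 | h0
  · rw [← hr] at h0; rw [← h0]; simp only [inv_zero, zero_mul, mul_zero, zero_add]; positivity
  change 0 < r at h0
  have hsecond : 0 ≤ s⁻¹ * exp (-(s / 2)) * exp (-(β * α / (8 * s) *
      (x - (√(α ^ 2 / 4 - s ^ 2) - α / 2))) ^ 2) := by positivity
  have hβα : 0 < β * α := mul_pos hβ hα
  have hhalf : exp (-(r / 2)) = exp (-(1 / 4 * r)) * exp (-(1 / 4 * r)) := by
    rw [← exp_add]; ring_nf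
  have hone : exp (-(1 / 4 * r)) ≤ 1 := exp_le_one_iff.2 (by linarith)
  by_cases h1 : α ≤ 8 * r
  · -- far from the origin the exponential decay suffices
    refine le_add_of_le_of_nonneg ?_ hsecond
    have h2 : exp (-(1 / 4 * r)) ≤ 32 / (β * α) := by
      rw [le_div_iff₀ hβα, exp_neg, inv_mul_le_iff₀ (exp_pos _)]
      nlinarith [add_one_le_exp (1 / 4 * r), mul_le_mul_of_nonneg_right hβ1 hα.le]
    calc _ ≤ r⁻¹ * exp (-(r / 2)) * 1 :=
          mul_le_mul_of_nonneg_left (exp_le_one_iff.2 (by nlinarith [sq_nonneg (β *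
            (α * x / r + r))])) (by positivity)
      _ = exp (-(1 / 4 * r)) * (r⁻¹ * exp (-(1 / 4 * r))) := by rw [hhalf]; ring
      _ ≤ _ := by gcongr
  by_cases h3 : r < 4 * |x|
  · -- away from the equator the point is far from the shell
    refine le_add_of_le_of_nonneg ?_ hsecond
    have h4 : β * α / 8 ≤ |β * (α * x / r + r)| := by
      rw [abs_mul, abs_of_pos hβ, mul_div_assoc]
      refine mul_le_mul_of_nonneg_left ?_ hβ.le
      have h5 : α / 4 ≤ |α * x / r| := by
        rw [abs_div, abs_mul, abs_of_pos hα, abs_of_pos h0, le_div_iff₀ h0]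
        nlinarith
      have h6 := abs_sub_abs_le_abs_sub (α * x / r) (-r)
      rw [abs_neg, abs_of_pos h0, sub_neg_eq_add] at h6
      linarith
    have h5 : exp (-(β * (α * x / r + r)) ^ 2) ≤ 32 / (β * α) := by
      have h6 : (β * α / 8) ^ 2 ≤ (β * (α * x / r + r)) ^ 2 := by
        rw [← sq_abs (β * (α * x / r + r))]
        exact pow_le_pow_left₀ (by positivity) h4 2
      rw [le_div_iff₀ hβα, exp_neg, inv_mul_le_iff₀ (exp_pos _)]
      nlinarith [add_one_le_exp ((β * (α * x / r + r)) ^ 2), sq_nonneg (β * α / 8 - 1)]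
    calc _ ≤ r⁻¹ * exp (-(r / 2)) * (32 / (β * α)) :=
          mul_le_mul_of_nonneg_left h5 (by positivity)
      _ = 32 / (β * α) * (r⁻¹ * exp (-(1 / 4 * r))) * exp (-(1 / 4 * r)) := by
          rw [hhalf]; ring
      _ ≤ _ := mul_le_of_le_one_right (by positivity) hone
  refine le_add_of_nonneg_of_le (by positivity) ?_
  have hx2 : 16 * x ^ 2 ≤ r ^ 2 := by
    rw [← sq_abs x]; nlinarith [abs_nonneg x]
  have hsr : s ≤ r := (abs_le_of_sq_le_sq' (by nlinarith) h0.le).2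
  have hr2s : r ≤ 2 * s := (abs_le_of_sq_le_sq' (by nlinarith) (by positivity)).2
  have hs1 : 0 < s := by linarith
  have hroot : √(α ^ 2 / 4 - s ^ 2) ^ 2 = α ^ 2 / 4 - s ^ 2 :=
    sq_sqrt (by nlinarith)
  have hroot0 := sqrt_nonneg (α ^ 2 / 4 - s ^ 2)
  set h := √(α ^ 2 / 4 - s ^ 2)
  -- the defining function of the sphere factors along the axis
  have hfac : α * x / r + r = (x - (h - α / 2)) * (x + α / 2 + h) / r := by
    field_simp; linear_combination 4 * hrs + 4 * hroot
  have hlow : α / 4 ≤ x + α / 2 + h := by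
    have := neg_abs_le x; linarith
  have hkey : (β * α / (8 * s) * (x - (h - α / 2))) ^ 2 ≤ (β * (α * x / r + r)) ^ 2 := by
    rw [hfac]
    have e1 : (β * α / (8 * s) * (x - (h - α / 2))) ^ 2 =
        (β * (x - (h - α / 2))) ^ 2 * (α / 4 / (2 * s)) ^ 2 := by ring
    have e2 : (β * ((x - (h - α / 2)) * (x + α / 2 + h) / r)) ^ 2 =
        (β * (x - (h - α / 2))) ^ 2 * ((x + α / 2 + h) / r) ^ 2 := by ring
    rw [e1, e2]
    have : 0 ≤ x + α / 2 + h := by linarith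
    gcongr
  refine mul_le_mul (mul_le_mul ?_ (exp_le_exp.2 (by linarith)) (by positivity)
    (by positivity)) (exp_le_exp.2 (by linarith)) (by positivity) (by positivity)
  exact inv_anti₀ hs1 hsr

lemma exists_isometry_map_eq {a b : E3} (h : ‖a‖ = ‖b‖) : ∃ L : E3 ≃ₗᵢ[ℝ] E3, L a = b :=
  ⟨Submodule.reflection (ℝ ∙ (a - b))ᗮ, Submodule.reflection_sub h⟩

/-- Integrals over shells are inversely proportional to the radius of the sphere and to the inverse
thickness. -/
lemma exists_integral_shell_le : ∃ C : ℝ, 0 < C ∧ ∀ a : E3, a ≠ 0 → ∀ β : ℝ, 0 < β → β ≤ 1 →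
    Integrable (shell a β) ∧ ∫ w, shell a β w ≤ C / (β * ‖a‖) := by
  obtain ⟨C₁, hC₁⟩ : ∃ C, C = ∫ w : E3, ‖w‖⁻¹ * exp (-(1 / 4 * ‖w‖)) := ⟨_, rfl⟩
  obtain ⟨C₂, hC₂⟩ : ∃ C, C = ∫ y : Fin 2 → ℝ, exp (-(planar y / 2)) := ⟨_, rfl⟩
  have hC₁0 : 0 ≤ C₁ := hC₁ ▸ integral_nonneg fun w => by positivity
  have hC₂0 : 0 ≤ C₂ := hC₂ ▸ integral_nonneg fun w => by positivity
  refine ⟨32 * C₁ + 8 * √π * C₂ + 1, by positivity, fun a ha β hβ hβ1 => ?_⟩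
  obtain ⟨α, hαa⟩ : ∃ α, α = ‖a‖ := ⟨_, rfl⟩
  have hα : 0 < α := hαa ▸ norm_pos_iff.2 ha
  rw [← hαa]
  have hβα : 0 < β * α := mul_pos hβ hα
  suffices H : ∫⁻ w, ENNReal.ofReal (shell a β w) ≤
      ENNReal.ofReal ((32 * C₁ + 8 * √π * C₂ + 1) / (β * α)) by
    have hi : Integrable (shell a β) := by
      refine ⟨(measurable_shell a β).aestronglyMeasurable, ?_⟩
      rw [hasFiniteIntegral_iff_ofReal (Eventually.of_forall (shell_nonneg a β))]
      exact H.trans_lt ENNReal.ofReal_lt_top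
    refine ⟨hi, ?_⟩
    rw [← ofReal_integral_eq_lintegral_ofReal hi (Eventually.of_forall (shell_nonneg a β))] at H
    exact (ENNReal.ofReal_le_ofReal_iff (by positivity)).1 H
  -- rotate `a` to the first axis
  have hna : ‖a‖ = ‖(single 0 α : E3)‖ := by
    rw [PiLp.norm_single, norm_of_nonneg hα.le, hαa]
  obtain ⟨L, hL⟩ : ∃ L : E3 ≃ₗᵢ[ℝ] E3, L a = single 0 α :=
    exists_isometry_map_eq hna
  have hrot : ∀ w, shell a β w = shell (single 0 α) β (L w) := fun w => by
    rw [shell, shell, ← hL, LinearIsometryEquiv.inner_map_map, LinearIsometryEquiv.norm_map]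
  simp only [hrot]
  rw [L.measurePreserving.lintegral_comp
    (f := fun w => ENNReal.ofReal (shell (single 0 α) β w))
    (measurable_shell _ β).ennreal_ofReal]
  set F : ℝ × (Fin 2 → ℝ) → ENNReal := fun z => ENNReal.ofReal
    ((planar z.2)⁻¹ * exp (-(planar z.2 / 2)) * exp (-(β * α / (8 * planar z.2) *
      (z.1 - (√(α ^ 2 / 4 - planar z.2 ^ 2) - α / 2))) ^ 2)) with hF
  have hFm : Measurable F := by
    have := measurable_planar
    fun_prop
  have hF1 : ∫⁻ z, F z ≤ ENNReal.ofReal (8 * √π * C₂ / (β * α)) := by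
    rw [Measure.volume_eq_prod, lintegral_prod_symm _ hFm.aemeasurable]
    calc _ ≤ ∫⁻ y : Fin 2 → ℝ, ENNReal.ofReal
          (8 * √π / (β * α) * exp (-(planar y / 2))) := by
          refine lintegral_mono fun y => ?_
          rcases (sqrt_nonneg (y 0 ^ 2 + y 1 ^ 2)).eq_or_lt with h0 | h0
          · have : planar y = 0 := h0.symm
            simp [hF, this]
          change 0 < planar y at h0
          have e : ∀ x, F (x, y) = ENNReal.ofReal ((planar y)⁻¹ * exp (-(planar y / 2))) *
              ENNReal.ofReal (exp (-(β * α / (8 * planar y) *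
                (x - (√(α ^ 2 / 4 - planar y ^ 2) - α / 2))) ^ 2)) := fun x =>
            ENNReal.ofReal_mul (by positivity)
          simp only [e]
          rw [lintegral_const_mul _ (by fun_prop), lintegral_gaussian (by positivity),
            ← ENNReal.ofReal_mul (by positivity)]
          refine ENNReal.ofReal_le_ofReal (le_of_eq ?_)
          field_simp
      _ = _ := by
          rw [← ofReal_integral_eq_lintegral_ofReal (integrable_exp_planar.const_mul _)
            (Eventually.of_forall fun _ => by positivity), integral_const_mul, hC₂]
          ring_nf
  -- the first coordinate and the other two
  have hmp : MeasurePreserving (fun w : E3 => (w 0, fun i : Fin 2 => w i.succ)) volume volume :=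
    (volume_preserving_piFinSuccAbove (fun _ : Fin 3 => ℝ) 0).comp
      (PiLp.volume_preserving_ofLp (Fin 3))
  calc ∫⁻ w, ENNReal.ofReal (shell (single 0 α) β w)
      ≤ ∫⁻ w : E3, (ENNReal.ofReal (32 / (β * α) * (‖w‖⁻¹ * exp (-(1 / 4 * ‖w‖)))) +
          F (w 0, fun i => w i.succ)) := by
        refine lintegral_mono fun w => ?_
        rw [hF, ← ENNReal.ofReal_add (by positivity) (by unfold planar; positivity)]
        exact ENNReal.ofReal_le_ofReal (shell_le hα hβ hβ1 w)
    _ = ENNReal.ofReal (32 / (β * α) * C₁) + ∫⁻ z, F z := by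
        rw [lintegral_add_left (by fun_prop), hmp.lintegral_comp hFm,
          ← ofReal_integral_eq_lintegral_ofReal
            ((integrable_inv_mul_exp (by norm_num : (0 : ℝ) < 1 / 4)).const_mul _)
            (Eventually.of_forall fun _ => by positivity), integral_const_mul, hC₁]
    _ ≤ ENNReal.ofReal (32 / (β * α) * C₁) +
          ENNReal.ofReal (8 * √π * C₂ / (β * α)) := by gcongr
    _ ≤ _ := by
        rw [← ENNReal.ofReal_add (by positivity) (by positivity)]
        refine ENNReal.ofReal_le_ofReal ?_
        rw [div_mul_eq_mul_div, ← add_div]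
        exact div_le_div_of_nonneg_right (by linarith) hβα.le

/-! ### Integrating the difference of the kernels -/

/-- `e^{-|w|/2} / |w|`. -/
def yukawa (w : E3) : ℝ := ‖w‖⁻¹ * exp (-(1 / 2 * ‖w‖))

lemma yukawa_nonneg (w : E3) : 0 ≤ yukawa w := by unfold yukawa; positivity

lemma shell_eq (a : E3) (β : ℝ) (w : E3) :
    shell a β w = yukawa w * exp (-(β * (inner ℝ a w / ‖w‖ + ‖w‖)) ^ 2) := by
  rw [shell, yukawa]; ring_nf

/-- The centre, up to the factor `-1/2`, of the sphere near which the energy transfer in the rest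
frame of the relativistic fluid is small. -/
def relAxis (c : ℝ) (u p : E3) : E3 := (2 : ℝ) • (p - (energy c p / energy c u) • u)

/-- The inverse thickness of the shell in which the relativistic kernel is not exponentially small. -/
def relSlope (D c : ℝ) (p : E3) : ℝ := c / max c ‖p‖ / (20 * D)

lemma relSlope_pos {D c : ℝ} (hD : 1 ≤ D) (hc : 0 < c) (p : E3) : 0 < relSlope D c p := by
  unfold relSlope; positivity

lemma relSlope_le_one {D c : ℝ} (hD : 1 ≤ D) (hc : 0 < c) (p : E3) : relSlope D c p ≤ 1 := by
  have h : 0 < max c ‖p‖ := hc.trans_le (le_max_left _ _)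
  have h1 : c / max c ‖p‖ ≤ 1 := (div_le_one h).2 (le_max_left _ _)
  rw [relSlope, div_le_one (by positivity)]
  linarith

namespace KPt

variable {D : ℝ} (k : KPt D)

/-- The shell of the relativistic kernel. -/
def sh : ℝ := shell (relAxis k.c k.u k.p) (relSlope D k.c k.p) (k.q - k.p)

/-- The shell of the classical kernel. -/
def sh' : ℝ := shell ((2 : ℝ) • (k.p - k.v)) (1 / (20 * D)) (k.q - k.p)

/-- The Yukawa weight of the momentum transfer. -/
def yk : ℝ := yukawa (k.q - k.p)

lemma yk_eq : k.yk = k.r⁻¹ * exp (-(1 / 2 * k.r)) := by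
  rw [yk, yukawa, norm_sub_rev]; rfl

lemma yk_pos : 0 < k.yk := by rw [yk_eq]; have := k.r_pos; positivity

lemma exp_neg_R_le : exp (-k.R) ≤ k.R⁻¹ := by
  rw [exp_neg]
  exact inv_anti₀ (by linarith [k.one_le_R]) (by linarith [add_one_le_exp k.R])

lemma exp_half_le {f : KPt D → ℝ} (hf : ∀ k : KPt D, 2 * k.r - 64 * D ≤ f k) :
    (fun k : KPt D => exp (-(f k / 2))) =O[⊤] fun k => exp (-k.r) :=
  exp_neg_le (32 * D) fun k => by linarith [hf k]

lemma bdd_exp_kernel {h f : KPt D → ℝ} (hh : h =O[⊤] fun k => 1 + k.r)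
    (hf : ∀ k : KPt D, 2 * k.r - 64 * D ≤ f k) :
    (fun k : KPt D => h k * k.r⁻¹ * exp (-f k)) =O[⊤]
      fun k => k.yk * exp (-(f k / 2)) := by
  have h1 := (((hh.mul (isBigO_refl (fun k : KPt D => k.r⁻¹) ⊤)).mul (exp_half_le hf)).mul
    (isBigO_refl (fun k : KPt D => exp (-(f k / 2))) ⊤))
  refine (h1.congr_left fun k => ?_).trans (Frame.le_top 2 fun k => ?_)
  · rw [mul_assoc, ← exp_add]; ring_nf
  · have hr := k.r_pos
    rw [yk_eq, abs_of_pos (by positivity), abs_of_pos (by positivity)]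
    have e : exp (-k.r) = exp (-(1 / 2 * k.r)) * exp (-(1 / 2 * k.r)) := by
      rw [← exp_add]; ring_nf
    have h2 : (1 + k.r) * exp (-(1 / 2 * k.r)) ≤ 2 := by
      rw [exp_neg, ← div_eq_mul_inv, div_le_iff₀ (exp_pos _)]
      linarith [add_one_le_exp (1 / 2 * k.r)]
    calc (1 + k.r) * k.r⁻¹ * exp (-k.r) * exp (-(f k / 2))
        = (1 + k.r) * exp (-(1 / 2 * k.r)) *
          (k.r⁻¹ * exp (-(1 / 2 * k.r)) * exp (-(f k / 2))) := by rw [e]; ring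
      _ ≤ _ := by gcongr

lemma kc2_bound : (fun k : KPt D => kc2 k.c k.n k.u k.θ k.p k.q) =O[⊤]
    fun k => k.yk * exp (-(k.X / 2)) :=
  (bdd_exp_kernel bdd_H fun k => k.r_le_X).congr_left fun k => k.kc2_eq.symm

lemma k2_bound : (fun k : KPt D => k2 k.ρ k.v k.θ' k.p k.q) =O[⊤]
    fun k => k.yk * exp (-(k.Y / 2)) := by
  have h1 : (fun k : KPt D => 4 * π * (k.A' * k.θ')) =O[⊤] fun k => 1 + k.r := by
    refine IsBigO.trans (((bdd_A_sub (D := D)).2.1.mul bdd_θ').const_mul_left (4 * π))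
      (Frame.le_top 1 fun k => ?_)
    have := k.r_pos
    rw [abs_of_pos (by positivity), abs_of_pos (by positivity)]; linarith
  exact (bdd_exp_kernel h1 fun k => k.r_le_Y).congr_left fun k => k.k2_eq.symm

/-- For a large momentum transfer both kernels are small. -/
lemma kc2_sub_k2_of_lt : (fun k : KPt D => kc2 k.c k.n k.u k.θ k.p k.q -
    k2 k.ρ k.v k.θ' k.p k.q) =O[𝓟 {k | k.R < k.r}] fun k => k.R⁻¹ * k.yk := by
  have key : ∀ f : KPt D → ℝ, (∀ k : KPt D, 2 * k.r - 64 * D ≤ f k) →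
      (fun k : KPt D => k.yk * exp (-(f k / 2))) =O[𝓟 {k | k.R < k.r}]
        fun k => k.R⁻¹ * k.yk := fun f hf => by
    refine IsBigO.trans (((isBigO_refl yk ⊤).mul (exp_half_le hf)).mono le_top)
      (isBigO_principal.2 ⟨1, fun k hk => ?_⟩)
    have hR := k.one_le_R
    have hy := k.yk_pos
    have hk' : k.R < k.r := hk
    rw [one_mul, norm_of_nonneg (by positivity), norm_of_nonneg (by positivity), mul_comm]
    refine mul_le_mul_of_nonneg_right ?_ hy.le
    exact (exp_le_exp.2 (by linarith)).trans k.exp_neg_R_le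
  exact ((kc2_bound.mono le_top).trans (key _ fun k => k.r_le_X)).sub
    ((k2_bound.mono le_top).trans (key _ fun k => k.r_le_Y))

lemma shell_arg : inner ℝ (relAxis k.c k.u k.p) (k.q - k.p) / ‖k.q - k.p‖ + ‖k.q - k.p‖ =
    (k.E - k.F) ^ 2 / k.r - 2 * (k.E / k.U) * (k.Λ / k.r) := by
  have hr := k.r_pos
  have hU : 0 < k.U := energy_pos _ k.c_pos
  have e1 : ‖k.q - k.p‖ = k.r := norm_sub_rev _ _
  have e2 : k.Λ = k.U * (k.E - k.F) - inner ℝ k.u (k.p - k.q) := rfl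
  have e3 : k.r ^ 2 = ‖k.p‖ ^ 2 + ‖k.q‖ ^ 2 - 2 * inner ℝ k.p k.q := norm_sub_sq_eq _ _
  have e4 : k.E ^ 2 = k.c ^ 2 + ‖k.p‖ ^ 2 := energy_sq _ _
  have e5 : k.F ^ 2 = k.c ^ 2 + ‖k.q‖ ^ 2 := energy_sq _ _
  have e6 : inner ℝ (relAxis k.c k.u k.p) (k.q - k.p) = 2 * (inner ℝ k.p k.q - ‖k.p‖ ^ 2 -
      k.E / k.U * (inner ℝ k.u k.q - inner ℝ k.u k.p)) := by
    rw [relAxis, inner_smul_left, inner_sub_left, inner_smul_left, inner_sub_right,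
      inner_sub_right, real_inner_self_eq_norm_sq]
    rfl
  rw [e1, e6, e2, inner_sub_right]
  field_simp
  linear_combination k.U * e3 + k.U * e4 - k.U * e5

/-- The relativistic kernel is small off its shell. -/
lemma kc2_shell : (fun k : KPt D => kc2 k.c k.n k.u k.θ k.p k.q) =O[⊤]
    fun k => k.sh + k.R⁻¹ * k.yk := by
  refine kc2_bound.trans (Frame.le_top 1 fun k => ?_)
  have hc := k.c_pos
  have hD := k.hD
  have hR := k.one_le_R
  have hy := k.yk_pos
  have hr := k.r_pos
  have hg := k.g_pos
  have hU : 0 < k.U := energy_pos _ k.c_pos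
  have hM : 0 < max k.c ‖k.p‖ := hc.trans_le (le_max_left _ _)
  set y := inner ℝ (relAxis k.c k.u k.p) (k.q - k.p) / ‖k.q - k.p‖ + ‖k.q - k.p‖ with hy'
  set l := k.c / max k.c ‖k.p‖ with hl
  have hl1 : l ≤ 1 := (div_le_one hM).2 (le_max_left _ _)
  have hsh : k.sh = k.yk * exp (-(l / (20 * D) * y) ^ 2) := shell_eq _ _ _
  -- the argument of the shell is controlled by the exponent
  have hz1 : k.r ^ 2 ≤ 16 * k.z := by
    have h1 := pow_le_pow_left₀ hr.le k.r_le_rb 2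
    have h2 : 0 ≤ k.Λ ^ 2 / k.g ^ 2 := by positivity
    rw [z_eq]; linarith
  have hz2 : (k.Λ / k.r) ^ 2 ≤ k.z := by
    have h1 : k.Λ ^ 2 / k.r ^ 2 ≤ k.Λ ^ 2 / k.g ^ 2 :=
      div_le_div_of_nonneg_left (sq_nonneg _) (by positivity) (pow_le_pow_left₀ hg.le k.g_le 2)
    rw [z_eq, div_pow]; linarith [sq_nonneg k.rb]
  have hly : (l * y) ^ 2 ≤ 64 * k.z := by
    have h1 : |l * ((k.E - k.F) ^ 2 / k.r)| ≤ k.r := by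
      rw [abs_of_nonneg (by positivity)]
      have h2 : (k.E - k.F) ^ 2 ≤ k.r ^ 2 := by
        rw [← sq_abs]; exact pow_le_pow_left₀ (abs_nonneg _) (abs_energy_sub_le _ _) 2
      calc l * ((k.E - k.F) ^ 2 / k.r) ≤ 1 * (k.r ^ 2 / k.r) := by gcongr
        _ = k.r := by field_simp
    have h3 : l * (k.E / k.U) ≤ 2 := by
      have h4 : k.E ≤ 2 * max k.c ‖k.p‖ := by
        refine (le_abs_self _).trans (abs_le_of_sq_le_sq ?_ (by positivity))
        have e : k.E ^ 2 = k.c ^ 2 + ‖k.p‖ ^ 2 := energy_sq _ _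
        have := pow_le_pow_left₀ hc.le (le_max_left k.c ‖k.p‖) 2
        have := pow_le_pow_left₀ (norm_nonneg _) (le_max_right k.c ‖k.p‖) 2
        linarith [pow_pos hM 2]
      rw [hl, div_mul_div_comm, div_le_iff₀ (by positivity)]
      nlinarith [mul_le_mul k.c_le_U h4 k.E_pos.le hU.le]
    have h5 : |l * (2 * (k.E / k.U) * (k.Λ / k.r))| ≤ 4 * |k.Λ / k.r| := by
      have e : l * (2 * (k.E / k.U) * (k.Λ / k.r)) = 2 * (l * (k.E / k.U)) * (k.Λ / k.r) := by ring
      have := k.E_pos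
      rw [e, abs_mul, abs_of_pos (by positivity)]
      gcongr; linarith
    have h6 : |l * y| ≤ k.r + 4 * |k.Λ / k.r| := by
      rw [hy', shell_arg, mul_sub]
      exact (abs_sub _ _).trans (add_le_add h1 h5)
    rw [← sq_abs]
    have h7 := pow_le_pow_left₀ (abs_nonneg _) h6 2
    have h8 := sq_abs (k.Λ / k.r)
    nlinarith [sq_nonneg (k.r - 4 * |k.Λ / k.r|)]
  have hexp : exp (-(k.X / 2)) ≤ exp (-(l / (20 * D) * y) ^ 2) + k.R⁻¹ := by
    by_cases hz : k.z ≤ k.c ^ 2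
    · -- the exponent is at least `z / (3 D)`
      refine le_add_of_le_of_nonneg (exp_le_exp.2 (neg_le_neg ?_)) (by positivity)
      have h1 := k.le_X (sqrt_nonneg k.z) (sq_sqrt k.z_nonneg).le
      have h2 : k.z / 3 / D ≤ k.X := by
        refine le_trans ?_ h1
        rw [sq_sqrt k.z_nonneg]
        have h3 : √k.z / k.c ≤ 1 := (div_le_one hc).2 (sqrt_le_iff.2 ⟨hc.le, hz⟩)
        have h4 := k.z_nonneg
        gcongr
        linarith
      have e : (l / (20 * D) * y) ^ 2 = (l * y) ^ 2 / (400 * D ^ 2) := by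
        ring
      rw [e]
      refine le_trans ?_ (div_le_div_of_nonneg_right h2 zero_le_two)
      rw [div_le_iff₀ (by positivity)]
      have e2 : k.z / 3 / D / 2 * (400 * D ^ 2) = 400 / 6 * (k.z * D) := by
        field_simp; ring
      nlinarith [mul_le_mul_of_nonneg_left hD k.z_nonneg, k.z_nonneg]
    · -- the exponent is at least `c² / (3 D)`
      refine le_add_of_nonneg_of_le (exp_pos _).le
        ((exp_le_exp.2 (neg_le_neg ?_)).trans k.exp_neg_R_le)
      have h1 := k.le_X hc.le (not_le.1 hz).le
      rw [div_self hc.ne', div_div, div_le_iff₀ (by positivity)] at h1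
      have h2 := k.R_le_c
      have h3 : k.c * (1000 * D) ≤ k.c * k.c := by gcongr; exact k.c_ge
      nlinarith
  rw [one_mul, abs_of_pos (by positivity), abs_of_nonneg (by rw [hsh]; positivity), hsh]
  calc k.yk * exp (-(k.X / 2)) ≤ k.yk * (exp (-(l / (20 * D) * y) ^ 2) + k.R⁻¹) :=
        mul_le_mul_of_nonneg_left hexp hy.le
    _ = _ := by ring

/-- The classical kernel is small off its shell. -/
lemma k2_shell : (fun k : KPt D => k2 k.ρ k.v k.θ' k.p k.q) =O[⊤] sh' := by
  refine k2_bound.trans (Frame.le_top 1 fun k => ?_)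
  have hD := k.hD
  have hy := k.yk_pos
  have hr := k.r_pos
  have hθ := k.st.θ'_pos
  have hsh : k.sh' = k.yk * exp (-(1 / (20 * D) * (inner ℝ ((2 : ℝ) • (k.p - k.v))
    (k.q - k.p) / ‖k.q - k.p‖ + ‖k.q - k.p‖)) ^ 2) := shell_eq _ _ _
  have e1 : ‖k.q - k.p‖ = k.r := norm_sub_rev _ _
  have e2 : inner ℝ ((2 : ℝ) • (k.p - k.v)) (k.q - k.p) / ‖k.q - k.p‖ + ‖k.q - k.p‖ =
      -2 * (k.Λ' / k.r) := by
    have e3 : k.r ^ 2 = ‖k.p‖ ^ 2 + ‖k.q‖ ^ 2 - 2 * inner ℝ k.p k.q := norm_sub_sq_eq _ _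
    have e4 : inner ℝ ((2 : ℝ) • (k.p - k.v)) (k.q - k.p) + k.r ^ 2 = -2 * k.Λ' := by
      rw [inner_smul_left, inner_sub_left, inner_sub_right, inner_sub_right, e3, Λ',
        norm_sub_sq_eq, norm_sub_sq_eq, real_inner_self_eq_norm_sq, real_inner_comm k.v k.p,
        real_inner_comm k.v k.q]
      simp only [RCLike.conj_to_real]
      ring
    rw [e1]
    field_simp
    linear_combination e4
  rw [one_mul, hsh, e2, abs_of_pos (by positivity), abs_of_pos (by positivity)]
  refine mul_le_mul_of_nonneg_left (exp_le_exp.2 (neg_le_neg ?_)) hy.le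
  have h1 : (k.Λ' / k.r) ^ 2 / (2 * D) ≤ k.Y :=
    div_le_div₀ (by positivity) (le_add_of_nonneg_left (by positivity)) (by positivity)
      (by linarith [k.st.θ'_le])
  refine le_trans ?_ (div_le_div_of_nonneg_right h1 zero_le_two)
  rw [mul_pow, mul_pow, div_pow, one_pow, div_div, div_mul_eq_mul_div, one_mul,
    div_le_div_iff₀ (by positivity) (by positivity)]
  nlinarith [mul_nonneg (sq_nonneg (k.Λ' / k.r)) (by linarith : 0 ≤ D - 1),
    mul_nonneg (mul_nonneg (sq_nonneg (k.Λ' / k.r)) (by linarith : 0 ≤ D - 1))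
      (by linarith : 0 ≤ D)]

/-- The second kernels differ by small terms and, for large `p`, by the two shells. -/
lemma exists_abs_kc2_sub_k2_le (D : ℝ) : ∃ K : ℝ, 0 ≤ K ∧ ∀ k : KPt D,
    (‖k.p‖ ≤ k.R → |kc2 k.c k.n k.u k.θ k.p k.q - k2 k.ρ k.v k.θ' k.p k.q| ≤
      K * (k.R⁻¹ * k.yk)) ∧
    |kc2 k.c k.n k.u k.θ k.p k.q - k2 k.ρ k.v k.θ' k.p k.q| ≤
      K * (k.R⁻¹ * k.yk + k.sh + k.sh') := by
  obtain ⟨K1, h1⟩ := isBigO_principal.1 (kc2_sub_k2 (D := D))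
  obtain ⟨K2, h2⟩ := isBigO_principal.1 (kc2_sub_k2_of_lt (D := D))
  obtain ⟨K3, h3⟩ := isBigO_top.1 (kc2_shell (D := D))
  obtain ⟨K4, h4⟩ := isBigO_top.1 (k2_shell (D := D))
  refine ⟨|K1| + |K2| + |K3| + |K4|, by positivity, fun k => ?_⟩
  have hR := k.one_le_R
  have hy := k.yk_pos
  have hr := k.r_pos
  have s0 : 0 ≤ k.sh := shell_nonneg _ _ _
  have s0' : 0 ≤ k.sh' := shell_nonneg _ _ _
  have hRy : 0 ≤ k.R⁻¹ * k.yk := by positivity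
  have mono : ∀ {K x y : ℝ}, x ≤ K * y → 0 ≤ y → K ≤ |K1| + |K2| + |K3| + |K4| →
      x ≤ (|K1| + |K2| + |K3| + |K4|) * y := fun hx hy hK =>
    hx.trans (by gcongr)
  have a1 := abs_nonneg K1
  have a2 := abs_nonneg K2
  have a3 := abs_nonneg K3
  have a4 := abs_nonneg K4
  constructor
  · intro hp
    by_cases hk : k.r ≤ k.R
    · refine mono ((h1 k ⟨hp, hk⟩).trans (?_ : _ ≤ |K1| * _)) hRy (by linarith)
      rw [norm_of_nonneg (by positivity)]
      refine mul_le_mul (le_abs_self _) ?_ (by positivity) (by positivity)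
      rw [yk_eq]
      gcongr
      linarith
    · refine mono ((h2 k (not_le.1 hk)).trans (?_ : _ ≤ |K2| * _)) hRy (by linarith)
      rw [norm_of_nonneg hRy]
      gcongr; exact le_abs_self _
  · have h3 := h3 k
    have h4 := h4 k
    rw [norm_eq_abs, norm_of_nonneg (by positivity)] at h3
    rw [norm_eq_abs, norm_of_nonneg s0'] at h4
    have h3 := mono h3 (by positivity) (by linarith [le_abs_self K3])
    have h4 := mono h4 s0' (by linarith [le_abs_self K4])
    refine (abs_sub _ _).trans ((add_le_add h3 h4).trans (le_of_eq ?_))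
    ring

end KPt

/-! ### Integrability and the final estimates -/

lemma measurable_energy {c : ℝ} {f : E3 → E3} (hf : Measurable f) :
    Measurable fun q => energy c (f q) := by unfold energy; fun_prop

lemma measurable_gInv (c : ℝ) (p : E3) : Measurable (gInv c p) := by
  have := measurable_energy (c := c) measurable_id
  unfold gInv; fun_prop

lemma measurable_sInv (c : ℝ) (p : E3) : Measurable (sInv c p) := by
  have := measurable_energy (c := c) measurable_id
  unfold sInv; fun_prop

lemma measurable_kc1_sub_k1 (c n θ ρ θ' : ℝ) (u v p : E3) :
    Measurable fun q => kc1 c n u θ p q - k1 ρ v θ' p q := by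
  have h1 := measurable_energy (c := c) measurable_id
  have h2 := measurable_gInv c p
  have h3 := measurable_sInv c p
  unfold kc1 k1 juttner
  fun_prop

lemma measurable_kc2_sub_k2 (c n θ ρ θ' : ℝ) (u v p : E3) :
    Measurable fun q => kc2 c n u θ p q - k2 ρ v θ' p q := by
  have h1 := measurable_energy (c := c) measurable_id
  have h2 := measurable_gInv c p
  have h3 := measurable_sInv c p
  have h4 : Measurable fun q => boost c u q := by unfold boost; fun_prop
  have h5 : Measurable fun q => jBar c u θ p q := by
    have e : ∀ p q, ‖cross p q‖ = √(‖p‖ ^ 2 * ‖q‖ ^ 2 - inner ℝ p q ^ 2) := fun p q => by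
      rw [← norm_cross_sq, sqrt_sq (norm_nonneg _)]
    simp only [jBar, e]
    fun_prop
  have h6 : Measurable fun q => ellBar c u θ p q := by unfold ellBar boostEnergy; fun_prop
  unfold kc2 k2 J1 J2
  fun_prop

/-- A function dominated off one point by an integrable function. -/
lemma integrable_and_integral_abs_le {f g : E3 → ℝ} {p : E3} (hf : Measurable f)
    (hg : Integrable g) (h : ∀ q, p ≠ q → |f q| ≤ g q) :
    Integrable f ∧ ∫ q, |f q| ≤ ∫ q, g q := by
  have hae : ∀ᵐ q, |f q| ≤ g q := by
    filter_upwards [compl_mem_ae_iff.2 (measure_singleton p)] with q hq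
    exact h q fun e => hq e.symm
  have hi : Integrable f := hg.mono' hf.aestronglyMeasurable hae
  exact ⟨hi, integral_mono_ae hi.abs hg hae⟩

lemma exists_integral_kc1_sub_k1_le (D : ℝ) : ∃ K : ℝ, 0 ≤ K ∧ ∀ k₀ : KPt D,
    Integrable (fun q => kc1 k₀.c k₀.n k₀.u k₀.θ k₀.p q - k1 k₀.ρ k₀.v k₀.θ' k₀.p q) ∧
    ∫ q, |kc1 k₀.c k₀.n k₀.u k₀.θ k₀.p q - k1 k₀.ρ k₀.v k₀.θ' k₀.p q| ≤
      K * k₀.c ^ (-(3 / 2) : ℝ) := by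
  obtain ⟨K, hK⟩ := isBigO_top.1 (KPt.kc1_sub_k1 (D := D))
  refine ⟨|K| * ∫ q : E3, exp (-(1 * ‖q‖)), by positivity, fun k₀ => ?_⟩
  have h0 := (integrable_exp_neg_norm one_pos).const_mul (|K| * k₀.δ)
  obtain ⟨h1, h2⟩ := integrable_and_integral_abs_le (p := k₀.p)
    (measurable_kc1_sub_k1 k₀.c k₀.n k₀.θ k₀.ρ k₀.θ' k₀.u k₀.v k₀.p) h0 fun q hq => by
      have h := hK { k₀ with q := q, hpq := hq }
      refine h.trans ?_
      have hδ := k₀.δ_pos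
      change K * ‖k₀.δ * exp (-(‖k₀.p‖ + ‖q‖))‖ ≤ _
      rw [norm_of_nonneg (by positivity), mul_assoc]
      refine mul_le_mul (le_abs_self _) (mul_le_mul_of_nonneg_left ?_ hδ.le) (by positivity)
        (abs_nonneg _)
      exact exp_le_exp.2 (by linarith [norm_nonneg k₀.p])
  refine ⟨h1, h2.trans (le_of_eq ?_)⟩
  rw [integral_const_mul, KPt.δ]
  ring

lemma integrable_yukawa : Integrable yukawa := integrable_inv_mul_exp (by norm_num)

lemma exists_integral_kc2_sub_k2_le (D : ℝ) : ∃ K : ℝ, 0 ≤ K ∧ ∀ k₀ : KPt D, 4 * D ≤ k₀.R →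
    Integrable (fun q => kc2 k₀.c k₀.n k₀.u k₀.θ k₀.p q - k2 k₀.ρ k₀.v k₀.θ' k₀.p q) ∧
    ∫ q, |kc2 k₀.c k₀.n k₀.u k₀.θ k₀.p q - k2 k₀.ρ k₀.v k₀.θ' k₀.p q| ≤
      K * k₀.c ^ (-(3 / 8) : ℝ) := by
  obtain ⟨K, hK0, hK⟩ := KPt.exists_abs_kc2_sub_k2_le D
  obtain ⟨C, hC0, hC⟩ := exists_integral_shell_le
  obtain ⟨Y, hY⟩ : ∃ Y, Y = ∫ w, yukawa w := ⟨_, rfl⟩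
  have hY0 : 0 ≤ Y := hY ▸ integral_nonneg yukawa_nonneg
  refine ⟨K * (Y + 40 * |D| * C), by positivity, fun k₀ hR4 => ?_⟩
  have hc := k₀.c_pos
  have hD := k₀.hD
  have hR := k₀.one_le_R
  have hmeas := measurable_kc2_sub_k2 k₀.c k₀.n k₀.θ k₀.ρ k₀.θ' k₀.u k₀.v k₀.p
  have hRinv : k₀.c ^ (-(3 / 8) : ℝ) = k₀.R⁻¹ := rpow_neg hc.le _
  rw [hRinv]
  have iy := integrable_yukawa.comp_sub_right k₀.p
  have ey : ∫ q, yukawa (q - k₀.p) = Y := by rw [integral_sub_right_eq_self, hY]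
  by_cases hp : ‖k₀.p‖ ≤ k₀.R
  · obtain ⟨h1, h2⟩ := integrable_and_integral_abs_le (p := k₀.p) hmeas
      ((iy.const_mul k₀.R⁻¹).const_mul K) fun q hq =>
        (hK { k₀ with q := q, hpq := hq }).1 hp
    refine ⟨h1, h2.trans ?_⟩
    rw [integral_const_mul, integral_const_mul, ey, mul_assoc K, mul_comm k₀.R⁻¹]
    refine mul_le_mul_of_nonneg_left (mul_le_mul_of_nonneg_right ?_ (by positivity)) hK0
    exact le_add_of_nonneg_right (by positivity)
  · -- both spheres have radius of order at least `R`
    have hU : 0 < energy k₀.c k₀.u := energy_pos _ hc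
    have ha : ‖k₀.p‖ ≤ ‖relAxis k₀.c k₀.u k₀.p‖ := by
      have h1 : energy k₀.c k₀.p / energy k₀.c k₀.u ≤ 1 + ‖k₀.p‖ / k₀.c := by
        have h2 : energy k₀.c k₀.p ≤ k₀.c + ‖k₀.p‖ := by
          nlinarith [energy_sq k₀.c k₀.p, norm_nonneg k₀.p]
        calc _ ≤ (k₀.c + ‖k₀.p‖) / k₀.c :=
              div_le_div₀ (by positivity) h2 hc (le_energy _ _)
          _ = _ := by field_simp
      have h2 : ‖(energy k₀.c k₀.p / energy k₀.c k₀.u) • k₀.u‖ ≤ (1 + ‖k₀.p‖ / k₀.c) * D := by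
        have := energy_pos k₀.p hc
        rw [norm_smul, norm_of_nonneg (by positivity)]
        exact mul_le_mul h1 k₀.st.u_le (norm_nonneg _) (by positivity)
      have h3 : ‖k₀.p‖ / k₀.c * D ≤ ‖k₀.p‖ / 4 := by
        rw [div_mul_eq_mul_div, div_le_div_iff₀ hc (by norm_num)]
        nlinarith [mul_le_mul_of_nonneg_left k₀.c_ge (norm_nonneg k₀.p), norm_nonneg k₀.p]
      have h4 := norm_sub_norm_le k₀.p ((energy k₀.c k₀.p / energy k₀.c k₀.u) • k₀.u)
      rw [relAxis, norm_smul, norm_ofNat]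
      linarith
    have ha' : ‖k₀.p‖ ≤ ‖(2 : ℝ) • (k₀.p - k₀.v)‖ := by
      rw [norm_smul, norm_ofNat]
      linarith [norm_sub_norm_le k₀.p k₀.v, k₀.st.v_le]
    have hM : 0 < max k₀.c ‖k₀.p‖ := hc.trans_le (le_max_left _ _)
    have hp0 : 0 < ‖k₀.p‖ := by linarith
    have hβ := relSlope_pos hD hc k₀.p
    have hβa : k₀.R / (20 * D) ≤ relSlope D k₀.c k₀.p * ‖relAxis k₀.c k₀.u k₀.p‖ := by
      have h1 : k₀.R ≤ k₀.c / max k₀.c ‖k₀.p‖ * ‖k₀.p‖ := by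
        rw [div_mul_eq_mul_div, le_div_iff₀ hM]
        rcases max_cases k₀.c ‖k₀.p‖ with ⟨h, _⟩ | ⟨h, _⟩ <;> rw [h]
        · nlinarith
        · gcongr; exact k₀.R_le_c
      calc k₀.R / (20 * D) ≤ k₀.c / max k₀.c ‖k₀.p‖ * ‖k₀.p‖ / (20 * D) := by gcongr
        _ = relSlope D k₀.c k₀.p * ‖k₀.p‖ := by rw [relSlope]; ring
        _ ≤ _ := by gcongr
    have hβa' : k₀.R / (20 * D) ≤ 1 / (20 * D) * ‖(2 : ℝ) • (k₀.p - k₀.v)‖ := by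
      rw [one_div_mul_eq_div]; gcongr; linarith
    have hshell : ∀ {a : E3} {β : ℝ}, a ≠ 0 → 0 < β → β ≤ 1 → k₀.R / (20 * D) ≤ β * ‖a‖ →
        Integrable (fun q => shell a β (q - k₀.p)) ∧
        ∫ q, shell a β (q - k₀.p) ≤ 20 * D * C * k₀.R⁻¹ := fun ha0 hβ0 hβ1 h => by
      obtain ⟨h1, h2⟩ := hC _ ha0 _ hβ0 hβ1
      refine ⟨h1.comp_sub_right k₀.p, ?_⟩
      rw [integral_sub_right_eq_self]
      refine h2.trans ((div_le_div_of_nonneg_left hC0.le (by positivity) h).trans (le_of_eq ?_))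
      field_simp
    obtain ⟨i1, b1⟩ := hshell (norm_pos_iff.1 (hp0.trans_le ha)) hβ (relSlope_le_one hD hc _) hβa
    obtain ⟨i2, b2⟩ := hshell (norm_pos_iff.1 (hp0.trans_le ha')) (by positivity)
      (by rw [div_le_one (by positivity)]; linarith) hβa'
    have iR := iy.const_mul k₀.R⁻¹
    obtain ⟨h1, h2⟩ := integrable_and_integral_abs_le (p := k₀.p) hmeas
      (((iR.add i1).add i2).const_mul K) fun q hq => (hK { k₀ with q := q, hpq := hq }).2
    refine ⟨h1, h2.trans ?_⟩
    rw [integral_const_mul, integral_add' (iR.add i1) i2, integral_add' iR i1, integral_const_mul,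
      ey, abs_of_pos (by linarith : 0 < D), mul_assoc K]
    refine mul_le_mul_of_nonneg_left ?_ hK0
    linarith

theorem lemma4 (N : ℕ) (hN : 3 ≤ N) (T : ℝ) (hT : 0 < T) (Pbar Sbar : ℝ) (hP : 0 < Pbar)
    (W : Fluid) (hW : W.IsClEuler T) (hWN : ∃ B' : ℝ, W.ClSobolev N T B' Pbar Sbar) (B : ℝ) :
    ∃ C > 0, ∃ c₀ > 0, ∀ c : ℝ, c₀ ≤ c →
      ∀ V : Fluid, V.IsRelEuler c T → V.RelSobolev c N T B Pbar Sbar → V.SameData c W →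
      ∀ t ∈ Set.Icc 0 T, ∀ x p : E3,
        (Integrable (fun q : E3 =>
            kc1 c (V.n t x) (V.u t x) (V.θ t x) p q - k1 (W.n t x) (W.u t x) (W.θ t x) p q) ∧
          ∫ q : E3, |kc1 c (V.n t x) (V.u t x) (V.θ t x) p q -
              k1 (W.n t x) (W.u t x) (W.θ t x) p q| ≤ C * c ^ (-(3 / 2) : ℝ)) ∧
        (Integrable (fun q : E3 =>
            kc2 c (V.n t x) (V.u t x) (V.θ t x) p q - k2 (W.n t x) (W.u t x) (W.θ t x) p q) ∧
          ∫ q : E3, |kc2 c (V.n t x) (V.u t x) (V.θ t x) p q -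
              k2 (W.n t x) (W.u t x) (W.θ t x) p q| ≤ C * c ^ (-(3 / 8) : ℝ)) := by
  obtain ⟨B', hB'⟩ := hWN
  obtain ⟨D₁, hD₁, c₁, hc₁, hst⟩ := exists_stateClose hN hT hP hW hB' B
  obtain ⟨ε₀, hε₀, C₀, hC₀, -, hQ⟩ := tameAtZero_Q0
  have hQ0 := Q0_pos (ε := 0) le_rfl
  set D := max D₁ (C₀ * D₁ / Q0 0) with hD
  have hD1 : 1 ≤ D := hD₁.trans (le_max_left _ _)
  obtain ⟨K₁, hK₁0, hK₁⟩ := exists_integral_kc1_sub_k1_le D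
  obtain ⟨K₂, hK₂0, hK₂⟩ := exists_integral_kc2_sub_k2_le D
  refine ⟨K₁ + K₂ + 1, by positivity, max c₁ (max (1000 * D ^ 3) (D / ε₀ + 1)),
    lt_max_of_lt_left (by linarith), fun c hc V hV hVN hVW t ht x p => ?_⟩
  have hcc₁ : c₁ ≤ c := (le_max_left _ _).trans hc
  have hcD : 1000 * D ^ 3 ≤ c := (le_max_left _ _).trans ((le_max_right _ _).trans hc)
  have hcε : D / ε₀ + 1 ≤ c := (le_max_right _ _).trans ((le_max_right _ _).trans hc)
  have hc1 : 1 ≤ c := hc₁.trans hcc₁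
  have hc0 : 0 < c := by linarith
  have h₁ := hst c hcc₁ V hV hVN hVW t ht x
  -- the normalization factor of the relativistic Maxwellian
  have hQ' : |Q0 0 / Q0 (V.θ t x / c ^ 2) - 1| ≤ D * c ^ (-(3 / 2) : ℝ) := by
    have hθ := h₁.θ_pos
    set ε := V.θ t x / c ^ 2 with hε
    have hε0 : 0 < ε := by positivity
    have hεε : ε < ε₀ := by
      have h2 : D / ε₀ < c := by linarith
      rw [div_lt_iff₀ hε₀] at h2
      rw [hε, div_lt_iff₀ (by positivity)]
      nlinarith [h₁.θ_le, le_max_left D₁ (C₀ * D₁ / Q0 0), mul_pos hε₀ hc0]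
    have h2 := (hQ ε ⟨hε0, hεε⟩).2.2
    have h3 : Q0 0 ≤ Q0 ε := lapInt_zero_le (by norm_num) (by norm_num) (by norm_num) hε0.le
    have h4 : Q0 0 / Q0 ε - 1 = -(Q0 ε - Q0 0) / Q0 ε := by
      have := hQ0.trans_le h3
      field_simp; ring
    have h5 : (c ^ 2)⁻¹ ≤ c ^ (-(3 / 2) : ℝ) := by
      rw [← rpow_natCast, ← rpow_neg hc0.le]
      exact rpow_le_rpow_of_exponent_le hc1 (by norm_num)
    have h6 : C₀ * ε ≤ C₀ * (D₁ * c ^ (-(3 / 2) : ℝ)) := by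
      gcongr; exact mul_le_mul h₁.θ_le h5 (by positivity) (by linarith)
    rw [h4, abs_div, abs_neg, abs_of_pos (hQ0.trans_le h3)]
    calc _ ≤ C₀ * (D₁ * c ^ (-(3 / 2) : ℝ)) / Q0 0 :=
          div_le_div₀ (by positivity) (h2.trans h6) hQ0 h3
      _ = C₀ * D₁ / Q0 0 * c ^ (-(3 / 2) : ℝ) := by ring
      _ ≤ _ := by gcongr; exact le_max_right _ _
  -- the second momentum of the base point plays no role
  have hne : p ≠ p + single 0 1 := by simp
  have hcD2 : 1000 * D ^ 2 ≤ c := by nlinarith [pow_pos (by linarith : 0 < D) 2]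
  let k₀ : KPt D := ⟨c, V.n t x, V.θ t x, W.n t x, W.θ t x, V.u t x, W.u t x, p, _, hD1, hcD2, hQ',
    h₁.mono (le_max_left _ _) hc0, hne⟩
  have hR : 4 * D ≤ k₀.R := by
    have h2 : ((4 * D) ^ 3) ^ (3 / 8 : ℝ) ≤ c ^ (3 / 8 : ℝ) :=
      rpow_le_rpow (by positivity) (by nlinarith [pow_pos (by linarith : 0 < D) 3])
        (by norm_num)
    refine le_trans ?_ h2
    rw [← rpow_natCast, ← rpow_mul (by positivity)]
    exact self_le_rpow_of_one_le (by linarith) (by norm_num)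
  obtain ⟨a1, b1⟩ := hK₁ k₀
  obtain ⟨a2, b2⟩ := hK₂ k₀ hR
  exact ⟨⟨a1, b1.trans (by gcongr; linarith)⟩,
    a2, b2.trans (by gcongr; linarith)⟩
end
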